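/- **Setting.** Let $T>0$, $\Gamma_0\subset\mathbb R^3$ a closed connected orientable $C^2$ surface, and $V\in C^1([0,T];C^2(\mathbb R^3;\mathbb R^3))$ a velocity field whose flow $\Phi$ ($\frac{d}{dt}\Phi=V(\Phi,t)$, $\Phi(\cdot,0)=\mathrm{id}$) maps $\Gamma_0$ $C^2$-diffeomorphically onto $\Gamma(t)=\Phi(\Gamma_0,t)$ for $t\in[0,T]$. An evolving triangulation consists of a conforming triangulation $\Gamma_h(0)$ with nodes on $\Gamma_0$, whose nodes are transported by $\dot x_i=V(x_i,t)$, giving triangles $K(t)\in\mathcal T_h(t)$ and $\Gamma_h(t)=\bigcup K(t)$; $h=\sup_t\max_K\operatorname{diam}K(t)$. For a constant $\rho>0$ it is assumed that for all $t\in[0,T]$: the diameter of the largest disc in each $K(t)$ is at least $\rho h$; $\Gamma_h(t)$ lies in a tubular neighbourhood of $\Gamma(t)$ and the images of the triangles under the normal projection form a conforming subdivision of $\Gamma(t)$; all angles are at most $\pi/2$; and $\nabla_{\Gamma_h}\cdot V_h\ge 0$, where $V_h$ is the piecewise linear interpolant of $V$. $S_h(t)$ is the space of continuous functions on $\Gamma_h(t)$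 that are affine on each triangle, $I_h$ is nodal interpolation, $\bar m_h(t;\eta,\zeta)=\int_{\Gamma_h(t)}I_h(\eta\zeta)$ and $a_h(t;\eta,\zeta)=\int_{\Gamma_h(t)}\nabla_{\Gamma_h}\eta\cdot\nabla_{\Gamma_h}\zeta$. Let $\varepsilon>0$, $\theta\in(0,1)$, $F_{\log}(r)=(1-r)\log(1-r)+(1+r)\log(1+r)$, $F(r)=\frac\theta2F_{\log}(r)+\frac{1-r^2}2$. For $\delta\in(0,1)$ let $F^\delta_{\log}=F_{\log}$ on $|r|<1-\delta$, $$F^\delta_{\log}(r)=(1-r)\log\delta+(1+r)\log(2-\delta)+\tfrac{(1-r)^2}{2\delta}+\tfrac{(1+r)^2}{2(2-\delta)}-1\quad(r\ge1-\delta),$$ and $F^\delta_{\log}(r)=F^\delta_{\log}(-r)$ for $r\le-1+\delta$; put $F^\delta=\frac\theta2F^\delta_{\log}+\frac{1-r^2}2$, $f^\delta=(F^\delta_{\log})'$ and $$E_h^{\mathrm{CH},\delta}[\eta;t]=\int_{\Gamma_h(t)}\frac{\varepsilon|\nabla_{\Gamma_h}\eta|^2}2+\frac1\varepsilon I_hF^\delta(\eta).$$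 Let $u_0\in H^1(\Gamma_0)$ with $|u_0|\le1$ a.e., $\int_{\Gamma_0}\frac{\varepsilon}{2}|\nabla_\Gamma u_0|^2+\frac1\varepsilon F(u_0)<\infty$ and $\frac1{|\Gamma(t)|}\left|\int_{\Gamma_0}u_0\right|<1$ for all $t\in[0,T]$, and let $c_0$ be a constant. The discrete initial data $U_{h,0}\in S_h(0)$ satisfy $|U_{h,0}|\le1$, have finite discrete energy $\int_{\Gamma_h(0)}\frac\varepsilon2|\nabla_{\Gamma_h}U_{h,0}|^2+\frac1\varepsilon I_hF(U_{h,0})$ and mean value of modulus less than $1$, and $$\|u_0-U_{h,0}^\ell\|_{L^2(\Gamma_0)}+h\|u_0-U_{h,0}^\ell\|_{H^1(\Gamma_0)}\le c_0h^2,$$ where $^\ell$ is the lift to $\Gamma_0$ along the normal projection. For a time step $\tau>0$ put $t_n=n\tau$; for functions on $\Gamma_h(t_n)$, resp. $\Gamma_h(t_{n-1})$, let $\underline{\phi}$, resp. $\overline{\phi}$, be the finite element function on $\Gamma_h(t_{n-1})$, resp. $\Gamma_h(t_n)$, with the same nodal values, and let $\partial^\bullet_\tau U^n=\frac1\tau(U^n-\overline{U^{n-1}})$.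 Given $U_h^{n-1,\delta}\in S_h(t_{n-1})$, a step of the regularised fully discrete scheme is to find $(U_h^{n,\delta},W_h^{n,\delta})\in S_h(t_n)^2$ such that for all $\phi\in S_h(t_n)$ $$\tfrac1\tau\left(\bar m_h(t_n;U_h^{n,\delta},\phi)-\bar m_h(t_{n-1};U_h^{n-1,\delta},\underline\phi)\right)+a_h(t_n;W_h^{n,\delta},\phi)=0,$$ $$\bar m_h(t_n;W_h^{n,\delta},\phi)=\varepsilon a_h(t_n;U_h^{n,\delta},\phi)+\tfrac{\theta}{2\varepsilon}\bar m_h(t_n;I_hf^\delta(U_h^{n,\delta}),\phi)-\tfrac1\varepsilon\bar m_h(t_n;U_h^{n,\delta},\phi),$$ starting from $U_h^{0,\delta}=U_{h,0}$. **Lemma.** There is $h_0>0$ depending only on $T,\Gamma_0,V,\rho$, and there are $\tau_0,C>0$ depending only on $T,\Gamma_0,V,\rho,\varepsilon,\theta,u_0,c_0$, such that for every evolving triangulation as above with $h<h_0$, all $U_{h,0}$ as above, all $\delta\in(0,1)$ and all $0<\tau\le\min\{\tau_0,\varepsilon^3/2\}$ the following holds. For each $1\le n\le\lfloor T/\tau\rfloor$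 and each $U_h^{n-1,\delta}\in S_h(t_{n-1})$ the step of the scheme has exactly one solution $(U_h^{n,\delta},W_h^{n,\delta})$; and the solution of the scheme starting from $U_{h,0}$ satisfies, for $1\le N\le\lfloor T/\tau\rfloor$, $$E_h^{\mathrm{CH},\delta}[U_h^{N,\delta};t_N]+\frac{\varepsilon\tau^2}4\sum_{n=1}^N\|\nabla_{\Gamma_h}\partial^\bullet_\tau U_h^{n,\delta}\|^2_{L^2(\Gamma_h(t_n))}+\tau\sum_{n=1}^N\|\nabla_{\Gamma_h}W_h^{n,\delta}\|^2_{L^2(\Gamma_h(t_n))}\le C\exp(Ct_N).$$ -/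

import Mathlib

open MeasureTheory Set Metric
open scoped RealInnerProductSpace

noncomputable section

/-- Euclidean three-space. -/
abbrev E3 : Type := EuclideanSpace ℝ (Fin 3)

/-! ### Surfaces, tangential calculus and the space `H¹` of a surface -/

/-- Surface measure: two-dimensional Hausdorff measure, normalised to agree with area. -/
def surfaceMeasure : Measure E3 := μHE[2]

/-- A closed (compact, without boundary) connected embedded `C²` surface in `ℝ³`: locally the
zero set of a `C²` function with nonvanishing differential.  Such a surface is orientable. -/
structure IsClosedC2Surface (Γ : Set E3) : Prop where
  isCompact : IsCompact Γ
  isConnected : IsConnected Γ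
  locally_levelSet : ∀ x ∈ Γ, ∃ (U : Set E3) (g : E3 → ℝ), IsOpen U ∧ x ∈ U ∧
    ContDiffOn ℝ 2 g U ∧ (∀ y ∈ U, fderiv ℝ g y ≠ 0) ∧ Γ ∩ U = {y ∈ U | g y = 0}

/-- The tangent plane of `Γ` at `x`, as a linear subspace of `ℝ³`. -/
def tangentPlane (Γ : Set E3) (x : E3) : Submodule ℝ E3 :=
  Submodule.span ℝ (tangentConeAt ℝ Γ x)

/-- The tangential divergence `∇_Γ · X = tr (P DX)`, with `P` the orthogonal projection onto the
tangent plane. -/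
def tangentialDiv (Γ : Set E3) (X : E3 → E3) (x : E3) : ℝ :=
  LinearMap.trace ℝ E3
    (((tangentPlane Γ x).starProjection ∘L fderiv ℝ X x : E3 →L[ℝ] E3) : E3 →ₗ[ℝ] E3)

/-- `u ∈ H¹(Γ)` with weak tangential gradient `g = ∇_Γ u`.  For tangential test fields the
curvature term in the integration by parts formula on `Γ` vanishes. -/
structure HasWeakTangentialGradient (Γ : Set E3) (u : E3 → ℝ) (g : E3 → E3) : Prop where
  memLp : MemLp u 2 (surfaceMeasure.restrict Γ)
  memLp_grad : MemLp g 2 (surfaceMeasure.restrict Γ)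
  tangential : ∀ᵐ x ∂(surfaceMeasure.restrict Γ), g x ∈ tangentPlane Γ x
  integral_by_parts : ∀ X : E3 → E3, ContDiff ℝ 1 X → (∀ x ∈ Γ, X x ∈ tangentPlane Γ x) →
    ∫ x in Γ, u x * tangentialDiv Γ X x ∂surfaceMeasure
      = - ∫ x in Γ, ⟪g x, X x⟫ ∂surfaceMeasure

/-- `‖f‖_{L²(Γ)}`. -/
def l2Norm {F : Type*} [NormedAddCommGroup F] (Γ : Set E3) (f : E3 → F) : ℝ :=
  (eLpNorm f 2 (surfaceMeasure.restrict Γ)).toReal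

/-- `{x : dist (x, Γ) < r}` is a tubular neighbourhood of `Γ`: each of its points has exactly one
closest point on `Γ`. -/
def IsTubularRadius (Γ : Set E3) (r : ℝ) : Prop :=
  0 < r ∧ ∀ x, infDist x Γ < r → ∃! p, p ∈ Γ ∧ dist x p = infDist x Γ

open Classical in
/-- The normal (closest point) projection `p` onto `Γ`. -/
def normalProj (Γ : Set E3) (x : E3) : E3 :=
  if h : ∃ p, p ∈ Γ ∧ dist x p = infDist x Γ then h.choose else x

open Classical in
/-- The lift `φ^ℓ` to `Γ` of a function `φ` on `A`, determined by `φ^ℓ (p x) = φ x`, `x ∈ A`. -/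
def liftFun (Γ A : Set E3) (φ : E3 → ℝ) (y : E3) : ℝ :=
  if h : ∃ x, x ∈ A ∧ normalProj Γ x = y then φ h.choose else 0

/-! ### Evolving surfaces -/

/-- `V ∈ C¹([0,T]; C²(ℝ³; ℝ³))`, with `W = ∂ₜ V`. -/
def IsC1C2 (T : ℝ) (V : ℝ → E3 → E3) : Prop :=
  ∃ W : ℝ → E3 → E3,
    (∀ t ∈ Icc 0 T, ContDiff ℝ 2 (V t) ∧ ContDiff ℝ 2 (W t)) ∧
    ∀ k : ℕ, k ≤ 2 →
      ContinuousOn (fun q : ℝ × E3 => iteratedFDeriv ℝ k (V q.1) q.2) (Icc 0 T ×ˢ univ) ∧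
      ContinuousOn (fun q : ℝ × E3 => iteratedFDeriv ℝ k (W q.1) q.2) (Icc 0 T ×ˢ univ) ∧
      ∀ t ∈ Icc 0 T, ∀ x, HasDerivWithinAt (fun s => iteratedFDeriv ℝ k (V s) x)
        (iteratedFDeriv ℝ k (W t) x) (Icc 0 T) t

/-- `f` restricts to a `C²` diffeomorphism between the compact `C²` surfaces `A` and `B`. -/
def IsC2Diffeo (f : E3 → E3) (A B : Set E3) : Prop :=
  BijOn f A B ∧ (∃ F : E3 → E3, ContDiff ℝ 2 F ∧ EqOn F f A) ∧
    ∃ G : E3 → E3, ContDiff ℝ 2 G ∧ ∀ x ∈ A, G (f x) = x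

/-- A `C²` evolving surface on `[0,T]`: the initial surface, the flow map and the velocity. -/
structure EvolvingSurface (T : ℝ) where
  Γ₀ : Set E3
  flow : E3 → ℝ → E3
  V : ℝ → E3 → E3
  isClosedC2Surface : IsClosedC2Surface Γ₀
  isC1C2 : IsC1C2 T V
  flow_zero : ∀ x ∈ Γ₀, flow x 0 = x
  flow_deriv : ∀ x ∈ Γ₀, ∀ t ∈ Icc 0 T,
    HasDerivWithinAt (flow x) (V t (flow x t)) (Icc 0 T) t
  flow_diffeo : ∀ t ∈ Icc 0 T,
    IsC2Diffeo (fun x => flow x t) Γ₀ ((fun x => flow x t) '' Γ₀)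

/-- `Γ(t)`. -/
def EvolvingSurface.surf {T : ℝ} (S : EvolvingSurface T) (t : ℝ) : Set E3 :=
  (fun x => S.flow x t) '' S.Γ₀

/-! ### Single triangles -/

/-- `ρ_K`: the supremum of the diameters of the two-dimensional balls contained in `K`. -/
def inDiameter (K : Set E3) : ℝ :=
  sSup {d | Module.finrank ℝ (vectorSpan ℝ K) = 2 ∧ ∃ c ∈ K, ∃ r : ℝ, 0 ≤ r ∧ d = 2 * r ∧
    closedBall c r ∩ (affineSpan ℝ K : Set E3) ⊆ K}

open Classical in
/-- The (constant) tangential gradient on a flat triangle `K` of a function `φ` which is affine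
on `K`: the vector `g` parallel to `K` with `φ x - φ y = g · (x - y)` on `K`. -/
def elemGrad (K : Set E3) (φ : E3 → ℝ) : E3 :=
  if h : ∃ g ∈ vectorSpan ℝ K, ∀ x ∈ K, ∀ y ∈ K, φ x - φ y = ⟪g, x - y⟫ then h.choose else 0

/-- The tangential divergence on a flat triangle `K` of a field which is affine on `K`. -/
def elemDiv (K : Set E3) (X : E3 → E3) : ℝ :=
  ∑ j : Fin 3, elemGrad K (fun y => X y j) j

/-! ### Evolving triangulations and linear finite elements -/

/-- An evolving triangulation: a triangulation of `Γ_h(0)` with nodes on `Γ₀`, whose nodes are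
transported by the velocity of the surface. A triangle is given by the set of its three nodes. -/
structure EvolvingTriangulation {T : ℝ} (S : EvolvingSurface T) where
  /-- The number of nodes. -/
  N : ℕ
  node : Fin N → ℝ → E3
  tri : Finset (Finset (Fin N))
  card_tri : ∀ K ∈ tri, K.card = 3
  node_used : ∀ i, ∃ K ∈ tri, i ∈ K
  node_mem : ∀ i, node i 0 ∈ S.Γ₀
  node_deriv : ∀ i, ∀ t ∈ Icc 0 T,
    HasDerivWithinAt (node i) (S.V t (node i t)) (Icc 0 T) t
  nondegenerate : ∀ K ∈ tri, AffineIndependent ℝ (fun i : K => node i 0)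
  conforming : ∀ K ∈ tri, ∀ L ∈ tri,
    convexHull ℝ ((fun i => node i 0) '' (K : Set (Fin N))) ∩
        convexHull ℝ ((fun i => node i 0) '' (L : Set (Fin N)))
      = convexHull ℝ ((fun i => node i 0) '' ((K : Set (Fin N)) ∩ L))

namespace EvolvingTriangulation

variable {T : ℝ} {S : EvolvingSurface T} (M : EvolvingTriangulation S)

/-- The closed simplex at time `t` spanned by a set of nodes. -/
def elem (t : ℝ) (K : Finset (Fin M.N)) : Set E3 :=
  convexHull ℝ ((fun i => M.node i t) '' (K : Set (Fin M.N)))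

/-- `Γ_h(t)`. -/
def surf (t : ℝ) : Set E3 := ⋃ K ∈ M.tri, M.elem t K

/-- The mesh size `h`: the supremum over `[0,T]` of the largest triangle diameter. -/
def h : ℝ := sSup {d | ∃ t ∈ Icc 0 T, ∃ K ∈ M.tri, d = diam (M.elem t K)}

/-- The finite element space `S_h(t)`: continuous functions on `Γ_h(t)` that are affine on every
triangle. Functions on `Γ_h(t)` are represented by their extension by zero to `ℝ³`. -/
def space (t : ℝ) : Set (E3 → ℝ) :=
  {φ | (∀ x, x ∉ M.surf t → φ x = 0) ∧ ContinuousOn φ (M.surf t) ∧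
    ∀ K ∈ M.tri, ∃ A : E3 →ᵃ[ℝ] ℝ, EqOn φ A (M.elem t K)}

/-- `w` is a system of barycentric coordinates of `x` in some triangle at time `t`. -/
def IsBary (t : ℝ) (x : E3) (w : Fin M.N → ℝ) : Prop :=
  ∃ K ∈ M.tri, (∀ i, 0 ≤ w i) ∧ (∀ i, i ∉ K → w i = 0) ∧ ∑ i, w i = 1 ∧
    ∑ i, w i • M.node i t = x

open Classical in
/-- `∑ v_i φ_i(t)`, with `φ_i(t)` the nodal basis functions: the continuous, elementwise affine
function on `Γ_h(t)` with the nodal values `v_i`. -/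
def interp {F : Type*} [AddCommGroup F] [Module ℝ F] (t : ℝ) (v : Fin M.N → F) (x : E3) : F :=
  if hx : ∃ w, M.IsBary t x w then ∑ i, hx.choose i • v i else 0

/-- The function on `Γ_h(t)` with the same nodal values as the function `φ` on `Γ_h(s)`. -/
def transfer (s t : ℝ) (φ : E3 → ℝ) : E3 → ℝ := M.interp t (fun i => φ (M.node i s))

/-- The Lagrange interpolation operator `I_h` at time `t`. -/
def lagrange (t : ℝ) (z : E3 → ℝ) : E3 → ℝ := M.interp t (fun i => z (M.node i t))

/-- The discrete velocity `V_h(t)`. -/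
def discreteVelocity (t : ℝ) : E3 → E3 := M.interp t (fun i => S.V t (M.node i t))

/-- The lumped mass form `m̄_h(t; η, ζ) = ∫_{Γ_h(t)} I_h (η ζ)`. -/
def lumpedMass (t : ℝ) (η ζ : E3 → ℝ) : ℝ :=
  ∫ x in M.surf t, M.lagrange t (fun y => η y * ζ y) x ∂surfaceMeasure

/-- `a_h(t; η, ζ) = ∫_{Γ_h(t)} ∇_{Γ_h} η · ∇_{Γ_h} ζ`. -/
def stiffness (t : ℝ) (η ζ : E3 → ℝ) : ℝ :=
  ∑ K ∈ M.tri, ∫ _x in M.elem t K,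
    ⟪elemGrad (M.elem t K) η, elemGrad (M.elem t K) ζ⟫ ∂surfaceMeasure

/-- `‖∇_{Γ_h} η‖²_{L²(Γ_h(t))}`. -/
def gradNormSq (t : ℝ) (η : E3 → ℝ) : ℝ :=
  ∑ K ∈ M.tri, ∫ _x in M.elem t K, ‖elemGrad (M.elem t K) η‖ ^ 2 ∂surfaceMeasure

/-- Exactness at time `t`: the lifted triangles form a conforming subdivision of `Γ(t)`. -/
def IsExactAt (t : ℝ) : Prop :=
  (∀ K ∈ M.tri, InjOn (normalProj (S.surf t)) (M.elem t K)) ∧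
  (⋃ K ∈ M.tri, normalProj (S.surf t) '' M.elem t K) = S.surf t ∧
  ∀ K ∈ M.tri, ∀ L ∈ M.tri,
    normalProj (S.surf t) '' M.elem t K ∩ normalProj (S.surf t) '' M.elem t L
      = normalProj (S.surf t) '' M.elem t (K ∩ L)

/-- The standing assumptions on the evolving triangulation: for all times it is uniformly
quasi-uniform with constant `ρ`, exact, acute, contained in a tubular neighbourhood of `Γ(t)`, and
the discrete velocity has nonnegative tangential divergence. -/
structure IsRegular (ρ : ℝ) : Prop where
  quasiUniform : ∀ t ∈ Icc 0 T, ∀ K ∈ M.tri, ρ * M.h ≤ inDiameter (M.elem t K)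
  exact : ∀ t ∈ Icc 0 T, M.IsExactAt t
  acute : ∀ t ∈ Icc 0 T, ∀ K ∈ M.tri, ∀ i ∈ K, ∀ j ∈ K, ∀ k ∈ K, i ≠ j → j ≠ k → i ≠ k →
    EuclideanGeometry.angle (M.node i t) (M.node j t) (M.node k t) ≤ Real.pi / 2
  tubular : ∀ t ∈ Icc 0 T, ∃ r, IsTubularRadius (S.surf t) r ∧
    ∀ x ∈ M.surf t, infDist x (S.surf t) < r
  div_nonneg : ∀ t ∈ Icc 0 T, ∀ K ∈ M.tri,
    0 ≤ elemDiv (M.elem t K) (M.discreteVelocity t)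

end EvolvingTriangulation

/-! ### The logarithmic potential and its regularisation -/

/-- `F_log(r) = (1-r) log (1-r) + (1+r) log (1+r)` (with `0 log 0 = 0`). -/
def Flog (r : ℝ) : ℝ := (1 - r) * Real.log (1 - r) + (1 + r) * Real.log (1 + r)

/-- `F(r) = θ/2 F_log(r) + (1 - r²)/2`. -/
def potential (θ r : ℝ) : ℝ := θ / 2 * Flog r + (1 - r ^ 2) / 2

open Classical in
/-- The regularised logarithmic potential `F_log^δ`. -/
def FlogReg (δ r : ℝ) : ℝ :=
  if 1 - δ ≤ r then
    (1 - r) * Real.log δ + (1 + r) * Real.log (2 - δ) + (1 - r) ^ 2 / (2 * δ)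
      + (1 + r) ^ 2 / (2 * (2 - δ)) - 1
  else if r ≤ -1 + δ then
    (1 + r) * Real.log δ + (1 - r) * Real.log (2 - δ) + (1 + r) ^ 2 / (2 * δ)
      + (1 - r) ^ 2 / (2 * (2 - δ)) - 1
  else (1 + r) * Real.log (1 + r) + (1 - r) * Real.log (1 - r)

/-- `F^δ(r) = θ/2 F_log^δ(r) + (1 - r²)/2`. -/
def potentialReg (θ δ r : ℝ) : ℝ := θ / 2 * FlogReg δ r + (1 - r ^ 2) / 2

/-- `f^δ = (F_log^δ)'`. -/
def flogReg (δ : ℝ) : ℝ → ℝ := deriv (FlogReg δ)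

/-! ### Initial data, energy and the fully discrete scheme -/

/-- `u₀ ∈ 𝓘₀`: an `H¹` function with `|u₀| ≤ 1`, finite Ginzburg-Landau energy, and
`|∫ u₀| < |Γ(t)|` for all `t`. -/
def IsAdmissible {T : ℝ} (S : EvolvingSurface T) (ε θ : ℝ) (u₀ : E3 → ℝ) : Prop :=
  (∃ g, HasWeakTangentialGradient S.Γ₀ u₀ g ∧
    IntegrableOn (fun x => ε * ‖g x‖ ^ 2 / 2 + 1 / ε * potential θ (u₀ x)) S.Γ₀ surfaceMeasure) ∧
  (∀ᵐ x ∂(surfaceMeasure.restrict S.Γ₀), |u₀ x| ≤ 1) ∧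
  ∀ t ∈ Icc 0 T,
    1 / surfaceMeasure.real (S.surf t) * |∫ x in S.Γ₀, u₀ x ∂surfaceMeasure| < 1

namespace EvolvingTriangulation

variable {T : ℝ} {S : EvolvingSurface T} (M : EvolvingTriangulation S)

/-- `η ∈ 𝓘_{h,0}`. The gradient part of the discrete energy is a finite sum of constants times
areas, so finiteness of the energy is integrability of its potential part. -/
def IsDiscreteAdmissible (θ : ℝ) (η : E3 → ℝ) : Prop :=
  η ∈ M.space 0 ∧
  (∀ᵐ x ∂(surfaceMeasure.restrict (M.surf 0)), |η x| ≤ 1) ∧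
  IntegrableOn (M.lagrange 0 (fun x => potential θ (η x))) (M.surf 0) surfaceMeasure ∧
  |1 / surfaceMeasure.real (M.surf 0) * ∫ x in M.surf 0, η x ∂surfaceMeasure| < 1

/-- `‖u₀ - η^ℓ‖_{L²(Γ₀)} + h ‖u₀ - η^ℓ‖_{H¹(Γ₀)} ≤ c h²`. -/
def Approximates (c : ℝ) (u₀ η : E3 → ℝ) : Prop :=
  ∃ g : E3 → E3,
    HasWeakTangentialGradient S.Γ₀ (fun x => u₀ x - liftFun S.Γ₀ (M.surf 0) η x) g ∧
    l2Norm S.Γ₀ (fun x => u₀ x - liftFun S.Γ₀ (M.surf 0) η x)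
      + M.h * √(l2Norm S.Γ₀ (fun x => u₀ x - liftFun S.Γ₀ (M.surf 0) η x) ^ 2
          + l2Norm S.Γ₀ g ^ 2) ≤ c * M.h ^ 2

/-- The regularised discrete energy
`E_h^{CH,δ}[η; t] = ∫_{Γ_h(t)} ε |∇_{Γ_h} η|² / 2 + (1/ε) I_h F^δ(η)`. -/
def energyReg (ε θ δ t : ℝ) (η : E3 → ℝ) : ℝ :=
  ε / 2 * M.gradNormSq t η
    + 1 / ε * ∫ x in M.surf t, M.lagrange t (fun y => potentialReg θ δ (η y)) x ∂surfaceMeasure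

/-- One step of the regularised fully discrete scheme: `(U, W) ∈ S_h(t) × S_h(t)` is obtained
at the time `t` from `Uprev ∈ S_h(s)` at the previous time `s = t - τ`. -/
def IsStep (ε θ δ τ s t : ℝ) (Uprev U W : E3 → ℝ) : Prop :=
  U ∈ M.space t ∧ W ∈ M.space t ∧
  (∀ φ ∈ M.space t,
    1 / τ * (M.lumpedMass t U φ - M.lumpedMass s Uprev (M.transfer t s φ))
      + M.stiffness t W φ = 0) ∧
  ∀ φ ∈ M.space t,
    M.lumpedMass t W φ = ε * M.stiffness t U φ
      + θ / (2 * ε) * M.lumpedMass t (M.lagrange t (fun y => flogReg δ (U y))) φ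
      - 1 / ε * M.lumpedMass t U φ

/-- `(U n, W n)`, `1 ≤ n ≤ ⌊T/τ⌋`, solves the regularised fully discrete scheme with `U 0 = Uh₀`
and `t_n = n τ`. -/
def IsDiscreteSolution (ε θ δ τ : ℝ) (Uh₀ : E3 → ℝ) (U W : ℕ → E3 → ℝ) : Prop :=
  U 0 = Uh₀ ∧ ∀ n, 1 ≤ n → n ≤ ⌊T / τ⌋₊ →
    M.IsStep ε θ δ τ ((n - 1 : ℝ) * τ) ((n : ℝ) * τ) (U (n - 1)) (U n) (W n)

/-- The fully discrete material derivative `∂_τ Uⁿ = (Uⁿ - \overline{Uⁿ⁻¹}) / τ`. -/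
def materialDiff (τ : ℝ) (U : ℕ → E3 → ℝ) (n : ℕ) : E3 → ℝ :=
  fun x => 1 / τ * (U n x - M.transfer ((n - 1 : ℝ) * τ) ((n : ℝ) * τ) (U (n - 1)) x)

end EvolvingTriangulation

end

noncomputable section

/-! ### The regularised logarithmic potential -/

/-! In nodal values the scheme is a finite system with diagonal lumped masses `m` and a positive
semidefinite stiffness form `B`. Solvability of one step is a monotone operator argument. The first
equation determines `U` from `W`, and what remains for `W` is strongly monotone on the range of the
stiffness operator: the concave part of the potential contributes only `|u|²/ε = -τ B(w,u)/ε`, which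
Young's inequality absorbs when `τ ≤ ε³/2`. The same computation on differences gives uniqueness
(`step_exists`, `step_unique`).

The energy estimate compares consecutive steps (`energy_step`). Masses and forms change between the
two times, so the natural increment is not `U - V` but `D = U - r V`, where `r` is the nodal ratio
of old to new mass: the first equation then reads `m(D, φ) = -τ B(W, φ)`. Testing with `W` and with
`D` produces the energy balance. Convexity of the regularised logarithm handles the nonlinear term
for every `δ`, and nonnegative discrete divergence gives `r ≤ 1`, so that `F(rV) ≤ F(V)`. Since the
energy itself is not obviously bounded below uniformly in `δ`, the quantity propagated is a modified
energy in which the sign of the quadratic term is reversed; the difference is controlled by testing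
the first equation with `U`. A discrete Gronwall argument sums the steps.

The geometric heart is the bound on `B(rV, rV)` by `(1 + Cτ) B'(V, V)` plus lower order
(`StepControl`). A gradient of `r` costs a factor `1/h`, so the ratios `r` at neighbouring nodes
must differ by `O(hτ)`. The ratio at a node is an average of area ratios of the adjacent triangles,
and areas grow at the rate of the discrete divergence; it therefore suffices that the divergences on
two triangles with a common node differ by `O(h)` (`abs_divK_sub_divK_le`). Their normals agree up
to sign and `O(h)` at time zero, because the nodes lie on a `C²` surface, and both are transported
by the same linear equation up to `O(h)`; Gronwall preserves the closeness.

It remains to bound the initial energy independently of `δ` and of the mesh. The potential part is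
bounded because the data lie in `[-1, 1]`. For the gradient, the weak gradient of the lifted datum
is known only as a difference `g₀ - g'`. In each triangle a small patch of the surface is tested
with a tangential field pointing along the elementwise gradient; integration by parts bounds that
gradient by the local `L²` norm of `g₀ - g'` up to a curvature error
(`exists_local_gradient_const`). The patches of different triangles are disjoint, so the estimates
add up (`exists_initial_bound`), and the same packing bounds the number of triangles. -/

/-- Truncation of `r` to `[-(1-δ), 1-δ]`. -/
def truncReg (δ r : ℝ) : ℝ := max (-(1 - δ)) (min (1 - δ) r)

/-- An explicit formula for the derivative of `FlogReg δ`. -/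
def flogFun (δ r : ℝ) : ℝ :=
  Real.log (1 + truncReg δ r) - Real.log (1 - truncReg δ r)
    + (r - truncReg δ r) * (1 / δ + 1 / (2 - δ))

theorem truncReg_of_ge {δ r : ℝ} (hδ1 : δ < 1) (h : 1 - δ ≤ r) : truncReg δ r = 1 - δ := by
  rw [truncReg, min_eq_left h, max_eq_right (by linarith)]

theorem truncReg_of_le {δ r : ℝ} (hδ1 : δ < 1) (h : r ≤ -1 + δ) : truncReg δ r = -(1 - δ) := by
  rw [truncReg, min_eq_right (by linarith), max_eq_left (by linarith)]

theorem truncReg_of_mem {δ r : ℝ} (h1 : -1 + δ ≤ r) (h2 : r ≤ 1 - δ) : truncReg δ r = r := by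
  rw [truncReg, min_eq_right h2, max_eq_right (by linarith)]

theorem hasDerivAt_FlogReg_top {δ : ℝ} (r : ℝ) :
    HasDerivAt (fun r => (1 - r) * Real.log δ + (1 + r) * Real.log (2 - δ) + (1 - r) ^ 2 / (2 * δ)
      + (1 + r) ^ 2 / (2 * (2 - δ)) - 1)
      (-Real.log δ + Real.log (2 - δ) - (1 - r) / δ + (1 + r) / (2 - δ)) r := by
  have h1 : HasDerivAt (fun r : ℝ => 1 - r) (-1) r := by simpa using (hasDerivAt_id r).const_sub 1
  have h2 : HasDerivAt (fun r : ℝ => 1 + r) 1 r := by simpa using (hasDerivAt_id r).const_add 1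
  have := ((((h1.mul_const (Real.log δ)).add (h2.mul_const (Real.log (2 - δ)))).add
    ((h1.pow 2).div_const (2 * δ))).add ((h2.pow 2).div_const (2 * (2 - δ)))).sub_const 1
  refine this.congr_deriv ?_
  rw [mul_comm 2 δ, mul_comm 2 (2 - δ), ← div_div, ← div_div]
  ring

theorem hasDerivAt_FlogReg_bot {δ : ℝ} (r : ℝ) :
    HasDerivAt (fun r => (1 + r) * Real.log δ + (1 - r) * Real.log (2 - δ) + (1 + r) ^ 2 / (2 * δ)
      + (1 - r) ^ 2 / (2 * (2 - δ)) - 1)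
      (Real.log δ - Real.log (2 - δ) + (1 + r) / δ - (1 - r) / (2 - δ)) r := by
  have h := (hasDerivAt_FlogReg_top (δ := δ) (-r)).comp r (hasDerivAt_neg r)
  refine (h.congr_deriv ?_).congr_of_eventuallyEq (Filter.Eventually.of_forall fun x => ?_)
  · ring
  · simp only [Function.comp]; ring

theorem hasDerivAt_FlogReg_mid {r : ℝ} (h1 : -1 < r) (h2 : r < 1) :
    HasDerivAt (fun r => (1 + r) * Real.log (1 + r) + (1 - r) * Real.log (1 - r))
      (Real.log (1 + r) - Real.log (1 - r)) r := by
  have e1 : HasDerivAt (fun r : ℝ => 1 - r) (-1) r := by simpa using (hasDerivAt_id r).const_sub 1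
  have e2 : HasDerivAt (fun r : ℝ => 1 + r) 1 r := by simpa using (hasDerivAt_id r).const_add 1
  have n1 : 1 - r ≠ 0 := by linarith
  have n2 : 1 + r ≠ 0 := by linarith
  refine ((e2.mul (e2.log n2)).add (e1.mul (e1.log n1))).congr_deriv ?_
  field_simp
  ring

theorem FlogReg_eq_top {δ r : ℝ} (h : 1 - δ ≤ r) :
    FlogReg δ r = (1 - r) * Real.log δ + (1 + r) * Real.log (2 - δ) + (1 - r) ^ 2 / (2 * δ)
      + (1 + r) ^ 2 / (2 * (2 - δ)) - 1 := by rw [FlogReg, if_pos h]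

theorem FlogReg_eq_bot {δ r : ℝ} (hδ1 : δ < 1) (h : r ≤ -1 + δ) :
    FlogReg δ r = (1 + r) * Real.log δ + (1 - r) * Real.log (2 - δ) + (1 + r) ^ 2 / (2 * δ)
      + (1 - r) ^ 2 / (2 * (2 - δ)) - 1 := by
  rw [FlogReg, if_neg (by linarith), if_pos h]

theorem FlogReg_eq_mid {δ r : ℝ} (hδ0 : 0 < δ) (hδ1 : δ < 1) (h1 : -1 + δ ≤ r) (h2 : r ≤ 1 - δ) :
    FlogReg δ r = (1 + r) * Real.log (1 + r) + (1 - r) * Real.log (1 - r) := by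
  have n1 : δ ≠ 0 := hδ0.ne'
  have n2 : 2 - δ ≠ 0 := by linarith
  rcases h2.eq_or_lt with rfl | h2
  · rw [FlogReg_eq_top le_rfl, show 1 + (1 - δ) = 2 - δ by ring, show 1 - (1 - δ) = δ by ring]
    field_simp
    ring
  rcases h1.eq_or_lt with rfl | h1
  · rw [FlogReg_eq_bot hδ1 le_rfl, show 1 + (-1 + δ) = δ by ring,
      show 1 - (-1 + δ) = 2 - δ by ring]
    field_simp
    ring
  rw [FlogReg, if_neg (by linarith), if_neg (by linarith)]

/-- The quadratic branches continue the logarithmic one with matching value and slope at `±(1-δ)`,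
so one-sided derivatives on adjacent closed intervals can be glued. -/
theorem hasDerivAt_FlogReg {δ : ℝ} (hδ0 : 0 < δ) (hδ1 : δ < 1) (r : ℝ) :
    HasDerivAt (FlogReg δ) (flogFun δ r) r := by
  have n1 : δ ≠ 0 := hδ0.ne'
  have n2 : 2 - δ ≠ 0 := by linarith
  have top : ∀ r, 1 - δ ≤ r → HasDerivWithinAt (FlogReg δ) (flogFun δ r) (Ici (1 - δ)) r := by
    intro r hr
    refine ((hasDerivAt_FlogReg_top (δ := δ) r).hasDerivWithinAt.congr
      (fun x hx => FlogReg_eq_top hx) (FlogReg_eq_top hr)).congr_deriv ?_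
    rw [flogFun, truncReg_of_ge hδ1 hr, show 1 + (1 - δ) = 2 - δ by ring,
      show 1 - (1 - δ) = δ by ring]
    field_simp
    ring
  have bot : ∀ r, r ≤ -1 + δ → HasDerivWithinAt (FlogReg δ) (flogFun δ r) (Iic (-1 + δ)) r := by
    intro r hr
    refine ((hasDerivAt_FlogReg_bot (δ := δ) r).hasDerivWithinAt.congr
      (fun x hx => FlogReg_eq_bot hδ1 hx) (FlogReg_eq_bot hδ1 hr)).congr_deriv ?_
    rw [flogFun, truncReg_of_le hδ1 hr, show 1 + -(1 - δ) = δ by ring,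
      show 1 - -(1 - δ) = 2 - δ by ring]
    field_simp
    ring
  have mid : ∀ r, -1 + δ ≤ r → r ≤ 1 - δ →
      HasDerivWithinAt (FlogReg δ) (flogFun δ r) (Icc (-1 + δ) (1 - δ)) r := by
    intro r h1 h2
    refine ((hasDerivAt_FlogReg_mid (by linarith) (by linarith)).hasDerivWithinAt.congr
      (fun x hx => FlogReg_eq_mid hδ0 hδ1 hx.1 hx.2) (FlogReg_eq_mid hδ0 hδ1 h1 h2)).congr_deriv ?_
    rw [flogFun, truncReg_of_mem h1 h2]
    ring
  rcases lt_trichotomy r (1 - δ) with h2 | h2 | h2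
  · rcases lt_trichotomy r (-1 + δ) with h1 | h1 | h1
    · exact (bot r h1.le).hasDerivAt (Iic_mem_nhds h1)
    · refine ((bot r h1.le).union (mid r h1.ge h2.le)).hasDerivAt ?_
      rw [Iic_union_Icc_eq_Iic (by linarith)]
      exact Iic_mem_nhds h2
    · exact (mid r h1.le h2.le).hasDerivAt (Icc_mem_nhds h1 h2)
  · refine ((mid r (by linarith) h2.le).union (top r h2.ge)).hasDerivAt ?_
    rw [Icc_union_Ici_eq_Ici (by linarith)]
    exact Ici_mem_nhds (by linarith)
  · exact (top r h2.le).hasDerivAt (Ici_mem_nhds h2)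

theorem flogReg_eq {δ : ℝ} (hδ0 : 0 < δ) (hδ1 : δ < 1) : flogReg δ = flogFun δ :=
  funext fun r => (hasDerivAt_FlogReg hδ0 hδ1 r).deriv

theorem truncReg_mem {δ : ℝ} (hδ1 : δ < 1) (r : ℝ) : truncReg δ r ∈ Icc (-(1 - δ)) (1 - δ) :=
  ⟨le_max_left _ _, max_le (by linarith) (min_le_left _ _)⟩

theorem truncReg_sub {δ r s : ℝ} (h : r ≤ s) :
    0 ≤ truncReg δ s - truncReg δ r ∧ truncReg δ s - truncReg δ r ≤ s - r := by
  unfold truncReg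
  constructor
  · have : min (1 - δ) r ≤ min (1 - δ) s := min_le_min_left _ h
    have := max_le_max_left (-(1 - δ)) this
    linarith
  · have h1 : min (1 - δ) s ≤ min (1 - δ) r + (s - r) := by
      rcases le_total (1 - δ) r with h' | h'
      · rw [min_eq_left h']; have := min_le_left (1 - δ) s; linarith
      · rw [min_eq_right h']; have := min_le_right (1 - δ) s; linarith
    have : max (-(1 - δ)) (min (1 - δ) s) ≤ max (-(1 - δ)) (min (1 - δ) r) + (s - r) :=
      max_le (by have := le_max_left (-(1 - δ)) (min (1 - δ) r); linarith)
        (by have := le_max_right (-(1 - δ)) (min (1 - δ) r); linarith)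
    linarith

/-- The logarithm is increasing and `1/δ`-Lipschitz on `[δ, ∞)`, which contains `1 + a` and `1 - a`;
the two logarithms contribute `1/δ` each. -/
theorem log_ratio_sub_le {δ a b : ℝ} (hδ0 : 0 < δ) (ha : a ∈ Icc (-(1 - δ)) (1 - δ))
    (hb : b ∈ Icc (-(1 - δ)) (1 - δ)) (hab : a ≤ b) :
    0 ≤ (Real.log (1 + b) - Real.log (1 - b)) - (Real.log (1 + a) - Real.log (1 - a)) ∧
    (Real.log (1 + b) - Real.log (1 - b)) - (Real.log (1 + a) - Real.log (1 - a))
      ≤ 2 / δ * (b - a) := by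
  have h1 : Real.log (1 + a) ≤ Real.log (1 + b) :=
    Real.log_le_log (by linarith [ha.1]) (by linarith)
  have h2 : Real.log (1 - b) ≤ Real.log (1 - a) :=
    Real.log_le_log (by linarith [hb.2]) (by linarith)
  have key : ∀ x y : ℝ, δ ≤ x → x ≤ y → Real.log y - Real.log x ≤ (y - x) / δ := by
    intro x y hx hxy
    have hx0 : 0 < x := by linarith
    rw [← Real.log_div (by linarith) hx0.ne']
    have := Real.log_le_sub_one_of_pos (div_pos (lt_of_lt_of_le hx0 hxy) hx0)
    have e : y / x - 1 = (y - x) / x := by field_simp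
    rw [e] at this
    exact this.trans (div_le_div_of_nonneg_left (by linarith) hδ0 hx)
  have h3 := key (1 + a) (1 + b) (by linarith [ha.1]) (by linarith)
  have h4 := key (1 - b) (1 - a) (by linarith [hb.2]) (by linarith)
  refine ⟨by linarith, ?_⟩
  have e : 2 / δ * (b - a) = (1 + b - (1 + a)) / δ + (1 - a - (1 - b)) / δ := by field_simp; ring
  linarith

/-- Past the truncation level the function continues linearly with slope `1/δ + 1/(2-δ) ≤ 2/δ`. The
`δ`-dependent Lipschitz constant serves only the existence of a discrete solution and never enters
the energy bound. -/
theorem flogFun_sub {δ r s : ℝ} (hδ0 : 0 < δ) (hδ1 : δ < 1) (h : r ≤ s) :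
    0 ≤ flogFun δ s - flogFun δ r ∧ flogFun δ s - flogFun δ r ≤ 4 / δ * (s - r) := by
  obtain ⟨h1, h2⟩ := log_ratio_sub_le hδ0 (truncReg_mem hδ1 r) (truncReg_mem hδ1 s)
    (by linarith [(truncReg_sub (δ := δ) h).1])
  obtain ⟨h3, h4⟩ := truncReg_sub (δ := δ) h
  have hk0 : 0 ≤ 1 / δ + 1 / (2 - δ) :=
    add_nonneg (by positivity) (one_div_nonneg.2 (by linarith))
  have hk1 : 1 / δ + 1 / (2 - δ) ≤ 2 / δ := by
    have : 1 / (2 - δ) ≤ 1 / δ := one_div_le_one_div_of_le hδ0 (by linarith)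
    have e : 2 / δ = 1 / δ + 1 / δ := by ring
    linarith
  have e : flogFun δ s - flogFun δ r =
      ((Real.log (1 + truncReg δ s) - Real.log (1 - truncReg δ s))
        - (Real.log (1 + truncReg δ r) - Real.log (1 - truncReg δ r)))
      + ((s - r) - (truncReg δ s - truncReg δ r)) * (1 / δ + 1 / (2 - δ)) := by
    unfold flogFun; ring
  have h5 : 0 ≤ (s - r) - (truncReg δ s - truncReg δ r) := by linarith
  have hd : 0 < 2 / δ := by positivity
  refine ⟨by rw [e]; positivity, ?_⟩
  have h6 : ((s - r) - (truncReg δ s - truncReg δ r)) * (1 / δ + 1 / (2 - δ)) ≤ (s - r) * (2 / δ) :=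
    mul_le_mul (by linarith) hk1 hk0 (by linarith)
  have h7 : 2 / δ * (truncReg δ s - truncReg δ r) ≤ 2 / δ * (s - r) :=
    mul_le_mul_of_nonneg_left h4 hd.le
  have e4 : 4 / δ * (s - r) = 2 / δ * (s - r) + (s - r) * (2 / δ) := by ring
  linarith

theorem flogReg_monotone {δ : ℝ} (hδ0 : 0 < δ) (hδ1 : δ < 1) : Monotone (flogReg δ) := by
  rw [flogReg_eq hδ0 hδ1]
  exact fun r s h => by linarith [(flogFun_sub hδ0 hδ1 h).1]

theorem flogReg_lipschitz {δ : ℝ} (hδ0 : 0 < δ) (hδ1 : δ < 1) :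
    ∀ r s, |flogReg δ r - flogReg δ s| ≤ 4 / δ * |r - s| := by
  rw [flogReg_eq hδ0 hδ1]
  intro r s
  rcases le_total r s with h | h
  · obtain ⟨h1, h2⟩ := flogFun_sub hδ0 hδ1 h
    rw [abs_sub_comm, abs_of_nonneg h1, abs_sub_comm, abs_of_nonneg (by linarith : 0 ≤ s - r)]
    exact h2
  · obtain ⟨h1, h2⟩ := flogFun_sub hδ0 hδ1 h
    rw [abs_of_nonneg h1, abs_of_nonneg (by linarith : 0 ≤ r - s)]
    exact h2

theorem FlogReg_convex {δ : ℝ} (hδ0 : 0 < δ) (hδ1 : δ < 1) : ConvexOn ℝ univ (FlogReg δ) := by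
  refine Monotone.convexOn_univ_of_deriv
    (fun r => (hasDerivAt_FlogReg hδ0 hδ1 r).differentiableAt) ?_
  exact flogReg_monotone hδ0 hδ1

/-- A convex graph lies above its tangent at `a`. This is what makes the implicit treatment of the
logarithm stable. -/
theorem FlogReg_sub_le {δ : ℝ} (hδ0 : 0 < δ) (hδ1 : δ < 1) (a b : ℝ) :
    FlogReg δ a - FlogReg δ b ≤ flogReg δ a * (a - b) := by
  have hd := hasDerivAt_FlogReg hδ0 hδ1 a
  rw [← flogReg_eq hδ0 hδ1] at hd
  have hc := FlogReg_convex hδ0 hδ1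
  rcases lt_trichotomy a b with h | h | h
  · have := hc.le_slope_of_hasDerivAt (mem_univ a) (mem_univ b) h hd
    rw [slope_def_field, le_div_iff₀ (by linarith)] at this
    linarith
  · simp [h]
  · have := hc.slope_le_of_hasDerivAt (mem_univ b) (mem_univ a) h hd
    rw [slope_def_field, div_le_iff₀ (by linarith)] at this
    linarith

theorem FlogReg_zero {δ : ℝ} (hδ0 : 0 < δ) (hδ1 : δ < 1) : FlogReg δ 0 = 0 := by
  rw [FlogReg_eq_mid hδ0 hδ1 (by linarith) (by linarith)]; simp

theorem flogReg_zero {δ : ℝ} (hδ0 : 0 < δ) (hδ1 : δ < 1) : flogReg δ 0 = 0 := by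
  rw [flogReg_eq hδ0 hδ1, flogFun, truncReg_of_mem (by linarith) (by linarith)]; simp

theorem FlogReg_nonneg {δ : ℝ} (hδ0 : 0 < δ) (hδ1 : δ < 1) (r : ℝ) : 0 ≤ FlogReg δ r := by
  have := FlogReg_sub_le hδ0 hδ1 0 r
  rw [FlogReg_zero hδ0 hδ1, flogReg_zero hδ0 hδ1] at this
  linarith

/-- Convexity together with `F(0) = 0 ≤ F` makes shrinking towards the origin decrease `F`. It is
applied to old nodal values scaled by a mass ratio in `[0, 1]`. -/
theorem FlogReg_mul_le {δ : ℝ} (hδ0 : 0 < δ) (hδ1 : δ < 1) {c : ℝ} (h0 : 0 ≤ c) (h1 : c ≤ 1)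
    (r : ℝ) : FlogReg δ (c * r) ≤ FlogReg δ r := by
  have := (FlogReg_convex hδ0 hδ1).2 (mem_univ r) (mem_univ 0) h0 (by linarith : 0 ≤ 1 - c)
    (by ring)
  simp only [smul_eq_mul, mul_zero, add_zero, FlogReg_zero hδ0 hδ1] at this
  nlinarith [FlogReg_nonneg hδ0 hδ1 r]

/-- By convexity the maximum over `[-1, 1]` is attained at an end point, where the value is bounded
independently of `δ`. -/
theorem FlogReg_le_three {δ : ℝ} (hδ0 : 0 < δ) (hδ1 : δ < 1) {r : ℝ} (hr : |r| ≤ 1) :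
    FlogReg δ r ≤ 3 := by
  have hl : Real.log (2 - δ) ≤ 1 := by
    have := Real.log_le_sub_one_of_pos (by linarith : 0 < 2 - δ); linarith
  have hq : 2 ^ 2 / (2 * (2 - δ)) ≤ 2 := by
    rw [div_le_iff₀ (by linarith)]; linarith
  have h1 : FlogReg δ 1 ≤ 3 := by
    rw [FlogReg_eq_top (by linarith)]; norm_num at hq ⊢; linarith
  have h2 : FlogReg δ (-1) ≤ 3 := by
    rw [FlogReg_eq_bot hδ1 (by linarith)]; norm_num at hq ⊢; linarith
  have hr' := abs_le.1 hr
  have := (FlogReg_convex hδ0 hδ1).2 (mem_univ (-1)) (mem_univ 1)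
    (by linarith : 0 ≤ (1 - r) / 2) (by linarith : 0 ≤ (1 + r) / 2) (by ring)
  simp only [smul_eq_mul] at this
  rw [show (1 - r) / 2 * -1 + (1 + r) / 2 * 1 = r by ring] at this
  nlinarith

/-! ### Solvability of one step of the scheme -/

/-- A strongly monotone Lipschitz map of a Hilbert space has a zero. -/
theorem exists_zero_of_stronglyMonotone {H : Type*} [NormedAddCommGroup H] [InnerProductSpace ℝ H]
    [CompleteSpace H] (G : H → H) {c L : ℝ} (hc : 0 < c)
    (hL : ∀ x y, ‖G x - G y‖ ≤ L * ‖x - y‖)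
    (hm : ∀ x y, c * ‖x - y‖ ^ 2 ≤ ⟪G x - G y, x - y⟫) : ∃ x, G x = 0 := by
  -- Step length of the damped iteration `x ↦ x - l G x`, whose squared contraction factor is at
  -- most `1 - 2lc + l²L² ≤ 1 - lc`. The extra `c²` keeps the denominator positive and gives `lc ≤
  -- 1`.
  set l : ℝ := c / (L ^ 2 + c ^ 2) with hl
  have hl0 : 0 < l := by positivity
  have hlL : l * (L ^ 2 + c ^ 2) = c := by rw [hl]; field_simp
  have hlc : l * c ≤ 1 := by
    rw [hl, div_mul_eq_mul_div, div_le_one (by positivity)]; nlinarith [sq_nonneg L]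
  have key : ∀ x y, ‖(x - l • G x) - (y - l • G y)‖ ≤ √(1 - l * c) * ‖x - y‖ := by
    intro x y
    have e : (x - l • G x) - (y - l • G y) = (x - y) - l • (G x - G y) := by
      rw [smul_sub]; abel
    have h1 := hm x y
    have h2 := hL x y
    have h3 : ‖G x - G y‖ ^ 2 ≤ L ^ 2 * ‖x - y‖ ^ 2 := by
      rw [← mul_pow]; exact pow_le_pow_left₀ (norm_nonneg _) h2 2
    refine abs_le_of_sq_le_sq' ?_ (by positivity) |>.2
    rw [mul_pow, Real.sq_sqrt (by linarith), e, norm_sub_sq_real, inner_smul_right, norm_smul,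
      mul_pow, Real.norm_eq_abs, sq_abs, real_inner_comm]
    have h4 : l ^ 2 * ‖G x - G y‖ ^ 2 ≤ l ^ 2 * (L ^ 2 * ‖x - y‖ ^ 2) :=
      mul_le_mul_of_nonneg_left h3 (by positivity)
    have h5 : l * (c * ‖x - y‖ ^ 2) ≤ l * ⟪G x - G y, x - y⟫ :=
      mul_le_mul_of_nonneg_left h1 hl0.le
    have h6 : l ^ 2 * L ^ 2 ≤ l * c := by
      have : l ^ 2 * L ^ 2 + l ^ 2 * c ^ 2 = l * c := by linear_combination l * hlL
      nlinarith [sq_nonneg (l * c)]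
    nlinarith [mul_le_mul_of_nonneg_right h6 (sq_nonneg ‖x - y‖)]
  have hlip : LipschitzWith (Real.toNNReal √(1 - l * c)) fun x => x - l • G x := by
    refine LipschitzWith.of_dist_le_mul fun x y => ?_
    rw [dist_eq_norm, dist_eq_norm, Real.coe_toNNReal _ (Real.sqrt_nonneg _)]
    exact key x y
  have hK : Real.toNNReal √(1 - l * c) < 1 := by
    rw [Real.toNNReal_lt_one]
    have : 0 < l * c := by positivity
    calc √(1 - l * c) < √1 := Real.sqrt_lt_sqrt (by linarith) (by linarith)
      _ = 1 := Real.sqrt_one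
  have hcw : ContractingWith (Real.toNNReal √(1 - l * c)) fun x => x - l • G x := ⟨hK, hlip⟩
  refine ⟨hcw.fixedPoint, ?_⟩
  have hfix : hcw.fixedPoint - l • G hcw.fixedPoint = hcw.fixedPoint := hcw.fixedPoint_isFixedPt
  have h0 : l • G hcw.fixedPoint = 0 := by
    have := sub_eq_self.1 hfix
    exact this
  exact (smul_eq_zero.1 h0).resolve_left hl0.ne'

/-- Positive definite forms on a finite dimensional space are coercive. -/
theorem exists_coercive_of_pos {H : Type*} [NormedAddCommGroup H] [InnerProductSpace ℝ H]
    [FiniteDimensional ℝ H] (A : H →ₗ[ℝ] H) (hpos : ∀ x, x ≠ 0 → 0 < ⟪A x, x⟫) :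
    ∃ c > 0, ∀ x, c * ‖x‖ ^ 2 ≤ ⟪A x, x⟫ := by
  by_cases hH : Nontrivial H
  · have hcont : Continuous fun x : H => ⟪A x, x⟫ :=
      (A.toContinuousLinearMap.continuous.inner continuous_id)
    obtain ⟨x₀, hx₀, hmin⟩ := (isCompact_sphere (0 : H) 1).exists_isMinOn
      (NormedSpace.sphere_nonempty.2 zero_le_one) hcont.continuousOn
    have hx₀n : ‖x₀‖ = 1 := by simpa using hx₀
    refine ⟨⟪A x₀, x₀⟫, hpos x₀ (by intro h; simp [h] at hx₀n), fun x => ?_⟩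
    by_cases hx : x = 0
    · simp [hx]
    have hn : ‖x‖ ≠ 0 := norm_ne_zero_iff.2 hx
    have := hmin (show ‖x‖⁻¹ • x ∈ sphere (0 : H) 1 by simp [norm_smul, hn])
    simp only [mem_ofPred_eq, map_smul, inner_smul_left, inner_smul_right] at this
    have e : ⟪A x, x⟫ = ‖x‖ ^ 2 * (‖x‖⁻¹ * (‖x‖⁻¹ * ⟪A x, x⟫)) := by field_simp
    rw [e, mul_comm]
    exact mul_le_mul_of_nonneg_left (by simpa using this) (by positivity)
  · rw [not_nontrivial_iff_subsingleton] at hH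
    exact ⟨1, one_pos, fun x => by simp [Subsingleton.elim x 0]⟩

section Step

variable {ι : Type*} [Fintype ι]

/-- The weighted discrete inner product. -/
def wsum (m x y : ι → ℝ) : ℝ := ∑ i, m i * (x i * y i)

theorem wsum_nonneg {m : ι → ℝ} (hm : ∀ i, 0 < m i) (x : ι → ℝ) : 0 ≤ wsum m x x :=
  Finset.sum_nonneg fun i _ => mul_nonneg (hm i).le (mul_self_nonneg _)

theorem eq_zero_of_wsum {m : ι → ℝ} (hm : ∀ i, 0 < m i) {x : ι → ℝ} (h : wsum m x x ≤ 0) :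
    x = 0 := by
  have := (Finset.sum_eq_zero_iff_of_nonneg
    (fun i _ => mul_nonneg (hm i).le (mul_self_nonneg (x i)))).1 (le_antisymm h (wsum_nonneg hm x))
  funext i
  have h1 := this i (Finset.mem_univ i)
  rcases mul_eq_zero.1 h1 with h2 | h2
  · exact absurd h2 (hm i).ne'
  · exact mul_self_eq_zero.1 h2

theorem wsum_sub_left (m x y z : ι → ℝ) : wsum m (x - y) z = wsum m x z - wsum m y z := by
  simp only [wsum, Pi.sub_apply, ← Finset.sum_sub_distrib]
  exact Finset.sum_congr rfl fun i _ => by ring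

theorem wsum_comm (m x y : ι → ℝ) : wsum m x y = wsum m y x :=
  Finset.sum_congr rfl fun i _ => by ring

/-- Weighted Young inequality for a positive semidefinite symmetric form. -/
theorem form_young {E : Type*} [AddCommGroup E] [Module ℝ E] (B : E →ₗ[ℝ] E →ₗ[ℝ] ℝ)
    (hsymm : ∀ x y, B x y = B y x) (hpos : ∀ x, 0 ≤ B x x) (x y : E) {s : ℝ} (hs : 0 < s) :
    2 * |B x y| ≤ s * B x x + s⁻¹ * B y y := by
  have h1 := hpos (s • x + y)
  have h2 := hpos (s • x - y)
  simp only [map_add, map_sub, map_smul, LinearMap.add_apply, LinearMap.sub_apply,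
    LinearMap.smul_apply, smul_eq_mul, hsymm y x] at h1 h2
  have e : s * B x x + s⁻¹ * B y y = s⁻¹ * (s * (s * B x x) + B y y) := by field_simp
  rw [e, ← sub_nonneg]
  have e1 : s⁻¹ * (s * (s * B x x) + B y y) - 2 * |B x y|
      = s⁻¹ * (s * (s * B x x) + B y y - 2 * s * |B x y|) := by field_simp
  rw [e1]
  refine mul_nonneg (inv_nonneg.2 hs.le) ?_
  rcases abs_cases (B x y) with ⟨h, -⟩ | ⟨h, -⟩ <;> rw [h] <;> nlinarith

/-- For the differences `u`, `w` of two solutions, testing with `w` and `u` leaves `τ B(w,w) + ε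
B(u,u) ≤ |u|²/ε`, while the first equation gives `|u|² = -τ B(w,u)`. Young's inequality with weight
`ε` and `τ ≤ ε³/2` absorb the right-hand side, so both forms vanish, then `u`, and finally `w` by
the second equation. -/
theorem step_unique (m b : ι → ℝ) (hm : ∀ i, 0 < m i)
    (B : (ι → ℝ) →ₗ[ℝ] (ι → ℝ) →ₗ[ℝ] ℝ) (hsymm : ∀ x y, B x y = B y x) (hpos : ∀ x, 0 ≤ B x x)
    {ε θ τ : ℝ} (hε : 0 < ε) (hθ : 0 < θ) (hτ : 0 < τ) (hτε : τ ≤ ε ^ 3 / 2)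
    {f : ℝ → ℝ} (hf : Monotone f) {U W U' W' : ι → ℝ}
    (h1 : ∀ φ, 1 / τ * (wsum m U φ - ∑ i, b i * φ i) + B W φ = 0)
    (h2 : ∀ φ, wsum m W φ = ε * B U φ + θ / (2 * ε) * wsum m (fun i => f (U i)) φ
      - 1 / ε * wsum m U φ)
    (h1' : ∀ φ, 1 / τ * (wsum m U' φ - ∑ i, b i * φ i) + B W' φ = 0)
    (h2' : ∀ φ, wsum m W' φ = ε * B U' φ + θ / (2 * ε) * wsum m (fun i => f (U' i)) φ
      - 1 / ε * wsum m U' φ) : U = U' ∧ W = W' := by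
  set u := U - U' with hu
  set w := W - W' with hw
  have d1 : ∀ φ, wsum m u φ = -τ * B w φ := by
    intro φ
    have a := h1 φ
    have a' := h1' φ
    rw [hu, hw, wsum_sub_left, map_sub, LinearMap.sub_apply]
    field_simp at a a'
    linarith
  have d2 : wsum m w u = ε * B u u
      + θ / (2 * ε) * wsum m (fun i => f (U i) - f (U' i)) u - 1 / ε * wsum m u u := by
    have e : wsum m (fun i => f (U i) - f (U' i)) u
        = wsum m (fun i => f (U i)) u - wsum m (fun i => f (U' i)) u :=
      wsum_sub_left m (fun i => f (U i)) (fun i => f (U' i)) u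
    have eu : wsum m u u = wsum m U u - wsum m U' u := wsum_sub_left m U U' u
    have ew : wsum m w u = wsum m W u - wsum m W' u := wsum_sub_left m W W' u
    have eB : B u u = B U u - B U' u := by
      conv_lhs => rw [show B u = B U - B U' by rw [hu, map_sub]]
      rfl
    rw [e, eu, ew, eB, h2, h2']
    ring
  have hmon : 0 ≤ wsum m (fun i => f (U i) - f (U' i)) u := by
    refine Finset.sum_nonneg fun i _ => mul_nonneg (hm i).le ?_
    change 0 ≤ (f (U i) - f (U' i)) * (U i - U' i)
    rcases le_total (U i) (U' i) with h | h
    · exact mul_nonneg_of_nonpos_of_nonpos (by linarith [hf h]) (by linarith)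
    · exact mul_nonneg (by linarith [hf h]) (by linarith)
  have q1 := d1 w
  rw [wsum_comm, d2] at q1
  have q2 := d1 u
  have hy := form_young B hsymm hpos w u (s := ε) hε
  have hle := neg_abs_le (B w u)
  have hww := hpos w
  have huu := hpos u
  have hq0 := wsum_nonneg hm u
  have hmon' : 0 ≤ θ / (2 * ε) * wsum m (fun i => f (U i) - f (U' i)) u := by positivity
  -- `τ B(w,w) + ε B(u,u) ≤ |u|² / ε`
  have k1 : τ * B w w + ε * B u u ≤ 1 / ε * wsum m u u := by linarith
  have k2 : 1 / ε * wsum m u u ≤ τ / ε * |B w u| := by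
    rw [q2]
    have : 1 / ε * (-τ * B w u) = τ / ε * (-B w u) := by ring
    rw [this]
    exact mul_le_mul_of_nonneg_left (neg_le_abs _) (by positivity)
  have k3 : τ / ε * |B w u| ≤ τ / 2 * B w w + τ / (2 * ε ^ 2) * B u u := by
    have := mul_le_mul_of_nonneg_left hy (by positivity : 0 ≤ τ / (2 * ε))
    calc τ / ε * |B w u| = τ / (2 * ε) * (2 * |B w u|) := by field_simp
      _ ≤ _ := this
      _ = _ := by field_simp
  have k4 : τ / (2 * ε ^ 2) * B u u ≤ ε / 4 * B u u := by
    refine mul_le_mul_of_nonneg_right ?_ huu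
    rw [div_le_iff₀ (by positivity)]
    nlinarith
  have k5 : B u u ≤ 0 := by
    by_contra hcon
    push Not at hcon
    nlinarith [mul_pos hε hcon, mul_nonneg hτ.le hww]
  have k6 : B w w ≤ 0 := by
    by_contra hcon
    push Not at hcon
    nlinarith [mul_nonneg hε.le huu, mul_pos hτ hcon]
  have z1 : u = 0 := by
    refine eq_zero_of_wsum hm ?_
    have : 1 / ε * wsum m u u ≤ 0 := by
      have h3 := mul_nonpos_of_nonneg_of_nonpos (by positivity : 0 ≤ τ / 2) k6
      have h4 := mul_nonpos_of_nonneg_of_nonpos (by positivity : 0 ≤ ε / 4) k5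
      linarith
    by_contra hcon
    push Not at hcon
    have := mul_pos (one_div_pos.2 hε) hcon
    linarith
  have hUU : U = U' := sub_eq_zero.1 z1
  refine ⟨hUU, sub_eq_zero.1 (eq_zero_of_wsum hm (x := w) ?_)⟩
  have : wsum m w w = 0 := by
    have ew : wsum m w w = wsum m W w - wsum m W' w := wsum_sub_left m W W' w
    rw [ew, h2, h2', hUU]; ring
  exact this.le

/-- The first equation expresses `U` through `A W`, with `A` the stiffness operator, and the second
then has the form `W = N(W)`. Applying `A` gives `A(W - N(W)) = 0`, a Lipschitz problem on the range
of `A`. It is strongly monotone by the estimate used for uniqueness, which leaves half of `B(w,w)`.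
-/
theorem step_exists (m b : ι → ℝ) (hm : ∀ i, 0 < m i)
    (B : (ι → ℝ) →ₗ[ℝ] (ι → ℝ) →ₗ[ℝ] ℝ) (hsymm : ∀ x y, B x y = B y x) (hpos : ∀ x, 0 ≤ B x x)
    {ε θ τ L : ℝ} (hε : 0 < ε) (hθ : 0 < θ) (hτ : 0 < τ) (hτε : τ ≤ ε ^ 3 / 2)
    {f : ℝ → ℝ} (hf : Monotone f) (hfL : ∀ r s, |f r - f s| ≤ L * |r - s|) :
    ∃ U W : ι → ℝ,
      (∀ φ, 1 / τ * (wsum m U φ - ∑ i, b i * φ i) + B W φ = 0) ∧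
      (∀ φ, wsum m W φ = ε * B U φ + θ / (2 * ε) * wsum m (fun i => f (U i)) φ
        - 1 / ε * wsum m U φ) := by
  classical
  let toE : (ι → ℝ) ≃ₗ[ℝ] (EuclideanSpace ℝ ι) := (WithLp.linearEquiv 2 ℝ (ι → ℝ)).symm
  -- the operator of the form
  let A : (EuclideanSpace ℝ ι) →ₗ[ℝ] (EuclideanSpace ℝ ι) :=
    { toFun := fun x => WithLp.toLp 2 fun i => B (toE.symm x) (Pi.single i 1)
      map_add' := fun x y => by ext i; simp
      map_smul' := fun c x => by ext i; simp }
  have hBsum : ∀ x y : ι → ℝ, B x y = ∑ i, B x (Pi.single i 1) * y i := by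
    intro x y
    conv_lhs => rw [← Finset.univ_sum_single y, map_sum]
    refine Finset.sum_congr rfl fun i _ => ?_
    rw [show Pi.single i (y i) = y i • (Pi.single i 1 : ι → ℝ) by
      rw [← Pi.single_smul]; simp, map_smul, smul_eq_mul, mul_comm]
  have hA : ∀ x y : EuclideanSpace ℝ ι, ⟪A x, y⟫ = B (toE.symm x) (toE.symm y) := by
    intro x y
    rw [hBsum, PiLp.inner_apply]
    exact Finset.sum_congr rfl fun i _ => by
      simp only [RCLike.inner_apply, conj_trivial]
      exact mul_comm _ _
  have hAsymm : ∀ x y : EuclideanSpace ℝ ι, ⟪A x, y⟫ = ⟪x, A y⟫ := fun x y => by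
    rw [hA, hsymm, ← hA, real_inner_comm]
  -- `A` has a kernel in general (nodal constants have zero gradient). By symmetry the range is
  -- orthogonal to the kernel, so the form is positive definite on the range.
  let Hs : Submodule ℝ (EuclideanSpace ℝ ι) := LinearMap.range A
  let AH : Hs →ₗ[ℝ] Hs := (A.comp Hs.subtype).codRestrict Hs fun x => ⟨_, rfl⟩
  have hAHpos : ∀ x : Hs, x ≠ 0 → 0 < ⟪AH x, x⟫ := by
    intro x hx
    have h0 : ⟪AH x, x⟫ = B (toE.symm x) (toE.symm x) := hA (x : (EuclideanSpace ℝ ι)) x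
    rw [h0]
    refine lt_of_le_of_ne (hpos _) fun h => hx ?_
    -- a null vector of the form is in the kernel
    have hker : ∀ y : ι → ℝ, B (toE.symm x) y = 0 := by
      intro y
      have hy := hpos y
      by_contra hne
      -- When `B x x = 0` this weight gives `2|B x y| ≤ |B x y| · B y y / (B y y + 1)`, impossible
      -- for `B x y ≠ 0`.
      have hy' := form_young B hsymm hpos (toE.symm x) y
        (s := (B y y + 1) / |B (toE.symm x) y|) (by positivity)
      rw [← h, mul_zero, zero_add, inv_div, div_mul_eq_mul_div, le_div_iff₀ (by positivity)] at hy'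
      have hab := abs_pos.2 hne
      nlinarith
    obtain ⟨z, hz⟩ := x.2
    have : ⟪(x : (EuclideanSpace ℝ ι)), x⟫ = 0 := by
      conv_lhs => rw [← hz]
      rw [hAsymm, real_inner_comm, hA, hz]
      exact hker _
    exact Subtype.ext (inner_self_eq_zero.1 this)
  obtain ⟨c, hc, hcoer⟩ := exists_coercive_of_pos AH hAHpos
  -- the nonlinear map
  let Uof : (EuclideanSpace ℝ ι) → ι → ℝ := fun W i => (b i - τ * A W i) / m i
  let Nof : (EuclideanSpace ℝ ι) → (EuclideanSpace ℝ ι) := fun W => WithLp.toLp 2 fun i =>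
    ε * (A (toE (Uof W)) i / m i) + θ / (2 * ε) * f (Uof W i) - 1 / ε * Uof W i
  let G : Hs → Hs := fun W => ⟨A ((W : (EuclideanSpace ℝ ι)) - Nof W), _, rfl⟩
  have hAn : ∃ CA : ℝ, 0 ≤ CA ∧ ∀ x : EuclideanSpace ℝ ι, ‖A x‖ ≤ CA * ‖x‖ :=
    ⟨‖A.toContinuousLinearMap‖, norm_nonneg _, fun x => A.toContinuousLinearMap.le_opNorm x⟩
  obtain ⟨CA, hCA0, hCA⟩ := hAn
  have hcoord : ∀ (x : (EuclideanSpace ℝ ι)) i, |x i| ≤ ‖x‖ := fun x i => by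
    simpa using PiLp.norm_apply_le x i
  have hsumn : ∀ x : EuclideanSpace ℝ ι, ‖x‖ ≤ ∑ i, |x i| := by
    intro x
    rw [EuclideanSpace.norm_eq]
    refine Real.sqrt_le_iff.2 ⟨Finset.sum_nonneg fun i _ => abs_nonneg _, ?_⟩
    simpa using Finset.sum_sq_le_sq_sum_of_nonneg (s := Finset.univ) (f := fun i => |x i|)
      (fun i _ => abs_nonneg _)
  have hUdiff : ∀ x y : EuclideanSpace ℝ ι, ∀ i, Uof x i - Uof y i = -τ / m i * (A (x - y)) i := by
    intro x y i
    simp only [Uof, map_sub, PiLp.sub_apply]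
    have := (hm i).ne'
    field_simp
    ring
  obtain ⟨CU, hCU0, hCU⟩ : ∃ CU : ℝ, 0 ≤ CU ∧ ∀ x y : EuclideanSpace ℝ ι, ∀ i,
      |Uof x i - Uof y i| ≤ CU * ‖x - y‖ := by
    refine ⟨∑ j, τ / m j * CA, Finset.sum_nonneg fun j _ => mul_nonneg (div_nonneg hτ.le (hm j).le) hCA0,
      fun x y i => ?_⟩
    rw [hUdiff, abs_mul, abs_div, abs_neg, abs_of_pos hτ, abs_of_pos (hm i)]
    calc τ / m i * |A (x - y) i| ≤ τ / m i * (CA * ‖x - y‖) :=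
          mul_le_mul_of_nonneg_left ((hcoord _ i).trans (hCA _)) (div_nonneg hτ.le (hm i).le)
      _ = τ / m i * CA * ‖x - y‖ := by ring
      _ ≤ _ := mul_le_mul_of_nonneg_right (Finset.single_le_sum
          (f := fun j => τ / m j * CA)
          (fun j _ => mul_nonneg (div_nonneg hτ.le (hm j).le) hCA0) (Finset.mem_univ i))
          (norm_nonneg _)
  have hL0 : 0 ≤ L := by
    have := (abs_nonneg _).trans (hfL 1 0); simpa using this
  obtain ⟨CN, hCN0, hCN⟩ : ∃ CN : ℝ, 0 ≤ CN ∧ ∀ x y : EuclideanSpace ℝ ι, ‖Nof x - Nof y‖ ≤ CN * ‖x - y‖ := by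
    have hi : ∀ i, ∃ C : ℝ, 0 ≤ C ∧ ∀ x y : EuclideanSpace ℝ ι, |(Nof x - Nof y) i| ≤ C * ‖x - y‖ := by
      intro i
      have hmi := hm i
      refine ⟨ε * (CA * (∑ _j : ι, CU) / m i) + θ / (2 * ε) * (L * CU) + 1 / ε * CU, ?_,
        fun x y => ?_⟩
      · have : 0 ≤ ∑ _j : ι, CU := Finset.sum_nonneg fun _ _ => hCU0
        positivity
      have e : (Nof x - Nof y) i = ε * (A (toE (Uof x) - toE (Uof y)) i / m i)
          + θ / (2 * ε) * (f (Uof x i) - f (Uof y i)) - 1 / ε * (Uof x i - Uof y i) := by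
        simp only [Nof, PiLp.sub_apply, map_sub]
        ring
      have t1 : |A (toE (Uof x) - toE (Uof y)) i| ≤ CA * ((∑ _j : ι, CU) * ‖x - y‖) := by
        refine (hcoord _ i).trans ((hCA _).trans (mul_le_mul_of_nonneg_left ?_ hCA0))
        refine (hsumn _).trans ?_
        rw [Finset.sum_mul]
        exact Finset.sum_le_sum fun j _ => hCU x y j
      have t2 : |f (Uof x i) - f (Uof y i)| ≤ L * (CU * ‖x - y‖) :=
        (hfL _ _).trans (mul_le_mul_of_nonneg_left (hCU x y i) hL0)
      have t3 := hCU x y i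
      rw [e]
      have s1 : |ε * (A (toE (Uof x) - toE (Uof y)) i / m i)|
          ≤ ε * (CA * ((∑ _j : ι, CU) * ‖x - y‖) / m i) := by
        rw [abs_mul, abs_div, abs_of_pos hε, abs_of_pos hmi]
        gcongr
      have s2 : |θ / (2 * ε) * (f (Uof x i) - f (Uof y i))|
          ≤ θ / (2 * ε) * (L * (CU * ‖x - y‖)) := by
        rw [abs_mul, abs_of_pos (by positivity : 0 < θ / (2 * ε))]
        gcongr
      have s3 : |1 / ε * (Uof x i - Uof y i)| ≤ 1 / ε * (CU * ‖x - y‖) := by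
        rw [abs_mul, abs_of_pos (by positivity : 0 < 1 / ε)]
        gcongr
      refine (abs_sub _ _).trans ((add_le_add (abs_add_le _ _) le_rfl).trans
        ((add_le_add (add_le_add s1 s2) s3).trans (le_of_eq ?_)))
      ring
    choose C hC0 hC using hi
    refine ⟨∑ i, C i, Finset.sum_nonneg fun i _ => hC0 i, fun x y => (hsumn _).trans ?_⟩
    rw [Finset.sum_mul]
    exact Finset.sum_le_sum fun i _ => hC i x y
  have hGL : ∀ x y : Hs, ‖G x - G y‖ ≤ (CA * (1 + CN)) * ‖x - y‖ := by
    intro x y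
    have e : ‖G x - G y‖ = ‖A (((x : (EuclideanSpace ℝ ι)) - y) - (Nof x - Nof y))‖ := by
      change ‖A ((x : EuclideanSpace ℝ ι) - Nof x) - A ((y : EuclideanSpace ℝ ι) - Nof y)‖ = _
      rw [← map_sub]
      congr 2
      abel
    rw [e]
    refine (hCA _).trans ?_
    rw [mul_assoc]
    refine mul_le_mul_of_nonneg_left ((norm_sub_le _ _).trans ?_) hCA0
    have := hCN x y
    have hn : ‖x - y‖ = ‖(x : (EuclideanSpace ℝ ι)) - y‖ := rfl
    rw [hn]
    linarith
  have hGm : ∀ x y : Hs, (c / 2) * ‖x - y‖ ^ 2 ≤ ⟪G x - G y, x - y⟫ := by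
    intro x y
    set w : (EuclideanSpace ℝ ι) := (x : (EuclideanSpace ℝ ι)) - y with hw
    set u : ι → ℝ := Uof x - Uof y with hu
    have huA : ∀ i, m i * u i = -τ * A w i := by
      intro i
      have := hUdiff x y i
      have h0 := (hm i).ne'
      rw [hu, Pi.sub_apply, this, ← hw]
      field_simp
    have e1 : ⟪G x - G y, x - y⟫ = ⟪A (w - (Nof x - Nof y)), w⟫ := by
      change ⟪A ((x : (EuclideanSpace ℝ ι)) - Nof x) - A ((y : (EuclideanSpace ℝ ι)) - Nof y), (x : (EuclideanSpace ℝ ι)) - y⟫ = _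
      rw [← map_sub]
      congr 2
      rw [hw]
      abel
    have e2 : ⟪A (w - (Nof x - Nof y)), w⟫
        = B (toE.symm w) (toE.symm w) - ⟪Nof x - Nof y, A w⟫ := by
      rw [map_sub, inner_sub_left, hA, hAsymm (Nof x - Nof y)]
    have e3 : ⟪Nof x - Nof y, A w⟫ = -(1 / τ) * (ε * B u u
        + θ / (2 * ε) * wsum m (fun i => f (Uof x i) - f (Uof y i)) u - 1 / ε * wsum m u u) := by
      rw [PiLp.inner_apply, hBsum, wsum, wsum, Finset.mul_sum, Finset.mul_sum, Finset.mul_sum,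
        ← Finset.sum_add_distrib, ← Finset.sum_sub_distrib, Finset.mul_sum]
      refine Finset.sum_congr rfl fun i _ => ?_
      have hAi : A w i = -(1 / τ) * (m i * u i) := by rw [huA]; field_simp
      have hBi : B u (Pi.single i 1) = A (toE (Uof x)) i - A (toE (Uof y)) i := by
        rw [hu, map_sub]
        rfl
      have hui : u i = Uof x i - Uof y i := rfl
      simp only [RCLike.inner_apply, conj_trivial, PiLp.sub_apply, hAi, hBi, Nof, hui]
      have := (hm i).ne'
      field_simp
      ring
    have hmon : 0 ≤ wsum m (fun i => f (Uof x i) - f (Uof y i)) u := by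
      refine Finset.sum_nonneg fun i _ => mul_nonneg (hm i).le ?_
      change 0 ≤ (f (Uof x i) - f (Uof y i)) * (Uof x i - Uof y i)
      rcases le_total (Uof x i) (Uof y i) with h | h
      · exact mul_nonneg_of_nonpos_of_nonpos (by linarith [hf h]) (by linarith)
      · exact mul_nonneg (by linarith [hf h]) (by linarith)
    have e4 : wsum m u u = -τ * B (toE.symm w) u := by
      rw [hBsum, wsum, Finset.mul_sum]
      refine Finset.sum_congr rfl fun i _ => ?_
      have hAi : A w i = B (toE.symm w) (Pi.single i 1) := rfl
      rw [← hAi, ← mul_assoc, huA]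
      ring
    have hy := form_young B hsymm hpos (toE.symm w) u (s := ε) hε
    have hcw : c * ‖x - y‖ ^ 2 ≤ B (toE.symm w) (toE.symm w) := by
      have := hcoer (x - y)
      rwa [show ⟪AH (x - y), x - y⟫ = B (toE.symm w) (toE.symm w) from hA w w] at this
    have huu := hpos u
    have k1 : 1 / τ * (1 / ε * wsum m u u) ≤ 1 / 2 * B (toE.symm w) (toE.symm w)
        + 1 / τ * (ε * B u u) := by
      rw [e4]
      have a1 : 1 / τ * (1 / ε * (-τ * B (toE.symm w) u)) = 1 / ε * (-B (toE.symm w) u) := by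
        field_simp
      have a2 : 1 / ε * (-B (toE.symm w) u) ≤ 1 / ε * |B (toE.symm w) u| :=
        mul_le_mul_of_nonneg_left (neg_le_abs _) (by positivity)
      have a3 : 1 / ε * |B (toE.symm w) u| ≤ 1 / 2 * B (toE.symm w) (toE.symm w)
          + 1 / (2 * ε ^ 2) * B u u := by
        have := mul_le_mul_of_nonneg_left hy (by positivity : 0 ≤ 1 / (2 * ε))
        calc 1 / ε * |B (toE.symm w) u| = 1 / (2 * ε) * (2 * |B (toE.symm w) u|) := by field_simp
          _ ≤ _ := this
          _ = _ := by field_simp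
      have a4 : 1 / (2 * ε ^ 2) * B u u ≤ 1 / τ * (ε * B u u) := by
        rw [← mul_assoc]
        refine mul_le_mul_of_nonneg_right ?_ huu
        rw [div_mul_eq_mul_div, one_mul, div_le_div_iff₀ (by positivity) hτ]
        have : 0 < ε ^ 3 := by positivity
        nlinarith
      linarith
    have hmon' : 0 ≤ 1 / τ * (θ / (2 * ε) * wsum m (fun i => f (Uof x i) - f (Uof y i)) u) := by
      positivity
    rw [e1, e2, e3]
    nlinarith
  obtain ⟨W₀, hW₀⟩ := exists_zero_of_stronglyMonotone G (by positivity : 0 < c / 2) hGL hGm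
  have hAW : A (Nof W₀) = A W₀ := by
    have : A ((W₀ : (EuclideanSpace ℝ ι)) - Nof W₀) = 0 := congrArg Subtype.val hW₀
    rw [map_sub, sub_eq_zero] at this
    exact this.symm
  -- `W₀` solves `W = N(W)` only modulo the kernel of `A`. Since `U` depends on `W` through `A W`
  -- alone, passing from `W₀` to `Nof W₀` leaves `U` unchanged and makes the second equation hold
  -- exactly.
  refine ⟨Uof W₀, toE.symm (Nof W₀), fun φ => ?_, fun φ => ?_⟩
  · have : B (toE.symm (Nof W₀)) φ = ∑ i, A W₀ i * φ i := by
      rw [hBsum, ← hAW]; rfl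
    rw [this, wsum, ← Finset.sum_sub_distrib, Finset.mul_sum, ← Finset.sum_add_distrib]
    refine Finset.sum_eq_zero fun i _ => ?_
    have := (hm i).ne'
    simp only [Uof]
    field_simp
    ring
  · rw [hBsum, wsum, wsum, wsum, Finset.mul_sum, Finset.mul_sum, Finset.mul_sum,
      ← Finset.sum_add_distrib, ← Finset.sum_sub_distrib]
    refine Finset.sum_congr rfl fun i _ => ?_
    have hBi : B (Uof W₀) (Pi.single i 1) = A (toE (Uof W₀)) i := rfl
    have hNi : toE.symm (Nof W₀) i = ε * (A (toE (Uof W₀)) i / m i) + θ / (2 * ε) * f (Uof W₀ i)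
      - 1 / ε * Uof W₀ i := rfl
    rw [hBi, hNi]
    have := (hm i).ne'
    field_simp

end Step

/-! ### The discrete energy inequality for one step -/

section Energy

variable {ι : Type*} [Fintype ι]

/-- The modified (nonnegative) energy: gradient, logarithmic and quadratic part. -/
def modEnergy (ε θ : ℝ) (F : ℝ → ℝ) (m : ι → ℝ) (B : (ι → ℝ) →ₗ[ℝ] (ι → ℝ) →ₗ[ℝ] ℝ)
    (U : ι → ℝ) : ℝ :=
  ε / 2 * B U U + θ / (2 * ε) * (∑ i, m i * F (U i)) + 1 / (2 * ε) * wsum m U U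

/-- The growth constant of one step. -/
def stepConst (ε C : ℝ) : ℝ :=
  C + C * ε ^ 2 + 16 / ε ^ 2 * (2 * (1 + C) / ε + 2 * ε * C) + ε / 8 * C * (2 / ε + 2 * ε)

theorem stepConst_pos {ε C : ℝ} (hε : 0 < ε) (hC : 0 ≤ C) : 0 < stepConst ε C := by
  unfold stepConst; positivity

-- With `P = rV` and `D = U - P` the first equation becomes `m(D, φ) = -τ B(W, φ)`. Choosing `φ = W`
-- there and `φ = D` in the second equation yields an energy balance with dissipation `B(D,D)` and
-- `τ B(W,W)`. The gradient part is compared through `hB1`, the convex part through `F(rV) ≤ F(V)`,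
-- and the concave quadratic part is absorbed using the first equation twice more, with `D` and with
-- `U`. Every change of geometry costs a factor `1 + O(τ)`.
set_option maxHeartbeats 1600000 in
theorem energy_step {m m' : ι → ℝ} (hm : ∀ i, 0 < m i) (hm' : ∀ i, 0 < m' i)
    {B B' : (ι → ℝ) →ₗ[ℝ] (ι → ℝ) →ₗ[ℝ] ℝ} (hsymm : ∀ x y, B x y = B y x)
    (hpos : ∀ x, 0 ≤ B x x) (hpos' : ∀ x, 0 ≤ B' x x)
    {ε θ τ C : ℝ} (hε : 0 < ε) (hθ : 0 < θ) (hτ : 0 < τ)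
    (hτ1 : τ ≤ 1) (hτ2 : τ ≤ ε ^ 3 / 128) (hC : 0 ≤ C)
    {F f : ℝ → ℝ} (hF0 : ∀ a, 0 ≤ F a) (hF : ∀ a b, F a - F b ≤ f a * (a - b))
    (hFc : ∀ c b, 0 ≤ c → c ≤ 1 → F (c * b) ≤ F b)
    {r U V W : ι → ℝ} (hr : ∀ i, m i * r i = m' i)
    (hmm : ∀ i, m' i ≤ m i) (hmm' : ∀ i, m i ≤ (1 + C * τ) * m' i) (hrC : ∀ i, 1 - C * τ ≤ r i)
    (hB1 : B (fun i => r i * V i) (fun i => r i * V i)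
      ≤ (1 + C * τ) * B' V V + C * τ * wsum m' V V)
    (hB2 : B (fun i => (1 - r i) * V i) (fun i => (1 - r i) * V i)
      ≤ C * τ ^ 2 * (B' V V + wsum m' V V))
    (h1 : ∀ φ, 1 / τ * (wsum m U φ - ∑ i, m' i * V i * φ i) + B W φ = 0)
    (h2 : ∀ φ, wsum m W φ = ε * B U φ + θ / (2 * ε) * wsum m (fun i => f (U i)) φ
      - 1 / ε * wsum m U φ) :
    modEnergy ε θ F m B U + 1 / 4 * (ε / 4 * B (U - V) (U - V) + τ * B W W)
      ≤ (1 + stepConst ε C * τ) * modEnergy ε θ F m' B' V := by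
  set P : ι → ℝ := fun i => r i * V i with hP
  set D : ι → ℝ := U - P with hD
  have hr0 : ∀ i, 0 ≤ r i := fun i => by
    by_contra h; push Not at h
    have := mul_neg_of_pos_of_neg (hm i) h
    linarith [hr i, hm' i]
  have hr1 : ∀ i, r i ≤ 1 := fun i => by
    by_contra h; push Not at h
    have := (mul_lt_mul_iff_right₀ (hm i)).2 h
    linarith [hr i, hmm i]
  -- the first equation
  have d1 : ∀ φ, wsum m D φ = -τ * B W φ := by
    intro φ
    have e : wsum m D φ = wsum m U φ - ∑ i, m' i * V i * φ i := by
      rw [hD, wsum_sub_left]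
      congr 1
      refine Finset.sum_congr rfl fun i _ => ?_
      rw [← hr i, hP]; ring
    have a := h1 φ
    rw [e]
    field_simp at a
    linarith
  set a := B U U
  set a' := B' V V
  set b := B D D
  set w := B W W
  set q := wsum m U U
  set q' := wsum m' V V
  set l := ∑ i, m i * F (U i)
  set l' := ∑ i, m' i * F (V i)
  have ha : 0 ≤ a := hpos U
  have ha' : 0 ≤ a' := hpos' V
  have hb : 0 ≤ b := hpos D
  have hw : 0 ≤ w := hpos W
  have hq : 0 ≤ q := wsum_nonneg hm U
  have hq' : 0 ≤ q' := wsum_nonneg hm' V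
  have hl' : 0 ≤ l' := Finset.sum_nonneg fun i _ => mul_nonneg (hm' i).le (hF0 _)
  have e1 : -τ * w = ε * B U D + θ / (2 * ε) * wsum m (fun i => f (U i)) D - 1 / ε * wsum m U D := by
    rw [← h2 D, wsum_comm, d1 W]
  have hBP : ∀ x y : ι → ℝ, B (x - y) (x - y) = B x x - 2 * B x y + B y y := by
    intro x y
    simp only [map_sub, LinearMap.sub_apply, hsymm y x]
    ring
  have hBA : ∀ x y : ι → ℝ, B (x + y) (x + y) = B x x + 2 * B x y + B y y := by
    intro x y
    simp only [map_add, LinearMap.add_apply, hsymm y x]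
    ring
  have e2 : B U D = 1 / 2 * (a - B P P + b) := by
    have k1 := hBP U P
    have k2 : B U D = a - B U P := by rw [hD, map_sub]
    have k3 : b = a - 2 * B U P + B P P := k1
    linarith
  -- Convexity gives `F(U) - F(rV)` on the left, and `F(rV) ≤ F(V)` removes the ratio without any
  -- growth assumption on `F`.
  have e3 : l - (1 + C * τ) * l' ≤ wsum m (fun i => f (U i)) D := by
    rw [Finset.mul_sum, ← Finset.sum_sub_distrib]
    refine Finset.sum_le_sum fun i _ => ?_
    have k1 : F (U i) - F (r i * V i) ≤ f (U i) * D i := hF _ _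
    have k2 := hFc (r i) (V i) (hr0 i) (hr1 i)
    have k3 : m i * F (V i) ≤ (1 + C * τ) * m' i * F (V i) :=
      mul_le_mul_of_nonneg_right (hmm' i) (hF0 _)
    have k4 := mul_le_mul_of_nonneg_left (show F (U i) - F (V i) ≤ f (U i) * D i by linarith)
      (hm i).le
    change _ ≤ m i * (f (U i) * D i)
    linarith
  have e4 : wsum m U D ≤ 1 / 2 * (q - (1 - C * τ) * q' + wsum m D D) := by
    have k : (1 - C * τ) * q' ≤ wsum m P P := by
      change _ * wsum m' V V ≤ _
      rw [wsum, Finset.mul_sum]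
      refine Finset.sum_le_sum fun i _ => ?_
      have : m i * (P i * P i) = r i * (m' i * (V i * V i)) := by rw [← hr i, hP]; ring
      rw [this]
      exact mul_le_mul_of_nonneg_right (hrC i) (mul_nonneg (hm' i).le (mul_self_nonneg _))
    have k2 : wsum m U D = 1 / 2 * (q - wsum m P P + wsum m D D) := by
      change _ = 1 / 2 * (wsum m U U - wsum m P P + wsum m D D)
      rw [wsum, wsum, wsum, wsum, ← Finset.sum_sub_distrib, ← Finset.sum_add_distrib,
        Finset.mul_sum]
      refine Finset.sum_congr rfl fun i _ => ?_
      rw [hD, Pi.sub_apply]; ring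
    linarith
  -- The implicit treatment of the concave term `-r²/2` costs `|D|²/(2ε)`. The first equation tested
  -- with `D` turns it into `-τ B(W,D)`, which is split between the two dissipation terms.
  have e5 : 1 / (2 * ε) * wsum m D D ≤ ε / 4 * b + τ / 8 * w := by
    have hy := form_young B hsymm hpos W D (s := τ / ε ^ 2) (by positivity)
    rw [d1 D]
    have k1 : 1 / (2 * ε) * (-τ * B W D) ≤ τ / (4 * ε) * (2 * |B W D|) := by
      have : 1 / (2 * ε) * (-τ * B W D) = τ / (4 * ε) * (2 * (-B W D)) := by field_simp; ring
      rw [this]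
      have := neg_le_abs (B W D)
      have h0 : 0 < τ / (4 * ε) := by positivity
      nlinarith
    have k2 := mul_le_mul_of_nonneg_left hy (by positivity : 0 ≤ τ / (4 * ε))
    have k3 : τ / (4 * ε) * (τ / ε ^ 2 * w + (τ / ε ^ 2)⁻¹ * b)
        = τ * (τ / (4 * ε ^ 3)) * w + ε / 4 * b := by field_simp
    have k4 : τ / (4 * ε ^ 3) ≤ 1 / 8 := by
      rw [div_le_iff₀ (by positivity)]; linarith
    have k5 : τ * (τ / (4 * ε ^ 3)) * w ≤ τ * (1 / 8) * w := by gcongr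
    linarith
  -- The growth of the weighted `L²` norm, from the first equation tested with `U`. It allows the
  -- sign of the quadratic term to be reversed in the modified energy.
  have e6 : 1 / ε * (q - q') ≤ τ / 8 * w + 8 * τ / ε ^ 2 * a := by
    have k0 : 1 / 2 * q - 1 / 2 * q' ≤ wsum m D U := by
      change 1 / 2 * wsum m U U - 1 / 2 * wsum m' V V ≤ _
      rw [wsum, wsum, wsum, Finset.mul_sum, Finset.mul_sum, ← Finset.sum_sub_distrib]
      refine Finset.sum_le_sum fun i _ => ?_
      have : m i * (D i * U i) = m i * (U i * U i) - m' i * (V i * U i) := by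
        rw [← hr i, hD, Pi.sub_apply, hP]; ring
      rw [this]
      nlinarith [mul_nonneg (hm' i).le (sq_nonneg (U i - V i)),
        mul_nonneg (sub_nonneg.2 (hmm i)) (mul_self_nonneg (U i))]
    have hy := form_young B hsymm hpos W U (s := ε / 8) (by positivity)
    rw [d1 U] at k0
    have k1 : 1 / ε * (q - q') ≤ τ / ε * (2 * |B W U|) := by
      have := neg_le_abs (B W U)
      have h3 : q - q' ≤ τ * (2 * |B W U|) := by nlinarith
      calc 1 / ε * (q - q') ≤ 1 / ε * (τ * (2 * |B W U|)) := by gcongr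
        _ = _ := by ring
    have k2 := mul_le_mul_of_nonneg_left hy (by positivity : 0 ≤ τ / ε)
    have k3 : τ / ε * (ε / 8 * w + (ε / 8)⁻¹ * a) = τ / 8 * w + 8 * τ / ε ^ 2 * a := by field_simp
    linarith
  have e7 : a ≤ 2 * B P P + 2 * b := by
    have k1 := hpos (P - D)
    have k2 : a = B P P + 2 * B P D + b := by
      change B U U = _
      have : U = P + D := by rw [hD]; abel
      rw [this, hBA]
    rw [hBP] at k1
    linarith
  have e7' : 8 * τ / ε ^ 2 * a ≤ ε / 8 * b + τ * (16 / ε ^ 2 * ((1 + C) * a' + C * q')) := by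
    have k0 : B P P ≤ (1 + C) * a' + C * q' := by
      have t1 : C * τ * a' ≤ C * a' := by
        have := mul_le_mul_of_nonneg_left hτ1 (mul_nonneg hC ha'); linarith
      have t2 : C * τ * q' ≤ C * q' := by
        have := mul_le_mul_of_nonneg_left hτ1 (mul_nonneg hC hq'); linarith
      linarith
    have k1 : 8 * τ / ε ^ 2 * a ≤ 8 * τ / ε ^ 2 * (2 * ((1 + C) * a' + C * q') + 2 * b) := by
      gcongr; linarith
    -- This is exactly the restriction `τ ≤ ε³/128`.
    have k2 : 16 * τ / ε ^ 2 ≤ ε / 8 := by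
      rw [div_le_iff₀ (by positivity)]
      have : ε / 8 * ε ^ 2 = ε ^ 3 / 8 := by ring
      rw [this]; linarith
    have k3 : 16 * τ / ε ^ 2 * b ≤ ε / 8 * b := by gcongr
    calc _ ≤ _ := k1
      _ = 16 * τ / ε ^ 2 * b + τ * (16 / ε ^ 2 * ((1 + C) * a' + C * q')) := by ring
      _ ≤ _ := by linarith
  -- The balance controls `D`, whereas the dissipation is wanted for `U - V = D - (1 - r)V`. The
  -- discrepancy is of size `τ` by `hB2`, so its square is harmless.
  have e8 : B (U - V) (U - V) ≤ 2 * b + 2 * (C * τ ^ 2 * (a' + q')) := by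
    set R : ι → ℝ := fun i => (1 - r i) * V i with hR
    have k0 : U - V = D - R := by
      funext i
      change U i - V i = U i - r i * V i - (1 - r i) * V i
      ring
    have k1 := hpos (D + R)
    have k2 : B (D + R) (D + R) = b + 2 * B D R + B R R := hBA D R
    rw [k0, hBP]
    linarith
  have e8' : ε / 16 * B (U - V) (U - V) ≤ ε / 8 * b + τ * (ε / 8 * C * (a' + q')) := by
    have t : τ ^ 2 ≤ τ := by nlinarith
    have : C * τ ^ 2 * (a' + q') ≤ C * τ * (a' + q') := by gcongr
    have k := mul_le_mul_of_nonneg_left e8 (by positivity : 0 ≤ ε / 16)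
    have k' := mul_le_mul_of_nonneg_left this (by positivity : 0 ≤ ε / 8)
    linarith
  -- conclusion
  have hX : modEnergy ε θ F m' B' V = ε / 2 * a' + θ / (2 * ε) * l' + 1 / (2 * ε) * q' := rfl
  set X' := modEnergy ε θ F m' B' V
  have hl'' : 0 ≤ θ / (2 * ε) * l' := by positivity
  have hXa : a' ≤ 2 / ε * X' := by
    have : 2 / ε * X' = a' + 2 / ε * (θ / (2 * ε) * l' + 1 / (2 * ε) * q') := by
      rw [hX]; field_simp; ring
    rw [this]
    have : 0 ≤ 2 / ε * (θ / (2 * ε) * l' + 1 / (2 * ε) * q') := by positivity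
    linarith
  have hXq : q' ≤ 2 * ε * X' := by
    have : 2 * ε * X' = q' + 2 * ε * (θ / (2 * ε) * l' + ε / 2 * a') := by
      rw [hX]; field_simp; ring
    rw [this]
    have : 0 ≤ 2 * ε * (θ / (2 * ε) * l' + ε / 2 * a') := by positivity
    linarith
  have main : ε / 2 * a + θ / (2 * ε) * l - 1 / (2 * ε) * q + ε / 4 * b + 7 / 8 * (τ * w)
      ≤ ε / 2 * a' + θ / (2 * ε) * l' - 1 / (2 * ε) * q' + C * τ * X' + C * τ * (ε / 2 * q') := by
    have k3 := mul_le_mul_of_nonneg_left e3 (by positivity : 0 ≤ θ / (2 * ε))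
    have k4 := mul_le_mul_of_nonneg_left e4 (by positivity : 0 ≤ 1 / ε)
    have k4' : 1 / ε * (1 / 2 * (q - (1 - C * τ) * q' + wsum m D D))
        = 1 / (2 * ε) * q - (1 - C * τ) * (1 / (2 * ε) * q') + 1 / (2 * ε) * wsum m D D := by
      field_simp
    have k5 := mul_le_mul_of_nonneg_left hB1 (by positivity : 0 ≤ ε / 2)
    rw [e2] at e1
    rw [k4'] at k4
    rw [hX]
    linarith
  have f1 : τ * (16 / ε ^ 2 * ((1 + C) * a' + C * q'))
      ≤ τ * (16 / ε ^ 2 * (2 * (1 + C) / ε + 2 * ε * C) * X') := by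
    have : (1 + C) * a' + C * q' ≤ (2 * (1 + C) / ε + 2 * ε * C) * X' := by
      have t1 := mul_le_mul_of_nonneg_left hXa (by positivity : 0 ≤ 1 + C)
      have t2 := mul_le_mul_of_nonneg_left hXq hC
      have : (2 * (1 + C) / ε + 2 * ε * C) * X' = (1 + C) * (2 / ε * X') + C * (2 * ε * X') := by
        ring
      linarith
    rw [mul_assoc (16 / ε ^ 2)]
    gcongr
  have f2 : τ * (ε / 8 * C * (a' + q')) ≤ τ * (ε / 8 * C * (2 / ε + 2 * ε) * X') := by
    rw [mul_assoc (ε / 8 * C)]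
    have : a' + q' ≤ (2 / ε + 2 * ε) * X' := by linarith
    gcongr
  have f3 : C * τ * (ε / 2 * q') ≤ τ * (C * ε ^ 2 * X') := by
    have : ε / 2 * q' ≤ ε ^ 2 * X' := by nlinarith
    calc C * τ * (ε / 2 * q') ≤ C * τ * (ε ^ 2 * X') := by gcongr
      _ = _ := by ring
  have goal_eq : modEnergy ε θ F m B U = ε / 2 * a + θ / (2 * ε) * l + 1 / (2 * ε) * q := rfl
  -- The balance `main` carries `-q/(2ε)`; adding `e6` changes it into the `+q/(2ε)` of the modified
  -- energy.
  have hqq : 1 / (2 * ε) * q = -(1 / (2 * ε) * q) + 1 / ε * q := by field_simp; ring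
  have hqq' : 1 / (2 * ε) * q' = -(1 / (2 * ε) * q') + 1 / ε * q' := by field_simp; ring
  have hτw : 0 ≤ τ * w := by positivity
  have hst : (1 + stepConst ε C * τ) * X' = X' + C * τ * X' + τ * (C * ε ^ 2 * X')
      + τ * (16 / ε ^ 2 * (2 * (1 + C) / ε + 2 * ε * C) * X')
      + τ * (ε / 8 * C * (2 / ε + 2 * ε) * X') := by
    unfold stepConst; ring
  rw [goal_eq, hst]
  linarith

end Energy

/-- Discrete Gronwall inequality with dissipation. -/
theorem dissipative_gronwall {X D : ℕ → ℝ} {c : ℝ} {N₀ : ℕ} (hc : 0 ≤ c) (hD : ∀ n, 0 ≤ D n)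
    (hstep : ∀ n, 1 ≤ n → n ≤ N₀ → X n + D n ≤ (1 + c) * X (n - 1)) (N : ℕ) (hN : N ≤ N₀) :
    X N + ∑ n ∈ Finset.Icc 1 N, D n ≤ (1 + c) ^ N * X 0 := by
  induction N with
  | zero => simp
  | succ N ih =>
    have h1 := ih (by omega)
    have h2 := hstep (N + 1) (by omega) hN
    rw [Nat.add_sub_cancel] at h2
    rw [Finset.sum_Icc_succ_top (by omega), pow_succ]
    have h3 : 0 ≤ ∑ n ∈ Finset.Icc 1 N, D n := Finset.sum_nonneg fun n _ => hD n
    nlinarith [mul_le_mul_of_nonneg_left h1 (by linarith : 0 ≤ 1 + c)]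

/-! ### The cross product of `ℝ³` -/

theorem inner3 (u v : E3) : ⟪u, v⟫ = u 0 * v 0 + u 1 * v 1 + u 2 * v 2 := by
  simp only [PiLp.inner_apply, Fin.sum_univ_three, RCLike.inner_apply, conj_trivial]
  ring

theorem norm3_sq (u : E3) : ‖u‖ ^ 2 = u 0 ^ 2 + u 1 ^ 2 + u 2 ^ 2 := by
  rw [← real_inner_self_eq_norm_sq, inner3]; ring

/-- The cross product. -/
def cr (u v : E3) : E3 :=
  !₂[u 1 * v 2 - u 2 * v 1, u 2 * v 0 - u 0 * v 2, u 0 * v 1 - u 1 * v 0]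

@[simp] theorem cr_zero_coord (u v : E3) : cr u v 0 = u 1 * v 2 - u 2 * v 1 := rfl
@[simp] theorem cr_one_coord (u v : E3) : cr u v 1 = u 2 * v 0 - u 0 * v 2 := rfl
@[simp] theorem cr_two_coord (u v : E3) : cr u v 2 = u 0 * v 1 - u 1 * v 0 := rfl

theorem E3_ext {u v : E3} (h0 : u 0 = v 0) (h1 : u 1 = v 1) (h2 : u 2 = v 2) : u = v := by
  ext i; fin_cases i <;> assumption

theorem cr_add_left (u v w : E3) : cr (u + v) w = cr u w + cr v w := by
  apply E3_ext <;> simp <;> ring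

theorem cr_add_right (u v w : E3) : cr u (v + w) = cr u v + cr u w := by
  apply E3_ext <;> simp <;> ring

theorem cr_smul_left (c : ℝ) (u v : E3) : cr (c • u) v = c • cr u v := by
  apply E3_ext <;> simp <;> ring

theorem cr_smul_right (c : ℝ) (u v : E3) : cr u (c • v) = c • cr u v := by
  apply E3_ext <;> simp <;> ring

theorem cr_self (u : E3) : cr u u = 0 := by
  apply E3_ext <;> simp <;> ring

theorem cr_swap (u v : E3) : cr v u = -cr u v := by
  apply E3_ext <;> simp <;> ring

theorem cr_sub_left (u v w : E3) : cr (u - v) w = cr u w - cr v w := by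
  apply E3_ext <;> simp <;> ring

theorem cr_sub_right (u v w : E3) : cr u (v - w) = cr u v - cr u w := by
  apply E3_ext <;> simp <;> ring

theorem norm_cr_sq (u v : E3) : ‖cr u v‖ ^ 2 = ‖u‖ ^ 2 * ‖v‖ ^ 2 - ⟪u, v⟫ ^ 2 := by
  rw [norm3_sq, norm3_sq, norm3_sq, inner3]; simp; ring

theorem norm_cr_le (u v : E3) : ‖cr u v‖ ≤ ‖u‖ * ‖v‖ := by
  refine abs_le_of_sq_le_sq' ?_ (by positivity) |>.2
  rw [norm_cr_sq, mul_pow]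
  linarith [sq_nonneg ⟪u, v⟫]

theorem inner_cr_left (u v : E3) : ⟪cr u v, u⟫ = 0 := by
  rw [inner3]; simp; ring

theorem inner_cr_right (u v : E3) : ⟪cr u v, v⟫ = 0 := by
  rw [inner3]; simp; ring

theorem inner_cr_cr (a b c d : E3) : ⟪cr a b, cr c d⟫ = ⟪a, c⟫ * ⟪b, d⟫ - ⟪a, d⟫ * ⟪b, c⟫ := by
  simp only [inner3, cr_zero_coord, cr_one_coord, cr_two_coord]; ring

/-- Expansion of a vector in terms of three others (Cramer's rule). -/
theorem cramer (a b n x : E3) :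
    ⟪cr a b, n⟫ • x = ⟪cr x b, n⟫ • a + ⟪cr a x, n⟫ • b + ⟪cr a b, x⟫ • n := by
  apply E3_ext <;> simp only [inner3, PiLp.smul_apply, PiLp.add_apply, smul_eq_mul, cr_zero_coord,
    cr_one_coord, cr_two_coord] <;> ring

theorem cr_cr_left (a b n : E3) : cr (cr a b) n = ⟪a, n⟫ • b - ⟪b, n⟫ • a := by
  apply E3_ext <;> simp only [inner3, PiLp.smul_apply, PiLp.sub_apply, smul_eq_mul, cr_zero_coord,
    cr_one_coord, cr_two_coord] <;> ring

/-! ### Parametrised planes and triangles -/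

/-- The plane. -/
abbrev E2 : Type := EuclideanSpace ℝ (Fin 2)

/-- The linear map `s ↦ s₀ e₁ + s₁ e₂`. -/
def planeLin (e₁ e₂ : E3) : E2 →ₗ[ℝ] E3 where
  toFun s := s 0 • e₁ + s 1 • e₂
  map_add' s t := by simp only [PiLp.add_apply]; module
  map_smul' c s := by simp only [PiLp.smul_apply, smul_eq_mul, RingHom.id_apply]; module

/-- The affine parametrisation `s ↦ a + s₀ e₁ + s₁ e₂`. -/
def planeMap (a e₁ e₂ : E3) (s : E2) : E3 := a + planeLin e₁ e₂ s

theorem planeMap_apply (a e₁ e₂ : E3) (s : E2) : planeMap a e₁ e₂ s = a + (s 0 • e₁ + s 1 • e₂) := rfl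

/-- The Gram determinant of the two columns is `‖e₁‖²‖e₂‖² - ⟪e₁,e₂⟫²`, which is the squared length
of the cross product by Lagrange's identity. -/
theorem planeLin_normDet (e₁ e₂ : E3) : (planeLin e₁ e₂).normDet = ‖cr e₁ e₂‖ := by
  have h := LinearMap.normDet_sq_eq_det_gram (planeLin e₁ e₂) (EuclideanSpace.basisFun (Fin 2) ℝ)
  rw [Matrix.det_fin_two] at h
  have h0 : planeLin e₁ e₂ (EuclideanSpace.basisFun (Fin 2) ℝ 0) = e₁ := by simp [planeLin]
  have h1 : planeLin e₁ e₂ (EuclideanSpace.basisFun (Fin 2) ℝ 1) = e₂ := by simp [planeLin]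
  have h2 : (planeLin e₁ e₂).normDet ^ 2 = ‖cr e₁ e₂‖ ^ 2 := by
    rw [norm_cr_sq]
    simp only [Matrix.gram_apply, h0, h1, real_inner_self_eq_norm_sq,
      real_inner_comm e₁ e₂] at h
    refine Eq.trans ?_ (h.trans ?_)
    · simp
    · ring
  exact (sq_eq_sq₀ (LinearMap.normDet_nonneg _) (norm_nonneg _)).1 h2

theorem surfaceMeasure_planeMap_image (a e₁ e₂ : E3) (s : Set E2) :
    surfaceMeasure (planeMap a e₁ e₂ '' s) = ENNReal.ofReal ‖cr e₁ e₂‖ * volume s := by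
  have e : planeMap a e₁ e₂ '' s = (fun x => a + x) '' (planeLin e₁ e₂ '' s) := by
    rw [image_image]; rfl
  rw [e, surfaceMeasure, (isometry_add_left a).euclideanHausdorffMeasure_image, ← planeLin_normDet]
  have := (planeLin e₁ e₂).euclideanHausdorffMeasure_image_eq_normDet_mul_volume s
  rwa [finrank_euclideanSpace_fin] at this

theorem planeLin_injective {e₁ e₂ : E3} (h : cr e₁ e₂ ≠ 0) : Function.Injective (planeLin e₁ e₂) := by
  refine (injective_iff_map_eq_zero _).2 fun s hs => ?_
  change s 0 • e₁ + s 1 • e₂ = 0 at hs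
  have h1 : cr (s 0 • e₁ + s 1 • e₂) e₂ = s 0 • cr e₁ e₂ := by
    rw [cr_add_left, cr_smul_left, cr_smul_left, cr_self]; simp
  have h2 : cr e₁ (s 0 • e₁ + s 1 • e₂) = s 1 • cr e₁ e₂ := by
    rw [cr_add_right, cr_smul_right, cr_smul_right, cr_self]; simp
  have z1 : cr (0 : E3) e₂ = 0 := by simpa using cr_smul_left 0 (0 : E3) e₂
  have z2 : cr e₁ (0 : E3) = 0 := by simpa using cr_smul_right 0 e₁ (0 : E3)
  rw [hs] at h1 h2
  rw [z1] at h1; rw [z2] at h2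
  ext i
  fin_cases i
  · exact (smul_eq_zero.1 h1.symm).resolve_right h
  · exact (smul_eq_zero.1 h2.symm).resolve_right h

theorem planeMap_injective {a e₁ e₂ : E3} (h : cr e₁ e₂ ≠ 0) :
    Function.Injective (planeMap a e₁ e₂) := fun _ _ hs =>
  planeLin_injective h (add_left_cancel hs)

theorem planeMap_continuous (a e₁ e₂ : E3) : Continuous (planeMap a e₁ e₂) :=
  continuous_const.add (planeLin e₁ e₂).continuous_of_finiteDimensional

theorem planeMap_measurableEmbedding {a e₁ e₂ : E3} (h : cr e₁ e₂ ≠ 0) :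
    MeasurableEmbedding (planeMap a e₁ e₂) := by
  have := (LinearMap.isClosedEmbedding_of_injective (LinearMap.ker_eq_bot.2 (planeLin_injective h)))
  exact ((Homeomorph.addLeft a).isClosedEmbedding.comp this).measurableEmbedding

theorem surfaceMeasure_restrict_plane (a e₁ e₂ : E3) :
    surfaceMeasure.restrict (range (planeMap a e₁ e₂))
      = ENNReal.ofReal ‖cr e₁ e₂‖ • (volume : Measure E2).map (planeMap a e₁ e₂) := by
  ext A hA
  rw [Measure.restrict_apply hA, Measure.smul_apply,
    Measure.map_apply (planeMap_continuous _ _ _).measurable hA, smul_eq_mul,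
    ← surfaceMeasure_planeMap_image a, image_preimage_eq_inter_range]

theorem setIntegral_planeMap_image {a e₁ e₂ : E3} (h : cr e₁ e₂ ≠ 0) {s : Set E2}
    (hs : MeasurableSet s) (f : E3 → ℝ) :
    ∫ x in planeMap a e₁ e₂ '' s, f x ∂surfaceMeasure
      = ‖cr e₁ e₂‖ * ∫ p in s, f (planeMap a e₁ e₂ p) := by
  have hme := planeMap_measurableEmbedding (a := a) h
  have h1 : surfaceMeasure.restrict (planeMap a e₁ e₂ '' s)
      = (surfaceMeasure.restrict (range (planeMap a e₁ e₂))).restrict (planeMap a e₁ e₂ '' s) := by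
    rw [Measure.restrict_restrict (hme.measurableSet_image' hs),
      inter_eq_left.2 (image_subset_range _ _)]
  rw [h1, surfaceMeasure_restrict_plane, Measure.restrict_smul, integral_smul_measure,
    hme.setIntegral_map, (planeMap_injective h).preimage_image,
    ENNReal.toReal_ofReal (norm_nonneg _), smul_eq_mul]

/-- The reference triangle. -/
def refTri : Set E2 := {s | 0 ≤ s 0 ∧ 0 ≤ s 1 ∧ s 0 + s 1 ≤ 1}

theorem E2_coord_continuous (i : Fin 2) : Continuous fun s : E2 => s i :=
  (EuclideanSpace.proj (𝕜 := ℝ) i).continuous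

theorem isClosed_refTri : IsClosed refTri :=
  (isClosed_le continuous_const (E2_coord_continuous 0)).inter
    ((isClosed_le continuous_const (E2_coord_continuous 1)).inter
      (isClosed_le ((E2_coord_continuous 0).add (E2_coord_continuous 1)) continuous_const))

theorem isCompact_refTri : IsCompact refTri := by
  refine isCompact_of_isClosed_isBounded isClosed_refTri
    ((isBounded_iff_forall_norm_le).2 ⟨2, fun s hs => ?_⟩)
  rw [EuclideanSpace.norm_eq, Fin.sum_univ_two]
  refine Real.sqrt_le_iff.2 ⟨by norm_num, ?_⟩
  simp only [Real.norm_eq_abs, sq_abs]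
  nlinarith [hs.1, hs.2.1, hs.2.2]

/-- The interior of the reference triangle. -/
def refTriInt : Set E2 := {s | 0 < s 0 ∧ 0 < s 1 ∧ s 0 + s 1 < 1}

theorem isOpen_refTriInt : IsOpen refTriInt :=
  (isOpen_lt continuous_const (E2_coord_continuous 0)).inter
    ((isOpen_lt continuous_const (E2_coord_continuous 1)).inter
      (isOpen_lt ((E2_coord_continuous 0).add (E2_coord_continuous 1)) continuous_const))

theorem refTriInt_volume_pos : 0 < volume refTriInt := by
  refine isOpen_refTriInt.measure_pos _ ⟨!₂[1 / 4, 1 / 4], ?_⟩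
  refine ⟨?_, ?_, ?_⟩ <;> norm_num

theorem refTriInt_subset : refTriInt ⊆ refTri := fun _ hs => ⟨hs.1.le, hs.2.1.le, hs.2.2.le⟩

/-- The area of the reference triangle. -/
def refArea : ℝ := volume.real refTri

/-- The integral of a barycentric coordinate over the reference triangle. -/
def refBary : ℝ := ∫ s in refTri, (1 - s 0 - s 1)

theorem refArea_pos : 0 < refArea :=
  ENNReal.toReal_pos ((refTriInt_volume_pos.trans_le (measure_mono refTriInt_subset)).ne')
    isCompact_refTri.measure_lt_top.ne

theorem integrableOn_refTri {f : E2 → ℝ} (hf : Continuous f) : IntegrableOn f refTri :=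
  hf.continuousOn.integrableOn_compact isCompact_refTri

theorem refBary_pos : 0 < refBary := by
  have hc : Continuous fun s : E2 => 1 - s 0 - s 1 :=
    (continuous_const.sub (E2_coord_continuous 0)).sub (E2_coord_continuous 1)
  refine (setIntegral_pos_iff_support_of_nonneg_ae ?_ (integrableOn_refTri hc)).2 ?_
  · refine (ae_restrict_iff' isClosed_refTri.measurableSet).2 (Filter.Eventually.of_forall ?_)
    intro s hs
    change 0 ≤ 1 - s 0 - s 1
    linarith [hs.2.2]
  · refine refTriInt_volume_pos.trans_le (measure_mono fun s hs => ⟨?_, refTriInt_subset hs⟩)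
    change 1 - s 0 - s 1 ≠ 0
    linarith [hs.2.2]

/-- The triangle with vertices `a`, `a + e₁`, `a + e₂`. -/
theorem surfaceMeasure_tri (a e₁ e₂ : E3) :
    surfaceMeasure.real (planeMap a e₁ e₂ '' refTri) = refArea * ‖cr e₁ e₂‖ := by
  rw [Measure.real, surfaceMeasure_planeMap_image, ENNReal.toReal_mul,
    ENNReal.toReal_ofReal (norm_nonneg _), mul_comm]
  rfl

theorem surfaceMeasure_tri_lt_top (a e₁ e₂ : E3) :
    surfaceMeasure (planeMap a e₁ e₂ '' refTri) < ⊤ := by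
  rw [surfaceMeasure_planeMap_image]
  exact ENNReal.mul_lt_top ENNReal.ofReal_lt_top isCompact_refTri.measure_lt_top

/-! ### The gradient of an affine function on a triangle -/

/-- The vector in the plane spanned by `e₁, e₂` with inner products `d₁, d₂` with them. -/
def gvec (e₁ e₂ : E3) (d₁ d₂ : ℝ) : E3 :=
  (‖cr e₁ e₂‖ ^ 2)⁻¹ • cr (d₁ • e₂ - d₂ • e₁) (cr e₁ e₂)

theorem gvec_add (e₁ e₂ : E3) (c₁ c₂ d₁ d₂ : ℝ) :
    gvec e₁ e₂ (c₁ + d₁) (c₂ + d₂) = gvec e₁ e₂ c₁ c₂ + gvec e₁ e₂ d₁ d₂ := by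
  unfold gvec
  rw [← smul_add, ← cr_add_left]
  congr 2
  module

theorem gvec_smul (e₁ e₂ : E3) (c d₁ d₂ : ℝ) :
    gvec e₁ e₂ (c * d₁) (c * d₂) = c • gvec e₁ e₂ d₁ d₂ := by
  unfold gvec
  rw [mul_smul, mul_smul, ← smul_sub, cr_smul_left, smul_comm]

theorem inner_gvec_left {e₁ e₂ : E3} (h : cr e₁ e₂ ≠ 0) (d₁ d₂ : ℝ) :
    ⟪gvec e₁ e₂ d₁ d₂, e₁⟫ = d₁ := by
  have hn : ‖cr e₁ e₂‖ ^ 2 ≠ 0 := by simpa using h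
  rw [gvec, inner_smul_left, conj_trivial, inv_mul_eq_iff_eq_mul₀ hn, norm3_sq, inner3]
  simp only [cr_zero_coord, cr_one_coord, cr_two_coord, PiLp.sub_apply, PiLp.smul_apply,
    smul_eq_mul]
  ring

theorem inner_gvec_right {e₁ e₂ : E3} (h : cr e₁ e₂ ≠ 0) (d₁ d₂ : ℝ) :
    ⟪gvec e₁ e₂ d₁ d₂, e₂⟫ = d₂ := by
  have hn : ‖cr e₁ e₂‖ ^ 2 ≠ 0 := by simpa using h
  rw [gvec, inner_smul_left, conj_trivial, inv_mul_eq_iff_eq_mul₀ hn, norm3_sq, inner3]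
  simp only [cr_zero_coord, cr_one_coord, cr_two_coord, PiLp.sub_apply, PiLp.smul_apply,
    smul_eq_mul]
  ring

theorem gvec_mem_span (e₁ e₂ : E3) (d₁ d₂ : ℝ) :
    gvec e₁ e₂ d₁ d₂ ∈ Submodule.span ℝ {e₁, e₂} := by
  rw [Submodule.mem_span_pair]
  set y := d₁ • e₂ - d₂ • e₁
  refine ⟨(‖cr e₁ e₂‖ ^ 2)⁻¹ * ⟪e₂, y⟫, -((‖cr e₁ e₂‖ ^ 2)⁻¹ * ⟪e₁, y⟫), ?_⟩
  rw [gvec, ← neg_neg (cr (d₁ • e₂ - d₂ • e₁) (cr e₁ e₂)), ← cr_swap, cr_cr_left]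
  module

/-- The combination `d₁e₂ - d₂e₁` is orthogonal to the normal, so crossing it with the normal just
multiplies lengths. -/
theorem norm_gvec {e₁ e₂ : E3} (h : cr e₁ e₂ ≠ 0) (d₁ d₂ : ℝ) :
    ‖gvec e₁ e₂ d₁ d₂‖ = ‖d₁ • e₂ - d₂ • e₁‖ / ‖cr e₁ e₂‖ := by
  have hn : ‖cr e₁ e₂‖ ≠ 0 := by simpa using h
  have horth : ⟪d₁ • e₂ - d₂ • e₁, cr e₁ e₂⟫ = 0 := by
    rw [inner_sub_left, inner_smul_left, inner_smul_left, real_inner_comm, inner_cr_right,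
      real_inner_comm, inner_cr_left]; simp
  have h1 : ‖cr (d₁ • e₂ - d₂ • e₁) (cr e₁ e₂)‖ = ‖d₁ • e₂ - d₂ • e₁‖ * ‖cr e₁ e₂‖ := by
    refine (sq_eq_sq₀ (norm_nonneg _) (by positivity)).1 ?_
    rw [norm_cr_sq, horth]; ring
  rw [gvec, norm_smul, h1, norm_inv, norm_pow, norm_norm]
  field_simp

theorem eq_of_mem_span_pair {e₁ e₂ g g' : E3} (hg : g ∈ Submodule.span ℝ {e₁, e₂})
    (hg' : g' ∈ Submodule.span ℝ {e₁, e₂}) (h1 : ⟪g, e₁⟫ = ⟪g', e₁⟫) (h2 : ⟪g, e₂⟫ = ⟪g', e₂⟫) :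
    g = g' := by
  obtain ⟨a, b, hab⟩ := Submodule.mem_span_pair.1 (Submodule.sub_mem _ hg hg')
  have : ⟪g - g', g - g'⟫ = 0 := by
    nth_rewrite 2 [← hab]
    rw [inner_add_right, inner_smul_right, inner_smul_right, inner_sub_left, inner_sub_left, h1, h2]
    simp
  exact sub_eq_zero.1 (inner_self_eq_zero.1 this)

/-! ### Barycentric coordinates, nodal interpolation and the finite element space. -/

namespace EvolvingTriangulation

variable {T : ℝ} {S : EvolvingSurface T} (M : EvolvingTriangulation S)

/-- The edge vector from node `i` to node `j`. -/
def ed (t : ℝ) (i j : Fin M.N) : E3 := M.node j t - M.node i t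

/-- `i, j, k` are the vertices of the triangle `K`. -/
structure IsTri (K : Finset (Fin M.N)) (i j k : Fin M.N) : Prop where
  mem : K ∈ M.tri
  eq : K = {i, j, k}
  ij : i ≠ j
  ik : i ≠ k
  jk : j ≠ k

variable {M}

theorem exists_isTri {K : Finset (Fin M.N)} (hK : K ∈ M.tri) {i : Fin M.N} (hi : i ∈ K) :
    ∃ j k, M.IsTri K i j k := by
  have hc : (K.erase i).card = 2 := by rw [Finset.card_erase_of_mem hi, M.card_tri K hK]
  obtain ⟨j, k, hjk, he⟩ := Finset.card_eq_two.1 hc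
  have hj : j ∈ K.erase i := by rw [he]; simp
  have hk : k ∈ K.erase i := by rw [he]; simp
  refine ⟨j, k, hK, ?_, (Finset.ne_of_mem_erase hj).symm, (Finset.ne_of_mem_erase hk).symm, hjk⟩
  rw [← Finset.insert_erase hi, he]

theorem exists_isTri' {K : Finset (Fin M.N)} (hK : K ∈ M.tri) : ∃ i j k, M.IsTri K i j k := by
  have : K.Nonempty := by rw [← Finset.card_pos, M.card_tri K hK]; norm_num
  obtain ⟨i, hi⟩ := this
  exact ⟨i, exists_isTri hK hi⟩

namespace IsTri
variable {K : Finset (Fin M.N)} {i j k : Fin M.N}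

theorem mem_i (h : M.IsTri K i j k) : i ∈ K := by rw [h.eq]; simp
theorem mem_j (h : M.IsTri K i j k) : j ∈ K := by rw [h.eq]; simp
theorem mem_k (h : M.IsTri K i j k) : k ∈ K := by rw [h.eq]; simp

theorem swap (h : M.IsTri K i j k) : M.IsTri K i k j :=
  ⟨h.mem, by rw [h.eq, Finset.pair_comm], h.ik, h.ij, h.jk.symm⟩

theorem rot (h : M.IsTri K i j k) : M.IsTri K j k i :=
  ⟨h.mem, by rw [h.eq]; ext x; simp; tauto, h.jk, h.ij.symm, h.ik.symm⟩

theorem sum_eq (h : M.IsTri K i j k) {F : Type*} [AddCommMonoid F] {f : Fin M.N → F}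
    (hf : ∀ l, l ∉ K → f l = 0) : ∑ l, f l = f i + (f j + f k) := by
  rw [← Finset.sum_subset (Finset.subset_univ K) fun l _ hl => hf l hl, h.eq,
    Finset.sum_insert (by simp [h.ij, h.ik]), Finset.sum_pair h.jk]

end IsTri

/-- `w` is a system of barycentric weights on the vertices in `K`. -/
structure IsWt (K : Finset (Fin M.N)) (w : Fin M.N → ℝ) : Prop where
  nonneg : ∀ i, 0 ≤ w i
  supp : ∀ i, i ∉ K → w i = 0
  sum : ∑ i, w i = 1

theorem mem_elem_iff {t : ℝ} {K : Finset (Fin M.N)} {x : E3} :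
    x ∈ M.elem t K ↔ ∃ w, IsWt K w ∧ ∑ i, w i • M.node i t = x := by
  classical
  constructor
  · intro hx
    have : M.elem t K ⊆ {x | ∃ w, IsWt K w ∧ ∑ i, w i • M.node i t = x} := by
      refine convexHull_min ?_ ?_
      · rintro _ ⟨i, hi, rfl⟩
        refine ⟨Pi.single i 1, ⟨fun l => ?_, fun l hl => ?_, by simp⟩, ?_⟩
        · rcases eq_or_ne l i with rfl | h <;> simp [*]
        · have : l ≠ i := by rintro rfl; exact hl hi
          simp [this]
        · rw [Finset.sum_eq_single i (fun l _ hl => by simp [hl]) (by simp)]; simp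
      · rintro x ⟨w, hw, rfl⟩ y ⟨w', hw', rfl⟩ a b ha hb hab
        refine ⟨fun i => a * w i + b * w' i, ⟨fun i => ?_, fun i hi => ?_, ?_⟩, ?_⟩
        · exact add_nonneg (mul_nonneg ha (hw.nonneg i)) (mul_nonneg hb (hw'.nonneg i))
        · simp [hw.supp i hi, hw'.supp i hi]
        · rw [Finset.sum_add_distrib, ← Finset.mul_sum, ← Finset.mul_sum, hw.sum, hw'.sum]
          linarith
        · rw [Finset.smul_sum, Finset.smul_sum, ← Finset.sum_add_distrib]
          exact Finset.sum_congr rfl fun i _ => by rw [add_smul, mul_smul, mul_smul]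
    exact this hx
  · rintro ⟨w, hw, rfl⟩
    have e : ∑ i, w i • M.node i t = ∑ i ∈ K, w i • M.node i t :=
      (Finset.sum_subset (Finset.subset_univ K) fun l _ hl => by simp [hw.supp l hl]).symm
    have e' : ∑ i ∈ K, w i = 1 := by
      rw [← hw.sum]
      exact Finset.sum_subset (Finset.subset_univ K) fun l _ hl => hw.supp l hl
    rw [e]
    exact (convex_convexHull ℝ _).sum_mem (fun i _ => hw.nonneg i) e'
      fun i hi => subset_convexHull ℝ _ ⟨i, hi, rfl⟩

theorem node_mem_elem {t : ℝ} {K : Finset (Fin M.N)} {i : Fin M.N} (hi : i ∈ K) :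
    M.node i t ∈ M.elem t K := subset_convexHull ℝ _ ⟨i, hi, rfl⟩

theorem isBary_iff {t : ℝ} {x : E3} {w : Fin M.N → ℝ} :
    M.IsBary t x w ↔ ∃ K ∈ M.tri, IsWt K w ∧ ∑ i, w i • M.node i t = x :=
  ⟨fun ⟨K, hK, h1, h2, h3, h4⟩ => ⟨K, hK, ⟨h1, h2, h3⟩, h4⟩,
    fun ⟨K, hK, h, h4⟩ => ⟨K, hK, h.1, h.2, h.3, h4⟩⟩

/-- The barycentric combination in terms of the edge vectors. -/
theorem IsTri.sum_node {K : Finset (Fin M.N)} {i j k : Fin M.N} (h : M.IsTri K i j k)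
    {w : Fin M.N → ℝ} (hw : IsWt K w) (t : ℝ) :
    ∑ l, w l • M.node l t = planeMap (M.node i t) (M.ed t i j) (M.ed t i k) !₂[w j, w k] := by
  rw [h.sum_eq fun l hl => by simp [hw.supp l hl]]
  have h1 := hw.sum
  rw [h.sum_eq fun l hl => hw.supp l hl] at h1
  have : w i = 1 - w j - w k := by linarith
  rw [planeMap_apply, this]
  simp only [ed, Matrix.cons_val_zero, Matrix.cons_val_one]
  module

/-- The weights with given second and third barycentric coordinate. -/
def triWt (i j k : Fin M.N) (s : E2) : Fin M.N → ℝ := fun l =>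
  if l = i then 1 - s 0 - s 1 else if l = j then s 0 else if l = k then s 1 else 0

theorem IsTri.isWt_triWt {K : Finset (Fin M.N)} {i j k : Fin M.N} (h : M.IsTri K i j k) {s : E2}
    (hs : s ∈ refTri) : IsWt K (triWt (M := M) i j k s) := by
  have hsupp : ∀ l, l ∉ K → triWt (M := M) i j k s l = 0 := by
    intro l hl
    rw [h.eq] at hl
    simp only [Finset.mem_insert, Finset.mem_singleton, not_or] at hl
    simp [triWt, hl]
  refine ⟨fun l => ?_, hsupp, ?_⟩
  · unfold triWt
    split_ifs
    · linarith [hs.2.2]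
    · exact hs.1
    · exact hs.2.1
    · exact le_rfl
  · rw [h.sum_eq hsupp]
    simp only [triWt, if_true, h.ij.symm, h.ik.symm, h.jk.symm, if_false]
    ring

theorem IsTri.sum_triWt {K : Finset (Fin M.N)} {i j k : Fin M.N} (h : M.IsTri K i j k) {s : E2}
    {F : Type*} [AddCommGroup F] [Module ℝ F] (v : Fin M.N → F) :
    ∑ l, triWt (M := M) i j k s l • v l = (1 - s 0 - s 1) • v i + (s 0 • v j + s 1 • v k) := by
  have hsupp : ∀ l, l ∉ K → triWt (M := M) i j k s l • v l = 0 := by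
    intro l hl
    rw [h.eq] at hl
    simp only [Finset.mem_insert, Finset.mem_singleton, not_or] at hl
    simp [triWt, hl]
  rw [h.sum_eq hsupp]
  simp only [triWt, if_true, h.ij.symm, h.ik.symm, h.jk.symm, if_false]

theorem IsTri.planeMap_eq {K : Finset (Fin M.N)} {i j k : Fin M.N} (h : M.IsTri K i j k) (t : ℝ)
    (s : E2) : planeMap (M.node i t) (M.ed t i j) (M.ed t i k) s
      = ∑ l, triWt (M := M) i j k s l • M.node l t := by
  rw [h.sum_triWt, planeMap_apply, ed, ed]
  module

theorem IsTri.elem_eq {K : Finset (Fin M.N)} {i j k : Fin M.N} (h : M.IsTri K i j k) (t : ℝ) :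
    M.elem t K = planeMap (M.node i t) (M.ed t i j) (M.ed t i k) '' refTri := by
  ext x
  rw [mem_elem_iff]
  constructor
  · rintro ⟨w, hw, rfl⟩
    refine ⟨!₂[w j, w k], ⟨hw.nonneg j, hw.nonneg k, ?_⟩, (h.sum_node hw t).symm⟩
    have h1 := hw.sum
    rw [h.sum_eq fun l hl => hw.supp l hl] at h1
    have := hw.nonneg i
    simp only [Matrix.cons_val_zero, Matrix.cons_val_one]
    linarith
  · rintro ⟨s, hs, rfl⟩
    exact ⟨_, h.isWt_triWt hs, (h.planeMap_eq t s).symm⟩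

theorem isCompact_elem {K : Finset (Fin M.N)} (hK : K ∈ M.tri) (t : ℝ) : IsCompact (M.elem t K) := by
  obtain ⟨i, j, k, h⟩ := exists_isTri' hK
  rw [h.elem_eq]
  exact isCompact_refTri.image (planeMap_continuous _ _ _)

variable (M)

/-- At time `t` the triangulation is conforming and nondegenerate. -/
structure IsProper (t : ℝ) : Prop where
  conforming : ∀ K ∈ M.tri, ∀ L ∈ M.tri, M.elem t K ∩ M.elem t L = M.elem t (K ∩ L)
  nondeg : ∀ K i j k, M.IsTri K i j k → cr (M.ed t i j) (M.ed t i k) ≠ 0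

/-- Twice the area of the triangle `K`, up to normalisation. -/
def dArea (t : ℝ) (K : Finset (Fin M.N)) : ℝ := surfaceMeasure.real (M.elem t K) / refArea

/-- The lumped mass of the node `i`. -/
def mass (t : ℝ) (i : Fin M.N) : ℝ := ∑ K ∈ M.tri with i ∈ K, refBary * M.dArea t K

variable {M}

theorem IsTri.dArea_eq {K : Finset (Fin M.N)} {i j k : Fin M.N} (h : M.IsTri K i j k) (t : ℝ) :
    M.dArea t K = ‖cr (M.ed t i j) (M.ed t i k)‖ := by
  rw [dArea, h.elem_eq, surfaceMeasure_tri, mul_div_cancel_left₀ _ refArea_pos.ne']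

theorem surfaceMeasure_elem {K : Finset (Fin M.N)} (t : ℝ) :
    surfaceMeasure.real (M.elem t K) = refArea * M.dArea t K := by
  rw [dArea, mul_div_cancel₀ _ refArea_pos.ne']

theorem surfaceMeasure_elem_lt_top {K : Finset (Fin M.N)} (hK : K ∈ M.tri) (t : ℝ) :
    surfaceMeasure (M.elem t K) < ⊤ := by
  obtain ⟨i, j, k, h⟩ := exists_isTri' hK
  rw [h.elem_eq]
  exact surfaceMeasure_tri_lt_top _ _ _

namespace IsProper
variable {t : ℝ} (hM : M.IsProper t)
include hM

theorem dArea_pos {K : Finset (Fin M.N)} (hK : K ∈ M.tri) : 0 < M.dArea t K := by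
  obtain ⟨i, j, k, h⟩ := exists_isTri' hK
  rw [h.dArea_eq]
  exact norm_pos_iff.2 (hM.nondeg _ _ _ _ h)

theorem mass_pos (i : Fin M.N) : 0 < M.mass t i := by
  obtain ⟨K, hK, hi⟩ := M.node_used i
  refine Finset.sum_pos (fun L hL => mul_pos refBary_pos (hM.dArea_pos (Finset.mem_filter.1 hL).1))
    ⟨K, Finset.mem_filter.2 ⟨hK, hi⟩⟩

theorem wt_unique {K : Finset (Fin M.N)} (hK : K ∈ M.tri) {w w' : Fin M.N → ℝ} (hw : IsWt K w)
    (hw' : IsWt K w') (h : ∑ i, w i • M.node i t = ∑ i, w' i • M.node i t) : w = w' := by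
  obtain ⟨i, j, k, hT⟩ := exists_isTri' hK
  rw [hT.sum_node hw, hT.sum_node hw'] at h
  have := planeMap_injective (hM.nondeg _ _ _ _ hT) h
  have hj : w j = w' j := by simpa using congrArg (fun s : E2 => s 0) this
  have hk : w k = w' k := by simpa using congrArg (fun s : E2 => s 1) this
  have s1 := hw.sum
  have s2 := hw'.sum
  rw [hT.sum_eq fun l hl => hw.supp l hl] at s1
  rw [hT.sum_eq fun l hl => hw'.supp l hl] at s2
  funext l
  by_cases hl : l ∈ K
  · rw [hT.eq] at hl
    simp only [Finset.mem_insert, Finset.mem_singleton] at hl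
    rcases hl with rfl | rfl | rfl
    · linarith
    · exact hj
    · exact hk
  · rw [hw.supp l hl, hw'.supp l hl]

/-- A point of two triangles lies, by conformity, in the simplex of their common nodes; weights
taken there serve both triangles and must equal each given system. This makes `interp` independent
of the choice in its definition. -/
theorem bary_unique {x : E3} {w w' : Fin M.N → ℝ} (hw : M.IsBary t x w) (hw' : M.IsBary t x w') :
    w = w' := by
  obtain ⟨K, hK, hwK, hwx⟩ := isBary_iff.1 hw
  obtain ⟨L, hL, hwL, hwx'⟩ := isBary_iff.1 hw'
  have hx : x ∈ M.elem t K ∩ M.elem t L :=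
    ⟨mem_elem_iff.2 ⟨w, hwK, hwx⟩, mem_elem_iff.2 ⟨w', hwL, hwx'⟩⟩
  rw [hM.conforming K hK L hL, mem_elem_iff] at hx
  obtain ⟨w'', h'', hx''⟩ := hx
  have e1 : w = w'' := hM.wt_unique hK hwK
    ⟨h''.nonneg, fun i hi => h''.supp i fun h => hi (Finset.mem_inter.1 h).1, h''.sum⟩
    (hwx.trans hx''.symm)
  have e2 : w' = w'' := hM.wt_unique hL hwL
    ⟨h''.nonneg, fun i hi => h''.supp i fun h => hi (Finset.mem_inter.1 h).2, h''.sum⟩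
    (hwx'.trans hx''.symm)
  rw [e1, e2]

theorem interp_of_isBary {F : Type*} [AddCommGroup F] [Module ℝ F] (v : Fin M.N → F) {x : E3}
    {w : Fin M.N → ℝ} (hw : M.IsBary t x w) : M.interp t v x = ∑ i, w i • v i := by
  have hx : ∃ w, M.IsBary t x w := ⟨w, hw⟩
  rw [interp, dif_pos hx, hM.bary_unique hx.choose_spec hw]

theorem interp_planeMap {F : Type*} [AddCommGroup F] [Module ℝ F] (v : Fin M.N → F)
    {K : Finset (Fin M.N)} {i j k : Fin M.N} (h : M.IsTri K i j k) {s : E2} (hs : s ∈ refTri) :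
    M.interp t v (planeMap (M.node i t) (M.ed t i j) (M.ed t i k) s)
      = (1 - s 0 - s 1) • v i + (s 0 • v j + s 1 • v k) := by
  rw [hM.interp_of_isBary v (isBary_iff.2 ⟨K, h.mem, h.isWt_triWt hs, (h.planeMap_eq t s).symm⟩),
    h.sum_triWt]

theorem interp_node {F : Type*} [AddCommGroup F] [Module ℝ F] (v : Fin M.N → F) (i : Fin M.N) :
    M.interp t v (M.node i t) = v i := by
  obtain ⟨K, hK, hi⟩ := M.node_used i
  obtain ⟨j, k, h⟩ := exists_isTri hK hi
  have h0 : (0 : E2) ∈ refTri := ⟨le_rfl, le_rfl, by simp⟩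
  have := hM.interp_planeMap v h h0
  simpa [planeMap] using this

omit hM in
theorem elem_subset_surf {K : Finset (Fin M.N)} (hK : K ∈ M.tri) : M.elem t K ⊆ M.surf t :=
  fun _ hx => mem_iUnion₂.2 ⟨K, hK, hx⟩

omit hM in
theorem interp_of_notMem (v : Fin M.N → ℝ) {x : E3} (hx : x ∉ M.surf t) : M.interp t v x = 0 := by
  rw [interp, dif_neg]
  rintro ⟨w, hw⟩
  obtain ⟨K, hK, hwK, hwx⟩ := isBary_iff.1 hw
  exact hx (mem_iUnion₂.2 ⟨K, hK, mem_elem_iff.2 ⟨w, hwK, hwx⟩⟩)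

/-- On a triangle the interpolant is an affine function with known gradient. -/
theorem interp_eq_on {K : Finset (Fin M.N)} {i j k : Fin M.N} (h : M.IsTri K i j k)
    (v : Fin M.N → ℝ) {x : E3} (hx : x ∈ M.elem t K) :
    M.interp t v x = v i
      + ⟪gvec (M.ed t i j) (M.ed t i k) (v j - v i) (v k - v i), x - M.node i t⟫ := by
  rw [h.elem_eq] at hx
  obtain ⟨s, hs, rfl⟩ := hx
  rw [hM.interp_planeMap v h hs, planeMap_apply, add_sub_cancel_left, inner_add_right,
    inner_smul_right, inner_smul_right, inner_gvec_left (hM.nondeg _ _ _ _ h),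
    inner_gvec_right (hM.nondeg _ _ _ _ h)]
  simp only [smul_eq_mul]
  ring

/-- Continuity on the whole discrete surface follows from continuity on finitely many closed
triangles, since the interpolant is single-valued on overlaps. -/
theorem interp_mem_space (v : Fin M.N → ℝ) : M.interp t v ∈ M.space t := by
  have haff : ∀ K ∈ M.tri, ∃ A : E3 →ᵃ[ℝ] ℝ, EqOn (M.interp t v) A (M.elem t K) := by
    intro K hK
    obtain ⟨i, j, k, h⟩ := exists_isTri' hK
    set g := gvec (M.ed t i j) (M.ed t i k) (v j - v i) (v k - v i) with hg
    refine ⟨(innerSL ℝ g).toLinearMap.toAffineMap + AffineMap.const ℝ E3 (v i - ⟪g, M.node i t⟫),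
      fun x hx => ?_⟩
    rw [hM.interp_eq_on h v hx, inner_sub_right]
    simp [hg]
    ring
  refine ⟨fun x hx => interp_of_notMem v hx, ?_, haff⟩
  have e : M.surf t = ⋃ K : M.tri, M.elem t K := by
    rw [surf, iUnion_subtype]
  rw [e]
  refine (locallyFinite_of_finite _).continuousOn_iUnion
    (fun K => (isCompact_elem K.2 t).isClosed) fun K => ?_
  obtain ⟨A, hA⟩ := haff K K.2
  exact (A.continuous_of_finiteDimensional.continuousOn).congr hA

theorem eq_interp_of_mem_space {φ : E3 → ℝ} (hφ : φ ∈ M.space t) :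
    φ = M.interp t fun i => φ (M.node i t) := by
  funext x
  by_cases hx : x ∈ M.surf t
  · obtain ⟨K, hK, hxK⟩ := mem_iUnion₂.1 hx
    obtain ⟨A, hA⟩ := hφ.2.2 K hK
    obtain ⟨i, j, k, h⟩ := exists_isTri' hK
    rw [hA hxK]
    rw [h.elem_eq] at hxK
    obtain ⟨s, hs, rfl⟩ := hxK
    rw [hM.interp_planeMap _ h hs, hA (node_mem_elem h.mem_i), hA (node_mem_elem h.mem_j),
      hA (node_mem_elem h.mem_k), planeMap_apply, add_comm (M.node i t), ← vadd_eq_add,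
      A.map_vadd, ed, ed, map_add, map_smul, map_smul, ← vsub_eq_sub, ← vsub_eq_sub,
      AffineMap.linearMap_vsub, AffineMap.linearMap_vsub]
    simp only [vsub_eq_sub, smul_eq_mul, vadd_eq_add]
    ring
  · rw [hφ.1 x hx, interp_of_notMem _ hx]

theorem interp_interp_congr {φ ψ : E3 → ℝ} (hφ : φ ∈ M.space t) (hψ : ψ ∈ M.space t)
    (h : ∀ i, φ (M.node i t) = ψ (M.node i t)) : φ = ψ := by
  rw [hM.eq_interp_of_mem_space hφ, hM.eq_interp_of_mem_space hψ]
  simp only [h]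

omit hM in
theorem vectorSpan_elem_le {K : Finset (Fin M.N)} {i j k : Fin M.N} (h : M.IsTri K i j k) :
    vectorSpan ℝ (M.elem t K) = Submodule.span ℝ {M.ed t i j, M.ed t i k} := by
  apply le_antisymm
  · rw [vectorSpan_def, Submodule.span_le]
    rintro _ ⟨x, hx, y, hy, rfl⟩
    rw [h.elem_eq] at hx hy
    obtain ⟨s, -, rfl⟩ := hx
    obtain ⟨s', -, rfl⟩ := hy
    refine Submodule.mem_span_pair.2 ⟨s 0 - s' 0, s 1 - s' 1, ?_⟩
    simp only [planeMap_apply, vsub_eq_sub]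
    module
  · rw [Submodule.span_le]
    intro x hx
    rcases hx with rfl | rfl
    · exact vsub_mem_vectorSpan ℝ (node_mem_elem h.mem_j) (node_mem_elem h.mem_i)
    · exact vsub_mem_vectorSpan ℝ (node_mem_elem h.mem_k) (node_mem_elem h.mem_i)

/-- A vector parallel to the triangle is determined by its inner products with two edges, so the
gradient chosen in `elemGrad` must be `gvec`. -/
theorem elemGrad_interp {K : Finset (Fin M.N)} {i j k : Fin M.N} (h : M.IsTri K i j k)
    (v : Fin M.N → ℝ) : elemGrad (M.elem t K) (M.interp t v)
      = gvec (M.ed t i j) (M.ed t i k) (v j - v i) (v k - v i) := by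
  set g := gvec (M.ed t i j) (M.ed t i k) (v j - v i) (v k - v i) with hg
  have hex : ∃ g ∈ vectorSpan ℝ (M.elem t K), ∀ x ∈ M.elem t K, ∀ y ∈ M.elem t K,
      M.interp t v x - M.interp t v y = ⟪g, x - y⟫ := by
    refine ⟨g, ?_, fun x hx y hy => ?_⟩
    · rw [vectorSpan_elem_le h]; exact gvec_mem_span _ _ _ _
    · rw [hM.interp_eq_on h v hx, hM.interp_eq_on h v hy, ← hg, add_sub_add_left_eq_sub,
        ← inner_sub_right, sub_sub_sub_cancel_right]
  rw [elemGrad, dif_pos hex]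
  obtain ⟨h1, h2⟩ := hex.choose_spec
  have h1' := (vectorSpan_elem_le h).le h1
  have hnd := hM.nondeg _ _ _ _ h
  refine eq_of_mem_span_pair h1' (gvec_mem_span _ _ _ _) ?_ ?_
  · rw [hg, inner_gvec_left hnd]
    have := h2 _ (node_mem_elem h.mem_j) _ (node_mem_elem h.mem_i)
    rw [hM.interp_node, hM.interp_node] at this
    exact this.symm
  · rw [hg, inner_gvec_right hnd]
    have := h2 _ (node_mem_elem h.mem_k) _ (node_mem_elem h.mem_i)
    rw [hM.interp_node, hM.interp_node] at this
    exact this.symm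

end IsProper
end EvolvingTriangulation

namespace EvolvingTriangulation

variable {T : ℝ} {S : EvolvingSurface T} {M : EvolvingTriangulation S}

/-! ### Integrals of finite element functions -/

/-- A node of `K` outside `L` has weight zero on the common simplex, which therefore lies over a
line in the parameter plane of `K`. -/
theorem surfaceMeasure_edge_null {t : ℝ} {K L : Finset (Fin M.N)} (hK : K ∈ M.tri)
    {k : Fin M.N} (hk : k ∈ K) (hkL : k ∉ L) : surfaceMeasure (M.elem t (K ∩ L)) = 0 := by
  obtain ⟨i, j, h⟩ := exists_isTri hK hk
  have h := h.rot
  have hsub : M.elem t (K ∩ L)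
      ⊆ planeMap (M.node i t) (M.ed t i j) (M.ed t i k) '' {s : E2 | s 1 = 0} := by
    intro x hx
    obtain ⟨w, hw, rfl⟩ := mem_elem_iff.1 hx
    have hw' : IsWt K w :=
      ⟨hw.nonneg, fun l hl => hw.supp l fun h => hl (Finset.mem_inter.1 h).1, hw.sum⟩
    refine ⟨_, ?_, (h.sum_node hw' t).symm⟩
    exact hw.supp k fun h => hkL (Finset.mem_inter.1 h).2
  refine measure_mono_null hsub ?_
  rw [surfaceMeasure_planeMap_image]
  have : {s : E2 | s 1 = 0} = ((EuclideanSpace.proj (𝕜 := ℝ) (1 : Fin 2) :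
      E2 →L[ℝ] ℝ).ker : Set E2) := by ext s; simp
  rw [this, Measure.addHaar_submodule, mul_zero]
  intro htop
  have : (!₂[0, 1] : E2) ∈ (EuclideanSpace.proj (𝕜 := ℝ) (1 : Fin 2) : E2 →L[ℝ] ℝ).ker := by
    rw [htop]; trivial
  simp at this

namespace IsProper
variable {t : ℝ} (hM : M.IsProper t)
include hM

theorem aedisjoint {K L : Finset (Fin M.N)} (hK : K ∈ M.tri) (hL : L ∈ M.tri) (hKL : K ≠ L) :
    AEDisjoint surfaceMeasure (M.elem t K) (M.elem t L) := by
  rw [AEDisjoint, hM.conforming K hK L hL]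
  have : ¬ K ⊆ L := fun h => hKL
    (Finset.eq_of_subset_of_card_le h (by rw [M.card_tri K hK, M.card_tri L hL]))
  obtain ⟨k, hk, hkL⟩ := Finset.not_subset.1 this
  exact surfaceMeasure_edge_null hK hk hkL

theorem integral_surf {f : E3 → ℝ}
    (hf : ∀ K ∈ M.tri, IntegrableOn f (M.elem t K) surfaceMeasure) :
    ∫ x in M.surf t, f x ∂surfaceMeasure
      = ∑ K ∈ M.tri, ∫ x in M.elem t K, f x ∂surfaceMeasure := by
  have e : M.surf t = ⋃ K : M.tri, M.elem t K := by
    rw [surf, iUnion_subtype]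
  have hint : IntegrableOn f (⋃ K : M.tri, M.elem t K) surfaceMeasure :=
    integrableOn_finite_iUnion.2 fun K => hf K K.2
  rw [e, integral_iUnion_ae (fun K => (isCompact_elem K.2 t).measurableSet.nullMeasurableSet)
    (fun K L hKL => hM.aedisjoint K.2 L.2 fun h => hKL (Subtype.ext h)) hint, tsum_fintype]
  exact Finset.sum_coe_sort M.tri (fun K => ∫ x in M.elem t K, f x ∂surfaceMeasure)

theorem interp_continuousOn_elem {K : Finset (Fin M.N)} (hK : K ∈ M.tri) (v : Fin M.N → ℝ) :
    ContinuousOn (M.interp t v) (M.elem t K) :=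
  (hM.interp_mem_space v).2.1.mono (elem_subset_surf hK)

theorem integrableOn_interp {K : Finset (Fin M.N)} (hK : K ∈ M.tri) (v : Fin M.N → ℝ) :
    IntegrableOn (M.interp t v) (M.elem t K) surfaceMeasure := by
  have : IsFiniteMeasure (surfaceMeasure.restrict (M.elem t K)) :=
    ⟨by rw [Measure.restrict_apply_univ]; exact surfaceMeasure_elem_lt_top hK t⟩
  obtain ⟨C, hC⟩ := (isCompact_elem hK t).exists_bound_of_continuousOn
    (hM.interp_continuousOn_elem hK v)
  refine Integrable.of_bound ((hM.interp_continuousOn_elem hK v).aestronglyMeasurable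
    (isCompact_elem hK t).measurableSet) C ?_
  exact (ae_restrict_iff' (isCompact_elem hK t).measurableSet).2 (Filter.Eventually.of_forall hC)

/-- Using the vertex in question as origin of the parametrisation reduces every barycentric
coordinate to the same integral over the reference triangle. Its numerical value is never needed,
only its positivity. -/
theorem integral_bary {K : Finset (Fin M.N)} {i j k : Fin M.N} (h : M.IsTri K i j k) :
    ∫ x in M.elem t K, M.interp t (Pi.single i (1 : ℝ)) x ∂surfaceMeasure
      = refBary * M.dArea t K := by
  rw [h.elem_eq, setIntegral_planeMap_image (hM.nondeg _ _ _ _ h) isClosed_refTri.measurableSet,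
    h.dArea_eq, mul_comm, refBary]
  congr 1
  refine setIntegral_congr_fun isClosed_refTri.measurableSet fun s hs => ?_
  rw [hM.interp_planeMap _ h hs]
  simp [h.ij.symm, h.ik.symm]

theorem interp_eq_sum (v : Fin M.N → ℝ) {K : Finset (Fin M.N)} (hK : K ∈ M.tri) {x : E3}
    (hx : x ∈ M.elem t K) :
    M.interp t v x = ∑ l ∈ K, v l * M.interp t (Pi.single l (1 : ℝ)) x := by
  obtain ⟨w, hw, hwx⟩ := mem_elem_iff.1 hx
  have hb : M.IsBary t x w := isBary_iff.2 ⟨K, hK, hw, hwx⟩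
  rw [hM.interp_of_isBary v hb]
  have : ∀ l, M.interp t (Pi.single l (1 : ℝ)) x = w l := by
    intro l
    rw [hM.interp_of_isBary _ hb, Finset.sum_eq_single l (fun i _ hi => by simp [hi]) (by simp)]
    simp
  simp only [this, smul_eq_mul]
  rw [← Finset.sum_subset (Finset.subset_univ K) fun l _ hl => by simp [hw.supp l hl]]
  exact Finset.sum_congr rfl fun l _ => mul_comm _ _

theorem integral_elem_interp {K : Finset (Fin M.N)} (hK : K ∈ M.tri) (v : Fin M.N → ℝ) :
    ∫ x in M.elem t K, M.interp t v x ∂surfaceMeasure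
      = ∑ l ∈ K, refBary * M.dArea t K * v l := by
  rw [setIntegral_congr_fun (isCompact_elem hK t).measurableSet
    (fun x hx => hM.interp_eq_sum v hK hx), integral_finsetSum]
  · refine Finset.sum_congr rfl fun l hl => ?_
    obtain ⟨j, k, h⟩ := exists_isTri hK hl
    rw [integral_const_mul, hM.integral_bary h, mul_comm]
  · exact fun l _ => (hM.integrableOn_interp hK _).const_mul _

theorem integral_surf_interp (v : Fin M.N → ℝ) :
    ∫ x in M.surf t, M.interp t v x ∂surfaceMeasure = ∑ i, M.mass t i * v i := by
  rw [hM.integral_surf fun K hK => hM.integrableOn_interp hK v,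
    Finset.sum_congr rfl fun K hK => hM.integral_elem_interp hK v]
  simp only [mass, Finset.sum_mul, Finset.sum_filter]
  rw [Finset.sum_comm]
  refine Finset.sum_congr rfl fun K _ => ?_
  simp only [ite_mul, zero_mul, Finset.sum_ite_mem, Finset.univ_inter]

theorem lumpedMass_eq (η ζ : E3 → ℝ) : M.lumpedMass t η ζ
    = wsum (M.mass t) (fun i => η (M.node i t)) (fun i => ζ (M.node i t)) :=
  hM.integral_surf_interp _

/-- The number of nodes of a triangle counted with the lumped masses. -/
theorem sum_dArea_mul (v : Fin M.N → ℝ) :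
    ∑ K ∈ M.tri, refBary * M.dArea t K * ∑ l ∈ K, v l = ∑ i, M.mass t i * v i := by
  rw [← hM.integral_surf_interp, hM.integral_surf fun K hK => hM.integrableOn_interp hK v]
  refine Finset.sum_congr rfl fun K hK => ?_
  rw [hM.integral_elem_interp hK, Finset.mul_sum]

end IsProper

/-! ### The stiffness form -/

variable (M) in
/-- The gradient on the triangle `K` of the function with given nodal values. -/
def gradK (t : ℝ) (K : Finset (Fin M.N)) : (Fin M.N → ℝ) →ₗ[ℝ] E3 :=
  open Classical in
  if h : ∃ i j k, M.IsTri K i j k then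
    { toFun := fun v => gvec (M.ed t h.choose h.choose_spec.choose)
        (M.ed t h.choose h.choose_spec.choose_spec.choose)
        (v h.choose_spec.choose - v h.choose) (v h.choose_spec.choose_spec.choose - v h.choose)
      map_add' := fun v w => by
        rw [← gvec_add]; congr 1 <;> simp only [Pi.add_apply] <;> ring
      map_smul' := fun c v => by
        rw [RingHom.id_apply, ← gvec_smul]
        congr 1 <;> simp only [Pi.smul_apply, smul_eq_mul] <;> ring }
  else 0

variable (M) in
/-- The stiffness form on nodal values. -/
def stiffForm (t : ℝ) : (Fin M.N → ℝ) →ₗ[ℝ] (Fin M.N → ℝ) →ₗ[ℝ] ℝ :=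
  ∑ K ∈ M.tri, (refArea * M.dArea t K) • (innerₗ E3).compl₁₂ (M.gradK t K) (M.gradK t K)

theorem stiffForm_apply (t : ℝ) (v w : Fin M.N → ℝ) : M.stiffForm t v w
    = ∑ K ∈ M.tri, refArea * M.dArea t K * ⟪M.gradK t K v, M.gradK t K w⟫ := by
  simp [stiffForm, LinearMap.sum_apply]

theorem stiffForm_symm (t : ℝ) (v w : Fin M.N → ℝ) : M.stiffForm t v w = M.stiffForm t w v := by
  simp only [stiffForm_apply, real_inner_comm]

theorem dArea_nonneg (t : ℝ) (K : Finset (Fin M.N)) : 0 ≤ M.dArea t K :=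
  div_nonneg measureReal_nonneg refArea_pos.le

theorem stiffForm_self (t : ℝ) (v : Fin M.N → ℝ) : M.stiffForm t v v
    = ∑ K ∈ M.tri, refArea * M.dArea t K * ‖M.gradK t K v‖ ^ 2 := by
  simp only [stiffForm_apply, real_inner_self_eq_norm_sq]

theorem stiffForm_nonneg (t : ℝ) (v : Fin M.N → ℝ) : 0 ≤ M.stiffForm t v v := by
  rw [stiffForm_self]
  exact Finset.sum_nonneg fun K _ =>
    mul_nonneg (mul_nonneg refArea_pos.le (dArea_nonneg t K)) (sq_nonneg _)

namespace IsProper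
variable {t : ℝ} (hM : M.IsProper t)
include hM

theorem elemGrad_eq_gradK {K : Finset (Fin M.N)} (hK : K ∈ M.tri) (v : Fin M.N → ℝ) :
    elemGrad (M.elem t K) (M.interp t v) = M.gradK t K v := by
  have h : ∃ i j k, M.IsTri K i j k := exists_isTri' hK
  rw [hM.elemGrad_interp h.choose_spec.choose_spec.choose_spec, gradK, dif_pos h]
  rfl

/-- The ordering of vertices chosen in `gradK` is immaterial: every ordering yields the elementwise
gradient of the same interpolant. -/
theorem gradK_eq {K : Finset (Fin M.N)} {i j k : Fin M.N} (h : M.IsTri K i j k)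
    (v : Fin M.N → ℝ) :
    M.gradK t K v = gvec (M.ed t i j) (M.ed t i k) (v j - v i) (v k - v i) := by
  rw [← hM.elemGrad_eq_gradK h.mem, hM.elemGrad_interp h]

theorem stiffness_eq {η ζ : E3 → ℝ} (hη : η ∈ M.space t) (hζ : ζ ∈ M.space t) :
    M.stiffness t η ζ
      = M.stiffForm t (fun i => η (M.node i t)) (fun i => ζ (M.node i t)) := by
  rw [stiffForm_apply, stiffness]
  refine Finset.sum_congr rfl fun K hK => ?_
  conv_lhs => rw [hM.eq_interp_of_mem_space hη, hM.eq_interp_of_mem_space hζ]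
  rw [hM.elemGrad_eq_gradK hK, hM.elemGrad_eq_gradK hK, setIntegral_const,
    surfaceMeasure_elem, smul_eq_mul]

theorem gradNormSq_eq {η : E3 → ℝ} (hη : η ∈ M.space t) :
    M.gradNormSq t η
      = M.stiffForm t (fun i => η (M.node i t)) (fun i => η (M.node i t)) := by
  rw [← hM.stiffness_eq hη hη]
  simp only [gradNormSq, stiffness, real_inner_self_eq_norm_sq]

theorem transfer_node (s : ℝ) (φ : E3 → ℝ) (i : Fin M.N) :
    M.transfer s t φ (M.node i t) = φ (M.node i s) := hM.interp_node _ i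

theorem energyReg_eq (ε θ δ : ℝ) {η : E3 → ℝ} (hη : η ∈ M.space t) :
    M.energyReg ε θ δ t η
      = ε / 2 * M.stiffForm t (fun i => η (M.node i t)) (fun i => η (M.node i t))
        + 1 / ε * ∑ i, M.mass t i * potentialReg θ δ (η (M.node i t)) := by
  rw [energyReg, hM.gradNormSq_eq hη]
  congr 2
  exact hM.integral_surf_interp _

end IsProper

/-! ### The scheme in terms of nodal values -/

/-- Finite element functions correspond bijectively to nodal vectors, so the variational step is an
algebraic system in the masses and the stiffness form. The transfer of a test function between times
keeps its nodal vector, which is why the old solution enters with the old masses only. -/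
theorem isStep_iff {s t : ℝ} (hs : M.IsProper s) (ht : M.IsProper t) {ε θ δ τ : ℝ}
    {P U W : E3 → ℝ} (hU : U ∈ M.space t) (hW : W ∈ M.space t) :
    M.IsStep ε θ δ τ s t P U W ↔
      (∀ φ, 1 / τ * (wsum (M.mass t) (fun i => U (M.node i t)) φ
        - ∑ i, M.mass s i * P (M.node i s) * φ i)
        + M.stiffForm t (fun i => W (M.node i t)) φ = 0) ∧
      ∀ φ, wsum (M.mass t) (fun i => W (M.node i t)) φ
        = ε * M.stiffForm t (fun i => U (M.node i t)) φ
          + θ / (2 * ε) * wsum (M.mass t) (fun i => flogReg δ (U (M.node i t))) φ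
          - 1 / ε * wsum (M.mass t) (fun i => U (M.node i t)) φ := by
  have hP : ∀ v : Fin M.N → ℝ, wsum (M.mass s) (fun i => P (M.node i s)) v
      = ∑ i, M.mass s i * P (M.node i s) * v i := fun v =>
    Finset.sum_congr rfl fun i _ => by ring
  have key : ∀ φ ∈ M.space t, ((1 / τ * (M.lumpedMass t U φ
      - M.lumpedMass s P (M.transfer t s φ)) + M.stiffness t W φ = 0) ↔
      1 / τ * (wsum (M.mass t) (fun i => U (M.node i t)) (fun i => φ (M.node i t))
        - ∑ i, M.mass s i * P (M.node i s) * φ (M.node i t))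
        + M.stiffForm t (fun i => W (M.node i t)) (fun i => φ (M.node i t)) = 0) := by
    intro φ hφ
    rw [ht.lumpedMass_eq, hs.lumpedMass_eq, ht.stiffness_eq hW hφ]
    simp only [hs.transfer_node]
    rw [hP]
  have key2 : ∀ φ ∈ M.space t, ((M.lumpedMass t W φ = ε * M.stiffness t U φ
      + θ / (2 * ε) * M.lumpedMass t (M.lagrange t (fun y => flogReg δ (U y))) φ
      - 1 / ε * M.lumpedMass t U φ) ↔
      wsum (M.mass t) (fun i => W (M.node i t)) (fun i => φ (M.node i t))
        = ε * M.stiffForm t (fun i => U (M.node i t)) (fun i => φ (M.node i t))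
          + θ / (2 * ε) * wsum (M.mass t) (fun i => flogReg δ (U (M.node i t)))
            (fun i => φ (M.node i t))
          - 1 / ε * wsum (M.mass t) (fun i => U (M.node i t)) (fun i => φ (M.node i t))) := by
    intro φ hφ
    have hl : ∀ i, M.lagrange t (fun y => flogReg δ (U y)) (M.node i t)
        = flogReg δ (U (M.node i t)) := fun i => ht.interp_node _ i
    rw [ht.lumpedMass_eq, ht.lumpedMass_eq, ht.lumpedMass_eq, ht.stiffness_eq hU hφ]
    simp only [hl]
  constructor
  · rintro ⟨-, -, h1, h2⟩
    refine ⟨fun v => ?_, fun v => ?_⟩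
    · have := (key _ (ht.interp_mem_space v)).1 (h1 _ (ht.interp_mem_space v))
      simpa only [ht.interp_node] using this
    · have := (key2 _ (ht.interp_mem_space v)).1 (h2 _ (ht.interp_mem_space v))
      simpa only [ht.interp_node] using this
  · rintro ⟨h1, h2⟩
    exact ⟨hU, hW, fun φ hφ => (key φ hφ).2 (h1 _), fun φ hφ => (key2 φ hφ).2 (h2 _)⟩

end EvolvingTriangulation

/-! ### Geometric consequences of mesh regularity. -/

theorem cr_cr_right_norm (e₁ e₂ : E3) : ‖cr (cr e₁ e₂) e₁‖ = ‖cr e₁ e₂‖ * ‖e₁‖ := by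
  refine (sq_eq_sq₀ (norm_nonneg _) (by positivity)).1 ?_
  rw [norm_cr_sq, inner_cr_left]; ring

theorem finrank_span_pair_le_one {e₁ e₂ : E3} (h : cr e₁ e₂ = 0) :
    Module.finrank ℝ (Submodule.span ℝ {e₁, e₂}) ≤ 1 := by
  have hle : ∃ v, Submodule.span ℝ {e₁, e₂} ≤ Submodule.span ℝ {v} := by
    rcases eq_or_ne e₁ 0 with h1 | h1
    · exact ⟨e₂, Submodule.span_le.2 (by
        rintro x (rfl | rfl)
        · rw [h1]; exact zero_mem _
        · exact Submodule.mem_span_singleton_self _)⟩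
    · refine ⟨e₁, Submodule.span_le.2 ?_⟩
      rintro x (rfl | rfl)
      · exact Submodule.mem_span_singleton_self _
      · have h2 := cr_cr_left e₁ x e₁
        rw [h, show cr 0 e₁ = 0 by simpa using cr_smul_left 0 (0 : E3) e₁] at h2
        have hn : ⟪e₁, e₁⟫ ≠ 0 := by simpa using h1
        have : x = (⟪e₁, e₁⟫⁻¹ * ⟪x, e₁⟫) • e₁ := by
          rw [mul_smul, ← sub_eq_zero.1 h2.symm, smul_smul, inv_mul_cancel₀ hn, one_smul]
        rw [this]
        exact Submodule.smul_mem _ _ (Submodule.mem_span_singleton_self _)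
  obtain ⟨v, hv⟩ := hle
  exact (Submodule.finrank_mono hv).trans
    ((finrank_span_le_card ({v} : Set E3)).trans (by simp))

namespace EvolvingTriangulation

variable {T : ℝ} {S : EvolvingSurface T} {M : EvolvingTriangulation S}

theorem node_continuousOn (i : Fin M.N) : ContinuousOn (M.node i) (Icc 0 T) := fun t ht =>
  (M.node_deriv i t ht).continuousWithinAt

theorem bddAbove_diam : BddAbove {d | ∃ t ∈ Icc 0 T, ∃ K ∈ M.tri, d = diam (M.elem t K)} := by
  have hb : ∀ i, ∃ C, ∀ t ∈ Icc 0 T, ‖M.node i t‖ ≤ C := fun i =>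
    isCompact_Icc.exists_bound_of_continuousOn (node_continuousOn i)
  choose C hC using hb
  refine ⟨diam (closedBall (0 : E3) (∑ i, |C i|)), ?_⟩
  rintro _ ⟨t, ht, K, -, rfl⟩
  refine diam_mono ?_ isBounded_closedBall
  refine convexHull_min ?_ (convex_closedBall _ _)
  rintro _ ⟨i, -, rfl⟩
  rw [mem_closedBall_zero_iff]
  exact (hC i t ht).trans ((le_abs_self _).trans
    (Finset.single_le_sum (f := fun i => |C i|) (fun i _ => abs_nonneg _) (Finset.mem_univ i)))

theorem diam_elem_le {t : ℝ} (ht : t ∈ Icc 0 T) {K : Finset (Fin M.N)} (hK : K ∈ M.tri) :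
    diam (M.elem t K) ≤ M.h := le_csSup bddAbove_diam ⟨t, ht, K, hK, rfl⟩

theorem dist_le_h {t : ℝ} (ht : t ∈ Icc 0 T) {K : Finset (Fin M.N)} (hK : K ∈ M.tri) {x y : E3}
    (hx : x ∈ M.elem t K) (hy : y ∈ M.elem t K) : dist x y ≤ M.h :=
  (dist_le_diam_of_mem (isCompact_elem hK t).isBounded hx hy).trans (diam_elem_le ht hK)

theorem norm_ed_le {t : ℝ} (ht : t ∈ Icc 0 T) {K : Finset (Fin M.N)} (hK : K ∈ M.tri)
    {i j : Fin M.N} (hi : i ∈ K) (hj : j ∈ K) : ‖M.ed t i j‖ ≤ M.h := by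
  rw [ed, ← dist_eq_norm]
  exact dist_le_h ht hK (node_mem_elem hj) (node_mem_elem hi)

theorem elem_mono {t : ℝ} {K L : Finset (Fin M.N)} (h : K ⊆ L) : M.elem t K ⊆ M.elem t L :=
  convexHull_mono (image_mono (by exact_mod_cast h))

/-- The triangle lies in a strip bounded by the line through one edge and its parallel through the
opposite vertex. The width of the strip is the height, and the diameter of an inscribed disc
perpendicular to the edge must fit in it. -/
theorem inDiameter_le {t : ℝ} {K : Finset (Fin M.N)} {i j k : Fin M.N} (h : M.IsTri K i j k) :
    inDiameter (M.elem t K) ≤ ‖cr (M.ed t i j) (M.ed t i k)‖ / ‖M.ed t i j‖ := by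
  refine Real.sSup_le ?_ (by positivity)
  rintro _ ⟨hfr, c, hc, r, hr, rfl, hsub⟩
  rw [IsProper.vectorSpan_elem_le h] at hfr
  set e₁ := M.ed t i j with he₁
  set e₂ := M.ed t i k with he₂
  have hcr : cr e₁ e₂ ≠ 0 := fun h0 => by
    have := finrank_span_pair_le_one h0
    omega
  have he1 : e₁ ≠ 0 := by
    rintro h0
    apply hcr
    rw [h0]
    simpa using cr_smul_left 0 (0 : E3) e₂
  have hX : 0 < ‖cr e₁ e₂‖ := norm_pos_iff.2 hcr
  have hE : 0 < ‖e₁‖ := norm_pos_iff.2 he1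
  set ν := (‖cr e₁ e₂‖ * ‖e₁‖)⁻¹ • cr (cr e₁ e₂) e₁ with hν
  have hν1 : ‖ν‖ = 1 := by
    rw [hν, norm_smul, cr_cr_right_norm, norm_inv, norm_mul, norm_norm, norm_norm]
    exact inv_mul_cancel₀ (by positivity)
  have hνs : ν ∈ vectorSpan ℝ (M.elem t K) := by
    rw [IsProper.vectorSpan_elem_le h, hν, cr_cr_left]
    refine Submodule.smul_mem _ _ (Submodule.sub_mem _ ?_ ?_) <;>
      exact Submodule.smul_mem _ _ (Submodule.subset_span (by simp [he₁, he₂]))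
  have hνe : ⟪ν, e₁⟫ = 0 := by rw [hν, inner_smul_left, inner_cr_right, mul_zero]
  have hνe2 : ⟪ν, e₂⟫ = ‖cr e₁ e₂‖ / ‖e₁‖ := by
    rw [hν, inner_smul_left, conj_trivial]
    have : ⟪cr (cr e₁ e₂) e₁, e₂⟫ = ‖cr e₁ e₂‖ ^ 2 := by
      rw [norm3_sq, inner3]; simp; ring
    rw [this]; field_simp
  have hmem : ∀ a : ℝ, |a| ≤ r → c + a • ν ∈ M.elem t K := by
    intro a ha
    refine hsub ⟨?_, ?_⟩
    · rw [mem_closedBall, dist_eq_norm, add_sub_cancel_left, norm_smul, hν1, mul_one]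
      exact ha
    · rw [add_comm]
      exact AffineSubspace.vadd_mem_of_mem_direction
        (by rw [direction_affineSpan]; exact Submodule.smul_mem _ _ hνs) (mem_affineSpan ℝ hc)
  have hin : ∀ x ∈ M.elem t K, 0 ≤ ⟪ν, x - M.node i t⟫ ∧
      ⟪ν, x - M.node i t⟫ ≤ ‖cr e₁ e₂‖ / ‖e₁‖ := by
    intro x hx
    rw [h.elem_eq] at hx
    obtain ⟨s, hs, rfl⟩ := hx
    rw [planeMap_apply, add_sub_cancel_left, inner_add_right, inner_smul_right, inner_smul_right,
      hνe, hνe2]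
    obtain ⟨h0, h1, h2⟩ := hs
    have : 0 ≤ ‖cr e₁ e₂‖ / ‖e₁‖ := by positivity
    constructor
    · simp only [mul_zero, zero_add]; positivity
    · nlinarith
  have h1 := (hin _ (hmem r (by rw [abs_of_nonneg hr]))).2
  have h2 := (hin _ (hmem (-r) (by rw [abs_neg, abs_of_nonneg hr]))).1
  have e1 : c + r • ν - M.node i t = (c + -r • ν - M.node i t) + (2 * r) • ν := by module
  rw [e1, inner_add_right, inner_smul_right, real_inner_self_eq_norm_sq, hν1] at h1
  linarith

namespace IsRegular

variable {ρ : ℝ} (hR : M.IsRegular ρ)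
include hR

/-- Conformity of the flat triangles is postulated at time zero only. Later it is pulled back from
the conforming lifted subdivision through injectivity of the projection on each triangle. -/
theorem conforming {t : ℝ} (ht : t ∈ Icc 0 T) {K : Finset (Fin M.N)} (hK : K ∈ M.tri)
    {L : Finset (Fin M.N)} (hL : L ∈ M.tri) :
    M.elem t K ∩ M.elem t L = M.elem t (K ∩ L) := by
  obtain ⟨hinj, -, hint⟩ := hR.exact t ht
  refine Subset.antisymm ?_ (subset_inter (elem_mono Finset.inter_subset_left)
    (elem_mono Finset.inter_subset_right))
  rintro x ⟨hxK, hxL⟩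
  have : normalProj (S.surf t) x ∈ normalProj (S.surf t) '' M.elem t (K ∩ L) := by
    rw [← hint K hK L hL]
    exact ⟨mem_image_of_mem _ hxK, mem_image_of_mem _ hxL⟩
  obtain ⟨z, hz, hzx⟩ := this
  rwa [← hinj K hK (elem_mono Finset.inter_subset_left hz) hxK hzx]

theorem tri_nonempty (hT : 0 ≤ T) : M.tri.Nonempty := by
  obtain ⟨-, hun, -⟩ := hR.exact 0 ⟨le_rfl, hT⟩
  obtain ⟨x, hx⟩ := S.isClosedC2Surface.isConnected.nonempty
  have : S.flow x 0 ∈ S.surf 0 := ⟨x, hx, rfl⟩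
  rw [← hun] at this
  obtain ⟨K, hK, -⟩ := mem_iUnion₂.1 this
  exact ⟨K, hK⟩

theorem h_pos (hT : 0 ≤ T) : 0 < M.h := by
  obtain ⟨K, hK⟩ := hR.tri_nonempty hT
  obtain ⟨i, j, k, h⟩ := exists_isTri' hK
  refine lt_of_lt_of_le ?_ (norm_ed_le (t := 0) ⟨le_rfl, hT⟩ hK h.mem_i h.mem_j)
  rw [norm_pos_iff, ed, sub_ne_zero]
  intro he
  have := (M.nondegenerate K hK).injective (a₁ := ⟨j, h.mem_j⟩) (a₂ := ⟨i, h.mem_i⟩) he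
  exact h.ij (Subtype.mk.inj this).symm

theorem shape_div {t : ℝ} (ht : t ∈ Icc 0 T) {K : Finset (Fin M.N)}
    {i j k : Fin M.N} (h : M.IsTri K i j k) :
    ρ * M.h ≤ ‖cr (M.ed t i j) (M.ed t i k)‖ / ‖M.ed t i j‖ :=
  (hR.quasiUniform t ht K h.mem).trans (inDiameter_le h)

theorem nondeg (hT : 0 ≤ T) (hρ : 0 < ρ) {t : ℝ} (ht : t ∈ Icc 0 T) {K : Finset (Fin M.N)}
    {i j k : Fin M.N} (h : M.IsTri K i j k) : cr (M.ed t i j) (M.ed t i k) ≠ 0 := by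
  intro h0
  have := hR.shape_div ht h
  rw [h0, norm_zero, zero_div] at this
  exact absurd (mul_pos hρ (hR.h_pos hT)) (not_lt.2 this)

theorem isProper (hT : 0 ≤ T) (hρ : 0 < ρ) {t : ℝ} (ht : t ∈ Icc 0 T) : M.IsProper t :=
  ⟨fun _ hK _ hL => hR.conforming ht hK hL, fun _ _ _ _ h => hR.nondeg hT hρ ht h⟩

theorem shape (hT : 0 ≤ T) (hρ : 0 < ρ) {t : ℝ} (ht : t ∈ Icc 0 T) {K : Finset (Fin M.N)}
    {i j k : Fin M.N} (h : M.IsTri K i j k) :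
    ρ * M.h * ‖M.ed t i j‖ ≤ ‖cr (M.ed t i j) (M.ed t i k)‖ := by
  have h1 := hR.shape_div ht h
  have hne : 0 < ‖M.ed t i j‖ := by
    rw [norm_pos_iff]
    intro h0
    apply hR.nondeg hT hρ ht h
    rw [h0]
    simpa using cr_smul_left 0 (0 : E3) _
  rwa [le_div_iff₀ hne] at h1

/-- The height bound relative to the edge `ik` says `ρ h ‖ik‖ ≤ ‖ij × ik‖ ≤ ‖ij‖ ‖ik‖`; one divides
by `‖ik‖`. -/
theorem le_norm_ed (hT : 0 ≤ T) (hρ : 0 < ρ) {t : ℝ} (ht : t ∈ Icc 0 T) {K : Finset (Fin M.N)}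
    {i j k : Fin M.N} (h : M.IsTri K i j k) : ρ * M.h ≤ ‖M.ed t i j‖ := by
  have h1 := hR.shape hT hρ ht h.swap
  rw [cr_swap, norm_neg] at h1
  have h2 := h1.trans (norm_cr_le _ _)
  have hne : 0 < ‖M.ed t i k‖ := by
    rw [norm_pos_iff]
    intro h0
    apply hR.nondeg hT hρ ht h.swap
    rw [h0]
    simpa using cr_smul_left 0 (0 : E3) _
  exact le_of_mul_le_mul_right h2 hne

theorem shape_sq (hT : 0 ≤ T) (hρ : 0 < ρ) {t : ℝ} (ht : t ∈ Icc 0 T) {K : Finset (Fin M.N)}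
    {i j k : Fin M.N} (h : M.IsTri K i j k) :
    (ρ * M.h) ^ 2 ≤ ‖cr (M.ed t i j) (M.ed t i k)‖ := by
  have h1 := hR.shape hT hρ ht h
  have h2 := hR.le_norm_ed hT hρ ht h
  have h3 : 0 ≤ ρ * M.h := (mul_pos hρ (hR.h_pos hT)).le
  nlinarith

theorem rho_le_one (hT : 0 ≤ T) (hρ : 0 < ρ) : ρ ≤ 1 := by
  obtain ⟨K, hK⟩ := hR.tri_nonempty hT
  obtain ⟨i, j, k, h⟩ := exists_isTri' hK
  have h0 : (0 : ℝ) ∈ Icc 0 T := ⟨le_rfl, hT⟩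
  have h1 := (hR.le_norm_ed hT hρ h0 h).trans (norm_ed_le h0 hK h.mem_i h.mem_j)
  have := hR.h_pos hT
  nlinarith

end IsRegular

end EvolvingTriangulation

/-! ### Bounds on the velocity and on its trajectories -/

theorem IsC1C2.exists_bound {T : ℝ} {V : ℝ → E3 → E3} (hV : IsC1C2 T V) (R : ℝ) :
    ∃ L, 1 ≤ L ∧ ∀ t ∈ Icc 0 T, Differentiable ℝ (V t) ∧
      (∀ x ∈ closedBall (0 : E3) R, ‖fderiv ℝ (V t) x‖ ≤ L) ∧
      ∀ x ∈ closedBall (0 : E3) R, ∀ y ∈ closedBall (0 : E3) R,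
        ‖fderiv ℝ (V t) x - fderiv ℝ (V t) y‖ ≤ L * ‖x - y‖ := by
  obtain ⟨W, hVW, hk⟩ := hV
  have hc : IsCompact (Icc 0 T ×ˢ closedBall (0 : E3) R) :=
    isCompact_Icc.prod (isCompact_closedBall _ _)
  have hsub : Icc 0 T ×ˢ closedBall (0 : E3) R ⊆ Icc 0 T ×ˢ univ :=
    prod_mono_right (subset_univ _)
  obtain ⟨C₁, h1⟩ := hc.exists_bound_of_continuousOn ((hk 1 (by norm_num)).1.mono hsub)
  obtain ⟨C₂, h2⟩ := hc.exists_bound_of_continuousOn ((hk 2 le_rfl).1.mono hsub)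
  refine ⟨max 1 (max C₁ C₂), le_max_left _ _, fun t ht => ?_⟩
  have hC2 := (hVW t ht).1
  have hd : Differentiable ℝ (fderiv ℝ (V t)) :=
    (hC2.fderiv_right (m := 1) (by norm_num)).differentiable (by norm_num)
  refine ⟨hC2.differentiable (by norm_num), fun x hx => ?_, fun x hx y hy => ?_⟩
  · have := h1 (t, x) ⟨ht, hx⟩
    rw [norm_iteratedFDeriv_one] at this
    exact this.trans ((le_max_left _ _).trans (le_max_right _ _))
  · refine (convex_closedBall (0 : E3) R).norm_image_sub_le_of_norm_fderiv_le
      (fun z _ => hd z) (fun z hz => ?_) hy hx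
    have := h2 (t, z) ⟨ht, hz⟩
    rw [← norm_iteratedFDeriv_fderiv (n := 1), norm_iteratedFDeriv_one] at this
    exact this.trans ((le_max_right _ _).trans (le_max_right _ _))

theorem norm_sub_le_of_fderiv_bound {f : E3 → E3} {R L : ℝ} (hf : Differentiable ℝ f)
    (h : ∀ x ∈ closedBall (0 : E3) R, ‖fderiv ℝ f x‖ ≤ L) {x y : E3}
    (hx : x ∈ closedBall (0 : E3) R) (hy : y ∈ closedBall (0 : E3) R) :
    ‖f y - f x‖ ≤ L * ‖y - x‖ :=
  (convex_closedBall (0 : E3) R).norm_image_sub_le_of_norm_fderiv_le (fun z _ => hf z) h hx hy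

/-- On the part of `s` within distance `‖y - x‖` of `x` the derivative deviates from that at `x` by
at most `L‖y - x‖`, so the mean value inequality applies there with this constant. -/
theorem norm_taylor_le {F : Type*} [NormedAddCommGroup F] [NormedSpace ℝ F] {f : E3 → F} {s : Set E3} (hs : Convex ℝ s) {L : ℝ} (hL : 0 ≤ L)
    (hf : ∀ x ∈ s, DifferentiableAt ℝ f x) {x y : E3}
    (h : ∀ z ∈ s, ‖fderiv ℝ f z - fderiv ℝ f x‖ ≤ L * ‖z - x‖)
    (hx : x ∈ s) (hy : y ∈ s) :
    ‖f y - f x - fderiv ℝ f x (y - x)‖ ≤ L * ‖y - x‖ ^ 2 := by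
  have := (hs.inter (convex_closedBall x ‖y - x‖)).norm_image_sub_le_of_norm_fderiv_le' (f := f)
    (φ := fderiv ℝ f x) (C := L * ‖y - x‖) (fun z hz => hf z hz.1)
    (fun z hz => (h z hz.1).trans (mul_le_mul_of_nonneg_left (by
      rw [← dist_eq_norm]; exact hz.2) hL))
    ⟨hx, mem_closedBall_self (norm_nonneg _)⟩ ⟨hy, by rw [mem_closedBall, dist_eq_norm]⟩
  calc _ ≤ _ := this
    _ = _ := by ring

theorem HasDerivWithinAt.Icc_to_Ici {F : Type*} [NormedAddCommGroup F] [NormedSpace ℝ F] {T t : ℝ}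
    {x : ℝ → F} {x' : F} (h : HasDerivWithinAt x x' (Icc 0 T) t) (ht : t ∈ Ico 0 T) :
    HasDerivWithinAt x x' (Ici t) t := by
  exact h.mono_of_mem_nhdsWithin (Icc_mem_nhdsGE_of_mem ht)

/-- `x` is a trajectory of the velocity field. -/
def EvolvingSurface.IsTraj {T : ℝ} (S : EvolvingSurface T) (x : ℝ → E3) : Prop :=
  x 0 ∈ S.Γ₀ ∧ ∀ t ∈ Icc 0 T, HasDerivWithinAt x (S.V t (x t)) (Icc 0 T) t

/-- The nodes are given only as solutions of the differential equation, and the velocity is only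
locally Lipschitz. Near each point of `Γ₀` a solution is compared with the flow line through that
point: as long as it is within distance one, the local Lipschitz constant applies and keeps it
there. Compactness of `Γ₀` makes the radius uniform. -/
theorem EvolvingSurface.exists_traj_bound {T : ℝ} (S : EvolvingSurface T) :
    ∃ R, ∀ y, S.IsTraj y → ∀ t ∈ Icc 0 T, y t ∈ closedBall (0 : E3) R := by
  suffices h : ∃ R, ∀ y, S.IsTraj y → y 0 ∈ S.Γ₀ → ∀ t ∈ Icc 0 T, y t ∈ closedBall (0 : E3) R by
    obtain ⟨R, hR⟩ := h
    exact ⟨R, fun y hy => hR y hy hy.1⟩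
  refine S.isClosedC2Surface.isCompact.induction_on
    (p := fun s => ∃ R, ∀ y, S.IsTraj y → y 0 ∈ s → ∀ t ∈ Icc 0 T, y t ∈ closedBall (0 : E3) R)
    ⟨0, fun y _ h => absurd h (notMem_empty _)⟩ ?_ ?_ ?_
  · rintro s t hst ⟨R, hR⟩
    exact ⟨R, fun y hy h => hR y hy (hst h)⟩
  · rintro s t ⟨R, hR⟩ ⟨R', hR'⟩
    refine ⟨max R R', fun y hy h u hu => ?_⟩
    rcases h with h | h
    · exact closedBall_subset_closedBall (le_max_left _ _) (hR y hy h u hu)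
    · exact closedBall_subset_closedBall (le_max_right _ _) (hR' y hy h u hu)
  · intro x hx
    have hfc : ContinuousOn (S.flow x) (Icc 0 T) := fun t ht =>
      (S.flow_deriv x hx t ht).continuousWithinAt
    obtain ⟨R, hR⟩ := isCompact_Icc.exists_bound_of_continuousOn hfc
    obtain ⟨L, hL1, hL⟩ := S.isC1C2.exists_bound (R + 1)
    -- Starting within `η` of the flow line, exponential growth at rate `L + 1` reaches distance at
    -- most one by time `T`. The rate exceeds `L` because the comparison principle below needs a
    -- strict derivative inequality.
    set η : ℝ := Real.exp (-((L + 1) * T)) with hη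
    have hηpos : 0 < η := Real.exp_pos _
    refine ⟨ball x η, mem_nhdsWithin_of_mem_nhds (ball_mem_nhds x hηpos), R + 1,
      fun y hy hy0 => ?_⟩
    have hB1 : ∀ t ∈ Icc 0 T, η * Real.exp ((L + 1) * t) ≤ 1 := by
      intro t ht
      rw [hη, ← Real.exp_add, Real.exp_le_one_iff]
      nlinarith [ht.2]
    have key : ∀ ⦃t⦄, t ∈ Icc 0 T → ‖y t - S.flow x t‖ ≤ η * Real.exp ((L + 1) * t) := by
      refine image_norm_le_of_norm_deriv_right_lt_deriv_boundary' (f := fun t => y t - S.flow x t)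
        (f' := fun t => S.V t (y t) - S.V t (S.flow x t))
        (B' := fun t => (L + 1) * (η * Real.exp ((L + 1) * t))) ?_ ?_ ?_ ?_ ?_ ?_
      · exact ContinuousOn.sub (fun t ht => (hy.2 t ht).continuousWithinAt) hfc
      · intro t ht
        exact ((hy.2 t (Ico_subset_Icc_self ht)).Icc_to_Ici ht).sub
          ((S.flow_deriv x hx t (Ico_subset_Icc_self ht)).Icc_to_Ici ht)
      · simp only [S.flow_zero x hx, mul_zero, Real.exp_zero, mul_one]
        rw [mem_ball, dist_eq_norm] at hy0
        exact hy0.le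
      · fun_prop
      · intro t _
        have h1 : HasDerivAt (fun t : ℝ => (L + 1) * t) (L + 1) t := by
          simpa using (hasDerivAt_id t).const_mul (L + 1)
        have h2 := (h1.exp.const_mul η).hasDerivWithinAt (s := Ici t)
        have h3 : (L + 1) * (η * Real.exp ((L + 1) * t)) = η * (Real.exp ((L + 1) * t) * (L + 1)) := by
          ring
        change HasDerivWithinAt _ ((L + 1) * (η * Real.exp ((L + 1) * t))) _ _
        rw [h3]
        exact h2
      · intro t ht heq
        have ht' := Ico_subset_Icc_self ht
        have hxt : ‖S.flow x t‖ ≤ R := hR t ht'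
        have hyt : ‖y t‖ ≤ R + 1 := by
          have : y t = S.flow x t + (y t - S.flow x t) := by abel
          rw [this]
          exact (norm_add_le _ _).trans (add_le_add hxt (heq.le.trans (hB1 t ht')))
        have := norm_sub_le_of_fderiv_bound (hL t ht').1 (hL t ht').2.1
          (x := S.flow x t) (y := y t) (by simpa using hxt.trans (by linarith)) (by simpa using hyt)
        refine this.trans_lt ?_
        rw [heq]
        have : 0 < η * Real.exp ((L + 1) * t) := by positivity
        nlinarith
    intro t ht
    rw [mem_closedBall_zero_iff]
    have : y t = S.flow x t + (y t - S.flow x t) := by abel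
    rw [this]
    exact (norm_add_le _ _).trans (add_le_add (hR t ht) ((key ht).trans (hB1 t ht)))

/-- Uniform bounds, along the trajectories, on the velocity and its derivative. -/
structure EvolvingSurface.VelBound {T : ℝ} (S : EvolvingSurface T) (L : ℝ) : Prop where
  one_le : 1 ≤ L
  norm_fderiv : ∀ x, S.IsTraj x → ∀ t ∈ Icc 0 T, ‖fderiv ℝ (S.V t) (x t)‖ ≤ L
  lip : ∀ x y, S.IsTraj x → S.IsTraj y → ∀ t ∈ Icc 0 T,
    ‖S.V t (y t) - S.V t (x t)‖ ≤ L * ‖y t - x t‖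
  taylor : ∀ x y, S.IsTraj x → S.IsTraj y → ∀ t ∈ Icc 0 T,
    ‖S.V t (y t) - S.V t (x t) - fderiv ℝ (S.V t) (x t) (y t - x t)‖ ≤ L * ‖y t - x t‖ ^ 2

theorem EvolvingSurface.exists_velBound {T : ℝ} (S : EvolvingSurface T) :
    ∃ L, S.VelBound L := by
  obtain ⟨R, hR⟩ := S.exists_traj_bound
  obtain ⟨L, hL1, hL⟩ := S.isC1C2.exists_bound R
  refine ⟨L, hL1, fun x hx t ht => (hL t ht).2.1 _ (hR x hx t ht), fun x y hx hy t ht => ?_,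
    fun x y hx hy t ht => ?_⟩
  · exact norm_sub_le_of_fderiv_bound (hL t ht).1 (hL t ht).2.1 (hR x hx t ht) (hR y hy t ht)
  · exact norm_taylor_le (convex_closedBall (0 : E3) R) (by linarith)
      (fun z _ => (hL t ht).1 z)
      (fun z hz => (hL t ht).2.2 z hz _ (hR x hx t ht)) (hR x hx t ht) (hR y hy t ht)

theorem EvolvingTriangulation.isTraj_node {T : ℝ} {S : EvolvingSurface T}
    (M : EvolvingTriangulation S) (i : Fin M.N) : S.IsTraj (M.node i) :=
  ⟨M.node_mem i, M.node_deriv i⟩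

/-- Gronwall's inequality in a simplified form: `K ≥ 1` absorbs the quotient `ε / K`, and the final
time replaces the running time. -/
theorem norm_le_of_norm_deriv_le {F : Type*} [NormedAddCommGroup F] [NormedSpace ℝ F] {T : ℝ}
    {f f' : ℝ → F} {δ K ε : ℝ} (hK : 1 ≤ K) (hδ : 0 ≤ δ) (hε : 0 ≤ ε)
    (hf : ∀ t ∈ Icc 0 T, HasDerivWithinAt f (f' t) (Icc 0 T) t) (h0 : ‖f 0‖ ≤ δ)
    (hb : ∀ t ∈ Icc 0 T, ‖f' t‖ ≤ K * ‖f t‖ + ε) {t : ℝ} (ht : t ∈ Icc 0 T) :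
    ‖f t‖ ≤ (δ + ε) * Real.exp (K * T) := by
  have := norm_le_gronwallBound_of_norm_deriv_right_le (f := f) (f' := f')
    (fun t ht => (hf t ht).continuousWithinAt)
    (fun t ht => (hf t (Ico_subset_Icc_self ht)).Icc_to_Ici ht) h0
    (fun t ht => hb t (Ico_subset_Icc_self ht)) t ht
  refine this.trans ?_
  rw [gronwallBound_of_K_ne_0 (by positivity), sub_zero]
  have he : Real.exp (K * t) ≤ Real.exp (K * T) :=
    Real.exp_le_exp.2 (mul_le_mul_of_nonneg_left ht.2 (by linarith))
  have h1 : ε / K ≤ ε := div_le_self hε hK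
  have h2 : 0 ≤ ε / K := by positivity
  have h3 := Real.exp_pos (K * t)
  have h4 := Real.exp_pos (K * T)
  calc δ * Real.exp (K * t) + ε / K * (Real.exp (K * t) - 1)
      ≤ δ * Real.exp (K * T) + ε / K * Real.exp (K * T) := by
        gcongr; linarith
    _ ≤ δ * Real.exp (K * T) + ε * Real.exp (K * T) := by gcongr
    _ = _ := by ring

/-! ### Linear transport of normals and comparison of unit vectors. -/

/-- The cross product as a continuous bilinear map. -/
def crL : E3 →L[ℝ] E3 →L[ℝ] E3 :=
  (LinearMap.mk₂ ℝ cr cr_add_left cr_smul_left cr_add_right cr_smul_right).mkContinuous₂ 1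
    fun u v => by simpa using norm_cr_le u v

theorem HasDerivWithinAt.cr {u v : ℝ → E3} {u' v' : E3} {s : Set ℝ} {t : ℝ}
    (hu : HasDerivWithinAt u u' s t) (hv : HasDerivWithinAt v v' s t) :
    HasDerivWithinAt (fun t => cr (u t) (v t)) (_root_.cr u' (v t) + _root_.cr (u t) v') s t := by
  rw [add_comm]
  exact crL.hasDerivWithinAt_of_bilinear hu hv

/-- The infinitesimal cofactor map: `(tr A) X - Aᵀ X`. -/
def cof (A : E3 →L[ℝ] E3) (X : E3) : E3 :=
  (A (EuclideanSpace.single 0 1) 0 + A (EuclideanSpace.single 1 1) 1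
      + A (EuclideanSpace.single 2 1) 2) • X
    - !₂[⟪A (EuclideanSpace.single 0 1), X⟫, ⟪A (EuclideanSpace.single 1 1), X⟫,
        ⟪A (EuclideanSpace.single 2 1), X⟫]

theorem E3_apply_eq (A : E3 →L[ℝ] E3) (u : E3) : A u = u 0 • A (EuclideanSpace.single 0 1)
    + u 1 • A (EuclideanSpace.single 1 1) + u 2 • A (EuclideanSpace.single 2 1) := by
  rw [← map_smul, ← map_smul, ← map_smul, ← map_add, ← map_add]
  congr 1
  apply E3_ext <;> simp

/-- If `u' = Au` and `v' = Av`, then `u × v` obeys a linear equation whose matrix depends on `A`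
alone. Normals of different triangles at a common node can therefore be compared through one
equation. -/
theorem cr_add_cr_eq_cof (A : E3 →L[ℝ] E3) (u v : E3) :
    cr (A u) v + cr u (A v) = cof A (cr u v) := by
  rw [E3_apply_eq A u, E3_apply_eq A v]
  apply E3_ext <;> simp [cof, inner3] <;> ring

theorem cof_sub (A : E3 →L[ℝ] E3) (X Y : E3) : cof A (X - Y) = cof A X - cof A Y := by
  apply E3_ext <;> simp [cof, inner_sub_right] <;> ring

theorem cof_smul (A : E3 →L[ℝ] E3) (c : ℝ) (X : E3) : cof A (c • X) = c • cof A X := by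
  apply E3_ext <;> simp [cof, inner_smul_right] <;> ring

theorem norm_cof_le (A : E3 →L[ℝ] E3) (X : E3) : ‖cof A X‖ ≤ 5 * ‖A‖ * ‖X‖ := by
  have hA : ∀ k : Fin 3, ‖A (EuclideanSpace.single k 1)‖ ≤ ‖A‖ := fun k => by
    simpa using A.le_opNorm (EuclideanSpace.single k (1 : ℝ))
  have hc : ∀ k l : Fin 3, |A (EuclideanSpace.single k 1) l| ≤ ‖A‖ := fun k l =>
    (PiLp.norm_apply_le (A (EuclideanSpace.single k 1)) l).trans (hA k)
  have hi : ∀ k : Fin 3, ⟪A (EuclideanSpace.single k 1), X⟫ ^ 2 ≤ (‖A‖ * ‖X‖) ^ 2 := fun k => by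
    rw [← sq_abs]
    gcongr
    exact (abs_real_inner_le_norm _ _).trans (by gcongr; exact hA k)
  have h2 : ‖(!₂[⟪A (EuclideanSpace.single 0 1), X⟫, ⟪A (EuclideanSpace.single 1 1), X⟫,
        ⟪A (EuclideanSpace.single 2 1), X⟫] : E3)‖ ≤ 2 * (‖A‖ * ‖X‖) := by
    refine abs_le_of_sq_le_sq' ?_ (by positivity) |>.2
    rw [norm3_sq]
    simp only [Matrix.cons_val_zero, Matrix.cons_val_one, Matrix.cons_val]
    nlinarith [hi 0, hi 1, hi 2, sq_nonneg (‖A‖ * ‖X‖)]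
  refine (norm_sub_le _ _).trans ?_
  rw [norm_smul, Real.norm_eq_abs]
  have h1 : |A (EuclideanSpace.single 0 1) 0 + A (EuclideanSpace.single 1 1) 1
      + A (EuclideanSpace.single 2 1) 2| ≤ 3 * ‖A‖ := by
    refine (abs_add_three _ _ _).trans ?_
    linarith [hc 0 0, hc 1 1, hc 2 2]
  calc _ ≤ 3 * ‖A‖ * ‖X‖ + 2 * (‖A‖ * ‖X‖) := by gcongr
    _ = _ := by ring

theorem norm_normalize_sub_le {u v : E3} (hu : 1 ≤ ‖u‖) (hv : v ≠ 0) :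
    ‖‖u‖⁻¹ • u - ‖v‖⁻¹ • v‖ ≤ 2 * ‖u - v‖ := by
  have hu0 : 0 < ‖u‖ := by linarith
  have hv0 : 0 < ‖v‖ := norm_pos_iff.2 hv
  have e : ‖u‖⁻¹ • u - ‖v‖⁻¹ • v = ‖u‖⁻¹ • ((u - v) + ((‖v‖ - ‖u‖) * ‖v‖⁻¹) • v) := by
    rw [smul_add, smul_sub, smul_smul]
    have : ‖u‖⁻¹ * ((‖v‖ - ‖u‖) * ‖v‖⁻¹) = ‖u‖⁻¹ - ‖v‖⁻¹ := by field_simp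
    rw [this]; module
  rw [e, norm_smul, norm_inv, norm_norm]
  have h1 : ‖(u - v) + ((‖v‖ - ‖u‖) * ‖v‖⁻¹) • v‖ ≤ 2 * ‖u - v‖ := by
    refine (norm_add_le _ _).trans ?_
    rw [norm_smul, norm_mul, norm_inv, norm_norm, mul_assoc, inv_mul_cancel₀ hv0.ne', mul_one,
      Real.norm_eq_abs]
    have := abs_norm_sub_norm_le v u
    rw [norm_sub_rev] at this
    linarith
  calc ‖u‖⁻¹ * _ ≤ 1 * (2 * ‖u - v‖) := by
        gcongr
        exact inv_le_one_of_one_le₀ hu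
    _ = _ := one_mul _

/-- Two unit vectors with small cross product agree up to sign. -/
theorem exists_sign_norm_sub_le {u v : E3} (hu : ‖u‖ = 1) (hv : ‖v‖ = 1) :
    ∃ σ : ℝ, (σ = 1 ∨ σ = -1) ∧ ‖u - σ • v‖ ≤ 2 * ‖cr u v‖ := by
  have hcr := norm_cr_sq u v
  rw [hu, hv] at hcr
  have hle : |⟪u, v⟫| ≤ 1 := by simpa [hu, hv] using abs_real_inner_le_norm u v
  have hn : ∀ σ : ℝ, σ ^ 2 = 1 → σ * ⟪u, v⟫ = |⟪u, v⟫| → ‖u - σ • v‖ ≤ 2 * ‖cr u v‖ := by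
    intro σ hσ hs
    refine abs_le_of_sq_le_sq' ?_ (by positivity) |>.2
    rw [norm_sub_sq_real, inner_smul_right, norm_smul, hs, mul_pow, mul_pow, hcr, hu, hv,
      Real.norm_eq_abs, sq_abs, hσ, ← sq_abs ⟪u, v⟫]
    nlinarith [abs_nonneg ⟪u, v⟫]
  rcases le_total 0 ⟪u, v⟫ with h | h
  · exact ⟨1, Or.inl rfl, hn 1 (by norm_num) (by rw [abs_of_nonneg h, one_mul])⟩
  · exact ⟨-1, Or.inr rfl, hn (-1) (by norm_num) (by rw [abs_of_nonpos h]; ring)⟩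

/-! ### Rates of change of edges, normals and areas. -/

namespace EvolvingTriangulation

variable {T : ℝ} {S : EvolvingSurface T} (M : EvolvingTriangulation S)

/-- The time derivative of the edge vector. -/
def edV (t : ℝ) (i j : Fin M.N) : E3 := S.V t (M.node j t) - S.V t (M.node i t)

/-- The normal `(x_j - x_i) × (x_k - x_i)` of a triangle. -/
def nrm (t : ℝ) (i j k : Fin M.N) : E3 := cr (M.ed t i j) (M.ed t i k)

/-- The time derivative of `nrm`. -/
def nrmV (t : ℝ) (i j k : Fin M.N) : E3 :=
  cr (M.edV t i j) (M.ed t i k) + cr (M.ed t i j) (M.edV t i k)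

/-- The discrete divergence of the velocity on a triangle. -/
def divK (t : ℝ) (K : Finset (Fin M.N)) : ℝ := elemDiv (M.elem t K) (M.discreteVelocity t)

variable {M}

theorem hasDerivWithinAt_ed (i j : Fin M.N) {t : ℝ} (ht : t ∈ Icc 0 T) :
    HasDerivWithinAt (fun t => M.ed t i j) (M.edV t i j) (Icc 0 T) t :=
  (M.node_deriv j t ht).sub (M.node_deriv i t ht)

theorem hasDerivWithinAt_nrm (i j k : Fin M.N) {t : ℝ} (ht : t ∈ Icc 0 T) :
    HasDerivWithinAt (fun t => M.nrm t i j k) (M.nrmV t i j k) (Icc 0 T) t :=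
  (hasDerivWithinAt_ed i j ht).cr (hasDerivWithinAt_ed i k ht)

theorem interp_apply (t : ℝ) (v : Fin M.N → E3) (x : E3) (l : Fin 3) :
    M.interp t v x l = M.interp t (fun i => v i l) x := by
  unfold interp
  split_ifs with hx
  · rw [WithLp.ofLp_sum, Finset.sum_apply]
    rfl
  · rfl

/-- The right-hand side is the logarithmic derivative of the area; this is the discrete transport
identity for surface measure. -/
theorem IsProper.divK_eq {t : ℝ} (hM : M.IsProper t) {K : Finset (Fin M.N)} {i j k : Fin M.N}
    (h : M.IsTri K i j k) :
    M.divK t K = ⟪M.nrm t i j k, M.nrmV t i j k⟫ / ‖M.nrm t i j k‖ ^ 2 := by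
  have hg : ∀ l : Fin 3, elemGrad (M.elem t K) (fun y => M.discreteVelocity t y l)
      = gvec (M.ed t i j) (M.ed t i k) (M.edV t i j l) (M.edV t i k l) := by
    intro l
    rw [show (fun y => M.discreteVelocity t y l) = M.interp t fun i => S.V t (M.node i t) l from
      funext fun y => interp_apply _ _ _ _, hM.elemGrad_interp h]
    simp [edV]
  simp only [divK, elemDiv, hg, Fin.sum_univ_three, gvec, nrm, nrmV]
  rw [div_eq_inv_mul]
  simp only [PiLp.smul_apply, smul_eq_mul]
  rw [← mul_add, ← mul_add]
  congr 1
  simp [inner3]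
  ring

end EvolvingTriangulation

/-- The surface deviates from its tangent planes at most quadratically. -/
def HasQuadNormals (Γ : Set E3) (L : ℝ) : Prop :=
  ∀ x ∈ Γ, ∃ n : E3, ‖n‖ = 1 ∧ ∀ w ∈ Γ, |⟪n, w - x⟫| ≤ L * ‖w - x‖ ^ 2

theorem inner_cof_sub_le {A : E3 →L[ℝ] E3} {u v : E3} (hu : ‖u‖ = 1) (hv : ‖v‖ = 1) :
    |⟪u, cof A u⟫ - ⟪v, cof A v⟫| ≤ 10 * ‖A‖ * ‖u - v‖ := by
  have e : ⟪u, cof A u⟫ - ⟪v, cof A v⟫ = ⟪u - v, cof A u⟫ + ⟪v, cof A (u - v)⟫ := by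
    rw [cof_sub, inner_sub_left, inner_sub_right]; ring
  rw [e]
  have h1 := abs_real_inner_le_norm (u - v) (cof A u)
  have h2 := abs_real_inner_le_norm v (cof A (u - v))
  have h3 := norm_cof_le A u
  have h4 := norm_cof_le A (u - v)
  rw [hu] at h3
  rw [hv] at h2
  have h5 : ‖u - v‖ * ‖cof A u‖ ≤ ‖u - v‖ * (5 * ‖A‖ * 1) := by gcongr
  exact (abs_add_le _ _).trans (by linarith)

theorem inner_normalize_cof (A : E3 →L[ℝ] E3) {c : ℝ} (hc : c ≠ 0) (X : E3) :
    ⟪‖c • X‖⁻¹ • c • X, cof A (‖c • X‖⁻¹ • c • X)⟫ = ⟪X, cof A X⟫ / ‖X‖ ^ 2 := by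
  rw [cof_smul, cof_smul, inner_smul_left, inner_smul_right, inner_smul_left, inner_smul_right,
    norm_smul, conj_trivial, conj_trivial, Real.norm_eq_abs, mul_inv]
  have : |c|⁻¹ ^ 2 * c ^ 2 = 1 := by
    rw [inv_pow, sq_abs]; exact inv_mul_cancel₀ (pow_ne_zero 2 hc)
  rw [div_eq_inv_mul, ← inv_pow]
  calc _ = (|c|⁻¹ ^ 2 * c ^ 2) * (‖X‖⁻¹ ^ 2 * ⟪X, cof A X⟫) := by ring
    _ = _ := by rw [this, one_mul]

namespace EvolvingTriangulation

variable {T : ℝ} {S : EvolvingSurface T} {M : EvolvingTriangulation S}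

theorem nrm_eq_norm {K : Finset (Fin M.N)} {i j k : Fin M.N} (h : M.IsTri K i j k) (t : ℝ) :
    M.dArea t K = ‖M.nrm t i j k‖ := h.dArea_eq t

namespace IsRegular

variable {ρ L : ℝ} (hR : M.IsRegular ρ) (hT : 0 ≤ T) (hρ : 0 < ρ) (hV : S.VelBound L)

section
include hV

omit hR in
theorem norm_edV_le {t : ℝ} (ht : t ∈ Icc 0 T) (i j : Fin M.N) :
    ‖M.edV t i j‖ ≤ L * ‖M.ed t i j‖ :=
  hV.lip _ _ (M.isTraj_node i) (M.isTraj_node j) t ht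

omit hR in
theorem norm_edV_le_h {t : ℝ} (ht : t ∈ Icc 0 T) {K : Finset (Fin M.N)} (hK : K ∈ M.tri)
    {i j : Fin M.N} (hi : i ∈ K) (hj : j ∈ K) : ‖M.edV t i j‖ ≤ L * M.h :=
  (norm_edV_le hV ht i j).trans
    (mul_le_mul_of_nonneg_left (norm_ed_le ht hK hi hj) (by linarith [hV.one_le]))

omit hR in
theorem norm_ed_sub_le {s t : ℝ} (hs : s ∈ Icc 0 T) (ht : t ∈ Icc 0 T) (hst : s ≤ t)
    {K : Finset (Fin M.N)} (hK : K ∈ M.tri) {i j : Fin M.N} (hi : i ∈ K) (hj : j ∈ K) :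
    ‖M.ed t i j - M.ed s i j‖ ≤ L * M.h * (t - s) := by
  have := (convex_Icc (0 : ℝ) T).norm_image_sub_le_of_norm_hasDerivWithin_le
    (fun u hu => hasDerivWithinAt_ed i j hu) (fun u hu => norm_edV_le_h hV hu hK hi hj) hs ht
  rwa [Real.norm_eq_abs, abs_of_nonneg (by linarith)] at this

include hR hT in
theorem norm_nrmV_le {t : ℝ} (ht : t ∈ Icc 0 T) {K : Finset (Fin M.N)} {i j k : Fin M.N}
    (h : M.IsTri K i j k) : ‖M.nrmV t i j k‖ ≤ 2 * L * M.h ^ 2 := by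
  have hh := (hR.h_pos hT).le
  refine (norm_add_le _ _).trans ?_
  have h1 := (norm_cr_le (M.edV t i j) (M.ed t i k)).trans
    (mul_le_mul (norm_edV_le_h hV ht h.mem h.mem_i h.mem_j)
      (norm_ed_le ht h.mem h.mem_i h.mem_k) (norm_nonneg _) (by have := hV.one_le; positivity))
  have h2 := (norm_cr_le (M.ed t i j) (M.edV t i k)).trans
    (mul_le_mul (norm_ed_le ht h.mem h.mem_i h.mem_j)
      (norm_edV_le_h hV ht h.mem h.mem_i h.mem_k) (norm_nonneg _) hh)
  linarith

end

section
include hR hT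

theorem dArea_le_sq {t : ℝ} (ht : t ∈ Icc 0 T) {K : Finset (Fin M.N)} (hK : K ∈ M.tri) :
    M.dArea t K ≤ M.h ^ 2 := by
  obtain ⟨i, j, k, h⟩ := exists_isTri' hK
  rw [h.dArea_eq, sq]
  exact (norm_cr_le _ _).trans (mul_le_mul (norm_ed_le ht h.mem h.mem_i h.mem_j)
    (norm_ed_le ht h.mem h.mem_i h.mem_k) (norm_nonneg _) (hR.h_pos hT).le)

include hρ

theorem le_dArea {t : ℝ} (ht : t ∈ Icc 0 T) {K : Finset (Fin M.N)} (hK : K ∈ M.tri) :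
    (ρ * M.h) ^ 2 ≤ M.dArea t K := by
  obtain ⟨i, j, k, h⟩ := exists_isTri' hK
  rw [h.dArea_eq]
  exact hR.shape_sq hT hρ ht h

theorem hasDerivWithinAt_dArea {t : ℝ} (ht : t ∈ Icc 0 T) {K : Finset (Fin M.N)}
    (hK : K ∈ M.tri) :
    HasDerivWithinAt (fun t => M.dArea t K) (M.dArea t K * M.divK t K) (Icc 0 T) t := by
  obtain ⟨i, j, k, h⟩ := exists_isTri' hK
  have hP := hR.isProper hT hρ ht
  have hpos : ‖M.nrm t i j k‖ ≠ 0 := norm_ne_zero_iff.2 (hP.nondeg _ _ _ _ h)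
  have := ((hasDerivWithinAt_nrm i j k ht).norm_sq).sqrt (by positivity)
  simp only [Real.sqrt_sq (norm_nonneg _)] at this
  simp only [nrm_eq_norm h, hP.divK_eq h]
  convert this using 1
  field_simp

/-- The area grows at the rate area times divergence, and the divergence is nonnegative by
assumption. -/
theorem dArea_mono {s t : ℝ} (hs : s ∈ Icc 0 T) (ht : t ∈ Icc 0 T) (hst : s ≤ t)
    {K : Finset (Fin M.N)} (hK : K ∈ M.tri) : M.dArea s K ≤ M.dArea t K := by
  have := monotoneOn_of_hasDerivWithinAt_nonneg (convex_Icc (0 : ℝ) T)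
    (f := fun t => M.dArea t K) (f' := fun t => M.dArea t K * M.divK t K)
    (fun u hu => (hR.hasDerivWithinAt_dArea hT hρ hu hK).continuousWithinAt)
    (fun u hu => (hR.hasDerivWithinAt_dArea hT hρ (interior_subset hu) hK).mono interior_subset)
    (fun u hu => mul_nonneg (dArea_nonneg _ _) (hR.div_nonneg u (interior_subset hu) K hK))
  exact this hs ht hst

include hV

theorem abs_divK_le {t : ℝ} (ht : t ∈ Icc 0 T) {K : Finset (Fin M.N)} (hK : K ∈ M.tri) :
    |M.divK t K| ≤ 2 * L / ρ ^ 2 := by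
  obtain ⟨i, j, k, h⟩ := exists_isTri' hK
  have hP := hR.isProper hT hρ ht
  have hh := hR.h_pos hT
  have hX : (ρ * M.h) ^ 2 ≤ ‖M.nrm t i j k‖ := hR.shape_sq hT hρ ht h
  have hX0 : 0 < ‖M.nrm t i j k‖ := lt_of_lt_of_le (by positivity) hX
  have h1 := abs_real_inner_le_norm (M.nrm t i j k) (M.nrmV t i j k)
  have h2 := hR.norm_nrmV_le hT hV ht h
  have hL := hV.one_le
  rw [hP.divK_eq h, abs_div, abs_of_nonneg (sq_nonneg ‖M.nrm t i j k‖), div_le_div_iff₀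
    (by positivity) (by positivity)]
  calc |⟪M.nrm t i j k, M.nrmV t i j k⟫| * ρ ^ 2
      ≤ ‖M.nrm t i j k‖ * (2 * L * M.h ^ 2) * ρ ^ 2 := by gcongr; exact h1.trans (by gcongr)
    _ = 2 * L * (‖M.nrm t i j k‖ * (ρ * M.h) ^ 2) := by ring
    _ ≤ 2 * L * (‖M.nrm t i j k‖ * ‖M.nrm t i j k‖) := by gcongr
    _ = _ := by ring

/-- The rate of change is `O(h²)`, and quasi-uniformity bounds `h²` by the area at any time. The
reference time `u` is left free so that the change can be measured against the old or the new area.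
-/
theorem abs_dArea_sub_le {s t u : ℝ} (hs : s ∈ Icc 0 T) (ht : t ∈ Icc 0 T) (hu : u ∈ Icc 0 T)
    (hst : s ≤ t) {K : Finset (Fin M.N)} (hK : K ∈ M.tri) :
    |M.dArea t K - M.dArea s K| ≤ 2 * L / ρ ^ 4 * (t - s) * M.dArea u K := by
  have hL := hV.one_le
  have := (convex_Icc (0 : ℝ) T).norm_image_sub_le_of_norm_hasDerivWithin_le
    (f := fun t => M.dArea t K) (C := M.h ^ 2 * (2 * L / ρ ^ 2))
    (fun u hu => hR.hasDerivWithinAt_dArea hT hρ hu hK) (fun u hu => by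
      rw [norm_mul, Real.norm_eq_abs, Real.norm_eq_abs, abs_of_nonneg (dArea_nonneg _ _)]
      exact mul_le_mul (hR.dArea_le_sq hT hu hK) (hR.abs_divK_le hT hρ hV hu hK) (abs_nonneg _)
        (sq_nonneg _)) hs ht
  rw [Real.norm_eq_abs, Real.norm_eq_abs, abs_of_nonneg (sub_nonneg.2 hst)] at this
  refine this.trans ?_
  have h1 := hR.le_dArea hT hρ hu hK
  have hts : 0 ≤ t - s := sub_nonneg.2 hst
  calc M.h ^ 2 * (2 * L / ρ ^ 2) * (t - s) = 2 * L / ρ ^ 4 * (t - s) * (ρ * M.h) ^ 2 := by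
        field_simp
    _ ≤ _ := by gcongr

/-! ### Normals of neighbouring triangles -/

-- Along an edge the velocity difference is the derivative applied to the edge, up to `L h²`.
-- Crossing with the other edge gives `h³`, one order below the normal itself.
omit hρ in
theorem norm_nrmV_sub_cof_le {t : ℝ} (ht : t ∈ Icc 0 T) {K : Finset (Fin M.N)} {i j k : Fin M.N}
    (h : M.IsTri K i j k) :
    ‖M.nrmV t i j k - cof (fderiv ℝ (S.V t) (M.node i t)) (M.nrm t i j k)‖
      ≤ 2 * L * M.h ^ 3 := by
  set A := fderiv ℝ (S.V t) (M.node i t) with hA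
  have hh := (hR.h_pos hT).le
  have hL := hV.one_le
  have e : M.nrmV t i j k - cof A (M.nrm t i j k)
      = cr (M.edV t i j - A (M.ed t i j)) (M.ed t i k)
        + cr (M.ed t i j) (M.edV t i k - A (M.ed t i k)) := by
    rw [nrm, ← cr_add_cr_eq_cof, nrmV, cr_sub_left, cr_sub_right]; abel
  have ht' : ∀ l ∈ K, ‖M.edV t i l - A (M.ed t i l)‖ ≤ L * M.h ^ 2 := fun l hl =>
    (hV.taylor _ _ (M.isTraj_node i) (M.isTraj_node l) t ht).trans (by
      have := norm_ed_le ht h.mem h.mem_i hl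
      rw [ed] at this
      gcongr)
  rw [e]
  have h1 := (norm_cr_le (M.edV t i j - A (M.ed t i j)) (M.ed t i k)).trans
    (mul_le_mul (ht' j h.mem_j) (norm_ed_le ht h.mem h.mem_i h.mem_k) (norm_nonneg _)
      (by positivity))
  have h2 := (norm_cr_le (M.ed t i j) (M.edV t i k - A (M.ed t i k))).trans
    (mul_le_mul (norm_ed_le ht h.mem h.mem_i h.mem_j) (ht' k h.mem_k) (norm_nonneg _) hh)
  calc _ ≤ _ := norm_add_le _ _
    _ ≤ L * M.h ^ 2 * M.h + M.h * (L * M.h ^ 2) := add_le_add h1 h2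
    _ = _ := by ring

theorem norm_nrmV_sub_cof_div_le {s t : ℝ} (hs : s ∈ Icc 0 T) (ht : t ∈ Icc 0 T)
    {K : Finset (Fin M.N)} {i j k : Fin M.N} (h : M.IsTri K i j k) :
    ‖M.nrm s i j k‖⁻¹ * ‖M.nrmV t i j k - cof (fderiv ℝ (S.V t) (M.node i t)) (M.nrm t i j k)‖
      ≤ 2 * L / ρ ^ 2 * M.h := by
  have hh := hR.h_pos hT
  have hL := hV.one_le
  have hX : (ρ * M.h) ^ 2 ≤ ‖M.nrm s i j k‖ := hR.shape_sq hT hρ hs h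
  have hX0 : 0 < ‖M.nrm s i j k‖ := lt_of_lt_of_le (by positivity) hX
  rw [inv_mul_le_iff₀ hX0]
  refine (hR.norm_nrmV_sub_cof_le hT hV ht h).trans ?_
  calc 2 * L * M.h ^ 3 = (ρ * M.h) ^ 2 * (2 * L / ρ ^ 2 * M.h) := by field_simp
    _ ≤ _ := by gcongr

theorem abs_divK_sub_le {t : ℝ} (ht : t ∈ Icc 0 T) {K : Finset (Fin M.N)} {i j k : Fin M.N}
    (h : M.IsTri K i j k) :
    |M.divK t K - ⟪M.nrm t i j k, cof (fderiv ℝ (S.V t) (M.node i t)) (M.nrm t i j k)⟫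
      / ‖M.nrm t i j k‖ ^ 2| ≤ 2 * L / ρ ^ 2 * M.h := by
  have hP := hR.isProper hT hρ ht
  have hX0 : 0 < ‖M.nrm t i j k‖ := norm_pos_iff.2 (hP.nondeg _ _ _ _ h)
  refine le_trans ?_ (hR.norm_nrmV_sub_cof_div_le hT hρ hV ht ht h)
  rw [hP.divK_eq h, ← sub_div, ← inner_sub_right, abs_div, abs_of_nonneg (sq_nonneg ‖_‖),
    div_le_iff₀ (by positivity)]
  refine (abs_real_inner_le_norm _ _).trans (le_of_eq ?_)
  field_simp

-- All nodes lie on `Γ₀` at time zero, so both edges have normal component `O(h²)` and `(e₁ × e₂) ×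
-- n = O(h³)`, against `‖e₁ × e₂‖ ≥ (ρh)²`. Unit vectors with small cross product agree up to a
-- sign, which reflects the arbitrary ordering of the vertices.
omit hV in
theorem exists_sign_nrm_zero {N : ℝ} {i j k : Fin M.N} {n : E3} (hn : ‖n‖ = 1)
    (hN : ∀ w ∈ S.Γ₀, |⟪n, w - M.node i 0⟫| ≤ N * ‖w - M.node i 0‖ ^ 2) (hN0 : 0 ≤ N)
    {K : Finset (Fin M.N)} (h : M.IsTri K i j k) :
    ∃ σ : ℝ, (σ = 1 ∨ σ = -1) ∧
      ‖‖M.nrm 0 i j k‖⁻¹ • M.nrm 0 i j k - σ • n‖ ≤ 4 * N / ρ ^ 2 * M.h := by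
  have h0 : (0 : ℝ) ∈ Icc 0 T := ⟨le_rfl, hT⟩
  have hh := hR.h_pos hT
  have hX : (ρ * M.h) ^ 2 ≤ ‖M.nrm 0 i j k‖ := hR.shape_sq hT hρ h0 h
  have hX0 : 0 < ‖M.nrm 0 i j k‖ := lt_of_lt_of_le (by positivity) hX
  have hu : ‖‖M.nrm 0 i j k‖⁻¹ • M.nrm 0 i j k‖ = 1 := by
    rw [norm_smul, norm_inv, norm_norm, inv_mul_cancel₀ hX0.ne']
  obtain ⟨σ, hσ, hle⟩ := exists_sign_norm_sub_le hu hn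
  refine ⟨σ, hσ, hle.trans ?_⟩
  have hin : ∀ l ∈ K, |⟪M.ed 0 i l, n⟫| ≤ N * M.h ^ 2 := fun l hl => by
    rw [real_inner_comm]
    refine (hN _ (M.node_mem l)).trans ?_
    have := norm_ed_le h0 h.mem h.mem_i hl
    rw [ed] at this
    gcongr
  rw [cr_smul_left, norm_smul, norm_inv, norm_norm, nrm, cr_cr_left, ← nrm]
  have h1 : ‖⟪M.ed 0 i j, n⟫ • M.ed 0 i k - ⟪M.ed 0 i k, n⟫ • M.ed 0 i j‖
      ≤ 2 * N * M.h ^ 3 := by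
    refine (norm_sub_le _ _).trans ?_
    rw [norm_smul, norm_smul, Real.norm_eq_abs, Real.norm_eq_abs]
    calc _ ≤ N * M.h ^ 2 * M.h + N * M.h ^ 2 * M.h := by
          gcongr
          · exact hin j h.mem_j
          · exact norm_ed_le h0 h.mem h.mem_i h.mem_k
          · exact hin k h.mem_k
          · exact norm_ed_le h0 h.mem h.mem_i h.mem_j
      _ = _ := by ring
  have h2 : ‖M.nrm 0 i j k‖⁻¹ * (2 * N * M.h ^ 3) ≤ 2 * N / ρ ^ 2 * M.h := by
    rw [inv_mul_le_iff₀ hX0]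
    calc 2 * N * M.h ^ 3 = (ρ * M.h) ^ 2 * (2 * N / ρ ^ 2 * M.h) := by field_simp
      _ ≤ _ := by gcongr
  calc 2 * (‖M.nrm 0 i j k‖⁻¹ * _) ≤ 2 * (‖M.nrm 0 i j k‖⁻¹ * (2 * N * M.h ^ 3)) := by gcongr
    _ ≤ 2 * (2 * N / ρ ^ 2 * M.h) := by gcongr
    _ = _ := by ring

/-- The discrete divergences on two triangles with a common node differ by `O(h)`. -/
theorem abs_divK_sub_divK_le {N : ℝ} (hN0 : 0 ≤ N) (hN : HasQuadNormals S.Γ₀ N) {t : ℝ}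
    (ht : t ∈ Icc 0 T) {K K' : Finset (Fin M.N)} (hK : K ∈ M.tri) (hK' : K' ∈ M.tri)
    {i : Fin M.N} (hi : i ∈ K) (hi' : i ∈ K') :
    |M.divK t K - M.divK t K'| ≤ (20 * L * ((8 * N / ρ ^ 2 + 4 * L / ρ ^ 2)
      * Real.exp (5 * L * T)) + 4 * L / ρ ^ 2) * M.h := by
  obtain ⟨j, k, h⟩ := exists_isTri hK hi
  obtain ⟨j', k', h'⟩ := exists_isTri hK' hi'
  obtain ⟨n, hn, hnN⟩ := hN _ (M.node_mem i)
  obtain ⟨σ₁, hσ₁, h1⟩ := hR.exists_sign_nrm_zero hT hρ hn hnN hN0 h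
  obtain ⟨σ₂, hσ₂, h2⟩ := hR.exists_sign_nrm_zero hT hρ hn hnN hN0 h'
  have h0 : (0 : ℝ) ∈ Icc 0 T := ⟨le_rfl, hT⟩
  have hh := hR.h_pos hT
  have hL := hV.one_le
  set A : ℝ → E3 →L[ℝ] E3 := fun t => fderiv ℝ (S.V t) (M.node i t) with hA
  have hAL : ∀ t ∈ Icc 0 T, ‖A t‖ ≤ L := fun t ht => hV.norm_fderiv _ (M.isTraj_node i) t ht
  set c := ‖M.nrm 0 i j k‖⁻¹ with hc
  set c' := ‖M.nrm 0 i j' k'‖⁻¹ with hc'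
  -- The relative orientation of the two triangles. The quantities compared at the end are quadratic
  -- in the normal, so the sign is harmless.
  set σ := σ₁ * σ₂ with hσ
  have hX0 : 0 < ‖M.nrm 0 i j k‖ := norm_pos_iff.2 (hR.nondeg hT hρ h0 h)
  have hX0' : 0 < ‖M.nrm 0 i j' k'‖ := norm_pos_iff.2 (hR.nondeg hT hρ h0 h')
  have hc0 : 0 < c := inv_pos.2 hX0
  have hc0' : 0 < c' := inv_pos.2 hX0'
  have hσ1 : |σ| = 1 := by
    rcases hσ₁ with r | r <;> rcases hσ₂ with r' | r' <;> rw [hσ, r, r'] <;> norm_num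
  have hσ0 : σ ≠ 0 := by rintro h; rw [h] at hσ1; simp at hσ1
  have hs0 : ‖c • M.nrm 0 i j k - (σ * c') • M.nrm 0 i j' k'‖ ≤ 8 * N / ρ ^ 2 * M.h := by
    have hσσ : σ₁ = σ * σ₂ := by
      rcases hσ₂ with r' | r' <;> rw [hσ, r'] <;> ring
    have e : c • M.nrm 0 i j k - (σ * c') • M.nrm 0 i j' k'
        = (c • M.nrm 0 i j k - σ₁ • n) - σ • (c' • M.nrm 0 i j' k' - σ₂ • n) := by
      rw [hσσ]; module
    rw [e]
    refine (norm_sub_le _ _).trans ?_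
    rw [norm_smul, Real.norm_eq_abs, hσ1, one_mul]
    calc _ ≤ _ := add_le_add h1 h2
      _ = _ := by ring
  -- Both normals, rescaled by constants fixed at time zero, solve `X' = cof (A t) X + O(h)` with
  -- the same `A t`, the velocity derivative at the common node. Gronwall keeps their difference
  -- `O(h)`. The surface `Γ(t)` at positive times plays no role here.
  have key : ∀ t ∈ Icc 0 T, ‖c • M.nrm t i j k - (σ * c') • M.nrm t i j' k'‖
      ≤ (8 * N / ρ ^ 2 * M.h + 4 * L / ρ ^ 2 * M.h) * Real.exp (5 * L * T) := by
    intro t ht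
    refine norm_le_of_norm_deriv_le (f := fun t => c • M.nrm t i j k - (σ * c') • M.nrm t i j' k')
      (f' := fun t => c • M.nrmV t i j k - (σ * c') • M.nrmV t i j' k') (by linarith)
      (by positivity) (by positivity) ?_ hs0 ?_ ht
    · intro t ht
      exact ((hasDerivWithinAt_nrm i j k ht).const_smul c).sub
        ((hasDerivWithinAt_nrm i j' k' ht).const_smul (σ * c'))
    · intro t ht
      have e : c • M.nrmV t i j k - (σ * c') • M.nrmV t i j' k'
          = cof (A t) (c • M.nrm t i j k - (σ * c') • M.nrm t i j' k')
            + (c • (M.nrmV t i j k - cof (A t) (M.nrm t i j k))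
              - (σ * c') • (M.nrmV t i j' k' - cof (A t) (M.nrm t i j' k'))) := by
        rw [cof_sub, cof_smul, cof_smul]; module
      have b1 := hR.norm_nrmV_sub_cof_div_le hT hρ hV h0 ht h
      have b2 := hR.norm_nrmV_sub_cof_div_le hT hρ hV h0 ht h'
      rw [e]
      refine (norm_add_le _ _).trans (add_le_add ((norm_cof_le _ _).trans ?_) ?_)
      · gcongr; exact hAL t ht
      · refine (norm_sub_le _ _).trans ?_
        rw [norm_smul, norm_smul, Real.norm_eq_abs, Real.norm_eq_abs, abs_mul, hσ1, one_mul,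
          abs_of_pos hc0, abs_of_pos hc0']
        calc _ ≤ _ := add_le_add b1 b2
          _ = _ := by ring
  have hk := key t ht
  -- Areas do not decrease, so the rescaled normal has length at least one, as Lipschitz continuity
  -- of normalisation requires.
  have hu1 : 1 ≤ ‖c • M.nrm t i j k‖ := by
    rw [norm_smul, Real.norm_eq_abs, abs_of_pos hc0, hc, ← nrm_eq_norm h, ← nrm_eq_norm h,
      ← div_eq_inv_mul, one_le_div (by rw [nrm_eq_norm h]; exact hX0)]
    exact hR.dArea_mono hT hρ h0 ht ht.1 hK
  have hv0 : (σ * c') • M.nrm t i j' k' ≠ 0 :=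
    smul_ne_zero (mul_ne_zero hσ0 hc0'.ne') (hR.nondeg hT hρ ht h')
  have hn := norm_normalize_sub_le hu1 hv0
  have hcof := inner_cof_sub_le (A := A t) (u := ‖c • M.nrm t i j k‖⁻¹ • c • M.nrm t i j k)
    (v := ‖(σ * c') • M.nrm t i j' k'‖⁻¹ • (σ * c') • M.nrm t i j' k')
    (by rw [norm_smul, norm_inv, norm_norm, inv_mul_cancel₀ (by linarith)])
    (by rw [norm_smul, norm_inv, norm_norm, inv_mul_cancel₀ (norm_ne_zero_iff.2 hv0)])
  rw [inner_normalize_cof _ hc0.ne', inner_normalize_cof _ (mul_ne_zero hσ0 hc0'.ne')] at hcof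
  have d1 : |M.divK t K - ⟪M.nrm t i j k, cof (A t) (M.nrm t i j k)⟫
      / ‖M.nrm t i j k‖ ^ 2| ≤ _ := hR.abs_divK_sub_le hT hρ hV ht h
  have d2 : |M.divK t K' - ⟪M.nrm t i j' k', cof (A t) (M.nrm t i j' k')⟫
      / ‖M.nrm t i j' k'‖ ^ 2| ≤ _ := hR.abs_divK_sub_le hT hρ hV ht h'
  have hf : |⟪M.nrm t i j k, cof (A t) (M.nrm t i j k)⟫ / ‖M.nrm t i j k‖ ^ 2
      - ⟪M.nrm t i j' k', cof (A t) (M.nrm t i j' k')⟫ / ‖M.nrm t i j' k'‖ ^ 2|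
      ≤ 10 * L * (2 * ((8 * N / ρ ^ 2 * M.h + 4 * L / ρ ^ 2 * M.h) * Real.exp (5 * L * T))) := by
    refine hcof.trans ?_
    gcongr
    · exact hAL t ht
    · exact hn.trans (by gcongr)
  rw [abs_sub_comm] at d2
  have e : (20 * L * ((8 * N / ρ ^ 2 + 4 * L / ρ ^ 2) * Real.exp (5 * L * T)) + 4 * L / ρ ^ 2) * M.h
      = 2 * L / ρ ^ 2 * M.h + (10 * L * (2 * ((8 * N / ρ ^ 2 * M.h + 4 * L / ρ ^ 2 * M.h)
        * Real.exp (5 * L * T))) + 2 * L / ρ ^ 2 * M.h) := by ring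
  rw [e]
  exact (abs_sub_le _ _ _).trans (add_le_add d1 ((abs_sub_le _ _ _).trans (add_le_add hf d2)))

end

end IsRegular

end EvolvingTriangulation

/-! ### Change of lumped masses and stiffness over one time step. -/

theorem one_add_mul_one_add_le {a b c τ : ℝ} (ha : 0 ≤ a) (hb : 0 ≤ b) (hτ : 0 ≤ τ) (hτ1 : τ ≤ 1)
    (hc : a + b + a * b ≤ c) : (1 + a * τ) * (1 + b * τ) ≤ 1 + c * τ := by
  have h1 : a * b * τ * τ ≤ a * b * τ * 1 := by gcongr
  have h2 : (a + b + a * b) * τ ≤ c * τ := by gcongr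
  nlinarith

theorem add_sq_le_young {a b τ : ℝ} (hτ : 0 < τ) (hτ1 : τ ≤ 1) :
    (a + τ * b) ^ 2 ≤ (1 + τ) * a ^ 2 + 2 * τ * b ^ 2 := by
  nlinarith [mul_nonneg hτ.le (sq_nonneg (a - b)),
    mul_nonneg (mul_nonneg hτ.le (sub_nonneg.2 hτ1)) (sq_nonneg b)]

namespace EvolvingTriangulation

variable {T : ℝ} {S : EvolvingSurface T} {M : EvolvingTriangulation S}

theorem IsTri.sum_eq' {K : Finset (Fin M.N)} {i j k : Fin M.N} (h : M.IsTri K i j k)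
    (f : Fin M.N → ℝ) : ∑ l ∈ K, f l = f i + (f j + f k) := by
  rw [h.eq, Finset.sum_insert (by simp [h.ij, h.ik]), Finset.sum_pair h.jk]

variable (M) in
/-- The quotient of the lumped masses at two times. -/
def massRatio (s t : ℝ) (i : Fin M.N) : ℝ := M.mass s i / M.mass t i

/-- Inverse estimate: on a shape-regular triangle the gradient is at most nodal differences over
`h`. -/
theorem norm_gvec_le {e₁ e₂ : E3} {h ρ : ℝ} (hh : 0 < h) (hρ : 0 < ρ) (h1 : ‖e₁‖ ≤ h)
    (h2 : ‖e₂‖ ≤ h) (hX : (ρ * h) ^ 2 ≤ ‖cr e₁ e₂‖) (d₁ d₂ : ℝ) :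
    ‖gvec e₁ e₂ d₁ d₂‖ ≤ (|d₁| + |d₂|) / (ρ ^ 2 * h) := by
  have hX0 : 0 < ‖cr e₁ e₂‖ := lt_of_lt_of_le (by positivity) hX
  rw [norm_gvec (norm_pos_iff.1 hX0), div_le_div_iff₀ hX0 (by positivity)]
  calc ‖d₁ • e₂ - d₂ • e₁‖ * (ρ ^ 2 * h) ≤ (|d₁| * h + |d₂| * h) * (ρ ^ 2 * h) := by
        gcongr
        refine (norm_sub_le _ _).trans ?_
        rw [norm_smul, norm_smul, Real.norm_eq_abs, Real.norm_eq_abs]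
        gcongr
    _ = (|d₁| + |d₂|) * (ρ * h) ^ 2 := by ring
    _ ≤ _ := by gcongr

namespace IsRegular

variable {ρ L : ℝ} (hR : M.IsRegular ρ) (hT : 0 ≤ T) (hρ : 0 < ρ) (hV : S.VelBound L)
  {s t : ℝ} (hs : s ∈ Icc 0 T) (ht : t ∈ Icc 0 T) (hst : s ≤ t)
include hR hT hρ hV hs ht hst

omit hV in
theorem mass_mono (i : Fin M.N) : M.mass s i ≤ M.mass t i :=
  Finset.sum_le_sum fun _ hK => mul_le_mul_of_nonneg_left
    (hR.dArea_mono hT hρ hs ht hst (Finset.mem_filter.1 hK).1) refBary_pos.le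

theorem mass_sub_le {u : ℝ} (hu : u ∈ Icc 0 T) (i : Fin M.N) :
    M.mass t i - M.mass s i ≤ 2 * L / ρ ^ 4 * (t - s) * M.mass u i := by
  simp only [mass]
  rw [← Finset.sum_sub_distrib, Finset.mul_sum]
  refine Finset.sum_le_sum fun K hK => ?_
  have h := (abs_le.1 (hR.abs_dArea_sub_le hT hρ hV hs ht hu hst (Finset.mem_filter.1 hK).1)).2
  have := mul_le_mul_of_nonneg_left h refBary_pos.le
  linarith

theorem massRatio_mem (i : Fin M.N) :
    M.massRatio s t i ∈ Icc (1 - 2 * L / ρ ^ 4 * (t - s)) 1 := by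
  have hp := (hR.isProper hT hρ ht).mass_pos i
  rw [massRatio]
  refine ⟨?_, (div_le_one hp).2 (hR.mass_mono hT hρ hs ht hst i)⟩
  rw [le_div_iff₀ hp]
  linarith [hR.mass_sub_le hT hρ hV hs ht hst ht i]

omit hV hst in
theorem massRatio_nonneg (i : Fin M.N) : 0 ≤ M.massRatio s t i :=
  _root_.div_nonneg ((hR.isProper hT hρ hs).mass_pos i).le ((hR.isProper hT hρ ht).mass_pos i).le

-- The quotient of the areas of `K` and `K'` has the difference of the divergences as logarithmic
-- derivative, so over the step it changes by `O(h(t-s))`. Multiplying by the bounded factor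
-- `area(s,K')/area(t,K)` converts this into the difference of the two growth ratios.
omit hV in
theorem abs_areaRatio_sub_le {A : ℝ} {K K' : Finset (Fin M.N)} (hK : K ∈ M.tri)
    (hK' : K' ∈ M.tri) (hdiv : ∀ u ∈ Icc 0 T, |M.divK u K - M.divK u K'| ≤ A * M.h) :
    |M.dArea s K / M.dArea t K - M.dArea s K' / M.dArea t K'|
      ≤ A / ρ ^ 4 * M.h * (t - s) := by
  have hh := hR.h_pos hT
  have hpos : ∀ {L}, L ∈ M.tri → ∀ u ∈ Icc 0 T, 0 < M.dArea u L := fun hL u hu =>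
    (hR.isProper hT hρ hu).dArea_pos hL
  have hquot : ∀ {L L'}, L ∈ M.tri → L' ∈ M.tri → ∀ u ∈ Icc 0 T, ∀ v ∈ Icc 0 T,
      M.dArea u L / M.dArea v L' ≤ 1 / ρ ^ 2 := by
    intro L L' hL hL' u hu v hv
    rw [div_le_div_iff₀ (hpos hL' v hv) (by positivity)]
    calc M.dArea u L * ρ ^ 2 ≤ M.h ^ 2 * ρ ^ 2 := by gcongr; exact hR.dArea_le_sq hT hu hL
      _ = (ρ * M.h) ^ 2 := by ring
      _ ≤ _ := by rw [one_mul]; exact hR.le_dArea hT hρ hv hL'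
  have hψ := (convex_Icc (0 : ℝ) T).norm_image_sub_le_of_norm_hasDerivWithin_le
    (f := fun u => M.dArea u K / M.dArea u K')
    (f' := fun u => M.dArea u K / M.dArea u K' * (M.divK u K - M.divK u K'))
    (C := 1 / ρ ^ 2 * (A * M.h)) (fun u hu => by
      have := (hR.hasDerivWithinAt_dArea hT hρ hu hK).div
        (hR.hasDerivWithinAt_dArea hT hρ hu hK') (hpos hK' u hu).ne'
      have e : M.dArea u K / M.dArea u K' * (M.divK u K - M.divK u K')
          = (M.dArea u K * M.divK u K * M.dArea u K' - M.dArea u K * (M.dArea u K' * M.divK u K'))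
            / M.dArea u K' ^ 2 := by
        have := (hpos hK' u hu).ne'
        field_simp
      rw [e]
      exact this) (fun u hu => by
      rw [norm_mul, Real.norm_eq_abs, Real.norm_eq_abs,
        abs_of_nonneg (_root_.div_nonneg (dArea_nonneg _ _) (dArea_nonneg _ _))]
      exact mul_le_mul (hquot hK hK' u hu u hu) (hdiv u hu) (abs_nonneg _) (by positivity)) ht hs
  rw [Real.norm_eq_abs, Real.norm_eq_abs, abs_sub_comm s t,
    abs_of_nonneg (sub_nonneg.2 hst)] at hψ
  have e : M.dArea s K / M.dArea t K - M.dArea s K' / M.dArea t K'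
      = M.dArea s K' / M.dArea t K
        * (M.dArea s K / M.dArea s K' - M.dArea t K / M.dArea t K') := by
    have h1 := (hpos hK' s hs).ne'
    have h2 := (hpos hK' t ht).ne'
    have h3 := (hpos hK t ht).ne'
    field_simp
  have h0 : 0 ≤ M.dArea s K' / M.dArea t K := _root_.div_nonneg (dArea_nonneg _ _) (dArea_nonneg _ _)
  rw [e, abs_mul, abs_of_nonneg h0]
  calc _ ≤ 1 / ρ ^ 2 * (1 / ρ ^ 2 * (A * M.h) * (t - s)) :=
        mul_le_mul (hquot hK' hK s hs t ht) hψ (abs_nonneg _) (by positivity)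
    _ = _ := by field_simp

-- The mass ratio at a node is the average, weighted by the new areas, of the area ratios of the
-- triangles around it, and these are close to one another.
omit hV in
theorem abs_massRatio_sub_le {A : ℝ} (hdiv : ∀ u ∈ Icc 0 T, ∀ K ∈ M.tri,
    ∀ K' ∈ M.tri, ∀ i, i ∈ K → i ∈ K' → |M.divK u K - M.divK u K'| ≤ A * M.h)
    {K : Finset (Fin M.N)} (hK : K ∈ M.tri) {i : Fin M.N} (hi : i ∈ K) :
    |M.massRatio s t i - M.dArea s K / M.dArea t K| ≤ A / ρ ^ 4 * M.h * (t - s) := by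
  have hp := (hR.isProper hT hρ ht).mass_pos i
  have e : M.massRatio s t i - M.dArea s K / M.dArea t K
      = (∑ K' ∈ M.tri with i ∈ K', refBary * M.dArea t K'
        * (M.dArea s K' / M.dArea t K' - M.dArea s K / M.dArea t K)) / M.mass t i := by
    rw [eq_div_iff hp.ne', sub_mul, massRatio, div_mul_cancel₀ _ hp.ne']
    simp only [mass]
    rw [Finset.mul_sum, ← Finset.sum_sub_distrib]
    refine Finset.sum_congr rfl fun K' hK' => ?_
    have := ((hR.isProper hT hρ ht).dArea_pos (Finset.mem_filter.1 hK').1).ne'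
    field_simp
  rw [e, abs_div, abs_of_pos hp, div_le_iff₀ hp]
  refine (Finset.abs_sum_le_sum_abs _ _).trans ?_
  rw [mass, Finset.mul_sum]
  refine Finset.sum_le_sum fun K' hK' => ?_
  obtain ⟨hK'1, hK'2⟩ := Finset.mem_filter.1 hK'
  have h0 : 0 ≤ refBary * M.dArea t K' := mul_nonneg refBary_pos.le (dArea_nonneg _ _)
  rw [abs_mul, abs_of_nonneg h0, mul_comm]
  exact mul_le_mul_of_nonneg_right (hR.abs_areaRatio_sub_le hT hρ hs ht hst hK'1 hK
    fun u hu => hdiv u hu _ hK'1 _ hK i hK'2 hi) h0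

/-- Gradient times area is the length of `d₁e₂ - d₂e₁` with time-independent nodal differences `d`,
each at most `h` times the old gradient. The edges move by `O(h(t-s))`, and the area in the
denominator only grows. -/
theorem norm_gradK_le {K : Finset (Fin M.N)} (hK : K ∈ M.tri) (V : Fin M.N → ℝ) :
    ‖M.gradK t K V‖ ≤ (1 + 2 * L / ρ ^ 2 * (t - s)) * ‖M.gradK s K V‖ := by
  obtain ⟨i, j, k, h⟩ := exists_isTri' hK
  have hPs := hR.isProper hT hρ hs
  have hPt := hR.isProper hT hρ ht
  have hh := hR.h_pos hT
  have hL := hV.one_le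
  have hts : 0 ≤ t - s := sub_nonneg.2 hst
  have hXs : 0 < M.dArea s K := hPs.dArea_pos hK
  have hXt : 0 < M.dArea t K := hPt.dArea_pos hK
  set d₁ := V j - V i with hd₁
  set d₂ := V k - V i with hd₂
  have hgs : ‖M.gradK s K V‖ * M.dArea s K = ‖d₁ • M.ed s i k - d₂ • M.ed s i j‖ := by
    rw [hPs.gradK_eq h, norm_gvec (hPs.nondeg _ _ _ _ h), ← h.dArea_eq, div_mul_cancel₀ _ hXs.ne']
  have hgt : ‖M.gradK t K V‖ * M.dArea t K = ‖d₁ • M.ed t i k - d₂ • M.ed t i j‖ := by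
    rw [hPt.gradK_eq h, norm_gvec (hPt.nondeg _ _ _ _ h), ← h.dArea_eq, div_mul_cancel₀ _ hXt.ne']
  have hd1 : |d₁| ≤ ‖M.gradK s K V‖ * M.h := by
    have := inner_gvec_left (hPs.nondeg _ _ _ _ h) d₁ d₂
    rw [← this, ← hPs.gradK_eq h]
    exact (abs_real_inner_le_norm _ _).trans (by
      gcongr; exact norm_ed_le hs hK h.mem_i h.mem_j)
  have hd2 : |d₂| ≤ ‖M.gradK s K V‖ * M.h := by
    have := inner_gvec_right (hPs.nondeg _ _ _ _ h) d₁ d₂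
    rw [← this, ← hPs.gradK_eq h]
    exact (abs_real_inner_le_norm _ _).trans (by
      gcongr; exact norm_ed_le hs hK h.mem_i h.mem_k)
  have e : d₁ • M.ed t i k - d₂ • M.ed t i j = (d₁ • M.ed s i k - d₂ • M.ed s i j)
      + (d₁ • (M.ed t i k - M.ed s i k) - d₂ • (M.ed t i j - M.ed s i j)) := by module
  have hx := hR.le_dArea hT hρ hs hK
  have hb : ‖d₁ • M.ed t i k - d₂ • M.ed t i j‖
      ≤ (1 + 2 * L / ρ ^ 2 * (t - s)) * ‖M.gradK s K V‖ * M.dArea s K := by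
    rw [e]
    refine (norm_add_le _ _).trans ?_
    rw [← hgs]
    have h1 : ‖d₁ • (M.ed t i k - M.ed s i k) - d₂ • (M.ed t i j - M.ed s i j)‖
        ≤ 2 * L / ρ ^ 2 * (t - s) * ‖M.gradK s K V‖ * M.dArea s K := by
      refine (norm_sub_le _ _).trans ?_
      rw [norm_smul, norm_smul, Real.norm_eq_abs, Real.norm_eq_abs]
      calc _ ≤ ‖M.gradK s K V‖ * M.h * (L * M.h * (t - s))
            + ‖M.gradK s K V‖ * M.h * (L * M.h * (t - s)) := by
            gcongr
            · exact norm_ed_sub_le hV hs ht hst hK h.mem_i h.mem_k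
            · exact norm_ed_sub_le hV hs ht hst hK h.mem_i h.mem_j
        _ = 2 * L / ρ ^ 2 * (t - s) * ‖M.gradK s K V‖ * (ρ * M.h) ^ 2 := by
            field_simp; ring
        _ ≤ _ := by gcongr
    linarith
  have hmono := hR.dArea_mono hT hρ hs ht hst hK
  have : ‖M.gradK t K V‖ * M.dArea t K
      ≤ (1 + 2 * L / ρ ^ 2 * (t - s)) * ‖M.gradK s K V‖ * M.dArea t K := by
    rw [hgt]
    refine hb.trans ?_
    have : 0 ≤ 1 + 2 * L / ρ ^ 2 * (t - s) := by positivity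
    gcongr
  exact le_of_mul_le_mul_right this hXt

-- Discrete product rule: the error involves the nodal variation of the mass ratio, `O(h(t-s))` on
-- one triangle, whose factor `h` cancels the inverse estimate.
omit hV in
theorem norm_gradK_mul_sub_le {A : ℝ} (hdiv : ∀ u ∈ Icc 0 T, ∀ K ∈ M.tri,
    ∀ K' ∈ M.tri, ∀ i, i ∈ K → i ∈ K' → |M.divK u K - M.divK u K'| ≤ A * M.h)
    {K : Finset (Fin M.N)} {i j k : Fin M.N} (h : M.IsTri K i j k) (V : Fin M.N → ℝ) :
    ‖M.gradK t K (fun l => M.massRatio s t l * V l) - M.massRatio s t i • M.gradK t K V‖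
      ≤ (t - s) * (2 * A / ρ ^ 6 * (|V j| + |V k|)) := by
  have hPt := hR.isProper hT hρ ht
  have hh := hR.h_pos hT
  have hr : ∀ l ∈ K, |M.massRatio s t l - M.massRatio s t i|
      ≤ 2 * A / ρ ^ 4 * M.h * (t - s) := by
    intro l hl
    have h1 := hR.abs_massRatio_sub_le hT hρ hs ht hst hdiv h.mem hl
    have h2 := hR.abs_massRatio_sub_le hT hρ hs ht hst hdiv h.mem h.mem_i
    rw [abs_sub_comm] at h2
    refine (abs_sub_le _ _ _).trans ((add_le_add h1 h2).trans (le_of_eq ?_))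
    ring
  rw [hPt.gradK_eq h, hPt.gradK_eq h, ← gvec_smul, sub_eq_add_neg, ← neg_one_smul ℝ (gvec _ _ _ _),
    ← gvec_smul, ← gvec_add]
  refine (norm_gvec_le hh hρ (norm_ed_le ht h.mem h.mem_i h.mem_j)
    (norm_ed_le ht h.mem h.mem_i h.mem_k) (hR.shape_sq hT hρ ht h) _ _).trans ?_
  have e : ∀ l, M.massRatio s t l * V l - M.massRatio s t i * V i
      + -1 * (M.massRatio s t i * (V l - V i))
      = (M.massRatio s t l - M.massRatio s t i) * V l := fun l => by ring
  rw [e, e, abs_mul, abs_mul, div_le_iff₀ (by positivity)]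
  calc _ ≤ 2 * A / ρ ^ 4 * M.h * (t - s) * |V j| + 2 * A / ρ ^ 4 * M.h * (t - s) * |V k| := by
        gcongr
        · exact hr j h.mem_j
        · exact hr k h.mem_k
    _ = _ := by field_simp

end IsRegular

variable (M) in
/-- The estimates, uniform in the time step, for the change of the lumped masses and of the
stiffness form from time `s` to time `t`. -/
structure StepControl (C s t : ℝ) : Prop where
  mass_mono : ∀ i, M.mass s i ≤ M.mass t i
  mass_le : ∀ i, M.mass t i ≤ (1 + C * (t - s)) * M.mass s i
  le_ratio : ∀ i, 1 - C * (t - s) ≤ M.massRatio s t i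
  stiff_mul : ∀ V, M.stiffForm t (fun i => M.massRatio s t i * V i)
    (fun i => M.massRatio s t i * V i)
      ≤ (1 + C * (t - s)) * M.stiffForm s V V + C * (t - s) * wsum (M.mass s) V V
  stiff_one_sub : ∀ V, M.stiffForm t (fun i => (1 - M.massRatio s t i) * V i)
    (fun i => (1 - M.massRatio s t i) * V i)
      ≤ C * (t - s) ^ 2 * (M.stiffForm s V V + wsum (M.mass s) V V)

/-- Squaring with a Young weight `τ` keeps the coefficient of `g²` at `1 + O(τ)`, which is essential
for summation over the steps. `G₂`, `G₃`, `G₄` collect successive products of such factors. -/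
theorem mul_sq_le_of_le_add {a G B τ g v q p x y : ℝ} (ha : 0 ≤ a) (hG : 0 ≤ G)
    (hτ0 : 0 < τ) (hτ1 : τ ≤ 1) (hp : 0 ≤ p) (hq : 0 ≤ q) (hx : 0 ≤ x)
    (hv : v ^ 2 ≤ 2 * q) (h : p ≤ (1 + G * τ) * g + τ * (B * v)) (hy : y ≤ (1 + a * τ) * x)
    {G₂ G₃ G₄ : ℝ} (hG2 : G₂ = G + G + G * G) (hG3 : G₃ = 1 + G₂ + 1 * G₂)
    (hG4 : G₄ = a + G₃ + a * G₃) :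
    y * p ^ 2 ≤ (1 + G₄ * τ) * (x * g ^ 2) + (1 + a) * (4 * B ^ 2) * τ * (x * q) := by
  have hG20 : 0 ≤ G₂ := by rw [hG2]; positivity
  have hG30 : 0 ≤ G₃ := by rw [hG3]; positivity
  have h4 : p ^ 2 ≤ (1 + G₃ * τ) * g ^ 2 + 4 * B ^ 2 * τ * q := by
    calc p ^ 2 ≤ ((1 + G * τ) * g + τ * (B * v)) ^ 2 := by gcongr
      _ ≤ (1 + τ) * ((1 + G * τ) * g) ^ 2 + 2 * τ * (B * v) ^ 2 := add_sq_le_young hτ0 hτ1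
      _ = (1 + 1 * τ) * ((1 + G * τ) * (1 + G * τ)) * g ^ 2 + 2 * τ * B ^ 2 * v ^ 2 := by ring
      _ ≤ (1 + 1 * τ) * (1 + G₂ * τ) * g ^ 2 + 2 * τ * B ^ 2 * (2 * q) := by
        gcongr
        exact one_add_mul_one_add_le hG hG hτ0.le hτ1 hG2.ge
      _ ≤ (1 + G₃ * τ) * g ^ 2 + 2 * τ * B ^ 2 * (2 * q) := by
        gcongr
        exact one_add_mul_one_add_le zero_le_one hG20 hτ0.le hτ1 hG3.ge
      _ = _ := by ring
  have h5 : (1 + a * τ) * (1 + G₃ * τ) ≤ 1 + G₄ * τ :=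
    one_add_mul_one_add_le ha hG30 hτ0.le hτ1 hG4.ge
  have h6 : 1 + a * τ ≤ 1 + a := by nlinarith
  calc y * p ^ 2 ≤ ((1 + a * τ) * x) * ((1 + G₃ * τ) * g ^ 2 + 4 * B ^ 2 * τ * q) := by gcongr
    _ = (1 + a * τ) * (1 + G₃ * τ) * (x * g ^ 2)
        + (1 + a * τ) * (4 * B ^ 2) * τ * (x * q) := by ring
    _ ≤ _ := by gcongr

/-- Here every contribution to `p` already carries a factor `τ`, so crude squaring suffices. -/
theorem mul_sq_le_of_le_mul {a G B τ g v q p x y : ℝ} (ha : 0 ≤ a)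
    (hτ1 : τ ≤ 1) (hp : 0 ≤ p) (hx : 0 ≤ x)
    (hv : v ^ 2 ≤ 2 * q) (h : p ≤ τ * (a * (1 + G) * g + B * v)) (hy : y ≤ (1 + a * τ) * x) :
    y * p ^ 2 ≤ τ ^ 2 * ((1 + a) * (2 * (a ^ 2 * (1 + G) ^ 2)) * (x * g ^ 2)
      + (1 + a) * (4 * B ^ 2) * (x * q)) := by
  have h4 : p ^ 2 ≤ τ ^ 2 * (2 * (a ^ 2 * (1 + G) ^ 2) * g ^ 2 + 4 * B ^ 2 * q) := by
    calc p ^ 2 ≤ (τ * (a * (1 + G) * g + B * v)) ^ 2 := by gcongr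
      _ ≤ τ ^ 2 * (2 * (a * (1 + G) * g) ^ 2 + 2 * (B * v) ^ 2) := by
        rw [mul_pow]
        gcongr
        nlinarith [sq_nonneg (a * (1 + G) * g - B * v)]
      _ = τ ^ 2 * (2 * (a ^ 2 * (1 + G) ^ 2) * g ^ 2 + 2 * B ^ 2 * v ^ 2) := by ring
      _ ≤ τ ^ 2 * (2 * (a ^ 2 * (1 + G) ^ 2) * g ^ 2 + 2 * B ^ 2 * (2 * q)) := by gcongr
      _ = _ := by ring
  have h6 : 1 + a * τ ≤ 1 + a := by nlinarith
  have hy' : y ≤ (1 + a) * x := hy.trans (by gcongr)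
  calc y * p ^ 2 ≤ ((1 + a) * x)
        * (τ ^ 2 * (2 * (a ^ 2 * (1 + G) ^ 2) * g ^ 2 + 4 * B ^ 2 * q)) := by gcongr
    _ = _ := by ring

theorem sum_nodes_sq_le {K : Finset (Fin M.N)} {i j k : Fin M.N} (h : M.IsTri K i j k)
    (V : Fin M.N → ℝ) : (|V j| + |V k|) ^ 2 ≤ 2 * ∑ l ∈ K, V l ^ 2 := by
  rw [h.sum_eq', ← sq_abs (V j), ← sq_abs (V k)]
  nlinarith [sq_nonneg (|V j| - |V k|), sq_nonneg (V i)]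

theorem IsProper.sum_dArea_sq {s : ℝ} (hM : M.IsProper s) (V : Fin M.N → ℝ) :
    ∑ K ∈ M.tri, refArea * M.dArea s K * ∑ l ∈ K, V l ^ 2
      = refArea / refBary * wsum (M.mass s) V V := by
  have hκ2 := refBary_pos
  have : wsum (M.mass s) V V = ∑ i, M.mass s i * V i ^ 2 :=
    Finset.sum_congr rfl fun i _ => by ring
  rw [this, ← hM.sum_dArea_mul, Finset.mul_sum]
  refine Finset.sum_congr rfl fun K _ => ?_
  field_simp

/-- On a triangle, `∇(rV)` is `r_i ∇V` plus the product-rule error, and `∇((1-r)V)` is `(1 - r_i)∇V`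
minus it, where `0 ≤ 1 - r_i = O(t-s)`. Here `a`, `G` and `B` measure the change of areas, of
gradients and of `r` between nodes. Squares of nodal values, weighted by areas, sum to the lumped
`L²` norm. -/
theorem IsRegular.stiffForm_massRatio_le {ρ L A : ℝ} (hR : M.IsRegular ρ) (hT : 0 ≤ T) (hρ : 0 < ρ)
    (hV : S.VelBound L) (hA : 0 ≤ A) (hdiv : ∀ u ∈ Icc 0 T, ∀ K ∈ M.tri,
      ∀ K' ∈ M.tri, ∀ i, i ∈ K → i ∈ K' → |M.divK u K - M.divK u K'| ≤ A * M.h)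
    {s t : ℝ} (hs : s ∈ Icc 0 T) (ht : t ∈ Icc 0 T) (hst : s < t) (hτ1 : t - s ≤ 1)
    {a G B G₂ G₃ G₄ : ℝ} (ha : a = 2 * L / ρ ^ 4) (hG : G = 2 * L / ρ ^ 2) (hB : B = 2 * A / ρ ^ 6)
    (hG2 : G₂ = G + G + G * G) (hG3 : G₃ = 1 + G₂ + 1 * G₂) (hG4 : G₄ = a + G₃ + a * G₃)
    (V : Fin M.N → ℝ) :
    M.stiffForm t (fun i => M.massRatio s t i * V i) (fun i => M.massRatio s t i * V i)
      ≤ (1 + G₄ * (t - s)) * M.stiffForm s V V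
        + (1 + a) * (4 * B ^ 2) * (refArea / refBary) * (t - s) * wsum (M.mass s) V V ∧
    M.stiffForm t (fun i => (1 - M.massRatio s t i) * V i) (fun i => (1 - M.massRatio s t i) * V i)
      ≤ (t - s) ^ 2 * ((1 + a) * (2 * (a ^ 2 * (1 + G) ^ 2)) * M.stiffForm s V V
        + (1 + a) * (4 * B ^ 2) * (refArea / refBary) * wsum (M.mass s) V V) := by
  have hL := hV.one_le
  have ha0 : 0 ≤ a := by rw [ha]; positivity
  have hG0 : 0 ≤ G := by rw [hG]; positivity
  have hB0 : 0 ≤ B := by rw [hB]; positivity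
  have hst' := hst.le
  have hτ0 : 0 < t - s := sub_pos.2 hst
  have hrat := hR.massRatio_mem hT hρ hV hs ht hst'
  rw [← ha] at hrat
  have hrat0 := hR.massRatio_nonneg hT hρ hs ht
  have hxt : ∀ K ∈ M.tri, refArea * M.dArea t K ≤ (1 + a * (t - s)) * (refArea * M.dArea s K) :=
    fun K hK => by
      have := (abs_le.1 (hR.abs_dArea_sub_le hT hρ hV hs ht hs hst' hK)).2
      rw [← ha] at this
      have h2 := mul_le_mul_of_nonneg_left this refArea_pos.le
      linarith
  have hx0 : ∀ K, 0 ≤ refArea * M.dArea s K := fun K =>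
    mul_nonneg refArea_pos.le (dArea_nonneg _ _)
  have hq0 : ∀ K : Finset (Fin M.N), 0 ≤ ∑ l ∈ K, V l ^ 2 := fun K =>
    Finset.sum_nonneg fun l _ => sq_nonneg _
  simp only [stiffForm_self]
  constructor
  · have hK : ∀ K ∈ M.tri, refArea * M.dArea t K
        * ‖M.gradK t K (fun l => M.massRatio s t l * V l)‖ ^ 2
        ≤ (1 + G₄ * (t - s)) * (refArea * M.dArea s K * ‖M.gradK s K V‖ ^ 2)
          + (1 + a) * (4 * B ^ 2) * (t - s) * (refArea * M.dArea s K * ∑ l ∈ K, V l ^ 2) := by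
      intro K hK
      obtain ⟨i, j, k, h⟩ := exists_isTri' hK
      refine mul_sq_le_of_le_add ha0 hG0 hτ0 hτ1 (norm_nonneg _) (hq0 K) (hx0 K)
        (sum_nodes_sq_le h V) ?_ (hxt K hK) hG2 hG3 hG4
      have h1 := hR.norm_gradK_mul_sub_le hT hρ hs ht hst' hdiv h V
      have h2 := hR.norm_gradK_le hT hρ hV hs ht hst' hK V
      rw [← hB] at h1
      rw [← hG] at h2
      have e : M.gradK t K (fun l => M.massRatio s t l * V l)
          = M.massRatio s t i • M.gradK t K V
            + (M.gradK t K (fun l => M.massRatio s t l * V l)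
              - M.massRatio s t i • M.gradK t K V) := by abel
      rw [e]
      refine (norm_add_le _ _).trans (add_le_add ?_ h1)
      rw [norm_smul, Real.norm_eq_abs, abs_of_nonneg (hrat0 i)]
      exact (mul_le_of_le_one_left (norm_nonneg _) (hrat i).2).trans h2
    refine (Finset.sum_le_sum hK).trans (le_of_eq ?_)
    rw [Finset.sum_add_distrib, ← Finset.mul_sum, ← Finset.mul_sum,
      (hR.isProper hT hρ hs).sum_dArea_sq]
    ring
  · have hK : ∀ K ∈ M.tri, refArea * M.dArea t K
        * ‖M.gradK t K (fun l => (1 - M.massRatio s t l) * V l)‖ ^ 2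
        ≤ (t - s) ^ 2 * ((1 + a) * (2 * (a ^ 2 * (1 + G) ^ 2))
            * (refArea * M.dArea s K * ‖M.gradK s K V‖ ^ 2)
          + (1 + a) * (4 * B ^ 2) * (refArea * M.dArea s K * ∑ l ∈ K, V l ^ 2)) := by
      intro K hK
      obtain ⟨i, j, k, h⟩ := exists_isTri' hK
      refine mul_sq_le_of_le_mul ha0 hτ1 (norm_nonneg _) (hx0 K)
        (sum_nodes_sq_le h V) ?_ (hxt K hK)
      have h1 := hR.norm_gradK_mul_sub_le hT hρ hs ht hst' hdiv h V
      have h2 : ‖M.gradK t K V‖ ≤ (1 + G) * ‖M.gradK s K V‖ := by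
        have h3 := hR.norm_gradK_le hT hρ hV hs ht hst' hK V
        rw [← hG] at h3
        have : G * (t - s) ≤ G * 1 := by gcongr
        rw [mul_one] at this
        exact h3.trans (by gcongr)
      rw [← hB] at h1
      have e0 : (fun l => (1 - M.massRatio s t l) * V l)
          = V - fun l => M.massRatio s t l * V l := by
        funext l; simp only [Pi.sub_apply]; ring
      have e : M.gradK t K (fun l => (1 - M.massRatio s t l) * V l)
          = (1 - M.massRatio s t i) • M.gradK t K V
            - (M.gradK t K (fun l => M.massRatio s t l * V l)
              - M.massRatio s t i • M.gradK t K V) := by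
        rw [e0, map_sub]; module
      rw [e]
      refine (norm_sub_le _ _).trans ?_
      have h4 : ‖(1 - M.massRatio s t i) • M.gradK t K V‖
          ≤ a * (t - s) * ((1 + G) * ‖M.gradK s K V‖) := by
        rw [norm_smul, Real.norm_eq_abs, abs_of_nonneg (by linarith [(hrat i).2])]
        have h5 : 1 - M.massRatio s t i ≤ a * (t - s) := by linarith [(hrat i).1]
        gcongr
      linarith
    refine (Finset.sum_le_sum hK).trans (le_of_eq ?_)
    rw [← Finset.mul_sum, Finset.sum_add_distrib, ← Finset.mul_sum, ← Finset.mul_sum,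
      (hR.isProper hT hρ hs).sum_dArea_sq]
    ring

/-- The constant is assembled from velocity bounds, the curvature bound `N` and `ρ` before any mesh
is introduced, which is the required uniformity. -/
theorem IsRegular.exists_stepControl (S : EvolvingSurface T) (hT : 0 ≤ T) {ρ L N : ℝ} (hρ : 0 < ρ)
    (hV : S.VelBound L) (hN0 : 0 ≤ N) (hN : HasQuadNormals S.Γ₀ N) :
    ∃ C, 0 ≤ C ∧ ∀ M : EvolvingTriangulation S, M.IsRegular ρ → ∀ s ∈ Icc 0 T, ∀ t ∈ Icc 0 T,
      s < t → t - s ≤ 1 → M.StepControl C s t := by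
  have hL := hV.one_le
  obtain ⟨A, hAdef⟩ : ∃ A, A = 20 * L * ((8 * N / ρ ^ 2 + 4 * L / ρ ^ 2) * Real.exp (5 * L * T))
    + 4 * L / ρ ^ 2 := ⟨_, rfl⟩
  have hA : 0 ≤ A := by rw [hAdef]; positivity
  obtain ⟨a, had⟩ : ∃ a, a = 2 * L / ρ ^ 4 := ⟨_, rfl⟩
  have ha : 0 ≤ a := by rw [had]; positivity
  obtain ⟨G, hGd⟩ : ∃ G, G = 2 * L / ρ ^ 2 := ⟨_, rfl⟩
  have hG : 0 ≤ G := by rw [hGd]; positivity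
  obtain ⟨B, hBd⟩ : ∃ B, B = 2 * A / ρ ^ 6 := ⟨_, rfl⟩
  have hκ : 0 ≤ refArea / refBary := _root_.div_nonneg refArea_pos.le refBary_pos.le
  obtain ⟨G₂, hG2⟩ : ∃ G₂, G₂ = G + G + G * G := ⟨_, rfl⟩
  obtain ⟨G₃, hG3⟩ : ∃ G₃, G₃ = 1 + G₂ + 1 * G₂ := ⟨_, rfl⟩
  obtain ⟨G₄, hG4⟩ : ∃ G₄, G₄ = a + G₃ + a * G₃ := ⟨_, rfl⟩
  obtain ⟨P, hP⟩ : ∃ P, P = (1 + a) * (4 * B ^ 2) * (refArea / refBary) := ⟨_, rfl⟩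
  obtain ⟨Q, hQ⟩ : ∃ Q, Q = (1 + a) * (2 * (a ^ 2 * (1 + G) ^ 2)) := ⟨_, rfl⟩
  have hG20 : 0 ≤ G₂ := by rw [hG2]; positivity
  have hG30 : 0 ≤ G₃ := by rw [hG3]; positivity
  have hG40 : 0 ≤ G₄ := by rw [hG4]; positivity
  have hP0 : 0 ≤ P := by rw [hP]; positivity
  have hQ0 : 0 ≤ Q := by rw [hQ]; positivity
  obtain ⟨C, hC⟩ : ∃ C, C = a + G₄ + P + Q := ⟨_, rfl⟩
  refine ⟨C, by rw [hC]; positivity, fun M hR s hs t ht hst hτ1 => ?_⟩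
  have hPs := hR.isProper hT hρ hs
  have hmass := hR.mass_sub_le hT hρ hV hs ht hst.le hs
  have hrat := hR.massRatio_mem hT hρ hV hs ht hst.le
  have hτ0 : 0 < t - s := sub_pos.2 hst
  have haC : a * (t - s) ≤ C * (t - s) := by gcongr; linarith
  have hGC : G₄ ≤ C := by linarith
  have hPC : P ≤ C := by linarith
  have hQC : Q ≤ C := by linarith
  have hstiff := fun V => hR.stiffForm_massRatio_le hT hρ hV hA
    (fun u hu K hK K' hK' i hi hi' => by
      rw [hAdef]; exact hR.abs_divK_sub_divK_le hT hρ hV hN0 hN hu hK hK' hi hi')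
    hs ht hst hτ1 had hGd hBd hG2 hG3 hG4 V
  rw [← hP, ← hQ] at hstiff
  rw [← had] at hmass hrat
  refine ⟨hR.mass_mono hT hρ hs ht hst.le, fun i => ?_, fun i => ?_, fun V => ?_, fun V => ?_⟩
  · have h2 := mul_le_mul_of_nonneg_right haC (hPs.mass_pos i).le
    linarith [hmass i]
  · linarith [(hrat i).1]
  · have h1 := stiffForm_nonneg (M := M) s V
    have h2 := wsum_nonneg hPs.mass_pos V
    exact (hstiff V).1.trans (by gcongr)
  · have h1 := stiffForm_nonneg (M := M) s V
    have h2 := wsum_nonneg hPs.mass_pos V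
    refine (hstiff V).2.trans ?_
    calc _ ≤ (t - s) ^ 2 * (C * M.stiffForm s V V + C * wsum (M.mass s) V V) := by gcongr
      _ = _ := by ring

end EvolvingTriangulation

/-! ### Level-set charts and unit normals of a `C²` surface. -/

/-- Near `x₀` the surface `Γ` is the zero set of `γ`, and `n` is a field of unit normals. -/
structure IsNormalChart (Γ : Set E3) (x₀ : E3) (δ L : ℝ) (n : E3 → E3) (γ : E3 → ℝ) : Prop where
  contDiffOn : ContDiffOn ℝ 1 n (ball x₀ δ)
  norm_eq : ∀ z ∈ ball x₀ δ, ‖n z‖ = 1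
  norm_fderiv : ∀ z ∈ ball x₀ δ, ‖fderiv ℝ n z‖ ≤ L
  quad : ∀ z ∈ Γ, z ∈ ball x₀ δ → ∀ w ∈ Γ, |⟪n z, w - z⟫| ≤ L * ‖w - z‖ ^ 2
  continuousOn : ContinuousOn γ (ball x₀ δ)
  mem_iff : ∀ z ∈ ball x₀ δ, z ∈ Γ ↔ γ z = 0
  pos : ∀ z ∈ ball x₀ δ, L * ‖z - x₀‖ ^ 2 < ⟪n x₀, z - x₀⟫ → 0 < γ z
  neg : ∀ z ∈ ball x₀ δ, ⟪n x₀, z - x₀⟫ < -(L * ‖z - x₀‖ ^ 2) → γ z < 0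

theorem IsNormalChart.mono {Γ : Set E3} {x₀ : E3} {δ L δ' L' : ℝ} {n : E3 → E3} {γ : E3 → ℝ}
    (h : IsNormalChart Γ x₀ δ L n γ) (hδ : δ' ≤ δ) (hL : L ≤ L') :
    IsNormalChart Γ x₀ δ' L' n γ := by
  have hb : ball x₀ δ' ⊆ ball x₀ δ := ball_subset_ball hδ
  have hq (z : E3) : L * ‖z‖ ^ 2 ≤ L' * ‖z‖ ^ 2 := by gcongr
  exact ⟨h.contDiffOn.mono hb, fun z hz => h.norm_eq z (hb hz),
    fun z hz => (h.norm_fderiv z (hb hz)).trans hL,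
    fun z hz hzb w hw => (h.quad z hz (hb hzb) w hw).trans (hq _),
    h.continuousOn.mono hb, fun z hz => h.mem_iff z (hb hz),
    fun z hz hlt => h.pos z (hb hz) ((hq _).trans_lt hlt),
    fun z hz hlt => h.neg z (hb hz) (hlt.trans_le (neg_le_neg (hq _)))⟩

theorem IsNormalChart.lipschitz {Γ : Set E3} {x₀ : E3} {δ L : ℝ} {n : E3 → E3} {γ : E3 → ℝ}
    (h : IsNormalChart Γ x₀ δ L n γ) {z w : E3} (hz : z ∈ ball x₀ δ) (hw : w ∈ ball x₀ δ) :
    ‖n w - n z‖ ≤ L * ‖w - z‖ :=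
  (convex_ball x₀ δ).norm_image_sub_le_of_norm_fderiv_le
    (fun z hz => (h.contDiffOn.differentiableOn one_ne_zero).differentiableAt
      (isOpen_ball.mem_nhds hz)) h.norm_fderiv hz hw

/-- The normal field is the normalised gradient of a local defining function `g`. Taylor's formula
for `g`, divided by the length of its gradient, gives the quadratic estimate between points of `Γ`
and the sign of `g` away from the tangent plane. One ball works for all nearby base points. -/
theorem IsClosedC2Surface.exists_chart_nhds {Γ : Set E3} (hΓ : IsClosedC2Surface Γ) {x : E3}
    (hx : x ∈ Γ) : ∃ δ L, 0 < δ ∧ 1 ≤ L ∧ ∀ x₀ ∈ ball x δ, x₀ ∈ Γ →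
      ∃ n γ, IsNormalChart Γ x₀ δ L n γ := by
  obtain ⟨U, g, hU, hxU, hg, hg0, hΓU⟩ := hΓ.locally_levelSet x hx
  obtain ⟨R, hR, hRU⟩ := Metric.isOpen_iff.1 hU x hxU
  set δ := R / 5 with hδ
  have hδ0 : 0 < δ := by positivity
  have hc : IsCompact (closedBall x (4 * δ)) := isCompact_closedBall _ _
  have hcU : closedBall x (4 * δ) ⊆ U :=
    (closedBall_subset_ball (by rw [hδ]; linarith)).trans hRU
  set G : E3 → E3 := fun z => (InnerProductSpace.toDual ℝ E3).symm (fderiv ℝ g z) with hG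
  have hGi : ∀ z v, ⟪G z, v⟫ = fderiv ℝ g z v := fun z v => by
    rw [hG]; exact InnerProductSpace.toDual_symm_apply
  have hfd : ContDiffOn ℝ 1 (fderiv ℝ g) U := hg.fderiv_of_isOpen hU (by norm_num)
  have hGc : ContDiffOn ℝ 1 G U :=
    (InnerProductSpace.toDual ℝ E3).symm.toContinuousLinearEquiv.contDiff.comp_contDiffOn hfd
  have hGn : ∀ z, ‖G z‖ = ‖fderiv ℝ g z‖ := fun z => by
    rw [hG]; exact LinearIsometryEquiv.norm_map _ _
  have hGne : ∀ z ∈ U, G z ≠ 0 := fun z hz => by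
    rw [← norm_ne_zero_iff, hGn, norm_ne_zero_iff]; exact hg0 z hz
  set n : E3 → E3 := fun z => ‖G z‖⁻¹ • G z with hn
  have hnc : ContDiffOn ℝ 1 n U :=
    ((hGc.norm ℝ hGne).inv fun z hz => norm_ne_zero_iff.2 (hGne z hz)).smul hGc
  -- bounds on the compact ball
  obtain ⟨L₁, hL₁⟩ := hc.exists_bound_of_continuousOn
    ((hnc.continuousOn_fderiv_of_isOpen hU le_rfl).mono hcU)
  obtain ⟨L₂, hL₂⟩ := hc.exists_bound_of_continuousOn
    ((hfd.continuousOn_fderiv_of_isOpen hU le_rfl).mono hcU)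
  obtain ⟨L₃, hL₃⟩ := hc.exists_bound_of_continuousOn (f := fun z => ‖G z‖⁻¹)
    (((hGc.continuousOn.norm).inv₀ fun z hz => norm_ne_zero_iff.2 (hGne z hz)).mono hcU)
  have hx4 : x ∈ closedBall x (4 * δ) := mem_closedBall_self (by positivity)
  have hL20 : 0 ≤ L₂ := (norm_nonneg _).trans (hL₂ x hx4)
  have hL30 : 0 ≤ L₃ := (norm_nonneg _).trans (hL₃ x hx4)
  have htaylor : ∀ z ∈ closedBall x (4 * δ), ∀ w ∈ closedBall x (4 * δ),
      |g w - g z - ⟪G z, w - z⟫| ≤ L₂ * ‖w - z‖ ^ 2 := by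
    intro z hz w hw
    rw [hGi]
    refine norm_taylor_le (convex_closedBall x (4 * δ)) hL20
      (fun y hy => (hg.differentiableOn two_ne_zero).differentiableAt (hU.mem_nhds (hcU hy)))
      (fun y hy => ?_) hz hw
    exact (convex_closedBall x (4 * δ)).norm_image_sub_le_of_norm_fderiv_le
      (fun u hu => (hfd.differentiableOn one_ne_zero).differentiableAt (hU.mem_nhds (hcU hu)))
      hL₂ hz hy
  set L := max 1 (max L₁ (max (L₂ * L₃) (1 / δ))) with hL
  have hLL1 : L₁ ≤ L := (le_max_left _ _).trans (le_max_right _ _)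
  have hLL2 : L₂ * L₃ ≤ L :=
    (le_max_left _ _).trans ((le_max_right _ _).trans (le_max_right _ _))
  have hLδ : 1 / δ ≤ L := (le_max_right _ _).trans ((le_max_right _ _).trans (le_max_right _ _))
  refine ⟨δ, L, hδ0, le_max_left _ _, fun x₀ hx₀ hx₀Γ => ⟨n, g, ?_⟩⟩
  have hb : ball x₀ δ ⊆ closedBall x (2 * δ) := fun z hz => by
    rw [mem_closedBall]
    have := dist_triangle z x₀ x
    rw [mem_ball] at hz hx₀
    linarith
  have hb4 : ball x₀ δ ⊆ closedBall x (4 * δ) :=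
    hb.trans (closedBall_subset_closedBall (by linarith))
  have hbU : ball x₀ δ ⊆ U := hb4.trans hcU
  have hmem : ∀ z ∈ U, z ∈ Γ ↔ g z = 0 := fun z hz =>
    ⟨fun h => (hΓU.subset ⟨h, hz⟩).2, fun h => (hΓU.superset ⟨hz, h⟩).1⟩
  have hn1 : ∀ z ∈ U, ‖n z‖ = 1 := fun z hz => by
    rw [hn]; simp only [norm_smul, norm_inv, norm_norm]
    exact inv_mul_cancel₀ (norm_ne_zero_iff.2 (hGne z hz))
  have hx₀b : x₀ ∈ ball x₀ δ := mem_ball_self hδ0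
  -- the Taylor expansion divided by the norm of the gradient
  have hdiv : ∀ z ∈ closedBall x (4 * δ), ∀ w ∈ closedBall x (4 * δ),
      |‖G z‖⁻¹ * (g w - g z) - ⟪n z, w - z⟫| ≤ L * ‖w - z‖ ^ 2 := by
    intro z hz w hw
    have e : ‖G z‖⁻¹ * (g w - g z) - ⟪n z, w - z⟫
        = ‖G z‖⁻¹ * (g w - g z - ⟪G z, w - z⟫) := by
      rw [hn]; simp only [inner_smul_left, conj_trivial]; ring
    rw [e, abs_mul]
    calc _ ≤ L₃ * (L₂ * ‖w - z‖ ^ 2) := by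
          gcongr
          · exact hL₃ z hz
          · exact htaylor z hz w hw
      _ = L₂ * L₃ * ‖w - z‖ ^ 2 := by ring
      _ ≤ _ := by gcongr
  have hgx₀ : g x₀ = 0 := (hmem x₀ (hbU hx₀b)).1 hx₀Γ
  have hGpos : 0 < ‖G x₀‖⁻¹ := inv_pos.2 (norm_pos_iff.2 (hGne _ (hbU hx₀b)))
  refine ⟨hnc.mono hbU, fun z hz => hn1 z (hbU hz), fun z hz => (hL₁ z (hb4 hz)).trans hLL1,
    fun z hzΓ hz w hw => ?_, hg.continuousOn.mono hbU, fun z hz => hmem z (hbU hz),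
    fun z hz hlt => ?_, fun z hz hlt => ?_⟩
  · by_cases hw4 : w ∈ closedBall x (4 * δ)
    · have := hdiv z (hb4 hz) w hw4
      rwa [(hmem z (hbU hz)).1 hzΓ, (hmem w (hcU hw4)).1 hw, sub_zero, mul_zero, zero_sub,
        abs_neg] at this
    -- Outside the large ball the quadratic bound is trivial, because `‖w - z‖ ≥ δ` and `L ≥ 1/δ`.
    -- It thus holds against all of `Γ` and not just a local piece, as needed for closest points.
    · have h1 : δ ≤ ‖w - z‖ := by
        rw [← dist_eq_norm]
        have h2 := hb hz
        rw [mem_closedBall] at h2 hw4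
        have := dist_triangle w z x
        push Not at hw4
        linarith
      have h3 := abs_real_inner_le_norm (n z) (w - z)
      rw [hn1 z (hbU hz), one_mul] at h3
      refine h3.trans ?_
      have h4 : 1 ≤ L * δ := by rwa [div_le_iff₀ hδ0] at hLδ
      have hL0 : 0 ≤ L := zero_le_one.trans (le_max_left _ _)
      calc ‖w - z‖ ≤ L * δ * ‖w - z‖ := le_mul_of_one_le_left (norm_nonneg _) h4
        _ ≤ L * ‖w - z‖ * ‖w - z‖ := by gcongr
        _ = _ := by ring
  · have := (abs_le.1 (hdiv x₀ (hb4 hx₀b) z (hb4 hz))).1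
    rw [hgx₀, sub_zero] at this
    exact pos_of_mul_pos_right (by linarith) hGpos.le
  · have := (abs_le.1 (hdiv x₀ (hb4 hx₀b) z (hb4 hz))).2
    rw [hgx₀, sub_zero] at this
    by_contra hcon
    push Not at hcon
    have := mul_nonneg hGpos.le hcon
    linarith

/-- Charts of uniform size around all points of the surface. -/
theorem IsClosedC2Surface.exists_chart {Γ : Set E3} (hΓ : IsClosedC2Surface Γ) :
    ∃ δ L, 0 < δ ∧ 1 ≤ L ∧ ∀ x₀ ∈ Γ, ∃ n γ, IsNormalChart Γ x₀ δ L n γ := by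
  suffices h : ∃ δ L, 0 < δ ∧ 1 ≤ L ∧ ∀ x₀ ∈ Γ, x₀ ∈ Γ → ∃ n γ, IsNormalChart Γ x₀ δ L n γ by
    obtain ⟨δ, L, hδ, hL, h⟩ := h
    exact ⟨δ, L, hδ, hL, fun x₀ hx => h x₀ hx hx⟩
  refine hΓ.isCompact.induction_on (p := fun s => ∃ δ L, 0 < δ ∧ 1 ≤ L ∧ ∀ x₀ ∈ s, x₀ ∈ Γ →
    ∃ n γ, IsNormalChart Γ x₀ δ L n γ) ⟨1, 1, one_pos, le_rfl, fun x h => absurd h (notMem_empty x)⟩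
    ?_ ?_ ?_
  · rintro s t hst ⟨δ, L, hδ, hL, h⟩
    exact ⟨δ, L, hδ, hL, fun x hx => h x (hst hx)⟩
  · rintro s t ⟨δ, L, hδ, hL, h⟩ ⟨δ', L', hδ', hL', h'⟩
    refine ⟨min δ δ', max L L', lt_min hδ hδ', hL.trans (le_max_left _ _), ?_⟩
    rintro x (hx | hx) hxΓ
    · obtain ⟨n, γ, hn⟩ := h x hx hxΓ
      exact ⟨n, γ, hn.mono (min_le_left _ _) (le_max_left _ _)⟩
    · obtain ⟨n, γ, hn⟩ := h' x hx hxΓ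
      exact ⟨n, γ, hn.mono (min_le_right _ _) (le_max_right _ _)⟩
  · intro x hx
    obtain ⟨δ, L, hδ, hL, h⟩ := hΓ.exists_chart_nhds hx
    exact ⟨ball x δ, mem_nhdsWithin_of_mem_nhds (ball_mem_nhds x hδ), δ, L, hδ, hL, h⟩

theorem hasQuadNormals_of_chart {Γ : Set E3} {δ L : ℝ} (hδ : 0 < δ)
    (h : ∀ x₀ ∈ Γ, ∃ n γ, IsNormalChart Γ x₀ δ L n γ) : HasQuadNormals Γ L := by
  intro x hx
  obtain ⟨n, γ, hn⟩ := h x hx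
  exact ⟨n x, hn.norm_eq x (mem_ball_self hδ), hn.quad x hx (mem_ball_self hδ)⟩

/-! ### Nearly flat patches and their area. -/

theorem euclideanHausdorffMeasure_image_le {X Y : Type*} [MetricSpace X] [MeasurableSpace X]
    [BorelSpace X] [MetricSpace Y] [MeasurableSpace Y] [BorelSpace Y] {K : NNReal} {f : X → Y}
    {s : Set X} (h : LipschitzOnWith K f s) :
    μHE[2] (f '' s) ≤ (K : ENNReal) ^ 2 * μHE[2] s := by
  have h1 := h.hausdorffMeasure_image_le (d := 2) (by norm_num)
  rw [ENNReal.rpow_ofNat] at h1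
  simp only [Measure.euclideanHausdorffMeasure_def, Measure.smul_apply, ENNReal.smul_def,
    smul_eq_mul, Nat.cast_ofNat]
  rw [mul_left_comm]
  gcongr

/-- `f₁, f₂, ν` is a positively oriented orthonormal frame. -/
structure IsFrame (f₁ f₂ ν : E3) : Prop where
  norm_fst : ‖f₁‖ = 1
  norm_snd : ‖f₂‖ = 1
  inner_eq : ⟪f₁, f₂⟫ = 0
  eq_cr : ν = cr f₁ f₂

theorem cr_cr_right (a b : E3) : cr a (cr b a) = ⟪a, a⟫ • b - ⟪a, b⟫ • a := by
  apply E3_ext <;> simp only [inner3, PiLp.smul_apply, PiLp.sub_apply, smul_eq_mul, cr_zero_coord,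
    cr_one_coord, cr_two_coord] <;> ring

theorem isFrame_of_inner_eq_zero {f ν : E3} (hf : ‖f‖ = 1) (hν : ‖ν‖ = 1) (h : ⟪f, ν⟫ = 0) :
    IsFrame f (cr ν f) ν := by
  refine ⟨hf, ?_, ?_, ?_⟩
  · refine (sq_eq_sq₀ (norm_nonneg _) zero_le_one).1 ?_
    rw [norm_cr_sq, hf, hν, real_inner_comm, h]; norm_num
  · rw [real_inner_comm, inner_cr_right]
  · rw [cr_cr_right, h, real_inner_self_eq_norm_sq, hf]; simp

theorem exists_unit_inner_eq_zero {ν : E3} (hν : ‖ν‖ = 1) : ∃ f : E3, ‖f‖ = 1 ∧ ⟪f, ν⟫ = 0 := by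
  obtain ⟨w, hw⟩ : ∃ w, cr ν w ≠ 0 := by
    by_contra hcon
    push Not at hcon
    have h0 := congrArg (fun v : E3 => v 1) (hcon !₂[1, 0, 0])
    have h1 := congrArg (fun v : E3 => v 2) (hcon !₂[0, 1, 0])
    have h2 := congrArg (fun v : E3 => v 2) (hcon !₂[1, 0, 0])
    have h3 := norm3_sq ν
    simp at h0 h1 h2
    rw [hν, h0, h1, h2] at h3
    norm_num at h3
  refine ⟨‖cr ν w‖⁻¹ • cr ν w, ?_, ?_⟩
  · rw [norm_smul, norm_inv, norm_norm, inv_mul_cancel₀ (norm_ne_zero_iff.2 hw)]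
  · rw [inner_smul_left, inner_cr_left, mul_zero]

namespace IsFrame
variable {f₁ f₂ ν : E3} (h : IsFrame f₁ f₂ ν)
include h

theorem norm_normal : ‖ν‖ = 1 := by
  refine (sq_eq_sq₀ (norm_nonneg _) zero_le_one).1 ?_
  rw [h.eq_cr, norm_cr_sq, h.norm_fst, h.norm_snd, h.inner_eq]; norm_num

theorem inner_fst : ⟪f₁, ν⟫ = 0 := by rw [h.eq_cr, real_inner_comm, inner_cr_left]
theorem inner_snd : ⟪f₂, ν⟫ = 0 := by rw [h.eq_cr, real_inner_comm, inner_cr_right]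

theorem expand (v : E3) : v = ⟪v, f₁⟫ • f₁ + ⟪v, f₂⟫ • f₂ + ⟪v, ν⟫ • ν := by
  have := cramer f₁ f₂ ν v
  have e0 : ⟪cr f₁ f₂, ν⟫ = 1 := by
    rw [← h.eq_cr, real_inner_self_eq_norm_sq, h.norm_normal]; norm_num
  have e1 : ⟪cr v f₂, ν⟫ = ⟪v, f₁⟫ := by
    rw [h.eq_cr, inner_cr_cr, real_inner_self_eq_norm_sq, h.norm_snd, real_inner_comm f₁ f₂,
      h.inner_eq]; ring
  have e2 : ⟪cr f₁ v, ν⟫ = ⟪v, f₂⟫ := by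
    rw [h.eq_cr, inner_cr_cr, real_inner_self_eq_norm_sq, h.norm_fst, h.inner_eq]; ring
  rw [e0, e1, e2, one_smul, ← h.eq_cr, real_inner_comm v ν] at this
  exact this

theorem norm_sq (v : E3) : ‖v‖ ^ 2 = ⟪v, f₁⟫ ^ 2 + ⟪v, f₂⟫ ^ 2 + ⟪v, ν⟫ ^ 2 := by
  rw [← real_inner_self_eq_norm_sq]
  conv_lhs => rw [h.expand v]
  simp only [inner_add_left, inner_add_right, inner_smul_left, inner_smul_right, conj_trivial,
    real_inner_self_eq_norm_sq, h.norm_fst, h.norm_snd, h.norm_normal, h.inner_eq, h.inner_fst,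
    h.inner_snd, real_inner_comm f₁ f₂, real_inner_comm f₁ ν, real_inner_comm f₂ ν]
  ring

end IsFrame

/-- Rescaled orthogonal coordinates in the plane through `c` spanned by `f₁, f₂`. -/
def frameCoord (c f₁ f₂ : E3) (r : ℝ) (y : E3) : E2 := !₂[⟪y - c, f₁⟫ / r, ⟪y - c, f₂⟫ / r]

theorem frameCoord_continuous (c f₁ f₂ : E3) (r : ℝ) : Continuous (frameCoord c f₁ f₂ r) := by
  refine (PiLp.continuous_toLp 2 _).comp (continuous_pi fun i => ?_)
  fin_cases i <;> simp <;> fun_prop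

theorem norm2_sq (s : E2) : ‖s‖ ^ 2 = s 0 ^ 2 + s 1 ^ 2 := by
  rw [EuclideanSpace.norm_sq_eq, Fin.sum_univ_two]; simp

theorem IsFrame.norm_sub_sq {f₁ f₂ ν : E3} (h : IsFrame f₁ f₂ ν) {r : ℝ} (hr : 0 < r)
    (c w z : E3) : ‖w - z‖ ^ 2
      = r ^ 2 * ‖frameCoord c f₁ f₂ r w - frameCoord c f₁ f₂ r z‖ ^ 2 + ⟪w - z, ν⟫ ^ 2 := by
  rw [h.norm_sq (w - z), norm2_sq]
  have e : ∀ f : E3, ⟪w - z, f⟫ = ⟪w - c, f⟫ - ⟪z - c, f⟫ := fun f => by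
    rw [← inner_sub_left]; congr 1; abel
  rw [e f₁, e f₂]
  simp only [frameCoord, PiLp.sub_apply, Matrix.cons_val_zero, Matrix.cons_val_one]
  field_simp

/-- The part of `Γ` in `ball c (2 r)` is a nearly flat graph over a planar domain that contains
the disc of radius `r`. -/
structure IsPatch (Γ : Set E3) (c f₁ f₂ ν : E3) (r κ : ℝ) : Prop where
  frame : IsFrame f₁ f₂ ν
  r_pos : 0 < r
  κ_nonneg : 0 ≤ κ
  κ_le : κ ≤ 1 / 2
  flat : ∀ w ∈ Γ ∩ ball c (2 * r), ∀ z ∈ Γ ∩ ball c (2 * r), |⟪w - z, ν⟫| ≤ κ * ‖w - z‖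
  height : ∀ z ∈ Γ ∩ ball c (2 * r), |⟪z - c, ν⟫| ≤ κ * r
  surj : ∀ z, ⟪z - c, ν⟫ = 0 → ‖z - c‖ < r → ∃ a, |a| < r ∧ z + a • ν ∈ Γ

namespace IsPatch
variable {Γ : Set E3} {c f₁ f₂ ν : E3} {r κ : ℝ} (h : IsPatch Γ c f₁ f₂ ν r κ)
include h

theorem norm_coord_sub_le (w z : E3) :
    ‖frameCoord c f₁ f₂ r w - frameCoord c f₁ f₂ r z‖ ≤ r⁻¹ * ‖w - z‖ := by
  have hr := h.r_pos
  refine abs_le_of_sq_le_sq' ?_ (by positivity) |>.2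
  rw [mul_pow, h.frame.norm_sub_sq hr c w z]
  have e : r⁻¹ ^ 2 * (r ^ 2 * ‖frameCoord c f₁ f₂ r w - frameCoord c f₁ f₂ r z‖ ^ 2
      + ⟪w - z, ν⟫ ^ 2) = ‖frameCoord c f₁ f₂ r w - frameCoord c f₁ f₂ r z‖ ^ 2
        + r⁻¹ ^ 2 * ⟪w - z, ν⟫ ^ 2 := by field_simp
  rw [e]
  have : 0 ≤ r⁻¹ ^ 2 * ⟪w - z, ν⟫ ^ 2 := by positivity
  linarith

/-- The normal component is at most `κ` times the distance, so Pythagoras leaves `(1 - κ²)‖w - z‖²`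
for the planar part, and `1/(1 - κ²) ≤ 1 + 2κ²` for `κ ≤ 1/2`. -/
theorem norm_sub_le {w z : E3} (hw : w ∈ Γ ∩ ball c (2 * r)) (hz : z ∈ Γ ∩ ball c (2 * r)) :
    ‖w - z‖ ≤ r * √(1 + 2 * κ ^ 2) * ‖frameCoord c f₁ f₂ r w - frameCoord c f₁ f₂ r z‖ := by
  have hr := h.r_pos
  have hκ := h.κ_nonneg
  have hκ1 := h.κ_le
  have h1 := h.frame.norm_sub_sq hr c w z
  have h2 : ⟪w - z, ν⟫ ^ 2 ≤ κ ^ 2 * ‖w - z‖ ^ 2 := by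
    rw [← sq_abs, ← mul_pow]
    exact pow_le_pow_left₀ (abs_nonneg _) (h.flat w hw z hz) 2
  refine abs_le_of_sq_le_sq' ?_ (by positivity) |>.2
  rw [mul_pow, mul_pow, Real.sq_sqrt (by positivity)]
  have h3 : κ ^ 2 ≤ 1 / 4 := by nlinarith
  set X := r ^ 2 * ‖frameCoord c f₁ f₂ r w - frameCoord c f₁ f₂ r z‖ ^ 2
  have h4 : (1 - κ ^ 2) * ‖w - z‖ ^ 2 ≤ X := by linarith
  have h5 : 1 ≤ (1 + 2 * κ ^ 2) * (1 - κ ^ 2) := by nlinarith [sq_nonneg κ]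
  calc ‖w - z‖ ^ 2 ≤ (1 + 2 * κ ^ 2) * (1 - κ ^ 2) * ‖w - z‖ ^ 2 :=
        le_mul_of_one_le_left (sq_nonneg _) h5
    _ = (1 + 2 * κ ^ 2) * ((1 - κ ^ 2) * ‖w - z‖ ^ 2) := by ring
    _ ≤ (1 + 2 * κ ^ 2) * X := by gcongr
    _ = _ := by ring

theorem injOn : InjOn (frameCoord c f₁ f₂ r) (Γ ∩ ball c (2 * r)) := fun w hw z hz he => by
  have := h.norm_sub_le hw hz
  rw [he, sub_self, norm_zero, mul_zero, norm_le_zero_iff, sub_eq_zero] at this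
  exact this

theorem volume_image_le (s : Set E3) :
    ENNReal.ofReal (r ^ 2) * volume (frameCoord c f₁ f₂ r '' s) ≤ surfaceMeasure s := by
  have hr := h.r_pos
  have hl : LipschitzOnWith (r⁻¹).toNNReal (frameCoord c f₁ f₂ r) s :=
    LipschitzOnWith.of_dist_le_mul fun w _ z _ => by
      rw [Real.coe_toNNReal _ (inv_pos.2 hr).le, dist_eq_norm, dist_eq_norm]
      exact h.norm_coord_sub_le w z
  have := euclideanHausdorffMeasure_image_le hl
  rw [EuclideanSpace.euclideanHausdorffMeasure_eq_volume] at this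
  calc _ ≤ ENNReal.ofReal (r ^ 2) * (((r⁻¹).toNNReal : ENNReal) ^ 2 * surfaceMeasure s) := by
        gcongr; exact this
    _ = surfaceMeasure s := by
        rw [← mul_assoc, ← ENNReal.ofReal, ← ENNReal.ofReal_pow (inv_pos.2 hr).le,
          ← ENNReal.ofReal_mul (by positivity), ← mul_pow, mul_inv_cancel₀ hr.ne', one_pow,
          ENNReal.ofReal_one, one_mul]

/-- The inverse of the planar coordinates is Lipschitz with constant `r√(1 + 2κ²)`. Together with
the lower bound, area is distorted only to second order in `κ`. -/
theorem surfaceMeasure_le {s : Set E3} (hs : s ⊆ Γ ∩ ball c (2 * r)) :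
    surfaceMeasure s
      ≤ ENNReal.ofReal (r ^ 2 * (1 + 2 * κ ^ 2)) * volume (frameCoord c f₁ f₂ r '' s) := by
  have hr := h.r_pos
  have hK : 0 ≤ r * √(1 + 2 * κ ^ 2) := by positivity
  set g := Function.invFunOn (frameCoord c f₁ f₂ r) s with hg
  have hinj := h.injOn.mono hs
  have hgs : g '' (frameCoord c f₁ f₂ r '' s) = s := by
    rw [image_image]
    exact (image_congr fun x hx => hinj.leftInvOn_invFunOn hx).trans (image_id s)
  have hl : LipschitzOnWith (r * √(1 + 2 * κ ^ 2)).toNNReal g (frameCoord c f₁ f₂ r '' s) := by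
    refine LipschitzOnWith.of_dist_le_mul ?_
    rintro _ ⟨w, hw, rfl⟩ _ ⟨z, hz, rfl⟩
    have hw' : g (frameCoord c f₁ f₂ r w) = w := hinj.leftInvOn_invFunOn hw
    have hz' : g (frameCoord c f₁ f₂ r z) = z := hinj.leftInvOn_invFunOn hz
    rw [Real.coe_toNNReal _ hK, dist_eq_norm, dist_eq_norm, hw', hz']
    exact h.norm_sub_le (hs hw) (hs hz)
  have := euclideanHausdorffMeasure_image_le hl
  rw [hgs, EuclideanSpace.euclideanHausdorffMeasure_eq_volume, ← ENNReal.ofReal,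
    ← ENNReal.ofReal_pow hK, mul_pow, Real.sq_sqrt (by positivity)] at this
  exact this

/-- Over each planar position `surj` provides a point of `Γ` at height below `r`, hence still inside
the ball of radius `2r`. -/
theorem image_coord_eq {E : Set E2} (hE : E ⊆ ball 0 1) :
    frameCoord c f₁ f₂ r '' (Γ ∩ ball c (2 * r) ∩ frameCoord c f₁ f₂ r ⁻¹' E) = E := by
  have hr := h.r_pos
  refine Subset.antisymm (by rintro _ ⟨y, hy, rfl⟩; exact hy.2) fun s hs => ?_
  have hs1 : ‖s‖ < 1 := by simpa using hE hs
  set v := (r * s 0) • f₁ + (r * s 1) • f₂ with hv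
  have hvν : ⟪v, ν⟫ = 0 := by
    rw [hv, inner_add_left, inner_smul_left, inner_smul_left, h.frame.inner_fst,
      h.frame.inner_snd]; simp
  have hv1 : ⟪v, f₁⟫ = r * s 0 := by
    rw [hv, inner_add_left, inner_smul_left, inner_smul_left, real_inner_comm f₁ f₂,
      h.frame.inner_eq, real_inner_self_eq_norm_sq, h.frame.norm_fst]; simp
  have hv2 : ⟪v, f₂⟫ = r * s 1 := by
    rw [hv, inner_add_left, inner_smul_left, inner_smul_left,
      h.frame.inner_eq, real_inner_self_eq_norm_sq, h.frame.norm_snd]; simp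
  have hvn : ‖v‖ ^ 2 = r ^ 2 * ‖s‖ ^ 2 := by
    rw [h.frame.norm_sq, hvν, hv1, hv2, norm2_sq]; ring
  have hvr : ‖v‖ < r := by
    refine abs_lt_of_sq_lt_sq' ?_ hr.le |>.2
    rw [hvn]
    have : ‖s‖ ^ 2 < 1 := by nlinarith [norm_nonneg s]
    nlinarith [sq_pos_of_pos hr]
  obtain ⟨a, ha, haΓ⟩ := h.surj (c + v) (by rw [add_sub_cancel_left, hvν])
    (by rwa [add_sub_cancel_left])
  have hq : frameCoord c f₁ f₂ r (c + v + a • ν) = s := by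
    have e : c + v + a • ν - c = v + a • ν := by abel
    have e1 : ⟪v + a • ν, f₁⟫ = r * s 0 := by
      rw [inner_add_left, hv1, inner_smul_left, real_inner_comm f₁ ν, h.frame.inner_fst]; simp
    have e2 : ⟪v + a • ν, f₂⟫ = r * s 1 := by
      rw [inner_add_left, hv2, inner_smul_left, real_inner_comm f₂ ν, h.frame.inner_snd]; simp
    rw [frameCoord, e, e1, e2]
    ext i; fin_cases i <;> simp [hr.ne']
  refine ⟨c + v + a • ν, ⟨⟨haΓ, ?_⟩, by rw [mem_preimage, hq]; exact hs⟩, hq⟩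
  rw [mem_ball, dist_eq_norm, add_assoc, add_sub_cancel_left]
  refine (norm_add_le _ _).trans_lt ?_
  rw [norm_smul, h.frame.norm_normal, Real.norm_eq_abs]
  linarith

theorem surfaceMeasure_lt_top : surfaceMeasure (Γ ∩ ball c (2 * r)) < ⊤ := by
  have hr := h.r_pos
  refine (h.surfaceMeasure_le Subset.rfl).trans_lt (ENNReal.mul_lt_top ENNReal.ofReal_lt_top ?_)
  refine (measure_mono (t := closedBall 0 2) ?_).trans_lt measure_closedBall_lt_top
  rintro _ ⟨y, hy, rfl⟩
  have h1 := h.norm_coord_sub_le y c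
  have h2 : frameCoord c f₁ f₂ r c = 0 := by
    ext i; fin_cases i <;> simp [frameCoord]
  rw [h2, sub_zero] at h1
  rw [mem_closedBall_zero_iff]
  refine h1.trans ?_
  rw [inv_mul_le_iff₀ hr, ← dist_eq_norm]
  linarith [mem_ball.1 hy.2]

end IsPatch

/-! ### Patches from charts, and tangent planes. -/

section TangentPlane

open Filter
open scoped Topology

/-- Normals vary by `O(h)`, so `Γ` has slope `O(h)` over the plane orthogonal to `ν`. For
surjectivity, along a line in direction `ν` the level function is negative at `-ηh/2` and positive
at `ηh/2`, since the `O(h²)` deviation is smaller than `ηh/2`; the intermediate value theorem gives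
a point of `Γ`. The direction `ν` may differ from the surface normal by `Bh`, which permits patches
over the plane of a triangle. -/
theorem IsNormalChart.isPatch {Γ : Set E3} {x₀ : E3} {δ L : ℝ} {n : E3 → E3} {γ : E3 → ℝ}
    (hc : IsNormalChart Γ x₀ δ L n γ) (hx₀ : x₀ ∈ Γ) (hL : 0 ≤ L) {c f₁ f₂ ν : E3}
    (hf : IsFrame f₁ f₂ ν) {h η B : ℝ} (hh : 0 < h) (hη : 0 < η) (hη1 : η ≤ 1) (hB : 0 ≤ B)
    (hcν : ⟪c - x₀, ν⟫ = 0) (hcx : ‖c - x₀‖ ≤ h) (hν : ‖n x₀ - ν‖ ≤ B * h) (hδ : 3 * h ≤ δ)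
    (hκ : (9 * L + 3 * B) / η * h < 1 / 2) :
    IsPatch Γ c f₁ f₂ ν (η * h) ((9 * L + 3 * B) / η * h) := by
  have hrh : η * h ≤ h := by nlinarith
  have hsub : ball c (2 * (η * h)) ⊆ ball x₀ (3 * h) := fun z hz => by
    rw [mem_ball] at hz ⊢
    have := dist_triangle z c x₀
    rw [dist_eq_norm c x₀] at this
    linarith
  have hsubδ : ball x₀ (3 * h) ⊆ ball x₀ δ := ball_subset_ball hδ
  have hx₀b : x₀ ∈ ball x₀ δ := mem_ball_self (by linarith)
  have hκe : (9 * L + 3 * B) / η * h * (η * h) = (9 * L + 3 * B) * h ^ 2 := by field_simp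
  refine ⟨hf, by positivity, by positivity, hκ.le, fun w hw z hz => ?_, fun z hz => ?_,
    fun z hz hzr => ?_⟩
  · have hzb := hsub hz.2
    have hwz : ‖w - z‖ ≤ 4 * h := by
      rw [← dist_eq_norm]
      have := dist_triangle_right w z c
      linarith [mem_ball.1 hw.2, mem_ball.1 hz.2]
    have h1 := hc.quad z hz.1 (hsubδ hzb) w hw.1
    have h2 : ‖ν - n z‖ ≤ (B + 3 * L) * h := by
      have h3 := hc.lipschitz (hsubδ hzb) hx₀b
      have e : ν - n z = -(n x₀ - ν) + (n x₀ - n z) := by abel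
      rw [e]
      refine (norm_add_le _ _).trans ?_
      rw [norm_neg]
      have h4 : ‖x₀ - z‖ ≤ 3 * h := by
        rw [← dist_eq_norm, dist_comm]; exact (mem_ball.1 hzb).le
      have h5 : L * ‖x₀ - z‖ ≤ L * (3 * h) := by gcongr
      linarith
    have e : ⟪w - z, ν⟫ = ⟪n z, w - z⟫ + ⟪w - z, ν - n z⟫ := by
      rw [inner_sub_right (w - z) ν (n z), real_inner_comm (w - z) (n z)]; ring
    have h6 := abs_real_inner_le_norm (w - z) (ν - n z)
    rw [e]
    calc _ ≤ L * ‖w - z‖ ^ 2 + ‖w - z‖ * ‖ν - n z‖ :=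
          (abs_add_le _ _).trans (add_le_add h1 h6)
      _ ≤ L * (‖w - z‖ * (4 * h)) + ‖w - z‖ * ((B + 3 * L) * h) := by
          rw [sq]; gcongr
      _ = (7 * L + B) / 1 * h * ‖w - z‖ := by ring
      _ ≤ _ := by gcongr <;> linarith
  · have hzb := hsub hz.2
    have h1 := hc.quad x₀ hx₀ hx₀b z hz.1
    have hzx : ‖z - x₀‖ ≤ 3 * h := by rw [← dist_eq_norm]; exact (mem_ball.1 hzb).le
    have e : ⟪z - c, ν⟫ = ⟪n x₀, z - x₀⟫ - ⟪n x₀ - ν, z - x₀⟫ := by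
      have : z - c = (z - x₀) - (c - x₀) := by abel
      rw [this, inner_sub_left (z - x₀), hcν, inner_sub_left (n x₀) ν, real_inner_comm (z - x₀) ν]; ring
    have h6 := abs_real_inner_le_norm (n x₀ - ν) (z - x₀)
    rw [e, hκe]
    calc _ ≤ L * ‖z - x₀‖ ^ 2 + ‖n x₀ - ν‖ * ‖z - x₀‖ :=
          (abs_sub _ _).trans (add_le_add h1 h6)
      _ ≤ L * (3 * h) ^ 2 + B * h * (3 * h) := by gcongr
      _ = _ := by ring
  · have hr : 0 < η * h := by positivity
    set a₀ := η * h / 2 with ha₀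
    have hbd : ∀ a : ℝ, |a| ≤ a₀ → ‖z + a • ν - x₀‖ < 3 * h := by
      intro a ha
      have e : z + a • ν - x₀ = (z - c) + (c - x₀) + a • ν := by abel
      rw [e]
      refine (norm_add₃_le).trans_lt ?_
      rw [norm_smul, hf.norm_normal, Real.norm_eq_abs]
      linarith
    have hmem : ∀ a : ℝ, |a| ≤ a₀ → z + a • ν ∈ ball x₀ δ := fun a ha =>
      hsubδ (by rw [mem_ball, dist_eq_norm]; exact hbd a ha)
    have hin : ∀ a : ℝ, |a| ≤ a₀ → |⟪n x₀, z + a • ν - x₀⟫ - a| ≤ 3 * B * h ^ 2 := by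
      intro a ha
      have e : ⟪n x₀, z + a • ν - x₀⟫ - a = ⟪n x₀ - ν, z + a • ν - x₀⟫ := by
        have e1 : z + a • ν - x₀ = (z - c) + (c - x₀) + a • ν := by abel
        have e2 : ⟪ν, z + a • ν - x₀⟫ = a := by
          rw [e1, inner_add_right, inner_add_right, inner_smul_right, real_inner_comm, hz,
            real_inner_comm, hcν, real_inner_self_eq_norm_sq, hf.norm_normal]; ring
        rw [inner_sub_left, e2]
      rw [e]
      refine (abs_real_inner_le_norm _ _).trans ?_
      calc _ ≤ B * h * (3 * h) := by gcongr; exact (hbd a ha).le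
        _ = _ := by ring
    have hLq : ∀ a : ℝ, |a| ≤ a₀ → L * ‖z + a • ν - x₀‖ ^ 2 ≤ 9 * L * h ^ 2 := fun a ha => by
      calc _ ≤ L * (3 * h) ^ 2 := by gcongr; exact (hbd a ha).le
        _ = _ := by ring
    have hbig : (9 * L + 3 * B) * h ^ 2 < a₀ := by
      rw [← hκe, ha₀]; nlinarith
    have ha₀0 : 0 < a₀ := by positivity
    have hp : 0 < γ (z + a₀ • ν) := by
      have ha : |a₀| ≤ a₀ := (abs_of_pos ha₀0).le
      refine hc.pos _ (hmem _ ha) ?_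
      have := (abs_le.1 (hin a₀ ha)).1
      linarith [hLq a₀ ha]
    have hn : γ (z + (-a₀) • ν) < 0 := by
      have ha : |-a₀| ≤ a₀ := by rw [abs_neg]; exact (abs_of_pos ha₀0).le
      refine hc.neg _ (hmem _ ha) ?_
      have := (abs_le.1 (hin (-a₀) ha)).2
      linarith [hLq (-a₀) ha]
    have hcont : ContinuousOn (fun a : ℝ => γ (z + a • ν)) (Icc (-a₀) a₀) :=
      hc.continuousOn.comp (by fun_prop) fun a ha => hmem a (abs_le.2 ha)
    obtain ⟨a, ha, haγ⟩ := intermediate_value_Icc (by linarith) hcont ⟨hn.le, hp.le⟩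
    have ha' : |a| ≤ a₀ := abs_le.2 ha
    exact ⟨a, by rw [ha₀] at ha'; linarith, (hc.mem_iff _ (hmem a ha')).2 haγ⟩

/-- The patches around a point of the surface, in the direction of its normal. -/
theorem IsNormalChart.isPatch_self {Γ : Set E3} {x₀ : E3} {δ L : ℝ} {n : E3 → E3} {γ : E3 → ℝ}
    (hc : IsNormalChart Γ x₀ δ L n γ) (hx₀ : x₀ ∈ Γ) (hL : 1 ≤ L) (hδ0 : 0 < δ) {h : ℝ} (hh : 0 < h)
    (hδ : 3 * h ≤ δ) (hκ : 9 * L * h < 1 / 2) :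
    ∃ f₁ f₂, IsPatch Γ x₀ f₁ f₂ (n x₀) h (9 * L * h) := by
  have hn := hc.norm_eq x₀ (mem_ball_self hδ0)
  obtain ⟨f, hf, hfn⟩ := exists_unit_inner_eq_zero hn
  refine ⟨f, cr (n x₀) f, ?_⟩
  have := hc.isPatch hx₀ (by linarith) (isFrame_of_inner_eq_zero hf hn hfn) (c := x₀) (B := 0)
    hh one_pos le_rfl le_rfl (by simp) (by simpa using hh.le) (by simp) hδ (by simpa using hκ)
  simpa using this

theorem IsClosedC2Surface.surfaceMeasure_lt_top {Γ : Set E3} (hΓ : IsClosedC2Surface Γ) :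
    surfaceMeasure Γ < ⊤ := by
  obtain ⟨δ, L, hδ, hL, hch⟩ := hΓ.exists_chart
  have : surfaceMeasure (Γ ∩ Γ) < ⊤ := by
    refine hΓ.isCompact.induction_on (p := fun s => surfaceMeasure (Γ ∩ s) < ⊤) (by simp)
      (fun s t hst ht => (measure_mono (inter_subset_inter_right _ hst)).trans_lt ht)
      (fun s t hs ht => by
        rw [inter_union_distrib_left]
        exact (measure_union_le _ _).trans_lt (ENNReal.add_lt_top.2 ⟨hs, ht⟩)) fun x hx => ?_
    obtain ⟨n, γ, hc⟩ := hch x hx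
    set h := min (δ / 3) (1 / (36 * L)) with hh
    have hh0 : 0 < h := by positivity
    have h1 : 3 * h ≤ δ := by linarith [min_le_left (δ / 3) (1 / (36 * L))]
    have h2 : 9 * L * h < 1 / 2 := by
      have : h ≤ 1 / (36 * L) := min_le_right _ _
      rw [le_div_iff₀ (by positivity)] at this
      linarith
    obtain ⟨f₁, f₂, hp⟩ := hc.isPatch_self hx hL hδ hh0 h1 h2
    exact ⟨ball x (2 * h), mem_nhdsWithin_of_mem_nhds (ball_mem_nhds x (by positivity)),
      hp.surfaceMeasure_lt_top⟩
  rwa [inter_self] at this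

/-- A tangent vector is a limit of `c_k d_k` with `d_k → 0` and `x + d_k ∈ Γ`. Its component along
`m` is the limit of terms bounded by `L ‖c_k d_k‖ ‖d_k‖`, hence zero. -/
theorem tangentPlane_le {Γ : Set E3} {x m : E3} {L : ℝ}
    (h : ∀ w ∈ Γ, |⟪m, w - x⟫| ≤ L * ‖w - x‖ ^ 2) :
    tangentPlane Γ x ≤ (ℝ ∙ m)ᗮ := by
  refine Submodule.span_le.2 fun v hv => ?_
  rw [SetLike.mem_coe, Submodule.mem_orthogonal_singleton_iff_inner_right]
  obtain ⟨α, l, hl, c, d, hd0, hds, hcd⟩ := exists_fun_of_mem_tangentConeAt hv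
  have h1 : Tendsto (fun k => ⟪m, c k • d k⟫) l (𝓝 ⟪m, v⟫) := tendsto_const_nhds.inner hcd
  have h2 : Tendsto (fun k => L * (‖c k • d k‖ * ‖d k‖)) l (𝓝 (L * (‖v‖ * ‖(0 : E3)‖))) :=
    (hcd.norm.mul hd0.norm).const_mul L
  rw [norm_zero, mul_zero, mul_zero] at h2
  refine tendsto_nhds_unique h1 (squeeze_zero_norm' ?_ h2)
  filter_upwards [hds] with k hk
  have := h _ hk
  rw [add_sub_cancel_left] at this
  rw [inner_smul_right, norm_mul, norm_smul, Real.norm_eq_abs, Real.norm_eq_abs]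
  calc |c k| * |⟪m, d k⟫| ≤ |c k| * (L * ‖d k‖ ^ 2) := by gcongr
    _ = _ := by ring

/-- Patches of all small radii `h` give points `x + (h/2)v + a n` of `Γ` with `a = O(h²)`; rescaling
the increments by `2/h` exhibits `v` in the tangent cone. -/
theorem IsClosedC2Surface.mem_tangentPlane {Γ : Set E3} {δ L : ℝ} {x : E3} (hx : x ∈ Γ)
    {n : E3 → E3} {γ : E3 → ℝ} (hc : IsNormalChart Γ x δ L n γ) (hL : 1 ≤ L) (hδ : 0 < δ) {v : E3}
    (hv1 : ‖v‖ = 1) (hv : ⟪v, n x⟫ = 0) : v ∈ tangentPlane Γ x := by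
  refine Submodule.subset_span ?_
  set h₀ := min (δ / 3) (1 / (36 * L)) with hh₀
  have hh0 : 0 < h₀ := by positivity
  have key : ∀ h : ℝ, 0 < h → h ≤ h₀ → ∃ a, x + (h / 2) • v + a • n x ∈ Γ ∧ |a| ≤ 9 * L * h ^ 2 := by
    intro h hpos hle
    have h1 : 3 * h ≤ δ := by linarith [min_le_left (δ / 3) (1 / (36 * L))]
    have h2 : 9 * L * h < 1 / 2 := by
      have : h ≤ 1 / (36 * L) := hle.trans (min_le_right _ _)
      rw [le_div_iff₀ (by positivity)] at this
      linarith
    obtain ⟨f₁, f₂, hp⟩ := hc.isPatch_self hx hL hδ hpos h1 h2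
    obtain ⟨a, ha, haΓ⟩ := hp.surj (x + (h / 2) • v)
      (by rw [add_sub_cancel_left, inner_smul_left, hv, mul_zero])
      (by rw [add_sub_cancel_left, norm_smul, hv1, Real.norm_eq_abs, abs_of_pos (by positivity)]
          linarith)
    have e : x + (h / 2) • v + a • n x - x = (h / 2) • v + a • n x := by abel
    have hb : x + (h / 2) • v + a • n x ∈ ball x (2 * h) := by
      rw [mem_ball, dist_eq_norm, e]
      refine (norm_add_le _ _).trans_lt ?_
      rw [norm_smul, norm_smul, hv1, hp.frame.norm_normal, Real.norm_eq_abs, Real.norm_eq_abs,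
        abs_of_pos (by positivity : 0 < h / 2)]
      linarith
    refine ⟨a, haΓ, ?_⟩
    have := hp.height _ ⟨haΓ, hb⟩
    rw [e, inner_add_left, inner_smul_left, inner_smul_left, hv, real_inner_self_eq_norm_sq,
      hp.frame.norm_normal] at this
    simp only [conj_trivial, mul_zero, one_pow, mul_one, zero_add] at this
    linarith
  choose! a ha1 ha2 using key
  have hev : ∀ᶠ h in 𝓝[>] (0 : ℝ), 0 < h ∧ h ≤ h₀ := by
    filter_upwards [self_mem_nhdsWithin, mem_nhdsWithin_of_mem_nhds (Iio_mem_nhds hh0)] with h h1 h2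
    exact ⟨h1, le_of_lt h2⟩
  have hid : Tendsto (fun h : ℝ => h) (𝓝[>] 0) (𝓝 0) := tendsto_nhdsWithin_of_tendsto_nhds tendsto_id
  have hq : Tendsto (fun h => (2 / h * a h) • n x) (𝓝[>] 0) (𝓝 0) := by
    have h1 : Tendsto (fun h : ℝ => 18 * L * h) (𝓝[>] 0) (𝓝 (18 * L * 0)) := hid.const_mul _
    rw [mul_zero] at h1
    refine squeeze_zero_norm' ?_ h1
    filter_upwards [hev] with h hh
    have hpos := hh.1
    rw [norm_smul, hc.norm_eq x (mem_ball_self hδ), mul_one, Real.norm_eq_abs, abs_mul,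
      abs_of_pos (by positivity : 0 < 2 / h)]
    calc 2 / h * |a h| ≤ 2 / h * (9 * L * h ^ 2) := by gcongr; exact ha2 h hh.1 hh.2
      _ = _ := by field_simp; ring
  have hcd : Tendsto (fun h : ℝ => (2 / h) • ((h / 2) • v + a h • n x)) (𝓝[>] 0) (𝓝 v) := by
    have h1 : Tendsto (fun h : ℝ => v + (2 / h * a h) • n x) (𝓝[>] 0) (𝓝 (v + 0)) := hq.const_add v
    rw [add_zero] at h1
    refine h1.congr' ?_
    filter_upwards [hev] with h hh
    have : h ≠ 0 := hh.1.ne'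
    rw [smul_add, smul_smul, smul_smul]
    have : 2 / h * (h / 2) = 1 := by field_simp
    rw [this, one_smul]
  refine mem_tangentConeAt_of_seq (𝓝[>] (0 : ℝ)) (fun h => 2 / h)
    (fun h => (h / 2) • v + a h • n x) ?_ ?_ hcd
  · have h1 : Tendsto (fun h : ℝ => (h / 2) • ((2 / h) • ((h / 2) • v + a h • n x))) (𝓝[>] 0)
        (𝓝 ((0 / 2 : ℝ) • v)) := (hid.div_const 2).smul hcd
    rw [zero_div, zero_smul] at h1
    refine h1.congr' ?_
    filter_upwards [hev] with h hh
    have : h ≠ 0 := hh.1.ne'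
    rw [smul_smul]
    have : h / 2 * (2 / h) = 1 := by field_simp
    rw [this, one_smul]
  · filter_upwards [hev] with h hh
    rw [← add_assoc]
    exact ha1 h hh.1 hh.2

/-- A unit vector to which the surface is quadratically orthogonal spans the normal space. -/
theorem IsClosedC2Surface.tangentPlane_eq {Γ : Set E3} (hΓ : IsClosedC2Surface Γ) {x m : E3}
    (hx : x ∈ Γ) (hm : ‖m‖ = 1) {L : ℝ} (h : ∀ w ∈ Γ, |⟪m, w - x⟫| ≤ L * ‖w - x‖ ^ 2) :
    tangentPlane Γ x = (ℝ ∙ m)ᗮ := by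
  obtain ⟨δ, L', hδ, hL', hch⟩ := hΓ.exists_chart
  obtain ⟨n, γ, hc⟩ := hch x hx
  have hle := tangentPlane_le h
  have hn := hc.norm_eq x (mem_ball_self hδ)
  have hsub : (ℝ ∙ n x)ᗮ ≤ tangentPlane Γ x := by
    intro v hv
    rw [Submodule.mem_orthogonal_singleton_iff_inner_left] at hv
    rcases eq_or_ne v 0 with rfl | hv0
    · exact zero_mem _
    · have h1 := mem_tangentPlane hx hc hL' hδ (v := ‖v‖⁻¹ • v)
        (by rw [norm_smul, norm_inv, norm_norm, inv_mul_cancel₀ (norm_ne_zero_iff.2 hv0)])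
        (by rw [inner_smul_left, hv, mul_zero])
      have h2 := Submodule.smul_mem _ ‖v‖ h1
      rwa [smul_smul, mul_inv_cancel₀ (norm_ne_zero_iff.2 hv0), one_smul] at h2
  refine le_antisymm hle ?_
  have hfin : Module.finrank ℝ (ℝ ∙ n x)ᗮ = Module.finrank ℝ (ℝ ∙ m)ᗮ := by
    have h1 := Submodule.finrank_add_finrank_orthogonal (ℝ ∙ n x)
    have h2 := Submodule.finrank_add_finrank_orthogonal (ℝ ∙ m)
    rw [finrank_span_singleton (by rintro h0; simp [h0] at hn)] at h1
    rw [finrank_span_singleton (by rintro h0; simp [h0] at hm)] at h2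
    omega
  rw [← Submodule.eq_of_le_of_finrank_eq (hsub.trans hle) hfin]
  exact hsub

/-- Removing the normal rank-one part of the derivative subtracts exactly its normal diagonal entry
from the trace. -/
theorem tangentialDiv_eq {Γ : Set E3} {x m : E3} (hm : ‖m‖ = 1) (hΓ : tangentPlane Γ x = (ℝ ∙ m)ᗮ)
    (X : E3 → E3) : tangentialDiv Γ X x
      = LinearMap.trace ℝ E3 (fderiv ℝ X x : E3 →ₗ[ℝ] E3) - ⟪m, fderiv ℝ X x m⟫ := by
  have h1 : (((tangentPlane Γ x).starProjection ∘L fderiv ℝ X x : E3 →L[ℝ] E3) : E3 →ₗ[ℝ] E3)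
      = (fderiv ℝ X x : E3 →ₗ[ℝ] E3)
        - (((innerSL ℝ m ∘L fderiv ℝ X x : E3 →L[ℝ] ℝ) : E3 →ₗ[ℝ] ℝ).smulRight m) := by
    ext1 v
    have : (ℝ ∙ m)ᗮ.starProjection (fderiv ℝ X x v)
        = fderiv ℝ X x v - ⟪m, fderiv ℝ X x v⟫ • m := by
      rw [Submodule.starProjection_orthogonal_val, Submodule.starProjection_unit_singleton ℝ hm]
    simp only [hΓ]
    simpa using this
  rw [tangentialDiv, h1, map_sub, LinearMap.trace_smulRight]
  simp

end TangentPlane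

/-! ### Integration over patches. -/

/-- The part of `Γ` near `c` over the planar disc of radius `r`. -/
def patchDisc (Γ : Set E3) (c f₁ f₂ : E3) (r : ℝ) : Set E3 :=
  Γ ∩ ball c (2 * r) ∩ frameCoord c f₁ f₂ r ⁻¹' ball 0 1

theorem measurableSet_patchDisc {Γ : Set E3} (hΓ : MeasurableSet Γ) (c f₁ f₂ : E3) (r : ℝ) :
    MeasurableSet (patchDisc Γ c f₁ f₂ r) :=
  (hΓ.inter measurableSet_ball).inter
    ((frameCoord_continuous c f₁ f₂ r).measurable measurableSet_ball)

/-- The area of the unit disc. -/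
def discArea : ℝ := volume.real (ball (0 : E2) 1)

theorem discArea_nonneg : 0 ≤ discArea := measureReal_nonneg

namespace IsPatch
variable {Γ : Set E3} {c f₁ f₂ ν : E3} {r κ : ℝ} (h : IsPatch Γ c f₁ f₂ ν r κ)
include h

theorem le_measure_inter_preimage {E : Set E2} (hE : E ⊆ ball 0 1) :
    ENNReal.ofReal (r ^ 2) * volume E
      ≤ surfaceMeasure (Γ ∩ ball c (2 * r) ∩ frameCoord c f₁ f₂ r ⁻¹' E) := by
  have := h.volume_image_le (Γ ∩ ball c (2 * r) ∩ frameCoord c f₁ f₂ r ⁻¹' E)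
  rwa [h.image_coord_eq hE] at this

theorem measure_inter_preimage_le {E : Set E2} (hE : E ⊆ ball 0 1) :
    surfaceMeasure (Γ ∩ ball c (2 * r) ∩ frameCoord c f₁ f₂ r ⁻¹' E)
      ≤ ENNReal.ofReal (r ^ 2 * (1 + 2 * κ ^ 2)) * volume E := by
  have := h.surfaceMeasure_le
    (inter_subset_left : Γ ∩ ball c (2 * r) ∩ frameCoord c f₁ f₂ r ⁻¹' E ⊆ _)
  rwa [h.image_coord_eq hE] at this

theorem measure_patchDisc_lt_top : surfaceMeasure (patchDisc Γ c f₁ f₂ r) < ⊤ :=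
  (measure_mono inter_subset_left).trans_lt h.surfaceMeasure_lt_top

theorem le_measureReal {E : Set E2} (hE : E ⊆ ball 0 1) :
    r ^ 2 * volume.real E
      ≤ surfaceMeasure.real (Γ ∩ ball c (2 * r) ∩ frameCoord c f₁ f₂ r ⁻¹' E) := by
  have h1 := ENNReal.toReal_mono
    ((measure_mono inter_subset_left).trans_lt h.surfaceMeasure_lt_top).ne
    (h.le_measure_inter_preimage hE)
  rwa [ENNReal.toReal_mul, ENNReal.toReal_ofReal (sq_nonneg r)] at h1

theorem measureReal_patchDisc_le :
    surfaceMeasure.real (patchDisc Γ c f₁ f₂ r) ≤ r ^ 2 * (1 + 2 * κ ^ 2) * discArea := by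
  have h1 := ENNReal.toReal_mono (ENNReal.mul_ne_top ENNReal.ofReal_ne_top
    measure_ball_lt_top.ne) (h.measure_inter_preimage_le (Subset.refl (ball 0 1)))
  rwa [ENNReal.toReal_mul, ENNReal.toReal_ofReal (by positivity)] at h1

theorem measureReal_patchDisc_le' :
    surfaceMeasure.real (patchDisc Γ c f₁ f₂ r) ≤ 2 * r ^ 2 * discArea := by
  refine h.measureReal_patchDisc_le.trans ?_
  have h1 := h.κ_nonneg
  have h2 := h.κ_le
  have := discArea_nonneg
  have h3 : 1 + 2 * κ ^ 2 ≤ 2 := by nlinarith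
  calc r ^ 2 * (1 + 2 * κ ^ 2) * discArea ≤ r ^ 2 * 2 * discArea := by gcongr
    _ = _ := by ring

/-- Integrals of odd functions of the planar coordinates nearly vanish. -/
theorem abs_integral_odd_le (hΓ : MeasurableSet Γ) {f : E2 → ℝ} (hf : Continuous f)
    (hodd : ∀ s, f (-s) = -f s) {F : ℝ} (hF : ∀ s ∈ ball (0 : E2) 1, |f s| ≤ F) :
    |∫ y in patchDisc Γ c f₁ f₂ r, f (frameCoord c f₁ f₂ r y) ∂surfaceMeasure|
      ≤ 2 * κ ^ 2 * r ^ 2 * F * discArea := by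
  have hF0 : 0 ≤ F := (abs_nonneg _).trans (hF 0 (mem_ball_self one_pos))
  have hq := frameCoord_continuous c f₁ f₂ r
  set q := frameCoord c f₁ f₂ r with hqdef
  set A := patchDisc Γ c f₁ f₂ r with hA
  have hAm : MeasurableSet A := measurableSet_patchDisc hΓ _ _ _ _
  set m : Measure E2 := (surfaceMeasure.restrict A).map q with hm
  set v : Measure E2 := volume.restrict (ball 0 1) with hv
  have hmE : ∀ E, MeasurableSet E →
      m E = surfaceMeasure (Γ ∩ ball c (2 * r) ∩ q ⁻¹' (E ∩ ball 0 1)) := by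
    intro E hE
    rw [hm, Measure.map_apply hq.measurable hE, Measure.restrict_apply (hq.measurable hE)]
    congr 1
    ext y
    simp only [hA, patchDisc, mem_inter_iff, mem_preimage]
    tauto
  have hlow : ENNReal.ofReal (r ^ 2) • v ≤ m := Measure.le_iff.2 fun E hE => by
    rw [hmE E hE, Measure.smul_apply, hv, Measure.restrict_apply hE, smul_eq_mul]
    exact h.le_measure_inter_preimage inter_subset_right
  have hup : m ≤ ENNReal.ofReal (r ^ 2 * (1 + 2 * κ ^ 2)) • v := Measure.le_iff.2 fun E hE => by
    rw [hmE E hE, Measure.smul_apply, hv, Measure.restrict_apply hE, smul_eq_mul]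
    exact h.measure_inter_preimage_le inter_subset_right
  have : IsFiniteMeasure v := ⟨by rw [hv, Measure.restrict_apply_univ]; exact measure_ball_lt_top⟩
  have hae : ∀ᵐ s ∂v, |f s| ≤ F := by
    rw [hv]; exact (ae_restrict_iff' measurableSet_ball).2 (Filter.Eventually.of_forall hF)
  have hfv : Integrable f v :=
    Integrable.of_bound hf.aestronglyMeasurable F (by simpa using hae)
  have hsm : ∀ a : ℝ, Integrable (fun s => f s + F) (ENNReal.ofReal a • v) := fun a =>
    (hfv.add (integrable_const F)).smul_measure ENNReal.ofReal_ne_top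
  have hcm : ∀ a : ℝ, Integrable (fun _ : E2 => F) (ENNReal.ofReal a • v) := fun a =>
    (integrable_const F).smul_measure ENNReal.ofReal_ne_top
  have hfm : Integrable f m := (hfv.smul_measure ENNReal.ofReal_ne_top).mono_measure hup
  have hFm : Integrable (fun _ : E2 => F) m := (hcm _).mono_measure hup
  -- The push-forward of surface measure lies between `r²` and `r²(1 + 2κ²)` times planar measure.
  -- To exploit this for a signed function the constant `F` is added, making it nonnegative, and the
  -- bounds for `F` alone are subtracted afterwards.
  have hpos : ∀ a : ℝ, ∀ᵐ s ∂(ENNReal.ofReal a • v), 0 ≤ f s + F := fun a =>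
    Measure.ae_smul_measure (hae.mono fun s hs => by linarith [(abs_le.1 hs).1]) _
  have hacm : ∀ᵐ s ∂m, 0 ≤ f s + F := ae_mono hup (hpos _)
  have hz : ∫ s, f s ∂v = 0 := by
    have h1 : ∫ s in ball (0 : E2) 1, f (-s) = ∫ s in ball (0 : E2) 1, f s := by
      have := (Measure.measurePreserving_neg (volume : Measure E2)).setIntegral_preimage_emb
        (MeasurableEquiv.neg E2).measurableEmbedding f (ball 0 1)
      have hb : Neg.neg ⁻¹' ball (0 : E2) 1 = ball 0 1 := by ext s; simp
      rwa [hb] at this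
    simp only [hodd, integral_neg] at h1
    rw [hv]; linarith
  have hvF : ∀ a : ℝ, 0 ≤ a → ∫ s, (f s + F) ∂(ENNReal.ofReal a • v) = a * (F * discArea) := by
    intro a ha
    rw [integral_smul_measure, ENNReal.toReal_ofReal ha, integral_add hfv (integrable_const F), hz,
      integral_const, zero_add, smul_eq_mul, smul_eq_mul, hv, measureReal_restrict_apply_univ,
      discArea, mul_comm F]
  have hvF' : ∀ a : ℝ, 0 ≤ a → ∫ _s : E2, F ∂(ENNReal.ofReal a • v) = a * (F * discArea) := by
    intro a ha
    rw [integral_smul_measure, ENNReal.toReal_ofReal ha, integral_const, smul_eq_mul, smul_eq_mul,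
      hv, measureReal_restrict_apply_univ, discArea, mul_comm F]
  have l1 := integral_mono_measure hlow hacm (hfm.add hFm)
  have l2 := integral_mono_measure hup (hpos _) (hsm _)
  have l3 := integral_mono_measure hlow (Filter.Eventually.of_forall fun _ => hF0) hFm
  have l4 := integral_mono_measure hup (Filter.Eventually.of_forall fun _ => hF0) (hcm _)
  rw [integral_add hfm hFm, hvF _ (by positivity)] at l1 l2
  rw [hvF' _ (by positivity)] at l3 l4
  have e : ∫ y in A, f (q y) ∂surfaceMeasure = ∫ s, f s ∂m := by
    rw [hm, integral_map hq.aemeasurable hf.aestronglyMeasurable]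
  rw [e, abs_le]
  constructor <;> nlinarith

end IsPatch

/-! ### Localised tangential test fields. -/

theorem hasDerivAt_sq_max_zero (t : ℝ) :
    HasDerivAt (fun t : ℝ => max t 0 ^ 2) (2 * max t 0) t := by
  rcases lt_trichotomy t 0 with ht | rfl | ht
  · rw [max_eq_right ht.le, mul_zero]
    refine (hasDerivAt_const t (0 : ℝ)).congr_of_eventuallyEq ?_
    filter_upwards [Iio_mem_nhds ht] with s hs
    rw [max_eq_right (le_of_lt hs)]; norm_num
  · rw [max_self, mul_zero]
    have h1 : (fun t : ℝ => max t 0 ^ 2) =O[nhds 0] fun t : ℝ => ‖t‖ ^ 2 := by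
      refine Asymptotics.IsBigO.of_bound 1 (Filter.Eventually.of_forall fun t => ?_)
      rw [one_mul, Real.norm_eq_abs, Real.norm_eq_abs, Real.norm_eq_abs, abs_pow, abs_pow, abs_abs]
      exact pow_le_pow_left₀ (abs_nonneg _) (abs_max_le_max_abs_abs.trans (by simp)) 2
    have h2 := (h1.trans_isLittleO (Asymptotics.isLittleO_norm_pow_id one_lt_two))
    rw [hasDerivAt_iff_isLittleO]
    simpa using h2
  · rw [max_eq_left ht.le]
    refine HasDerivAt.congr_of_eventuallyEq (f := fun s : ℝ => s ^ 2)
      (by simpa using hasDerivAt_pow 2 t) ?_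
    filter_upwards [Ioi_mem_nhds ht] with s hs
    rw [max_eq_left (le_of_lt hs)]

/-- The square makes the positive part `C¹`, so the cut-off yields admissible test fields. -/
theorem contDiff_sq_max_zero : ContDiff ℝ 1 (fun t : ℝ => max t 0 ^ 2) := by
  rw [contDiff_one_iff_deriv]
  refine ⟨fun t => (hasDerivAt_sq_max_zero t).differentiableAt, ?_⟩
  have : deriv (fun t : ℝ => max t 0 ^ 2) = fun t => 2 * max t 0 :=
    funext fun t => (hasDerivAt_sq_max_zero t).deriv
  rw [this]; fun_prop

/-- The function `(r² - |y - c|²)₊`. -/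
def paraboloid (c : E3) (r : ℝ) (y : E3) : ℝ := max (r ^ 2 - ‖y - c‖ ^ 2) 0

theorem paraboloid_nonneg (c : E3) (r : ℝ) (y : E3) : 0 ≤ paraboloid c r y := le_max_right _ _

theorem paraboloid_le (c : E3) (r : ℝ) (y : E3) : paraboloid c r y ≤ r ^ 2 :=
  max_le (by linarith [sq_nonneg ‖y - c‖]) (sq_nonneg r)

theorem paraboloid_eq_zero {c : E3} {r : ℝ} (hr : 0 ≤ r) {y : E3} (hy : y ∉ ball c r) :
    paraboloid c r y = 0 := by
  rw [mem_ball, dist_eq_norm, not_lt] at hy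
  exact max_eq_right (by nlinarith)

theorem continuous_paraboloid (c : E3) (r : ℝ) : Continuous (paraboloid c r) := by
  unfold paraboloid; fun_prop

theorem contDiff_paraboloid_sq (c : E3) (r : ℝ) : ContDiff ℝ 1 (fun y => paraboloid c r y ^ 2) :=
  contDiff_sq_max_zero.comp (contDiff_const.sub ((contDiff_id.sub contDiff_const).norm_sq ℝ))

theorem fderiv_paraboloid_sq (c : E3) (r : ℝ) (y v : E3) :
    fderiv ℝ (fun y => paraboloid c r y ^ 2) y v = -4 * paraboloid c r y * ⟪y - c, v⟫ := by
  have h1 : HasFDerivAt (fun y : E3 => r ^ 2 - ‖y - c‖ ^ 2)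
      (-((2 : ℕ) • (innerSL ℝ (y - c)) ∘L (ContinuousLinearMap.id ℝ E3))) y :=
    (((hasFDerivAt_id y).sub_const c).norm_sq).const_sub (r ^ 2)
  have h2 := (hasDerivAt_sq_max_zero (r ^ 2 - ‖y - c‖ ^ 2)).hasFDerivAt.comp y h1
  have h3 : HasFDerivAt (fun y => paraboloid c r y ^ 2) _ y := h2
  rw [h3.fderiv]
  simp [paraboloid, inner_sub_left]
  ring

/-- The localised tangential part of a constant vector. -/
def testField (c : E3) (r : ℝ) (n : E3 → E3) (g : E3) (y : E3) : E3 :=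
  paraboloid c r y ^ 2 • (g - ⟪g, n y⟫ • n y)

theorem norm_sub_inner_smul_le (g : E3) {m : E3} (hm : ‖m‖ = 1) : ‖g - ⟪g, m⟫ • m‖ ≤ ‖g‖ := by
  refine abs_le_of_sq_le_sq' ?_ (norm_nonneg _) |>.2
  rw [norm_sub_sq_real, inner_smul_right, norm_smul, hm, Real.norm_eq_abs, mul_one, sq_abs]
  nlinarith [sq_nonneg ⟪g, m⟫]

theorem abs_trace_le (A : E3 →L[ℝ] E3) :
    |LinearMap.trace ℝ E3 (A : E3 →ₗ[ℝ] E3)| ≤ 3 * ‖A‖ := by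
  rw [LinearMap.trace_eq_sum_inner (A : E3 →ₗ[ℝ] E3) (EuclideanSpace.basisFun (Fin 3) ℝ)]
  refine (Finset.abs_sum_le_sum_abs _ _).trans ?_
  refine (Finset.sum_le_card_nsmul _ _ ‖A‖ fun i _ => ?_).trans (by simp)
  refine (abs_real_inner_le_norm _ _).trans ?_
  rw [OrthonormalBasis.norm_eq_one, one_mul]
  refine (A.le_opNorm _).trans ?_
  rw [OrthonormalBasis.norm_eq_one, mul_one]

section testField
variable {c : E3} {r : ℝ} {n : E3 → E3} {g : E3}

theorem testField_eq_zero (hr : 0 ≤ r) {y : E3} (hy : y ∉ ball c r) :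
    testField c r n g y = 0 := by
  rw [testField, paraboloid_eq_zero hr hy]; simp

theorem testField_eventuallyEq_zero (hr : 0 ≤ r) {y : E3} (hy : y ∉ closedBall c r) :
    testField c r n g =ᶠ[nhds y] fun _ => 0 := by
  filter_upwards [isClosed_closedBall.isOpen_compl.mem_nhds hy] with z hz
  exact testField_eq_zero hr fun h => hz (ball_subset_closedBall h)

theorem norm_testField_le (hr : 0 ≤ r) (hn : ∀ y ∈ ball c r, ‖n y‖ = 1) (y : E3) :
    ‖testField c r n g y‖ ≤ r ^ 4 * ‖g‖ := by
  by_cases hy : y ∈ ball c r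
  · rw [testField, norm_smul, Real.norm_eq_abs, abs_of_nonneg (sq_nonneg _)]
    have h1 := pow_le_pow_left₀ (paraboloid_nonneg c r y) (paraboloid_le c r y) 2
    calc _ ≤ (r ^ 2) ^ 2 * ‖g‖ := by
          gcongr
          exact norm_sub_inner_smul_le g (hn y hy)
      _ = _ := by ring
  · rw [testField_eq_zero hr hy, norm_zero]; positivity

theorem inner_testField {y : E3} (hn : ‖n y‖ = 1) : ⟪testField c r n g y, n y⟫ = 0 := by
  rw [testField, inner_smul_left, inner_sub_left, inner_smul_left, real_inner_self_eq_norm_sq, hn]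
  simp

theorem contDiff_testField (hr : 0 < r) (hn : ContDiffOn ℝ 1 n (ball c (2 * r))) :
    ContDiff ℝ 1 (testField c r n g) := by
  rw [contDiff_iff_contDiffAt]
  intro y
  by_cases hy : y ∈ ball c (2 * r)
  · have h1 := hn.contDiffAt (isOpen_ball.mem_nhds hy)
    exact (contDiff_paraboloid_sq c r).contDiffAt.smul
      (contDiffAt_const.sub ((contDiffAt_const.inner ℝ h1).smul h1))
  · refine contDiffAt_const.congr_of_eventuallyEq (testField_eventuallyEq_zero hr.le fun h => hy ?_)
    exact closedBall_subset_ball (by linarith) h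

theorem tangentialDiv_testField_eq_zero {Γ : Set E3} (hr : 0 ≤ r) {y : E3}
    (hy : y ∉ closedBall c r) : tangentialDiv Γ (testField c r n g) y = 0 := by
  rw [tangentialDiv, (testField_eventuallyEq_zero hr hy).fderiv_eq]
  simp

/-- By the product rule the leading term is the derivative `-4p(y - c)` of the cut-off applied to
`g`. Differentiating the projection onto the tangent plane costs `p²` times the derivative of the
normal, and projecting `g` itself produces the product of the two normal components. -/
theorem abs_tangentialDiv_testField_add_le {Γ : Set E3} {L : ℝ} {y : E3}
    (hnd : DifferentiableAt ℝ n y) (hn : ‖n y‖ = 1) (hL : ‖fderiv ℝ n y‖ ≤ L)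
    (hΓ : tangentPlane Γ y = (ℝ ∙ n y)ᗮ) :
    |tangentialDiv Γ (testField c r n g) y + 4 * paraboloid c r y * ⟪y - c, g⟫|
      ≤ paraboloid c r y ^ 2 * (8 * L * ‖g‖)
        + 4 * paraboloid c r y * (|⟪g, n y⟫| * |⟪y - c, n y⟫|) := by
  set p := paraboloid c r y with hp
  set Z := g - ⟪g, n y⟫ • n y with hZ
  set N := fderiv ℝ n y with hN
  -- the derivative of the tangential part
  set D : E3 →L[ℝ] E3 :=
    -(⟪g, n y⟫ • N + ((innerSL ℝ g) ∘L N).smulRight (n y)) with hD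
  have hZd : HasFDerivAt (fun y => g - ⟪g, n y⟫ • n y) D y := by
    have h1 : HasFDerivAt n N y := hnd.hasFDerivAt
    have h2 : HasFDerivAt (fun y => ⟪g, n y⟫) ((innerSL ℝ g) ∘L N) y :=
      (innerSL ℝ g).hasFDerivAt.comp y h1
    exact (h2.smul h1).const_sub g
  have hχ : HasFDerivAt (fun y => paraboloid c r y ^ 2)
      (fderiv ℝ (fun y => paraboloid c r y ^ 2) y) y :=
    ((contDiff_paraboloid_sq c r).differentiable one_ne_zero y).hasFDerivAt
  set χ := fderiv ℝ (fun y => paraboloid c r y ^ 2) y with hχe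
  have hX : fderiv ℝ (testField c r n g) y = p ^ 2 • D + χ.smulRight Z := (hχ.smul hZd).fderiv
  have hnZ : ⟪n y, Z⟫ = 0 := by
    rw [hZ, inner_sub_right, inner_smul_right, real_inner_self_eq_norm_sq, hn,
      real_inner_comm]; ring
  have hdiv : tangentialDiv Γ (testField c r n g) y
      = p ^ 2 * (LinearMap.trace ℝ E3 (D : E3 →ₗ[ℝ] E3) - ⟪n y, D (n y)⟫) + χ Z := by
    rw [tangentialDiv_eq hn hΓ, hX]
    have : ((p ^ 2 • D + χ.smulRight Z : E3 →L[ℝ] E3) : E3 →ₗ[ℝ] E3)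
        = p ^ 2 • (D : E3 →ₗ[ℝ] E3) + (χ : E3 →ₗ[ℝ] ℝ).smulRight Z := rfl
    rw [this, map_add, map_smul, LinearMap.trace_smulRight]
    simp only [add_apply, smul_apply,
      ContinuousLinearMap.smulRight_apply, inner_add_right, inner_smul_right, hnZ, smul_eq_mul,
      ContinuousLinearMap.coe_coe]
    ring
  have hDn : ‖D‖ ≤ 2 * L * ‖g‖ := by
    refine ContinuousLinearMap.opNorm_le_bound _ (by
      have := (norm_nonneg N).trans hL; positivity) fun v => ?_
    have h1 : ‖N v‖ ≤ L * ‖v‖ := (N.le_opNorm v).trans (by gcongr)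
    have h2 := abs_real_inner_le_norm g (n y)
    have h3 := abs_real_inner_le_norm g (N v)
    rw [hn, mul_one] at h2
    rw [hD]
    simp only [neg_apply, add_apply,
      smul_apply, ContinuousLinearMap.smulRight_apply,
      ContinuousLinearMap.comp_apply, innerSL_apply_apply, norm_neg]
    refine (norm_add_le _ _).trans ?_
    rw [norm_smul, norm_smul, hn, mul_one, Real.norm_eq_abs, Real.norm_eq_abs]
    calc _ ≤ ‖g‖ * (L * ‖v‖) + ‖g‖ * (L * ‖v‖) := by
          gcongr
          exact h3.trans (by gcongr)
      _ = _ := by ring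
  have hω : |LinearMap.trace ℝ E3 (D : E3 →ₗ[ℝ] E3) - ⟪n y, D (n y)⟫| ≤ 8 * L * ‖g‖ := by
    have h1 := abs_trace_le D
    have h2 := abs_real_inner_le_norm (n y) (D (n y))
    have h3 := D.le_opNorm (n y)
    rw [hn] at h2 h3
    have := abs_sub (LinearMap.trace ℝ E3 (D : E3 →ₗ[ℝ] E3)) ⟪n y, D (n y)⟫
    linarith
  have hχZ : χ Z = -4 * p * ⟪y - c, g⟫ + 4 * p * (⟪g, n y⟫ * ⟪y - c, n y⟫) := by
    rw [hχe, fderiv_paraboloid_sq, hZ, inner_sub_right, inner_smul_right]; ring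
  have e : tangentialDiv Γ (testField c r n g) y + 4 * p * ⟪y - c, g⟫
      = p ^ 2 * (LinearMap.trace ℝ E3 (D : E3 →ₗ[ℝ] E3) - ⟪n y, D (n y)⟫)
        + 4 * p * (⟪g, n y⟫ * ⟪y - c, n y⟫) := by rw [hdiv, hχZ]; ring
  have hp0 := paraboloid_nonneg c r y
  rw [← hp] at hp0
  rw [e]
  refine (abs_add_le _ _).trans ?_
  rw [abs_mul, abs_mul (4 * p), abs_mul ⟪g, n y⟫, abs_of_nonneg (sq_nonneg p),
    abs_of_nonneg (by positivity : 0 ≤ 4 * p)]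
  gcongr

/-- Tangent planes are defined through tangent cones, so measurability is not immediate. On `Γ` the
divergence coincides with an expression continuous on the ball and with zero outside it. -/
theorem aestronglyMeasurable_tangentialDiv_testField {Γ : Set E3} (hΓm : MeasurableSet Γ)
    (hr : 0 < r) (hn : ContDiffOn ℝ 1 n (ball c (2 * r))) (hn1 : ∀ y ∈ ball c (2 * r), ‖n y‖ = 1)
    (hΓ : ∀ y ∈ Γ, y ∈ ball c (2 * r) → tangentPlane Γ y = (ℝ ∙ n y)ᗮ) :
    AEStronglyMeasurable (tangentialDiv Γ (testField c r n g)) (surfaceMeasure.restrict Γ) := by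
  classical
  have hX := (contDiff_testField (g := g) hr hn).continuous_fderiv one_ne_zero
  set X := testField c r n g with hXd
  have htr : Continuous fun A : E3 →L[ℝ] E3 => LinearMap.trace ℝ E3 (A : E3 →ₗ[ℝ] E3) :=
    LinearMap.continuous_of_finiteDimensional
      ((LinearMap.trace ℝ E3) ∘ₗ (ContinuousLinearMap.coeLM ℝ : (E3 →L[ℝ] E3) →ₗ[ℝ] (E3 →ₗ[ℝ] E3)))
  have hc : ContinuousOn (fun y => LinearMap.trace ℝ E3 (fderiv ℝ X y : E3 →ₗ[ℝ] E3)
      - ⟪n y, fderiv ℝ X y (n y)⟫) (ball c (2 * r)) :=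
    (htr.comp hX).continuousOn.sub
      (hn.continuousOn.inner (hX.continuousOn.clm_apply hn.continuousOn))
  have hm := hc.measurable_piecewise (g := fun _ => (0 : ℝ)) continuousOn_const
    (measurableSet_ball (x := c) (ε := 2 * r))
  refine hm.aestronglyMeasurable.congr ?_
  filter_upwards [ae_restrict_mem hΓm] with y hy
  by_cases hyb : y ∈ ball c (2 * r)
  · rw [piecewise_eq_of_mem _ _ _ hyb, tangentialDiv_eq (hn1 y hyb) (hΓ y hy hyb)]
  · rw [piecewise_eq_of_notMem _ _ _ hyb, tangentialDiv_testField_eq_zero hr.le fun h =>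
      hyb (closedBall_subset_ball (by linarith) h)]

end testField

/-! ### The local gradient estimate on a patch. -/

/-- A patch with a field of unit normals of controlled size. -/
structure IsNormalPatch (Γ : Set E3) (c f₁ f₂ ν : E3) (r κ D : ℝ) (n : E3 → E3) : Prop
    extends IsPatch Γ c f₁ f₂ ν r κ where
  contDiffOn : ContDiffOn ℝ 1 n (ball c (2 * r))
  norm_eq : ∀ y ∈ ball c (2 * r), ‖n y‖ = 1
  norm_fderiv : ∀ y ∈ ball c (2 * r), ‖fderiv ℝ n y‖ ≤ D
  tangentPlane_eq : ∀ y ∈ Γ, y ∈ ball c (2 * r) → tangentPlane Γ y = (ℝ ∙ n y)ᗮ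
  norm_sub : ∀ y ∈ ball c (2 * r), ‖n y - ν‖ ≤ D * r
  κ_le_mul : κ ≤ D * r
  r_le : r ≤ 1

theorem frameCoord_self (c f₁ f₂ : E3) (r : ℝ) : frameCoord c f₁ f₂ r c = 0 := by
  ext i; fin_cases i <;> simp [frameCoord]

/-- The planar components of a vector. -/
def frameVec (f₁ f₂ g : E3) : E2 := !₂[⟪g, f₁⟫, ⟪g, f₂⟫]

theorem IsFrame.norm_frameVec {f₁ f₂ ν g : E3} (h : IsFrame f₁ f₂ ν) (hg : ⟪g, ν⟫ = 0) :
    ‖frameVec f₁ f₂ g‖ = ‖g‖ := by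
  refine (sq_eq_sq₀ (norm_nonneg _) (norm_nonneg _)).1 ?_
  rw [norm2_sq, h.norm_sq g, hg]; simp [frameVec]

theorem IsFrame.inner_frameVec {f₁ f₂ ν g : E3} (h : IsFrame f₁ f₂ ν) (hg : ⟪g, ν⟫ = 0) {r : ℝ}
    (hr : 0 < r) (c y : E3) :
    ⟪y - c, g⟫ = r * ⟪frameVec f₁ f₂ g, frameCoord c f₁ f₂ r y⟫ := by
  conv_lhs => rw [h.expand g, hg]
  simp only [zero_smul, add_zero, inner_add_right, inner_smul_right, frameVec, frameCoord,
    PiLp.inner_apply, Fin.sum_univ_two]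
  simp
  field_simp

/-- The area of a small disc. -/
def smallDiscArea : ℝ := volume.real (ball (0 : E2) (1 / 8))

theorem smallDiscArea_pos : 0 < smallDiscArea :=
  ENNReal.toReal_pos (measure_ball_pos _ _ (by norm_num)).ne' measure_ball_lt_top.ne

/-- The lifted finite element function `v` is reached only through `u` and `u - v`, each with a weak
gradient; subtracting the two formulas gives one for `v`, and differentiability of the lift never
has to be discussed. -/
theorem HasWeakTangentialGradient.integral_sub {Γ : Set E3} (hΓ : surfaceMeasure Γ < ⊤)
    {u v : E3 → ℝ} {g g' : E3 → E3} (hu : HasWeakTangentialGradient Γ u g)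
    (hv : HasWeakTangentialGradient Γ (fun x => u x - v x) g') {X : E3 → E3} (hX : ContDiff ℝ 1 X)
    (hXt : ∀ x ∈ Γ, X x ∈ tangentPlane Γ x) {B : ℝ} (hXB : ∀ x, ‖X x‖ ≤ B)
    (hdiv : AEStronglyMeasurable (tangentialDiv Γ X) (surfaceMeasure.restrict Γ)) {B' : ℝ}
    (hdB : ∀ᵐ x ∂surfaceMeasure.restrict Γ, ‖tangentialDiv Γ X x‖ ≤ B') :
    IntegrableOn (fun x => v x * tangentialDiv Γ X x) Γ surfaceMeasure ∧
      IntegrableOn (fun x => ⟪g x - g' x, X x⟫) Γ surfaceMeasure ∧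
      ∫ x in Γ, v x * tangentialDiv Γ X x ∂surfaceMeasure
        = -∫ x in Γ, ⟪g x - g' x, X x⟫ ∂surfaceMeasure := by
  have : IsFiniteMeasure (surfaceMeasure.restrict Γ) :=
    ⟨by rwa [Measure.restrict_apply_univ]⟩
  have h2 : ∀ w : E3 → ℝ, MemLp w 2 (surfaceMeasure.restrict Γ) →
      Integrable (fun x => w x * tangentialDiv Γ X x) (surfaceMeasure.restrict Γ) := fun w hw =>
    (hw.integrable one_le_two).mul_bdd hdiv hdB
  have h3 : ∀ w : E3 → E3, MemLp w 2 (surfaceMeasure.restrict Γ) →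
      Integrable (fun x => ⟪w x, X x⟫) (surfaceMeasure.restrict Γ) := fun w hw =>
    ((hw.integrable one_le_two).norm.mul_const B).mono'
      (hw.aestronglyMeasurable.inner hX.continuous.aestronglyMeasurable)
      (Filter.Eventually.of_forall fun x => by
        refine (norm_inner_le_norm _ _).trans ?_
        gcongr
        exact hXB x)
  have i1 := h2 _ hu.memLp
  have i2 := h2 _ hv.memLp
  have i3 := h3 _ hu.memLp_grad
  have i4 := h3 _ hv.memLp_grad
  have e1 : (fun x => v x * tangentialDiv Γ X x) = fun x => u x * tangentialDiv Γ X x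
      - (u x - v x) * tangentialDiv Γ X x := funext fun x => by ring
  have e2 : (fun x => ⟪g x - g' x, X x⟫) = fun x => ⟪g x, X x⟫ - ⟪g' x, X x⟫ :=
    funext fun x => inner_sub_left _ _ _
  rw [e1, e2]
  refine ⟨i1.sub i2, i3.sub i4, ?_⟩
  rw [MeasureTheory.integral_sub i1 i2, MeasureTheory.integral_sub i3 i4, hu.integral_by_parts X hX hXt,
    hv.integral_by_parts X hX hXt]
  ring

namespace IsNormalPatch
variable {Γ : Set E3} {c f₁ f₂ ν : E3} {r κ D : ℝ} {n : E3 → E3}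
  (h : IsNormalPatch Γ c f₁ f₂ ν r κ D n) {g : E3}
include h

theorem D_nonneg : 0 ≤ D := nonneg_of_mul_nonneg_left (h.κ_nonneg.trans h.κ_le_mul) h.r_pos

theorem ball_inter_subset : Γ ∩ ball c r ⊆ patchDisc Γ c f₁ f₂ r := fun y hy => by
  have hr := h.r_pos
  refine ⟨⟨hy.1, ball_subset_ball (by linarith) hy.2⟩, ?_⟩
  rw [mem_preimage, mem_ball_zero_iff]
  have h1 := h.norm_coord_sub_le y c
  rw [frameCoord_self, sub_zero] at h1
  refine h1.trans_lt ?_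
  rw [inv_mul_lt_iff₀ hr, mul_one, ← dist_eq_norm]
  exact hy.2

/-- Since `⟪g, ν⟫ = 0`, both normal components gain a power of `r`. The error is of order `r⁴‖g‖`,
one order below the leading term. -/
theorem abs_div_add_le (hg : ⟪g, ν⟫ = 0) {y : E3} (hy : y ∈ Γ) (hyb : y ∈ ball c (2 * r)) :
    |tangentialDiv Γ (testField c r n g) y + 4 * paraboloid c r y * ⟪y - c, g⟫|
      ≤ r ^ 4 * ‖g‖ * (8 * D + 12 * D ^ 2) := by
  have hr := h.r_pos
  have hD := h.D_nonneg
  have h1 := abs_tangentialDiv_testField_add_le (Γ := Γ) (c := c) (r := r) (g := g)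
    ((h.contDiffOn.differentiableOn one_ne_zero).differentiableAt (isOpen_ball.mem_nhds hyb))
    (h.norm_eq y hyb) (h.norm_fderiv y hyb) (h.tangentPlane_eq y hy hyb)
  have hp0 := paraboloid_nonneg c r y
  have hp1 := paraboloid_le c r y
  have h2 : |⟪g, n y⟫| ≤ ‖g‖ * (D * r) := by
    have e : ⟪g, n y⟫ = ⟪g, n y - ν⟫ := by rw [inner_sub_right, hg, sub_zero]
    rw [e]
    exact (abs_real_inner_le_norm _ _).trans (by gcongr; exact h.norm_sub y hyb)
  have h3 : |⟪y - c, n y⟫| ≤ 3 * D * r ^ 2 := by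
    have e : ⟪y - c, n y⟫ = ⟪y - c, ν⟫ + ⟪y - c, n y - ν⟫ := by
      rw [inner_sub_right (y - c) (n y) ν]; ring
    have h4 := h.height y ⟨hy, hyb⟩
    have h5 := abs_real_inner_le_norm (y - c) (n y - ν)
    have h6 : ‖y - c‖ ≤ 2 * r := by rw [← dist_eq_norm]; exact (mem_ball.1 hyb).le
    rw [e]
    calc _ ≤ κ * r + ‖y - c‖ * ‖n y - ν‖ := (abs_add_le _ _).trans (add_le_add h4 h5)
      _ ≤ D * r * r + 2 * r * (D * r) := by
          gcongr
          · exact h.κ_le_mul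
          · exact h.norm_sub y hyb
      _ = _ := by ring
  refine h1.trans ?_
  calc _ ≤ (r ^ 2) ^ 2 * (8 * D * ‖g‖) + 4 * r ^ 2 * (‖g‖ * (D * r) * (3 * D * r ^ 2)) := by
        gcongr
    _ = r ^ 4 * ‖g‖ * (8 * D + 12 * D ^ 2 * r) := by ring
    _ ≤ r ^ 4 * ‖g‖ * (8 * D + 12 * D ^ 2 * 1) := by gcongr; exact h.r_le
    _ = _ := by ring

theorem tangentialDiv_eq_zero {y : E3} (hy : y ∈ Γ) (hyb : y ∉ ball c r) :
    tangentialDiv Γ (testField c r n g) y = 0 := by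
  have hr := h.r_pos
  by_cases hy2 : y ∈ ball c (2 * r)
  · have h1 := abs_tangentialDiv_testField_add_le (Γ := Γ) (c := c) (r := r) (g := g)
      ((h.contDiffOn.differentiableOn one_ne_zero).differentiableAt (isOpen_ball.mem_nhds hy2))
      (h.norm_eq y hy2) (h.norm_fderiv y hy2) (h.tangentPlane_eq y hy hy2)
    rw [paraboloid_eq_zero hr.le hyb] at h1
    simpa using h1
  · exact tangentialDiv_testField_eq_zero hr.le fun hc =>
      hy2 (closedBall_subset_ball (by linarith) hc)

theorem abs_tangentialDiv_le (hg : ⟪g, ν⟫ = 0) {y : E3} (hy : y ∈ Γ) :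
    |tangentialDiv Γ (testField c r n g) y|
      ≤ r ^ 4 * ‖g‖ * (8 * D + 12 * D ^ 2) + 4 * r ^ 2 * (r * ‖g‖) := by
  have hr := h.r_pos
  have hD := h.D_nonneg
  by_cases hyb : y ∈ ball c r
  · have h1 := h.abs_div_add_le hg hy (ball_subset_ball (by linarith) hyb)
    have hp0 := paraboloid_nonneg c r y
    have hp1 := paraboloid_le c r y
    have h2 : |4 * paraboloid c r y * ⟪y - c, g⟫| ≤ 4 * r ^ 2 * (r * ‖g‖) := by
      rw [abs_mul, abs_of_nonneg (by positivity)]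
      gcongr
      refine (abs_real_inner_le_norm _ _).trans ?_
      gcongr
      rw [← dist_eq_norm]; exact (mem_ball.1 hyb).le
    have h3 := abs_sub (tangentialDiv Γ (testField c r n g) y
      + 4 * paraboloid c r y * ⟪y - c, g⟫) (4 * paraboloid c r y * ⟪y - c, g⟫)
    rw [add_sub_cancel_right] at h3
    linarith
  · rw [h.tangentialDiv_eq_zero hy hyb, abs_zero]; positivity

theorem testField_mem_tangentPlane {y : E3} (hy : y ∈ Γ) :
    testField c r n g y ∈ tangentPlane Γ y := by
  have hr := h.r_pos
  by_cases hyb : y ∈ ball c (2 * r)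
  · rw [h.tangentPlane_eq y hy hyb, Submodule.mem_orthogonal_singleton_iff_inner_left]
    exact inner_testField (h.norm_eq y hyb)
  · rw [testField_eq_zero hr.le fun hc => hyb (ball_subset_ball (by linarith) hc)]
    exact zero_mem _

theorem norm_testField_le' (y : E3) : ‖testField c r n g y‖ ≤ r ^ 4 * ‖g‖ :=
  norm_testField_le h.r_pos.le
    (fun y hy => h.norm_eq y (ball_subset_ball (by linarith [h.r_pos]) hy)) y

theorem abs_paraboloid_sub_le {y : E3} (hy : y ∈ Γ) (hyb : y ∈ ball c (2 * r)) :
    |paraboloid c r y - r ^ 2 * max (1 - ‖frameCoord c f₁ f₂ r y‖ ^ 2) 0| ≤ D ^ 2 * r ^ 4 := by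
  have hr := h.r_pos
  have h1 := h.frame.norm_sub_sq hr c y c
  rw [frameCoord_self, sub_zero] at h1
  rw [mul_max_of_nonneg _ _ (sq_nonneg r), mul_zero, paraboloid]
  refine (abs_max_sub_max_le_max _ _ _ _).trans ?_
  rw [sub_self, abs_zero, max_eq_left (abs_nonneg _), h1]
  have e : r ^ 2 - (r ^ 2 * ‖frameCoord c f₁ f₂ r y‖ ^ 2 + ⟪y - c, ν⟫ ^ 2)
      - r ^ 2 * (1 - ‖frameCoord c f₁ f₂ r y‖ ^ 2) = -⟪y - c, ν⟫ ^ 2 := by ring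
  rw [e, abs_neg, abs_of_nonneg (sq_nonneg _), ← sq_abs]
  calc |⟪y - c, ν⟫| ^ 2 ≤ (D * r * r) ^ 2 := by
        gcongr
        exact (h.height y ⟨hy, hyb⟩).trans (by gcongr; exact h.κ_le_mul)
    _ = _ := by ring

/-- Where the linear part is large the quadratic term is. -/
theorem le_quadratic (hg : ⟪g, ν⟫ = 0) (hΓ : MeasurableSet Γ) :
    smallDiscArea / 32 * r ^ 6 * ‖g‖ ^ 2
      ≤ ∫ y in patchDisc Γ c f₁ f₂ r, 4 * paraboloid c r y * ⟪y - c, g⟫ ^ 2 ∂surfaceMeasure := by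
  have hr := h.r_pos
  have hκ0 := h.κ_nonneg
  have hκ1 := h.κ_le
  have hnn : ∀ y, 0 ≤ 4 * paraboloid c r y * ⟪y - c, g⟫ ^ 2 := fun y => by
    have := paraboloid_nonneg c r y; positivity
  rcases eq_or_ne g 0 with rfl | hg0
  · simp
  have hgp : 0 < ‖g‖ := norm_pos_iff.2 hg0
  set G := frameVec f₁ f₂ g with hG
  have hGn : ‖G‖ = ‖g‖ := h.frame.norm_frameVec hg
  -- The disc of radius `1/8` about `s₀`, at distance `1/4` in the direction of `g`: there the
  -- linear part is at least `‖g‖/8` and the cut-off stays at least `r²/2`.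
  set s₀ : E2 := (1 / (4 * ‖g‖)) • G with hs₀
  have hs₀n : ‖s₀‖ = 1 / 4 := by
    rw [hs₀, norm_smul, hGn, Real.norm_eq_abs, abs_of_pos (by positivity)]; field_simp
  have hGs₀ : ⟪G, s₀⟫ = ‖g‖ / 4 := by
    rw [hs₀, inner_smul_right, real_inner_self_eq_norm_sq, hGn]; field_simp
  have hE : ∀ s ∈ ball s₀ (1 / 8), ‖s‖ ≤ 3 / 8 ∧ ‖g‖ / 8 ≤ ⟪G, s⟫ := by
    intro s hs
    rw [mem_ball, dist_eq_norm] at hs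
    have e : s = s₀ + (s - s₀) := by abel
    constructor
    · rw [e]; refine (norm_add_le _ _).trans ?_; rw [hs₀n]; linarith
    · have h1 := neg_abs_le ⟪G, s - s₀⟫
      have h2 := abs_real_inner_le_norm G (s - s₀)
      have h3 : ‖G‖ * ‖s - s₀‖ ≤ ‖g‖ * (1 / 8) := by rw [hGn]; gcongr
      rw [e, inner_add_right, hGs₀]; linarith
  have hsub : ball s₀ (1 / 8) ⊆ ball 0 1 := fun s hs => by
    rw [mem_ball_zero_iff]; linarith [(hE s hs).1]
  set Q := Γ ∩ ball c (2 * r) ∩ frameCoord c f₁ f₂ r ⁻¹' ball s₀ (1 / 8) with hQ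
  have hQm : MeasurableSet Q := (hΓ.inter measurableSet_ball).inter
    ((frameCoord_continuous c f₁ f₂ r).measurable measurableSet_ball)
  have hQA : Q ⊆ patchDisc Γ c f₁ f₂ r := inter_subset_inter_right _ (preimage_mono hsub)
  have hlow : ∀ y ∈ Q, r ^ 4 * ‖g‖ ^ 2 / 32 ≤ 4 * paraboloid c r y * ⟪y - c, g⟫ ^ 2 := by
    intro y hy
    obtain ⟨h1, h2⟩ := hE _ hy.2
    have h3 := h.frame.norm_sub_sq hr c y c
    rw [frameCoord_self, sub_zero] at h3
    have h4 : ⟪y - c, ν⟫ ^ 2 ≤ r ^ 2 / 4 := by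
      rw [← sq_abs]
      calc |⟪y - c, ν⟫| ^ 2 ≤ (1 / 2 * r) ^ 2 := by
            gcongr
            exact (h.height y hy.1).trans (by gcongr)
        _ = _ := by ring
    have h5 : ‖frameCoord c f₁ f₂ r y‖ ^ 2 ≤ (3 / 8) ^ 2 := by gcongr
    have h6 : r ^ 2 / 2 ≤ paraboloid c r y := by
      refine le_trans ?_ (le_max_left _ _)
      nlinarith [sq_nonneg r]
    have h7 : (r * (‖g‖ / 8)) ^ 2 ≤ ⟪y - c, g⟫ ^ 2 := by
      rw [h.frame.inner_frameVec hg hr]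
      gcongr
    calc _ = 4 * (r ^ 2 / 2) * (r * (‖g‖ / 8)) ^ 2 := by ring
      _ ≤ _ := by
          have := paraboloid_nonneg c r y
          gcongr
  have hint : IntegrableOn (fun y => 4 * paraboloid c r y * ⟪y - c, g⟫ ^ 2)
      (patchDisc Γ c f₁ f₂ r) surfaceMeasure := by
    refine Measure.integrableOn_of_bounded h.measure_patchDisc_lt_top.ne (M := 4 * r ^ 2 * (2 * r * ‖g‖) ^ 2)
      ?_ ?_
    · have := continuous_paraboloid c r
      exact (by fun_prop : Continuous fun y => 4 * paraboloid c r y * ⟪y - c, g⟫ ^ 2).aestronglyMeasurable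
    · filter_upwards [ae_restrict_mem (measurableSet_patchDisc hΓ c f₁ f₂ r)] with y hy
      rw [Real.norm_eq_abs, abs_of_nonneg (hnn y), ← sq_abs ⟪y - c, g⟫]
      have := paraboloid_nonneg c r y
      gcongr
      · exact paraboloid_le c r y
      · refine (abs_real_inner_le_norm _ _).trans ?_
        gcongr
        rw [← dist_eq_norm]; exact (mem_ball.1 hy.1.2).le
  have hm := h.le_measureReal hsub
  have hvol : volume.real (ball s₀ (1 / 8)) = smallDiscArea := by
    rw [smallDiscArea, measureReal_def, measureReal_def, Measure.addHaar_ball_center]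
  rw [hvol, ← hQ] at hm
  have hQfin : surfaceMeasure Q ≠ ⊤ := ((measure_mono hQA).trans_lt h.measure_patchDisc_lt_top).ne
  calc smallDiscArea / 32 * r ^ 6 * ‖g‖ ^ 2
      = r ^ 2 * smallDiscArea * (r ^ 4 * ‖g‖ ^ 2 / 32) := by ring
    _ ≤ surfaceMeasure.real Q * (r ^ 4 * ‖g‖ ^ 2 / 32) := by gcongr
    _ = ∫ _y in Q, r ^ 4 * ‖g‖ ^ 2 / 32 ∂surfaceMeasure := by rw [setIntegral_const, smul_eq_mul]
    _ ≤ ∫ y in Q, 4 * paraboloid c r y * ⟪y - c, g⟫ ^ 2 ∂surfaceMeasure :=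
        setIntegral_mono_on (integrableOn_const hQfin) (hint.mono_set hQA) hQm hlow
    _ ≤ _ := setIntegral_mono_set hint (Filter.Eventually.of_forall hnn) hQA.eventuallyLE

end IsNormalPatch

namespace IsNormalPatch
variable {Γ : Set E3} {c f₁ f₂ ν : E3} {r κ D : ℝ} {n : E3 → E3}
  (h : IsNormalPatch Γ c f₁ f₂ ν r κ D n) {g : E3}
include h

/-- Insert `w = a + ⟪g, y - c⟫ + O(r²)` and the leading form of the divergence into `-w div X`. The
square on the left appears; the term with the constant `a` is odd in the planar coordinates up to a
small error and nearly integrates to zero; the rest is `O(r⁴‖g‖)`. -/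
theorem quadratic_le_pointwise (hg : ⟪g, ν⟫ = 0) (hgD : r * ‖g‖ ≤ D) {a w : ℝ} (ha : |a| ≤ 1) {y : E3}
    (hy : y ∈ Γ) (hyb : y ∈ ball c (2 * r)) (hw : |w - a - ⟪g, y - c⟫| ≤ D * r ^ 2) :
    4 * paraboloid c r y * ⟪y - c, g⟫ ^ 2
      ≤ -(w * tangentialDiv Γ (testField c r n g) y)
        - 4 * a * r ^ 3 * (max (1 - ‖frameCoord c f₁ f₂ r y‖ ^ 2) 0
          * ⟪frameVec f₁ f₂ g, frameCoord c f₁ f₂ r y⟫)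
        + ((1 + 3 * D) * (8 * D + 12 * D ^ 2) + 8 * D ^ 2 + 8 * D) * r ^ 4 * ‖g‖ := by
  have hr := h.r_pos
  have hr1 := h.r_le
  have hD := h.D_nonneg
  have hE := h.abs_div_add_le hg hy hyb
  have hπ := h.abs_paraboloid_sub_le hy hyb
  have hp0 := paraboloid_nonneg c r y
  have hp1 := paraboloid_le c r y
  have hq : |⟪y - c, g⟫| ≤ 2 * r * ‖g‖ := by
    refine (abs_real_inner_le_norm _ _).trans ?_
    gcongr
    rw [← dist_eq_norm]; exact (mem_ball.1 hyb).le
  have hqf := h.frame.inner_frameVec hg hr c y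
  rw [real_inner_comm] at hw
  set q := ⟪y - c, g⟫ with hqd
  set p := paraboloid c r y with hpd
  set E := tangentialDiv Γ (testField c r n g) y + 4 * p * q with hEd
  set P := max (1 - ‖frameCoord c f₁ f₂ r y‖ ^ 2) 0 with hP
  set e := w - a - q with hed
  have hr2 : r ^ 2 ≤ 1 := by nlinarith
  have hwb : |w| ≤ 1 + 3 * D := by
    have e1 : w = e + (a + q) := by rw [hed]; ring
    rw [e1]
    have h1 := abs_add_le e (a + q)
    have h2 := abs_add_le a q
    have h3 : D * r ^ 2 ≤ D * 1 := by gcongr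
    linarith
  have t1 : |w * E| ≤ (1 + 3 * D) * (r ^ 4 * ‖g‖ * (8 * D + 12 * D ^ 2)) := by
    rw [abs_mul]; gcongr
  have t2 : |4 * a * (p - r ^ 2 * P) * q| ≤ 8 * D ^ 2 * r ^ 4 * ‖g‖ := by
    rw [abs_mul, abs_mul, abs_mul, abs_of_pos (by norm_num : (0 : ℝ) < 4)]
    calc _ ≤ 4 * 1 * (D ^ 2 * r ^ 4) * (2 * r * ‖g‖) := by gcongr
      _ = 8 * D ^ 2 * r ^ 4 * ‖g‖ * r := by ring
      _ ≤ _ := mul_le_of_le_one_right (by positivity) hr1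
  have t3 : |4 * e * p * q| ≤ 8 * D * r ^ 4 * ‖g‖ := by
    rw [abs_mul, abs_mul, abs_mul, abs_of_pos (by norm_num : (0 : ℝ) < 4), abs_of_nonneg hp0]
    calc _ ≤ 4 * (D * r ^ 2) * r ^ 2 * (2 * r * ‖g‖) := by gcongr
      _ = 8 * D * r ^ 4 * ‖g‖ * r := by ring
      _ ≤ _ := mul_le_of_le_one_right (by positivity) hr1
  have key : 4 * p * q ^ 2 = -(w * tangentialDiv Γ (testField c r n g) y)
      - 4 * a * r ^ 3 * (P * ⟪frameVec f₁ f₂ g, frameCoord c f₁ f₂ r y⟫)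
      + (w * E - 4 * a * (p - r ^ 2 * P) * q - 4 * e * p * q) := by
    have e1 : a * r ^ 3 * (P * ⟪frameVec f₁ f₂ g, frameCoord c f₁ f₂ r y⟫) = a * r ^ 2 * P * q := by
      rw [hqf]; ring
    rw [hEd, hed]
    linear_combination 4 * e1
  have t1' := (abs_le.1 t1).2
  have t2' := (abs_le.1 t2).1
  have t3' := (abs_le.1 t3).1
  rw [key]
  nlinarith

/-- The local gradient estimate with explicit constants. -/
theorem sq_mul_norm_sq_le (hΓ : MeasurableSet Γ) (hfin : surfaceMeasure Γ < ⊤) (hg : ⟪g, ν⟫ = 0)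
    (hgD : r * ‖g‖ ≤ D) {a : ℝ} (ha : |a| ≤ 1) {u w : E3 → ℝ} {g₀ g' : E3 → E3}
    (hu : HasWeakTangentialGradient Γ u g₀)
    (hv : HasWeakTangentialGradient Γ (fun x => u x - w x) g')
    (hw : ∀ y ∈ Γ, y ∈ ball c (2 * r) → |w y - a - ⟪g, y - c⟫| ≤ D * r ^ 2) {β : ℝ} (hβ : 0 < β) :
    smallDiscArea / 32 * r ^ 2 * ‖g‖ ^ 2
      ≤ (β * ∫ y in Γ ∩ ball c (2 * r), ‖g₀ y - g' y‖ ^ 2 ∂surfaceMeasure)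
        + 1 / (4 * β) * (2 * discArea) * r ^ 2 * ‖g‖ ^ 2
        + (8 * D ^ 2 + 2 * ((1 + 3 * D) * (8 * D + 12 * D ^ 2) + 8 * D ^ 2 + 8 * D)) * discArea
          * r ^ 2 * ‖g‖ := by
  have hr := h.r_pos
  have hr1 := h.r_le
  have hD := h.D_nonneg
  have hdA := discArea_nonneg
  set R₀ := (1 + 3 * D) * (8 * D + 12 * D ^ 2) + 8 * D ^ 2 + 8 * D with hR₀
  set A := patchDisc Γ c f₁ f₂ r with hA
  set X := testField c r n g with hX
  have hAm : MeasurableSet A := measurableSet_patchDisc hΓ _ _ _ _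
  have hAΓ : A ⊆ Γ := fun y hy => hy.1.1
  have hAt := h.measure_patchDisc_lt_top
  have hAr := h.measureReal_patchDisc_le'
  rw [← hA] at hAt hAr
  have hAi : IsFiniteMeasure (surfaceMeasure.restrict A) :=
    ⟨by rwa [Measure.restrict_apply_univ]⟩
  obtain ⟨i1, i2, hIBP⟩ := hu.integral_sub hfin hv (contDiff_testField (g := g) hr h.contDiffOn)
    (fun x hx => h.testField_mem_tangentPlane hx) h.norm_testField_le'
    (aestronglyMeasurable_tangentialDiv_testField hΓ hr h.contDiffOn h.norm_eq h.tangentPlane_eq)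
    ((ae_restrict_iff' hΓ).2 (Filter.Eventually.of_forall fun y hy => h.abs_tangentialDiv_le hg hy))
  rw [← hX] at i1 i2 hIBP
  have hbz : ∀ y ∈ Γ \ A, y ∉ ball c r := fun y hy hb => hy.2 (h.ball_inter_subset ⟨hy.1, hb⟩)
  have e1 : ∫ y in Γ, w y * tangentialDiv Γ X y ∂surfaceMeasure
      = ∫ y in A, w y * tangentialDiv Γ X y ∂surfaceMeasure :=
    setIntegral_eq_of_subset_of_forall_sdiff_eq_zero hΓ hAΓ fun y hy => by
      rw [h.tangentialDiv_eq_zero hy.1 (hbz y hy), mul_zero]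
  have e2 : ∫ y in Γ, ⟪g₀ y - g' y, X y⟫ ∂surfaceMeasure
      = ∫ y in A, ⟪g₀ y - g' y, X y⟫ ∂surfaceMeasure :=
    setIntegral_eq_of_subset_of_forall_sdiff_eq_zero hΓ hAΓ fun y hy => by
      rw [hX, testField_eq_zero hr.le (hbz y hy), inner_zero_right]
  rw [e1, e2] at hIBP
  -- the odd term
  set f : E2 → ℝ := fun s => max (1 - ‖s‖ ^ 2) 0 * ⟪frameVec f₁ f₂ g, s⟫ with hf
  have hfc : Continuous f := by fun_prop
  have hfb : ∀ s ∈ ball (0 : E2) 1, |f s| ≤ ‖g‖ := by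
    intro s hs
    rw [mem_ball_zero_iff] at hs
    have h1 := abs_real_inner_le_norm (frameVec f₁ f₂ g) s
    rw [h.frame.norm_frameVec hg] at h1
    have h2 : max (1 - ‖s‖ ^ 2) 0 ≤ 1 := max_le (by linarith [sq_nonneg ‖s‖]) zero_le_one
    have h3 : 0 ≤ max (1 - ‖s‖ ^ 2) 0 := le_max_right _ _
    rw [hf]; simp only
    rw [abs_mul, abs_of_nonneg h3]
    calc _ ≤ 1 * (‖g‖ * 1) := by gcongr; exact h1.trans (by gcongr)
      _ = _ := by ring
  have hodd := h.abs_integral_odd_le hΓ hfc (fun s => by simp [hf]) hfb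
  rw [← hA] at hodd
  have hfi : IntegrableOn (fun y => f (frameCoord c f₁ f₂ r y)) A surfaceMeasure := by
    refine Measure.integrableOn_of_bounded hAt.ne (M := ‖g‖)
      (hfc.comp (frameCoord_continuous _ _ _ _)).aestronglyMeasurable ?_
    filter_upwards [ae_restrict_mem hAm] with y hy using hfb _ hy.2
  -- the field
  have hGm : MemLp (fun y => g₀ y - g' y) 2 (surfaceMeasure.restrict Γ) :=
    hu.memLp_grad.sub hv.memLp_grad
  have hG2 : IntegrableOn (fun y => ‖g₀ y - g' y‖ ^ 2) Γ surfaceMeasure := by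
    have := hGm.integrable_norm_pow two_ne_zero
    exact this
  have hYoung : ∀ y, ⟪g₀ y - g' y, X y⟫ ≤ r ^ 4 * (β * ‖g₀ y - g' y‖ ^ 2)
      + r ^ 4 * (1 / (4 * β) * ‖g‖ ^ 2) := by
    intro y
    have h1 : ⟪g₀ y - g' y, X y⟫ ≤ ‖g₀ y - g' y‖ * (r ^ 4 * ‖g‖) :=
      (real_inner_le_norm _ _).trans (by gcongr; exact h.norm_testField_le' y)
    have h2 : ‖g₀ y - g' y‖ * ‖g‖ ≤ β * ‖g₀ y - g' y‖ ^ 2 + 1 / (4 * β) * ‖g‖ ^ 2 := by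
      have e : β * ‖g₀ y - g' y‖ ^ 2 + 1 / (4 * β) * ‖g‖ ^ 2 - ‖g₀ y - g' y‖ * ‖g‖
          = (2 * β * ‖g₀ y - g' y‖ - ‖g‖) ^ 2 / (4 * β) := by field_simp; ring
      have : 0 ≤ (2 * β * ‖g₀ y - g' y‖ - ‖g‖) ^ 2 / (4 * β) := by positivity
      linarith
    calc _ ≤ r ^ 4 * (‖g₀ y - g' y‖ * ‖g‖) := h1.trans_eq (by ring)
      _ ≤ r ^ 4 * (β * ‖g₀ y - g' y‖ ^ 2 + 1 / (4 * β) * ‖g‖ ^ 2) := by gcongr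
      _ = _ := by ring
  have hGA : ∫ y in A, ‖g₀ y - g' y‖ ^ 2 ∂surfaceMeasure
      ≤ ∫ y in Γ ∩ ball c (2 * r), ‖g₀ y - g' y‖ ^ 2 ∂surfaceMeasure :=
    setIntegral_mono_set (hG2.mono_set inter_subset_left)
      (Filter.Eventually.of_forall fun y => sq_nonneg _) inter_subset_left.eventuallyLE
  have hflux : ∫ y in A, ⟪g₀ y - g' y, X y⟫ ∂surfaceMeasure
      ≤ r ^ 4 * (β * ∫ y in Γ ∩ ball c (2 * r), ‖g₀ y - g' y‖ ^ 2 ∂surfaceMeasure)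
        + r ^ 4 * (1 / (4 * β) * ‖g‖ ^ 2) * (2 * r ^ 2 * discArea) := by
    have j1 : IntegrableOn (fun y => r ^ 4 * (β * ‖g₀ y - g' y‖ ^ 2)) A surfaceMeasure :=
      ((hG2.mono_set hAΓ).const_mul β).const_mul (r ^ 4)
    have j2 : IntegrableOn (fun _ : E3 => r ^ 4 * (1 / (4 * β) * ‖g‖ ^ 2)) A surfaceMeasure :=
      integrableOn_const hAt.ne
    calc _ ≤ ∫ y in A, (r ^ 4 * (β * ‖g₀ y - g' y‖ ^ 2)
          + r ^ 4 * (1 / (4 * β) * ‖g‖ ^ 2)) ∂surfaceMeasure :=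
          integral_mono (i2.mono_set hAΓ) (IntegrableOn.fun_add j1 j2) hYoung
      _ = r ^ 4 * (β * ∫ y in A, ‖g₀ y - g' y‖ ^ 2 ∂surfaceMeasure)
          + r ^ 4 * (1 / (4 * β) * ‖g‖ ^ 2) * surfaceMeasure.real A := by
          rw [integral_add j1 j2, integral_const_mul, integral_const_mul, setIntegral_const,
            smul_eq_mul, mul_comm (surfaceMeasure.real A)]
      _ ≤ _ := by gcongr
  -- integrate the pointwise bound
  have k1 := i1.mono_set hAΓ
  have k2 : IntegrableOn (fun y => 4 * a * r ^ 3 * f (frameCoord c f₁ f₂ r y)) A surfaceMeasure :=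
    hfi.const_mul _
  have k3 : IntegrableOn (fun _ : E3 => R₀ * r ^ 4 * ‖g‖) A surfaceMeasure :=
    integrableOn_const hAt.ne
  have hp := continuous_paraboloid c r
  have k0 : IntegrableOn (fun y => 4 * paraboloid c r y * ⟪y - c, g⟫ ^ 2) A surfaceMeasure := by
    refine Measure.integrableOn_of_bounded hAt.ne (M := 4 * r ^ 2 * (2 * r * ‖g‖) ^ 2)
      (by fun_prop : Continuous fun y =>
        4 * paraboloid c r y * ⟪y - c, g⟫ ^ 2).aestronglyMeasurable ?_
    filter_upwards [ae_restrict_mem hAm] with y hy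
    have := paraboloid_nonneg c r y
    rw [Real.norm_eq_abs, abs_of_nonneg (by positivity), ← sq_abs ⟪y - c, g⟫]
    gcongr
    · exact paraboloid_le c r y
    · refine (abs_real_inner_le_norm _ _).trans ?_
      gcongr
      rw [← dist_eq_norm]; exact (mem_ball.1 hy.1.2).le
  have hup : ∫ y in A, 4 * paraboloid c r y * ⟪y - c, g⟫ ^ 2 ∂surfaceMeasure
      ≤ ∫ y in A, (-(w y * tangentialDiv Γ X y) - 4 * a * r ^ 3 * f (frameCoord c f₁ f₂ r y)
        + R₀ * r ^ 4 * ‖g‖) ∂surfaceMeasure :=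
    setIntegral_mono_on k0 (IntegrableOn.fun_add (IntegrableOn.fun_sub (IntegrableOn.fun_neg k1) k2) k3) hAm fun y hy =>
      h.quadratic_le_pointwise hg hgD ha hy.1.1 hy.1.2 (hw y hy.1.1 hy.1.2)
  rw [integral_add (IntegrableOn.fun_sub (IntegrableOn.fun_neg k1) k2) k3,
    MeasureTheory.integral_sub (IntegrableOn.fun_neg k1) k2, integral_neg, hIBP,
    neg_neg, integral_const_mul, setIntegral_const, smul_eq_mul] at hup
  have hlow := h.le_quadratic hg hΓ
  rw [← hA] at hlow
  have hoddb : |4 * a * r ^ 3 * ∫ y in A, f (frameCoord c f₁ f₂ r y) ∂surfaceMeasure|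
      ≤ 8 * D ^ 2 * discArea * r ^ 6 * ‖g‖ := by
    rw [abs_mul, abs_mul, abs_mul, abs_of_pos (by norm_num : (0 : ℝ) < 4),
      abs_of_nonneg (by positivity : 0 ≤ r ^ 3)]
    have hκ : κ ^ 2 ≤ (D * r) ^ 2 := by gcongr; exacts [h.κ_nonneg, h.κ_le_mul]
    calc _ ≤ 4 * 1 * r ^ 3 * (2 * (D * r) ^ 2 * r ^ 2 * ‖g‖ * discArea) := by
          gcongr
          exact hodd.trans (by gcongr)
      _ = 8 * D ^ 2 * discArea * r ^ 6 * ‖g‖ * r := by ring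
      _ ≤ _ := mul_le_of_le_one_right (by positivity) hr1
  have hR₀0 : 0 ≤ R₀ := by positivity
  have hcst : surfaceMeasure.real A * (R₀ * r ^ 4 * ‖g‖)
      ≤ 2 * r ^ 2 * discArea * (R₀ * r ^ 4 * ‖g‖) := by gcongr
  have hr4 : 0 < r ^ 4 := by positivity
  -- All terms carry the factor `r⁴`, which comes from the size of the cut-off.
  refine le_of_mul_le_mul_left ?_ hr4
  have := (abs_le.1 hoddb).1
  calc r ^ 4 * (smallDiscArea / 32 * r ^ 2 * ‖g‖ ^ 2)
      = smallDiscArea / 32 * r ^ 6 * ‖g‖ ^ 2 := by ring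
    _ ≤ r ^ 4 * (β * ∫ y in Γ ∩ ball c (2 * r), ‖g₀ y - g' y‖ ^ 2 ∂surfaceMeasure)
        + r ^ 4 * (1 / (4 * β) * ‖g‖ ^ 2) * (2 * r ^ 2 * discArea)
        + 8 * D ^ 2 * discArea * r ^ 6 * ‖g‖ + 2 * r ^ 2 * discArea * (R₀ * r ^ 4 * ‖g‖) := by
        linarith
    _ = _ := by ring

end IsNormalPatch

/-- The constant of the local gradient estimate. -/
theorem exists_local_gradient_const (D : ℝ) : ∃ C, 0 ≤ C ∧
    ∀ {Γ : Set E3} {c f₁ f₂ ν : E3} {r κ : ℝ} {n : E3 → E3},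
    IsNormalPatch Γ c f₁ f₂ ν r κ D n → MeasurableSet Γ → surfaceMeasure Γ < ⊤ →
    ∀ {g : E3}, ⟪g, ν⟫ = 0 → r * ‖g‖ ≤ D → ∀ {a : ℝ}, |a| ≤ 1 →
    ∀ {u w : E3 → ℝ} {g₀ g' : E3 → E3}, HasWeakTangentialGradient Γ u g₀ →
    HasWeakTangentialGradient Γ (fun x => u x - w x) g' →
    (∀ y ∈ Γ, y ∈ ball c (2 * r) → |w y - a - ⟪g, y - c⟫| ≤ D * r ^ 2) →
    r ^ 2 * ‖g‖ ^ 2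
      ≤ C * ((∫ y in Γ ∩ ball c (2 * r), ‖g₀ y - g' y‖ ^ 2 ∂surfaceMeasure) + r ^ 2) := by
  have hb := smallDiscArea_pos
  have hd := discArea_nonneg
  set b := smallDiscArea with hbd
  set d := discArea
  set C₁ := (8 * D ^ 2 + 2 * ((1 + 3 * D) * (8 * D + 12 * D ^ 2) + 8 * D ^ 2 + 8 * D)) * d
    with hC₁
  -- Chosen so that the Young terms from the field and from the linear error each use at most
  -- `b/128` of the available `b/32`, leaving `b/64`.
  set β := 64 * (d + 1) / b with hβ
  have hβ0 : 0 < β := by positivity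
  refine ⟨64 / b * (β + 32 * C₁ ^ 2 / b), by positivity, ?_⟩
  intro Γ c f₁ f₂ ν r κ n h hΓ hfin g hg hgD a ha u w g₀ g' hu hv hw
  have key := h.sq_mul_norm_sq_le hΓ hfin hg hgD ha hu hv hw hβ0
  rw [← hC₁, ← hbd] at key
  set I := ∫ y in Γ ∩ ball c (2 * r), ‖g₀ y - g' y‖ ^ 2 ∂surfaceMeasure with hI
  have hI0 : 0 ≤ I := integral_nonneg fun y => sq_nonneg _
  have h1 : 1 / (4 * β) * (2 * d) ≤ b / 128 := by
    rw [hβ, one_div, inv_mul_le_iff₀ (by positivity)]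
    have : 4 * (64 * (d + 1) / b) * (b / 128) = 2 * (d + 1) := by field_simp; norm_num
    rw [this]; linarith
  have h2 : C₁ * r ^ 2 * ‖g‖ ≤ b / 128 * r ^ 2 * ‖g‖ ^ 2 + 32 * C₁ ^ 2 / b * r ^ 2 := by
    have e : b / 128 * r ^ 2 * ‖g‖ ^ 2 + 32 * C₁ ^ 2 / b * r ^ 2 - C₁ * r ^ 2 * ‖g‖
        = r ^ 2 * (b * ‖g‖ - 64 * C₁) ^ 2 / (128 * b) := by field_simp; ring
    have : 0 ≤ r ^ 2 * (b * ‖g‖ - 64 * C₁) ^ 2 / (128 * b) := by positivity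
    linarith
  have h3 : 1 / (4 * β) * (2 * d) * r ^ 2 * ‖g‖ ^ 2 ≤ b / 128 * r ^ 2 * ‖g‖ ^ 2 := by gcongr
  have h4 : b / 64 * (r ^ 2 * ‖g‖ ^ 2) ≤ β * I + 32 * C₁ ^ 2 / b * r ^ 2 := by nlinarith
  have h5 : 0 ≤ C₁ ^ 2 / b := by positivity
  calc r ^ 2 * ‖g‖ ^ 2 = 64 / b * (b / 64 * (r ^ 2 * ‖g‖ ^ 2)) := by field_simp
    _ ≤ 64 / b * (β * I + 32 * C₁ ^ 2 / b * r ^ 2) := by gcongr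
    _ ≤ 64 / b * ((β + 32 * C₁ ^ 2 / b) * (I + r ^ 2)) := by
        gcongr
        have : 0 ≤ β * r ^ 2 + 32 * C₁ ^ 2 / b * I := by positivity
        linarith
    _ = _ := by ring

/-! ### Normal projection and lifts of triangles. -/

/-- A point close to the surface on a normal line is projected to the foot point. -/
theorem normalProj_add_smul {Γ : Set E3} {y m : E3} {L s : ℝ} (hy : y ∈ Γ) (hm : ‖m‖ = 1)
    (hq : ∀ w ∈ Γ, |⟪m, w - y⟫| ≤ L * ‖w - y‖ ^ 2) (hs : 2 * |s| * L < 1) :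
    normalProj Γ (y + s • m) = y := by
  have key : ∀ w ∈ Γ, s ^ 2 + (1 - 2 * |s| * L) * ‖w - y‖ ^ 2 ≤ dist (y + s • m) w ^ 2 := by
    intro w hw
    have e : y + s • m - w = s • m - (w - y) := by abel
    rw [dist_eq_norm, e, norm_sub_sq_real (s • m), norm_smul, hm, inner_smul_left, Real.norm_eq_abs,
      mul_one, sq_abs]
    have h1 : s * ⟪m, w - y⟫ ≤ |s| * (L * ‖w - y‖ ^ 2) := by
      refine (le_abs_self _).trans ?_
      rw [abs_mul]
      gcongr
      exact hq w hw
    simp only [conj_trivial]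
    linarith
  have hd : dist (y + s • m) y = |s| := by
    rw [dist_eq_norm, add_sub_cancel_left, norm_smul, hm, mul_one, Real.norm_eq_abs]
  have hle : ∀ w ∈ Γ, |s| ≤ dist (y + s • m) w := fun w hw => by
    refine abs_le_of_sq_le_sq ?_ dist_nonneg
    have : 0 ≤ (1 - 2 * |s| * L) * ‖w - y‖ ^ 2 := mul_nonneg (by linarith) (sq_nonneg _)
    linarith [key w hw]
  have hinf : infDist (y + s • m) Γ = |s| :=
    le_antisymm (hd ▸ infDist_le_dist_of_mem hy) ((le_infDist ⟨y, hy⟩).2 fun w hw => hle w hw)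
  have hex : ∃ p, p ∈ Γ ∧ dist (y + s • m) p = infDist (y + s • m) Γ := ⟨y, hy, by rw [hd, hinf]⟩
  rw [normalProj, dif_pos hex]
  obtain ⟨hp, hpd⟩ := hex.choose_spec
  generalize hex.choose = p at *
  have h1 := key _ hp
  rw [hpd, hinf, sq_abs] at h1
  have h2 : ‖p - y‖ ^ 2 ≤ 0 := by
    by_contra hcon
    push Not at hcon
    have := mul_pos (by linarith : 0 < 1 - 2 * |s| * L) hcon
    linarith
  have h3 : ‖p - y‖ = 0 := by
    have := sq_nonneg ‖p - y‖
    exact pow_eq_zero_iff two_ne_zero |>.1 (le_antisymm h2 this)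
  exact sub_eq_zero.1 (norm_eq_zero.1 h3)

theorem EvolvingSurface.surf_zero {T : ℝ} (S : EvolvingSurface T) : S.surf 0 = S.Γ₀ := by
  rw [EvolvingSurface.surf, image_congr fun x hx => S.flow_zero x hx, image_id']

namespace EvolvingTriangulation
variable {T : ℝ} {S : EvolvingSurface T} {M : EvolvingTriangulation S}

/-- The barycentre of a triangle at time zero. -/
def centre (M : EvolvingTriangulation S) (i j k : Fin M.N) : E3 :=
  planeMap (M.node i 0) (M.ed 0 i j) (M.ed 0 i k) !₂[1 / 3, 1 / 3]

theorem IsTri.centre_mem {K : Finset (Fin M.N)} {i j k : Fin M.N} (h : M.IsTri K i j k) :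
    M.centre i j k ∈ M.elem 0 K := by
  rw [h.elem_eq]
  exact ⟨_, ⟨by simp, by simp, by simp; norm_num⟩, rfl⟩

namespace IsRegular
variable {ρ : ℝ} (hR : M.IsRegular ρ) (hT : 0 ≤ T) (hρ : 0 < ρ)
include hR hT hρ

/-- Interior points of a triangle are the only points with the same projection. -/
theorem eq_of_normalProj_eq {t : ℝ} (ht : t ∈ Icc 0 T) {K L : Finset (Fin M.N)} (hK : K ∈ M.tri)
    (hL : L ∈ M.tri) {w : Fin M.N → ℝ} (hw : IsWt K w) (hpos : ∀ l ∈ K, 0 < w l) {x x' : E3}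
    (hx : ∑ l, w l • M.node l t = x) (hx' : x' ∈ M.elem t L)
    (h : normalProj (S.surf t) x' = normalProj (S.surf t) x) : L = K ∧ x' = x := by
  have hE := hR.exact t ht
  have hM := hR.isProper hT hρ ht
  have hxK : x ∈ M.elem t K := mem_elem_iff.2 ⟨w, hw, hx⟩
  have h1 : normalProj (S.surf t) x ∈ normalProj (S.surf t) '' M.elem t (K ∩ L) := by
    rw [← hE.2.2 K hK L hL]
    exact ⟨mem_image_of_mem _ hxK, ⟨x', hx', h⟩⟩
  obtain ⟨x'', hx'', hp⟩ := h1
  have hxx : x'' = x := hE.1 K hK (elem_mono Finset.inter_subset_left hx'') hxK hp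
  subst hxx
  obtain ⟨w', hw', hs⟩ := mem_elem_iff.1 hx''
  have hw'K : IsWt K w' := ⟨hw'.nonneg, fun l hl => hw'.supp l fun hc =>
    hl (Finset.mem_inter.1 hc).1, hw'.sum⟩
  have hww := hM.wt_unique hK hw hw'K (hx.trans hs.symm)
  have hKL : K ⊆ L := fun l hl => by
    by_contra hc
    have h2 := hw'.supp l fun hcc => hc (Finset.mem_inter.1 hcc).2
    rw [← hww] at h2
    exact (hpos l hl).ne' h2
  have hKL' : K = L := Finset.eq_of_subset_of_card_le hKL
    (by rw [M.card_tri K hK, M.card_tri L hL])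
  subst hKL'
  exact ⟨rfl, hE.1 K hK hx' hxK h⟩

/-- Points of the plane of a triangle that are close to the barycentre lie in its interior. -/
theorem exists_wt_centre_add {K : Finset (Fin M.N)} {i j k : Fin M.N} (h : M.IsTri K i j k) {v : E3}
    (hv : ⟪M.nrm 0 i j k, v⟫ = 0) (hvn : ‖v‖ ≤ ρ * M.h / 12) :
    ∃ w, IsWt K w ∧ (∀ l ∈ K, 0 < w l) ∧ ∑ l, w l • M.node l 0 = M.centre i j k + v := by
  have h0 : (0 : ℝ) ∈ Icc 0 T := ⟨le_rfl, hT⟩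
  set e₁ := M.ed 0 i j with he₁
  set e₂ := M.ed 0 i k with he₂
  have hcr : cr e₁ e₂ ≠ 0 := hR.nondeg hT hρ h0 h
  have hcp : 0 < ‖cr e₁ e₂‖ := norm_pos_iff.2 hcr
  have hh := hR.h_pos hT
  have hsh1 : ρ * M.h * ‖e₁‖ ≤ ‖cr e₁ e₂‖ := hR.shape hT hρ h0 h
  have hsh2 : ρ * M.h * ‖e₂‖ ≤ ‖cr e₁ e₂‖ := by
    have := hR.shape hT hρ h0 h.swap
    rwa [cr_swap, norm_neg] at this
  -- By Cramer's rule these are the edge coordinates of `v`. The height bound makes each at most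
  -- `1/12`, so the barycentric coordinates, all `1/3` at the centre, stay positive.
  have hcoef : ∀ e u : E3, ‖u‖ ≤ ‖v‖ * ‖e‖ → ρ * M.h * ‖e‖ ≤ ‖cr e₁ e₂‖ →
      |⟪u, cr e₁ e₂⟫ / ‖cr e₁ e₂‖ ^ 2| ≤ 1 / 12 := by
    intro e u hu he
    rw [abs_div, abs_of_nonneg (sq_nonneg ‖cr e₁ e₂‖), div_le_iff₀ (by positivity)]
    calc _ ≤ ‖u‖ * ‖cr e₁ e₂‖ := abs_real_inner_le_norm _ _
      _ ≤ ρ * M.h / 12 * ‖e‖ * ‖cr e₁ e₂‖ := by gcongr; exact hu.trans (by gcongr)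
      _ = 1 / 12 * (ρ * M.h * ‖e‖) * ‖cr e₁ e₂‖ := by ring
      _ ≤ 1 / 12 * ‖cr e₁ e₂‖ * ‖cr e₁ e₂‖ := by gcongr
      _ = _ := by ring
  set a := ⟪cr v e₂, cr e₁ e₂⟫ / ‖cr e₁ e₂‖ ^ 2 with ha
  set b := ⟪cr e₁ v, cr e₁ e₂⟫ / ‖cr e₁ e₂‖ ^ 2 with hb
  have ha1 := abs_le.1 (hcoef e₂ (cr v e₂) (norm_cr_le _ _) hsh2)
  have hb1 := abs_le.1 (hcoef e₁ (cr e₁ v) ((norm_cr_le _ _).trans_eq (mul_comm _ _)) hsh1)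
  have hve : v = a • e₁ + b • e₂ := by
    have := cramer e₁ e₂ (cr e₁ e₂) v
    have hv' : ⟪cr e₁ e₂, v⟫ = 0 := hv
    rw [hv', zero_smul, add_zero, real_inner_self_eq_norm_sq] at this
    have h2 := congrArg (fun z => (‖cr e₁ e₂‖ ^ 2)⁻¹ • z) this
    simp only [smul_smul, smul_add] at h2
    rw [inv_mul_cancel₀ (by positivity), one_smul] at h2
    rw [h2, ha, hb, div_eq_inv_mul, div_eq_inv_mul]
  set s : E2 := !₂[1 / 3 + a, 1 / 3 + b] with hs
  have hs0 : s 0 = 1 / 3 + a := by simp [hs]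
  have hs1 : s 1 = 1 / 3 + b := by simp [hs]
  have hsr : s ∈ refTri := ⟨by rw [hs0]; linarith, by rw [hs1]; linarith, by rw [hs0, hs1]; linarith⟩
  refine ⟨triWt i j k s, h.isWt_triWt hsr, fun l hl => ?_, ?_⟩
  · unfold triWt
    rw [h.eq] at hl
    simp only [Finset.mem_insert, Finset.mem_singleton] at hl
    split_ifs with q1 q2 q3
    · rw [hs0, hs1]; linarith
    · rw [hs0]; linarith
    · rw [hs1]; linarith
    · exact absurd hl (by tauto)
  · rw [← h.planeMap_eq, centre, planeMap_apply, planeMap_apply, hs0, hs1, hve]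
    simp only [Matrix.cons_val_zero, Matrix.cons_val_one]
    module

end IsRegular

/-- A patch of the initial surface that is the lift of a part of the interior of the triangle
`K`. -/
structure IsLiftPatch (M : EvolvingTriangulation S) (K : Finset (Fin M.N)) (c f₁ f₂ ν : E3)
    (r κ D : ℝ) (n : E3 → E3) : Prop extends IsNormalPatch S.Γ₀ c f₁ f₂ ν r κ D n where
  centre_mem : c ∈ M.elem 0 K
  inner_gradK : ∀ v, ⟪M.gradK 0 K v, ν⟫ = 0
  lift : ∀ y ∈ S.Γ₀, y ∈ ball c (2 * r) → ∃ x ∈ M.elem 0 K, normalProj S.Γ₀ x = y ∧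
    (∀ g, ⟪g, ν⟫ = 0 → |⟪g, x - y⟫| ≤ 2 * D ^ 2 * r ^ 3 * ‖g‖) ∧
    ∀ L ∈ M.tri, ∀ x' ∈ M.elem 0 L, normalProj S.Γ₀ x' = y → L = K ∧ x' = x

theorem inner_gradK_nrm (hM : M.IsProper 0) {K : Finset (Fin M.N)} {i j k : Fin M.N}
    (h : M.IsTri K i j k) (v : Fin M.N → ℝ) : ⟪M.gradK 0 K v, M.nrm 0 i j k⟫ = 0 := by
  rw [hM.gradK_eq h, gvec, inner_smul_left, nrm, inner_cr_right, mul_zero]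

-- Each patch is built over the plane of the triangle, centred at the barycentre, with `ν` the
-- triangle normal oriented like the surface normal at a node. From a point `y` of the patch one
-- follows the surface normal to that plane; the point reached is interior to the triangle, projects
-- to `y`, and by exactness is the only point of the discrete surface doing so. The displacement is
-- `O(r²)` and along a direction `O(r)`-close to `ν`, so vectors parallel to the triangle see it
-- only to order `r³`.
set_option maxHeartbeats 1000000 in
theorem exists_isLiftPatch (hT : 0 ≤ T) (S : EvolvingSurface T) {ρ : ℝ} (hρ : 0 < ρ) :
    ∃ h₀ D : ℝ, 0 < h₀ ∧ ∀ M : EvolvingTriangulation S, M.IsRegular ρ → M.h < h₀ →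
      ∀ K ∈ M.tri, ∃ c f₁ f₂ ν κ n, M.IsLiftPatch K c f₁ f₂ ν (ρ / 36 * M.h) κ D n := by
  obtain ⟨δ, L, hδ, hL, hch⟩ := S.isClosedC2Surface.exists_chart
  set η := ρ / 36 with hη
  set B := 4 * L / ρ ^ 2 with hB
  set κ₀ := (9 * L + 3 * B) / η with hκ₀
  have hη0 : 0 < η := by positivity
  have hB0 : 0 ≤ B := by positivity
  have hκ₀0 : 0 < κ₀ := by positivity
  refine ⟨min (δ / 3) (1 / (2 * κ₀)), κ₀ / η, by positivity, fun M hR hh K hK => ?_⟩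
  have h0 : (0 : ℝ) ∈ Icc 0 T := ⟨le_rfl, hT⟩
  have hM := hR.isProper hT hρ h0
  have hρ1 := hR.rho_le_one hT hρ
  have hη1 : η ≤ 1 := by rw [hη]; linarith
  have hh0 := hR.h_pos hT
  have hh1 : 3 * M.h ≤ δ := by linarith [hh.trans_le (min_le_left _ _)]
  have hh2 : κ₀ * M.h < 1 / 2 := by
    have := hh.trans_le (min_le_right _ _)
    rw [lt_div_iff₀ (by positivity)] at this
    linarith
  have hκ9 : 9 * L + 3 * B ≤ κ₀ := by
    rw [hκ₀, le_div_iff₀ hη0]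
    exact mul_le_of_le_one_right (by positivity) hη1
  have hLh : 9 * L * M.h + 3 * B * M.h < 1 / 2 := by
    refine lt_of_le_of_lt ?_ hh2
    rw [← add_mul]; gcongr
  have hκD : κ₀ ≤ κ₀ / η := by
    rw [le_div_iff₀ hη0]; exact mul_le_of_le_one_right hκ₀0.le hη1
  have hDr : κ₀ / η * (η * M.h) = κ₀ * M.h := by field_simp
  obtain ⟨i, j, k, h⟩ := exists_isTri' hK
  set x₀ := M.node i 0 with hx₀
  have hx₀Γ : x₀ ∈ S.Γ₀ := M.node_mem i
  obtain ⟨n, γ, hc⟩ := hch x₀ hx₀Γ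
  have hx₀b : x₀ ∈ ball x₀ δ := mem_ball_self hδ
  have hn1 := hc.norm_eq x₀ hx₀b
  obtain ⟨σ, hσ, hσn⟩ := hR.exists_sign_nrm_zero hT hρ hn1 (hc.quad x₀ hx₀Γ hx₀b) (by linarith) h
  set N := M.nrm 0 i j k with hN
  have hN0 : N ≠ 0 := hR.nondeg hT hρ h0 h
  have hσ2 : σ * σ = 1 := by rcases hσ with rfl | rfl <;> norm_num
  have hσa : |σ| = 1 := by rcases hσ with rfl | rfl <;> norm_num
  set ν := σ • (‖N‖⁻¹ • N) with hν
  have hνn : ‖ν‖ = 1 := by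
    rw [hν, norm_smul, norm_smul, norm_inv, norm_norm, inv_mul_cancel₀ (norm_ne_zero_iff.2 hN0),
      Real.norm_eq_abs, hσa, mul_one]
  have hνN : ∀ v, ⟪v, N⟫ = 0 → ⟪v, ν⟫ = 0 := fun v hv => by
    rw [hν, inner_smul_right, inner_smul_right, hv, mul_zero, mul_zero]
  have hNν : ∀ v, ⟪v, ν⟫ = 0 → ⟪N, v⟫ = 0 := fun v hv => by
    rw [hν, inner_smul_right, inner_smul_right] at hv
    rw [real_inner_comm]
    have h1 : σ ≠ 0 := by rintro rfl; norm_num at hσ2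
    have h2 : ‖N‖⁻¹ ≠ 0 := inv_ne_zero (norm_ne_zero_iff.2 hN0)
    simpa [h1, h2] using hv
  have hnν : ‖n x₀ - ν‖ ≤ B * M.h := by
    have e : n x₀ - ν = -(σ • (‖N‖⁻¹ • N - σ • n x₀)) := by
      rw [smul_sub, smul_smul σ σ, hσ2, one_smul, hν]; abel
    rw [e, norm_neg, norm_smul, Real.norm_eq_abs, hσa, one_mul]
    exact hσn
  set e₁ := M.ed 0 i j with he₁
  have he₁0 : 0 < ‖e₁‖ := lt_of_lt_of_le (by positivity) (hR.le_norm_ed hT hρ h0 h)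
  have he₁ν : ⟪‖e₁‖⁻¹ • e₁, ν⟫ = 0 := by
    rw [inner_smul_left, hνN e₁ (by rw [hN, nrm, real_inner_comm, inner_cr_left]), mul_zero]
  have hf := isFrame_of_inner_eq_zero (f := ‖e₁‖⁻¹ • e₁)
    (by rw [norm_smul, norm_inv, norm_norm, inv_mul_cancel₀ he₁0.ne']) hνn he₁ν
  set f₁ := ‖e₁‖⁻¹ • e₁
  set f₂ := cr ν f₁
  set c := M.centre i j k with hcc
  have hcx₀ : ⟪c - x₀, ν⟫ = 0 := by
    refine hνN _ ?_
    rw [hcc, centre, planeMap_apply, add_sub_cancel_left, inner_add_left, inner_smul_left,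
      inner_smul_left, hN, nrm, real_inner_comm, inner_cr_left, real_inner_comm, inner_cr_right]
    simp
  have hcn : ‖c - x₀‖ ≤ M.h := by
    rw [← dist_eq_norm]
    exact dist_le_h h0 hK h.centre_mem (node_mem_elem h.mem_i)
  have hp : IsPatch S.Γ₀ c f₁ f₂ ν (η * M.h) (κ₀ * M.h) :=
    hc.isPatch hx₀Γ (by linarith) hf hh0 hη0 hη1 hB0 hcx₀ hcn hnν hh1 hh2
  have hrh : η * M.h ≤ M.h := mul_le_of_le_one_left hh0.le hη1
  have hsub3 : ball c (2 * (η * M.h)) ⊆ ball x₀ (3 * M.h) := fun z hz => by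
    rw [mem_ball] at hz ⊢
    have := dist_triangle z c x₀
    rw [dist_eq_norm c x₀] at this
    linarith
  have hsub : ball c (2 * (η * M.h)) ⊆ ball x₀ δ := hsub3.trans (ball_subset_ball hh1)
  have hnsub : ∀ y ∈ ball c (2 * (η * M.h)), ‖n y - ν‖ ≤ (3 * L + B) * M.h := by
    intro y hy
    have h1 := hc.lipschitz hx₀b (hsub hy)
    have h2 : ‖y - x₀‖ ≤ 3 * M.h := by rw [← dist_eq_norm]; exact (mem_ball.1 (hsub3 hy)).le
    have h3 : L * ‖y - x₀‖ ≤ L * (3 * M.h) := by gcongr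
    have e : n y - ν = (n y - n x₀) + (n x₀ - ν) := by abel
    rw [e]
    refine (norm_add_le _ _).trans ?_
    linarith
  have hnsubD : ∀ y ∈ ball c (2 * (η * M.h)), ‖n y - ν‖ ≤ κ₀ / η * (η * M.h) := fun y hy => by
    refine (hnsub y hy).trans ?_
    rw [hDr]
    gcongr
    linarith
  have hnp : IsNormalPatch S.Γ₀ c f₁ f₂ ν (η * M.h) (κ₀ * M.h) (κ₀ / η) n :=
    { hp with
      contDiffOn := hc.contDiffOn.mono hsub
      norm_eq := fun y hy => hc.norm_eq y (hsub hy)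
      norm_fderiv := fun y hy => (hc.norm_fderiv y (hsub hy)).trans (by linarith)
      tangentPlane_eq := fun y hy hyb => S.isClosedC2Surface.tangentPlane_eq hy
        (hc.norm_eq y (hsub hyb)) (hc.quad y hy (hsub hyb))
      norm_sub := hnsubD
      κ_le_mul := hDr.ge
      r_le := by nlinarith }
  refine ⟨c, f₁, f₂, ν, κ₀ * M.h, n, { hnp with
    centre_mem := h.centre_mem
    inner_gradK := fun v => hνN _ (inner_gradK_nrm hM h v)
    lift := fun y hy hyb => ?_ }⟩
  -- the normal line through `y` meets the plane of the triangle
  have hny := hc.norm_eq y (hsub hyb)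
  have hinn : 1 / 2 ≤ ⟪n y, ν⟫ := by
    have h1 := norm_sub_sq_real (n y) ν
    rw [hny, hνn] at h1
    have h2 : ‖n y - ν‖ ≤ 1 / 2 := (hnsub y hyb).trans (by nlinarith)
    have h3 := norm_nonneg (n y - ν)
    nlinarith
  have hin0 : ⟪n y, ν⟫ ≠ 0 := by linarith
  set s := -⟪y - c, ν⟫ / ⟪n y, ν⟫ with hs
  have hr0 : 0 < η * M.h := by positivity
  have hsb : |s| ≤ 2 * (κ₀ * M.h) * (η * M.h) := by
    rw [hs, abs_div, abs_neg, abs_of_pos (by linarith : 0 < ⟪n y, ν⟫), div_le_iff₀ (by linarith)]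
    have h1 := hp.height y ⟨hy, hyb⟩
    have h2 : 0 ≤ κ₀ * M.h * (η * M.h) := by positivity
    nlinarith
  set x := y + s • n y with hx
  have hsr : |s| ≤ η * M.h := hsb.trans (by nlinarith)
  have hxν : ⟪x - c, ν⟫ = 0 := by
    have e : x - c = (y - c) + s • n y := by rw [hx]; abel
    rw [e, inner_add_left, inner_smul_left, hs]
    simp only [conj_trivial]
    field_simp
    ring
  -- At most `2r` from `c` to `y` plus `r` along the normal gives `3r = ρh/12`; this is the origin
  -- of `r = ρh/36`.
  have hxn : ‖x - c‖ ≤ ρ * M.h / 12 := by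
    have e : x - c = (y - c) + s • n y := by rw [hx]; abel
    rw [e]
    refine (norm_add_le _ _).trans ?_
    rw [norm_smul, hny, mul_one, Real.norm_eq_abs, ← dist_eq_norm]
    have e2 : ρ * M.h / 12 = 3 * (η * M.h) := by rw [hη]; ring
    linarith [mem_ball.1 hyb]
  obtain ⟨w, hw, hwpos, hwx⟩ := hR.exists_wt_centre_add hT hρ h (hNν _ hxν) hxn
  rw [← hcc, add_sub_cancel] at hwx
  have hproj : normalProj S.Γ₀ x = y := by
    refine normalProj_add_smul hy hny (hc.quad y hy (hsub hyb)) ?_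
    have h2 : 2 * |s| * L ≤ 2 * M.h * L := by gcongr; exact hsr.trans hrh
    nlinarith
  refine ⟨x, mem_elem_iff.2 ⟨w, hw, hwx⟩, hproj, fun g hg => ?_, fun L' hL' x' hx' hpx' => ?_⟩
  · rw [hx, add_sub_cancel_left, inner_smul_right, abs_mul]
    have h1 : |⟪g, n y⟫| ≤ ‖g‖ * (κ₀ / η * (η * M.h)) := by
      have e : ⟪g, n y⟫ = ⟪g, n y - ν⟫ := by rw [inner_sub_right, hg, sub_zero]
      rw [e]
      exact (abs_real_inner_le_norm _ _).trans (by gcongr; exact hnsubD y hyb)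
    have h2 : |s| ≤ 2 * (κ₀ / η * (η * M.h)) * (η * M.h) := by rw [hDr]; exact hsb
    exact (mul_le_mul h2 h1 (abs_nonneg _) (by positivity)).trans_eq (by ring)
  · rw [← S.surf_zero] at hpx' hproj
    exact hR.eq_of_normalProj_eq hT hρ h0 hK hL' hw hwpos hwx hx' (hpx'.trans hproj.symm)

end EvolvingTriangulation

/-! ### Bounds on the discrete initial data. -/

theorem discArea_pos : 0 < discArea :=
  ENNReal.toReal_pos (measure_ball_pos _ _ one_pos).ne' measure_ball_lt_top.ne

theorem sq_l2Norm {F : Type*} [NormedAddCommGroup F] {Γ : Set E3} {f : E3 → F}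
    (hf : MemLp f 2 (surfaceMeasure.restrict Γ)) :
    l2Norm Γ f ^ 2 = ∫ x in Γ, ‖f x‖ ^ 2 ∂surfaceMeasure := by
  have h0 : 0 ≤ ∫ x in Γ, ‖f x‖ ^ 2 ∂surfaceMeasure := integral_nonneg fun x => sq_nonneg _
  have h1 := hf.eLpNorm_eq_integral_rpow_norm two_ne_zero ENNReal.ofNat_ne_top
  simp only [ENNReal.toReal_ofNat, Real.rpow_ofNat] at h1
  rw [l2Norm, h1, ENNReal.toReal_ofReal (by positivity), ← Real.rpow_natCast, ← Real.rpow_mul h0]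
  norm_num

namespace EvolvingTriangulation
variable {T : ℝ} {S : EvolvingSurface T} {M : EvolvingTriangulation S}

theorem IsProper.interp_sub_eq {t : ℝ} (hM : M.IsProper t) {K : Finset (Fin M.N)} (hK : K ∈ M.tri)
    (v : Fin M.N → ℝ) {x y : E3} (hx : x ∈ M.elem t K) (hy : y ∈ M.elem t K) :
    M.interp t v x - M.interp t v y = ⟪M.gradK t K v, x - y⟫ := by
  obtain ⟨i, j, k, h⟩ := exists_isTri' hK
  rw [hM.interp_eq_on h v hx, hM.interp_eq_on h v hy, ← hM.gradK_eq h, ← sub_sub_sub_cancel_right x y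
    (M.node i t), inner_sub_right _ (x - M.node i t)]
  ring

theorem IsProper.abs_interp_le {t : ℝ} (hM : M.IsProper t) {v : Fin M.N → ℝ} (hv : ∀ i, |v i| ≤ 1)
    (x : E3) : |M.interp t v x| ≤ 1 := by
  by_cases hx : x ∈ M.surf t
  · obtain ⟨K, hK, hxK⟩ := mem_iUnion₂.1 hx
    obtain ⟨w, hw, hwx⟩ := mem_elem_iff.1 hxK
    rw [hM.interp_of_isBary v (isBary_iff.2 ⟨K, hK, hw, hwx⟩)]
    refine (Finset.abs_sum_le_sum_abs _ _).trans ?_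
    rw [← hw.sum]
    refine Finset.sum_le_sum fun i _ => ?_
    rw [smul_eq_mul, abs_mul, abs_of_nonneg (hw.nonneg i)]
    exact mul_le_of_le_one_right (hw.nonneg i) (hv i)
  · rw [interp_of_notMem v hx, abs_zero]; exact zero_le_one

/-- An almost everywhere bound on a finite element function holds at the nodes. -/
theorem IsProper.abs_node_le {t : ℝ} (hM : M.IsProper t) {η : E3 → ℝ} (hη : η ∈ M.space t)
    (h : ∀ᵐ x ∂(surfaceMeasure.restrict (M.surf t)), |η x| ≤ 1) (i : Fin M.N) :
    |η (M.node i t)| ≤ 1 := by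
  by_contra hcon
  push Not at hcon
  obtain ⟨K, hK, hi⟩ := M.node_used i
  obtain ⟨j, k, hT⟩ := exists_isTri hK hi
  set v : Fin M.N → ℝ := fun i => η (M.node i t) with hv
  set q := planeMap (M.node i t) (M.ed t i j) (M.ed t i k) with hq
  set f : E2 → ℝ := fun s => (1 - s 0 - s 1) • v i + (s 0 • v j + s 1 • v k) with hf
  have hfc : Continuous f := by
    have h0 := E2_coord_continuous 0
    have h1 := E2_coord_continuous 1
    fun_prop
  have hηq : ∀ s ∈ refTri, η (q s) = f s := fun s hs => by
    rw [hM.eq_interp_of_mem_space hη]; exact hM.interp_planeMap v hT hs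
  set O : Set E2 := refTriInt ∩ {s | 1 < |f s|} with hO
  have hOo : IsOpen O := isOpen_refTriInt.inter (isOpen_lt continuous_const hfc.abs)
  have hOne : O.Nonempty := by
    have hc : Continuous fun a : ℝ => |f !₂[a, a]| := by
      have e : (fun a : ℝ => |f !₂[a, a]|)
          = fun a => |(1 - a - a) • v i + (a • v j + a • v k)| := by
        funext a; simp [hf]
      rw [e]; fun_prop
    have h0 : (fun a : ℝ => |f !₂[a, a]|) 0 ∈ Ioi (1 : ℝ) := by simpa [hf] using hcon
    have h1 := hc.continuousAt.preimage_mem_nhds (isOpen_Ioi.mem_nhds h0)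
    obtain ⟨ε, hε, hb⟩ := Metric.mem_nhds_iff.1 h1
    set a := min (ε / 2) (1 / 4) with ha
    have ha0 : 0 < a := by positivity
    have ha1 : a ≤ 1 / 4 := min_le_right _ _
    refine ⟨!₂[a, a], ⟨by simpa using ha0, by simpa using ha0, by simp; linarith⟩, ?_⟩
    refine hb ?_
    rw [mem_ball_zero_iff, Real.norm_eq_abs, abs_of_pos ha0]
    linarith [min_le_left (ε / 2) (1 / 4)]
  have hsub : q '' O ⊆ M.surf t := by
    rintro _ ⟨s, hs, rfl⟩
    refine IsProper.elem_subset_surf hK ?_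
    rw [hT.elem_eq]
    exact mem_image_of_mem _ (refTriInt_subset hs.1)
  have hpos : 0 < surfaceMeasure (q '' O) := by
    rw [hq, surfaceMeasure_planeMap_image]
    have h1 := norm_pos_iff.2 (hM.nondeg K i j k hT)
    exact ENNReal.mul_pos (ENNReal.ofReal_pos.2 h1).ne' (hOo.measure_pos _ hOne).ne'
  have hnull : surfaceMeasure.restrict (M.surf t) (q '' O) = 0 := by
    refine measure_mono_null ?_ h
    rintro _ ⟨s, hs, rfl⟩
    rw [mem_compl_iff, mem_ofPred_eq, not_le, hηq s (refTriInt_subset hs.1)]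
    exact hs.2
  have hle := Measure.le_restrict_apply (μ := surfaceMeasure) (M.surf t) (q '' O)
  rw [inter_eq_left.2 hsub, hnull] at hle
  exact hpos.ne' (le_antisymm hle bot_le)

/-- Inverse estimate for data bounded by one. It supplies the a priori bound on `r‖g‖` required by
the local gradient estimate. -/
theorem IsRegular.mul_norm_gradK_le {ρ : ℝ} (hR : M.IsRegular ρ) (hT : 0 ≤ T) (hρ : 0 < ρ) {t : ℝ}
    (ht : t ∈ Icc 0 T) {K : Finset (Fin M.N)} (hK : K ∈ M.tri) {v : Fin M.N → ℝ}
    (hv : ∀ i, |v i| ≤ 1) : M.h * ‖M.gradK t K v‖ ≤ 4 / ρ ^ 2 := by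
  obtain ⟨i, j, k, h⟩ := exists_isTri' hK
  have hh := hR.h_pos hT
  have hcr := hR.nondeg hT hρ ht h
  have hsq := hR.shape_sq hT hρ ht h
  rw [(hR.isProper hT hρ ht).gradK_eq h, norm_gvec hcr]
  have hd : ∀ a b : Fin M.N, |v a - v b| ≤ 2 := fun a b =>
    (abs_sub _ _).trans (by linarith [hv a, hv b])
  have h1 : ‖(v j - v i) • M.ed t i k - (v k - v i) • M.ed t i j‖ ≤ 4 * M.h := by
    refine (norm_sub_le _ _).trans ?_
    rw [norm_smul, norm_smul, Real.norm_eq_abs, Real.norm_eq_abs]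
    calc _ ≤ 2 * M.h + 2 * M.h := by
          gcongr
          · exact hd _ _
          · exact norm_ed_le ht hK h.mem_i h.mem_k
          · exact hd _ _
          · exact norm_ed_le ht hK h.mem_i h.mem_j
      _ = _ := by ring
  calc _ ≤ M.h * (4 * M.h / (ρ * M.h) ^ 2) := by gcongr
    _ = _ := by field_simp

namespace IsLiftPatch
variable {K : Finset (Fin M.N)} {c f₁ f₂ ν : E3} {r κ D : ℝ} {n : E3 → E3}
  (h : M.IsLiftPatch K c f₁ f₂ ν r κ D n)
include h

/-- Uniqueness of the preimage `x` of `y` makes the value of `liftFun` independent of the choice in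
its definition. The function is affine on the triangle, and replacing `x` by `y` costs only `⟪∇, x -
y⟫`. -/
theorem abs_liftFun_sub_le (hM : M.IsProper 0) (hK : K ∈ M.tri) (v : Fin M.N → ℝ) {y : E3}
    (hy : y ∈ S.Γ₀) (hyb : y ∈ ball c (2 * r)) :
    |liftFun S.Γ₀ (M.surf 0) (M.interp 0 v) y - M.interp 0 v c - ⟪M.gradK 0 K v, y - c⟫|
      ≤ 2 * D ^ 2 * r ^ 3 * ‖M.gradK 0 K v‖ := by
  obtain ⟨x, hxK, hxy, hb, huniq⟩ := h.lift y hy hyb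
  have hex : ∃ x, x ∈ M.surf 0 ∧ normalProj S.Γ₀ x = y := ⟨x, IsProper.elem_subset_surf hK hxK, hxy⟩
  obtain ⟨h1, h2⟩ := hex.choose_spec
  obtain ⟨L, hL, hxL⟩ := mem_iUnion₂.1 h1
  rw [liftFun, dif_pos hex, (huniq L hL _ hxL h2).2, hM.interp_sub_eq hK v hxK h.centre_mem,
    ← inner_sub_right, sub_sub_sub_cancel_right]
  exact hb _ (h.inner_gradK v)

/-- A common point would have preimages in both triangles, while uniqueness of the preimage
identifies its triangle. -/
theorem disjoint {L : Finset (Fin M.N)} (hL : L ∈ M.tri) (hKL : K ≠ L) {c' f₁' f₂' ν' : E3}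
    {r' κ' D' : ℝ} {n' : E3 → E3} (h' : M.IsLiftPatch L c' f₁' f₂' ν' r' κ' D' n') :
    Disjoint (S.Γ₀ ∩ ball c (2 * r)) (S.Γ₀ ∩ ball c' (2 * r')) := by
  refine Set.disjoint_left.2 fun y hy hy' => hKL ?_
  obtain ⟨x, -, -, -, huniq⟩ := h.lift y hy.1 hy.2
  obtain ⟨x', hxL, hx', -, -⟩ := h'.lift y hy'.1 hy'.2
  exact (huniq L hL x' hxL hx').1.symm

end IsLiftPatch

/-- Bounds for the number of triangles and the gradient of the discrete initial data. -/
theorem exists_initial_bound (hT : 0 ≤ T) (S : EvolvingSurface T) {ρ : ℝ} (hρ : 0 < ρ) :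
    ∃ h₀ C : ℝ, 0 < h₀ ∧ 0 ≤ C ∧ ∀ M : EvolvingTriangulation S, M.IsRegular ρ → M.h < h₀ →
      M.tri.card * M.h ^ 2 ≤ C ∧
      ∀ v : Fin M.N → ℝ, (∀ i, |v i| ≤ 1) → ∀ (u : E3 → ℝ) (g₀ g' : E3 → E3),
        HasWeakTangentialGradient S.Γ₀ u g₀ →
        HasWeakTangentialGradient S.Γ₀
          (fun x => u x - liftFun S.Γ₀ (M.surf 0) (M.interp 0 v) x) g' →
        M.stiffForm 0 v v
          ≤ C * ((∫ y in S.Γ₀, ‖g₀ y - g' y‖ ^ 2 ∂surfaceMeasure) + C) := by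
  obtain ⟨h₀, D, hh₀, hpatch⟩ := exists_isLiftPatch hT S hρ
  -- One constant for the local estimate: `D` bounds the geometry, `4/ρ²` the scaled gradient
  -- `r‖g‖`, and `2D²·4/ρ²` the deviation of the lift from an affine function.
  set D' := max D (max (4 / ρ ^ 2) (2 * D ^ 2 * (4 / ρ ^ 2))) with hD'
  have hDD : D ≤ D' := le_max_left _ _
  have hDD1 : 4 / ρ ^ 2 ≤ D' := (le_max_left _ _).trans (le_max_right _ _)
  have hDD2 : 2 * D ^ 2 * (4 / ρ ^ 2) ≤ D' := (le_max_right _ _).trans (le_max_right _ _)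
  obtain ⟨C₂, hC₂, hloc⟩ := exists_local_gradient_const D'
  have hdA := discArea_pos
  have hfin := S.isClosedC2Surface.surfaceMeasure_lt_top
  have hΓm : MeasurableSet S.Γ₀ := S.isClosedC2Surface.isCompact.measurableSet
  have hrA := refArea_pos
  set C₁ := surfaceMeasure.real S.Γ₀ / ((ρ / 36) ^ 2 * discArea) with hC₁
  have hC₁0 : 0 ≤ C₁ := by positivity
  set C₃ := refArea * (C₂ / (ρ / 36) ^ 2) with hC₃
  have hC₃0 : 0 ≤ C₃ := by positivity
  refine ⟨h₀, C₁ + C₃, hh₀, by positivity, fun M hR hh => ?_⟩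
  have h0 : (0 : ℝ) ∈ Icc 0 T := ⟨le_rfl, hT⟩
  have hM := hR.isProper hT hρ h0
  have hhp := hR.h_pos hT
  have hρ1 := hR.rho_le_one hT hρ
  choose! c f₁ f₂ ν κ n hP using hpatch M hR hh
  set r := ρ / 36 * M.h with hr
  have hr0 : 0 < r := by positivity
  have hrh : r ≤ M.h := by rw [hr]; nlinarith
  set A : Finset (Fin M.N) → Set E3 := fun K => S.Γ₀ ∩ ball (c K) (2 * r) with hA
  have hAm : ∀ K, MeasurableSet (A K) := fun K => hΓm.inter measurableSet_ball
  have hAd : (M.tri : Set (Finset (Fin M.N))).PairwiseDisjoint A := fun K hK L hL hKL =>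
    (hP K hK).disjoint hL hKL (hP L hL)
  have hUsub : ⋃ K ∈ M.tri, A K ⊆ S.Γ₀ := iUnion₂_subset fun K _ => inter_subset_left
  have hAfin : ∀ K, surfaceMeasure (A K) ≠ ⊤ := fun K =>
    ((measure_mono inter_subset_left).trans_lt hfin).ne
  have hAlow : ∀ K ∈ M.tri, r ^ 2 * discArea ≤ surfaceMeasure.real (A K) := fun K hK => by
    refine ((hP K hK).le_measureReal (Subset.refl (ball 0 1))).trans ?_
    exact measureReal_mono inter_subset_left (hAfin K)
  -- Packing: disjoint patches of area at least `r² · discArea`, with `r` proportional to `h`, fit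
  -- into the finite area of `Γ₀`.
  have hcard : M.tri.card * M.h ^ 2 ≤ C₁ := by
    rw [hC₁, le_div_iff₀ (by positivity)]
    calc _ = ∑ _K ∈ M.tri, r ^ 2 * discArea := by
          rw [Finset.sum_const, nsmul_eq_mul, hr]; ring
      _ ≤ ∑ K ∈ M.tri, surfaceMeasure.real (A K) := Finset.sum_le_sum hAlow
      _ = surfaceMeasure.real (⋃ K ∈ M.tri, A K) :=
          (measureReal_biUnion_finset hAd (fun K _ => hAm K) fun K _ => hAfin K).symm
      _ ≤ _ := measureReal_mono hUsub hfin.ne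
  refine ⟨hcard.trans (by linarith), fun v hv u g₀ g' hu hu' => ?_⟩
  have hG2 : IntegrableOn (fun y => ‖g₀ y - g' y‖ ^ 2) S.Γ₀ surfaceMeasure := by
    have := (hu.memLp_grad.sub hu'.memLp_grad).integrable_norm_pow two_ne_zero
    exact this
  set I := ∫ y in S.Γ₀, ‖g₀ y - g' y‖ ^ 2 ∂surfaceMeasure with hI
  have hI0 : 0 ≤ I := integral_nonneg fun y => sq_nonneg _
  have hsumI : ∑ K ∈ M.tri, ∫ y in A K, ‖g₀ y - g' y‖ ^ 2 ∂surfaceMeasure ≤ I := by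
    rw [← integral_biUnion_finset M.tri (fun K _ => hAm K) hAd
      fun K _ => hG2.mono_set inter_subset_left]
    exact setIntegral_mono_set hG2 (Filter.Eventually.of_forall fun y => sq_nonneg _)
      hUsub.eventuallyLE
  have hK : ∀ K ∈ M.tri, M.dArea 0 K * ‖M.gradK 0 K v‖ ^ 2
      ≤ C₂ / (ρ / 36) ^ 2 * ((∫ y in A K, ‖g₀ y - g' y‖ ^ 2 ∂surfaceMeasure) + r ^ 2) := by
    intro K hK
    have hp := hP K hK
    have hgr := hR.mul_norm_gradK_le hT hρ h0 hK hv
    set g := M.gradK 0 K v with hg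
    have hrg : r * ‖g‖ ≤ 4 / ρ ^ 2 := le_trans (by gcongr) hgr
    have hp' : IsNormalPatch S.Γ₀ (c K) (f₁ K) (f₂ K) (ν K) r (κ K) D' (n K) :=
      { hp.toIsNormalPatch with
        norm_fderiv := fun y hy => (hp.norm_fderiv y hy).trans hDD
        norm_sub := fun y hy => (hp.norm_sub y hy).trans (by gcongr)
        κ_le_mul := hp.κ_le_mul.trans (by gcongr) }
    have h1 := hloc hp' hΓm hfin (hp.inner_gradK v) (hrg.trans hDD1)
      (hM.abs_interp_le hv (c K)) hu hu' fun y hy hyb => by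
        refine (hp.abs_liftFun_sub_le hM hK v hy hyb).trans ?_
        calc _ = 2 * D ^ 2 * (r * ‖g‖) * r ^ 2 := by ring
          _ ≤ 2 * D ^ 2 * (4 / ρ ^ 2) * r ^ 2 := by gcongr
          _ ≤ _ := by gcongr
    have h2 := hR.dArea_le_sq hT h0 hK
    calc _ ≤ M.h ^ 2 * ‖g‖ ^ 2 := by gcongr
      _ = 1 / (ρ / 36) ^ 2 * (r ^ 2 * ‖g‖ ^ 2) := by rw [hr]; field_simp
      _ ≤ 1 / (ρ / 36) ^ 2
          * (C₂ * ((∫ y in A K, ‖g₀ y - g' y‖ ^ 2 ∂surfaceMeasure) + r ^ 2)) := by gcongr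
      _ = _ := by ring
  rw [stiffForm_self]
  calc _ = refArea * ∑ K ∈ M.tri, M.dArea 0 K * ‖M.gradK 0 K v‖ ^ 2 := by
        rw [Finset.mul_sum]; exact Finset.sum_congr rfl fun K _ => by ring
    _ ≤ refArea * ∑ K ∈ M.tri, C₂ / (ρ / 36) ^ 2
          * ((∫ y in A K, ‖g₀ y - g' y‖ ^ 2 ∂surfaceMeasure) + r ^ 2) := by
        exact mul_le_mul_of_nonneg_left (Finset.sum_le_sum hK) hrA.le
    _ = C₃ * (∑ K ∈ M.tri, (∫ y in A K, ‖g₀ y - g' y‖ ^ 2 ∂surfaceMeasure)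
          + M.tri.card * r ^ 2) := by
        rw [← Finset.mul_sum, Finset.sum_add_distrib, Finset.sum_const, nsmul_eq_mul, hC₃]; ring
    _ ≤ C₃ * (I + C₁) := by
        gcongr
        refine le_trans ?_ hcard
        gcongr
    _ ≤ _ := by
        gcongr <;> linarith

end EvolvingTriangulation

/-! ### Solutions of the scheme and the stability estimate. -/

namespace EvolvingTriangulation
variable {T : ℝ} {S : EvolvingSurface T} {M : EvolvingTriangulation S}

theorem interp_const_mul_sub (t a : ℝ) (v w : Fin M.N → ℝ) (x : E3) :
    M.interp t (fun i => a * (v i - w i)) x = a * (M.interp t v x - M.interp t w x) := by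
  unfold interp
  split_ifs
  · rw [← Finset.sum_sub_distrib, Finset.mul_sum]
    exact Finset.sum_congr rfl fun i _ => by simp only [smul_eq_mul]; ring
  · simp

theorem IsProper.gradNormSq_materialDiff {τ : ℝ} {U : ℕ → E3 → ℝ} {n : ℕ}
    (hM : M.IsProper ((n : ℝ) * τ)) (hU : U n ∈ M.space ((n : ℝ) * τ)) (hτ : τ ≠ 0) :
    τ ^ 2 * M.gradNormSq ((n : ℝ) * τ) (M.materialDiff τ U n)
      = M.stiffForm ((n : ℝ) * τ)
        ((fun i => U n (M.node i ((n : ℝ) * τ)))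
          - fun i => U (n - 1) (M.node i ((n - 1 : ℝ) * τ)))
        ((fun i => U n (M.node i ((n : ℝ) * τ)))
          - fun i => U (n - 1) (M.node i ((n - 1 : ℝ) * τ))) := by
  set t := (n : ℝ) * τ
  set u : Fin M.N → ℝ := fun i => U n (M.node i t) with hu
  set v : Fin M.N → ℝ := fun i => U (n - 1) (M.node i ((n - 1 : ℝ) * τ)) with hv
  have e : M.materialDiff τ U n = M.interp t (fun i => 1 / τ * (u i - v i)) := by
    funext x
    rw [interp_const_mul_sub, materialDiff, transfer]
    conv_lhs => rw [hM.eq_interp_of_mem_space hU]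
  rw [e, hM.gradNormSq_eq (hM.interp_mem_space _)]
  simp only [hM.interp_node]
  have e2 : (fun i => 1 / τ * (u i - v i)) = (1 / τ) • (u - v) := rfl
  rw [e2, map_smul, map_smul, LinearMap.smul_apply, smul_eq_mul, smul_eq_mul]
  field_simp

theorem exists_isStep {s t : ℝ} (hs : M.IsProper s) (ht : M.IsProper t) {ε θ δ τ : ℝ} (hε : 0 < ε)
    (hθ : 0 < θ) (hδ0 : 0 < δ) (hδ1 : δ < 1) (hτ : 0 < τ) (hτε : τ ≤ ε ^ 3 / 2) (P : E3 → ℝ) :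
    ∃ p : (E3 → ℝ) × (E3 → ℝ), M.IsStep ε θ δ τ s t P p.1 p.2 := by
  obtain ⟨u, w, h1, h2⟩ := step_exists (M.mass t) (fun i => M.mass s i * P (M.node i s)) ht.mass_pos
    (M.stiffForm t) (stiffForm_symm t) (stiffForm_nonneg t) hε hθ hτ hτε
    (flogReg_monotone hδ0 hδ1) (flogReg_lipschitz hδ0 hδ1)
  refine ⟨(M.interp t u, M.interp t w),
    (isStep_iff hs ht (ht.interp_mem_space u) (ht.interp_mem_space w)).2 ?_⟩
  simp only [ht.interp_node]
  exact ⟨h1, h2⟩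

theorem isStep_unique {s t : ℝ} (hs : M.IsProper s) (ht : M.IsProper t) {ε θ δ τ : ℝ} (hε : 0 < ε)
    (hθ : 0 < θ) (hδ0 : 0 < δ) (hδ1 : δ < 1) (hτ : 0 < τ) (hτε : τ ≤ ε ^ 3 / 2) {P : E3 → ℝ}
    {p p' : (E3 → ℝ) × (E3 → ℝ)} (hp : M.IsStep ε θ δ τ s t P p.1 p.2)
    (hp' : M.IsStep ε θ δ τ s t P p'.1 p'.2) : p = p' := by
  obtain ⟨h1, h2⟩ := (isStep_iff hs ht hp.1 hp.2.1).1 hp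
  obtain ⟨h1', h2'⟩ := (isStep_iff hs ht hp'.1 hp'.2.1).1 hp'
  obtain ⟨hU, hW⟩ := step_unique (M.mass t) (fun i => M.mass s i * P (M.node i s)) ht.mass_pos
    (M.stiffForm t) (stiffForm_symm t) (stiffForm_nonneg t) hε hθ hτ hτε
    (flogReg_monotone hδ0 hδ1) h1 h2 h1' h2'
  exact Prod.ext (ht.interp_interp_congr hp.1 hp'.1 (congrFun hU))
    (ht.interp_interp_congr hp.2.1 hp'.2.1 (congrFun hW))

theorem exists_isDiscreteSolution {ε θ δ τ : ℝ}
    (h : ∀ n : ℕ, 1 ≤ n → n ≤ ⌊T / τ⌋₊ → ∀ P : E3 → ℝ, ∃ p : (E3 → ℝ) × (E3 → ℝ),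
      M.IsStep ε θ δ τ ((n - 1 : ℝ) * τ) ((n : ℝ) * τ) P p.1 p.2) (Uh₀ : E3 → ℝ) :
    ∃ U W : ℕ → E3 → ℝ, M.IsDiscreteSolution ε θ δ τ Uh₀ U W := by
  choose! Φ hΦ using h
  let Z : ℕ → (E3 → ℝ) × (E3 → ℝ) := fun n =>
    Nat.rec (Uh₀, 0) (fun m p => Φ (m + 1) p.1) n
  refine ⟨fun n => (Z n).1, fun n => (Z n).2, rfl, fun n h1 h2 => ?_⟩
  obtain ⟨m, rfl⟩ : ∃ m, n = m + 1 := ⟨n - 1, by omega⟩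
  exact hΦ (m + 1) h1 h2 (Z m).1

theorem IsProper.sum_mass {t : ℝ} (hM : M.IsProper t) :
    ∑ i, M.mass t i = 3 * refBary * ∑ K ∈ M.tri, M.dArea t K := by
  have := hM.sum_dArea_mul fun _ => 1
  simp only [mul_one] at this
  rw [← this, Finset.mul_sum]
  refine Finset.sum_congr rfl fun K hK => ?_
  rw [Finset.sum_const, M.card_tri K hK]
  simp; ring

theorem IsRegular.sum_mass_le {ρ C : ℝ} (hR : M.IsRegular ρ) (hT : 0 ≤ T) (hρ : 0 < ρ)
    (hC : M.tri.card * M.h ^ 2 ≤ C) {t : ℝ} (ht : t ∈ Icc 0 T) :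
    ∑ i, M.mass t i ≤ 3 * refBary * C := by
  rw [(hR.isProper hT hρ ht).sum_mass]
  have := refBary_pos
  gcongr
  refine (Finset.sum_le_card_nsmul _ _ _ fun K hK => hR.dArea_le_sq hT ht hK).trans ?_
  rwa [nsmul_eq_mul]

/-- The energy at a fixed time in terms of the modified energy. -/
theorem IsProper.energyReg_le {t : ℝ} (hM : M.IsProper t) {ε θ δ : ℝ} (hε : 0 < ε) {η : E3 → ℝ}
    (hη : η ∈ M.space t) : M.energyReg ε θ δ t η
      ≤ modEnergy ε θ (FlogReg δ) (M.mass t) (M.stiffForm t) (fun i => η (M.node i t))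
        + 1 / (2 * ε) * ∑ i, M.mass t i := by
  rw [hM.energyReg_eq ε θ δ hη, modEnergy]
  set v : Fin M.N → ℝ := fun i => η (M.node i t) with hv
  have hq := wsum_nonneg hM.mass_pos v
  have e : ∑ i, M.mass t i * potentialReg θ δ (v i) = θ / 2 * ∑ i, M.mass t i * FlogReg δ (v i)
      + 1 / 2 * ∑ i, M.mass t i - 1 / 2 * wsum (M.mass t) v v := by
    rw [wsum, Finset.mul_sum, Finset.mul_sum, Finset.mul_sum, ← Finset.sum_add_distrib,
      ← Finset.sum_sub_distrib]
    exact Finset.sum_congr rfl fun i _ => by rw [potentialReg]; ring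
  have e2 : 1 / ε * ∑ i, M.mass t i * potentialReg θ δ (v i)
      = θ / (2 * ε) * ∑ i, M.mass t i * FlogReg δ (v i) + 1 / (2 * ε) * ∑ i, M.mass t i
        - 1 / (2 * ε) * wsum (M.mass t) v v := by
    rw [e]; field_simp
  have h2 : 0 ≤ 1 / (2 * ε) * wsum (M.mass t) v v := by positivity
  change ε / 2 * M.stiffForm t v v + 1 / ε * ∑ i, M.mass t i * potentialReg θ δ (v i) ≤ _
  rw [e2]
  linarith

/-- For nodal values in `[-1, 1]` the potential terms are bounded by the total mass, uniformly in
`δ`. -/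
theorem modEnergy_le {ι : Type*} [Fintype ι] {ε θ δ : ℝ} (hε : 0 < ε) (hθ : 0 < θ) (hδ0 : 0 < δ)
    (hδ1 : δ < 1) {m : ι → ℝ} (hm : ∀ i, 0 < m i) (B : (ι → ℝ) →ₗ[ℝ] (ι → ℝ) →ₗ[ℝ] ℝ) {v : ι → ℝ}
    (hv : ∀ i, |v i| ≤ 1) : modEnergy ε θ (FlogReg δ) m B v
      ≤ ε / 2 * B v v + (3 * θ + 1) / (2 * ε) * ∑ i, m i := by
  have h1 : ∑ i, m i * FlogReg δ (v i) ≤ 3 * ∑ i, m i := by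
    rw [Finset.mul_sum]
    refine Finset.sum_le_sum fun i _ => ?_
    rw [mul_comm 3]
    exact mul_le_mul_of_nonneg_left (FlogReg_le_three hδ0 hδ1 (hv i)) (hm i).le
  have h2 : wsum m v v ≤ ∑ i, m i := Finset.sum_le_sum fun i _ => by
    refine mul_le_of_le_one_right (hm i).le ?_
    rw [← sq, ← sq_abs]
    exact pow_le_one₀ (abs_nonneg _) (hv i)
  have h3 : θ / (2 * ε) * ∑ i, m i * FlogReg δ (v i) ≤ θ / (2 * ε) * (3 * ∑ i, m i) := by gcongr
  have h4 : 1 / (2 * ε) * wsum m v v ≤ 1 / (2 * ε) * ∑ i, m i := by gcongr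
  rw [modEnergy]
  calc _ ≤ ε / 2 * B v v + θ / (2 * ε) * (3 * ∑ i, m i) + 1 / (2 * ε) * ∑ i, m i := by linarith
    _ = _ := by ring

theorem modEnergy_nonneg {ι : Type*} [Fintype ι] {ε θ δ : ℝ} (hε : 0 < ε) (hθ : 0 < θ) (hδ0 : 0 < δ)
    (hδ1 : δ < 1) {m : ι → ℝ} (hm : ∀ i, 0 < m i) {B : (ι → ℝ) →ₗ[ℝ] (ι → ℝ) →ₗ[ℝ] ℝ}
    (hB : ∀ v, 0 ≤ B v v) (v : ι → ℝ) : 0 ≤ modEnergy ε θ (FlogReg δ) m B v := by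
  have h1 : 0 ≤ ∑ i, m i * FlogReg δ (v i) := Finset.sum_nonneg fun i _ =>
    mul_nonneg (hm i).le (FlogReg_nonneg hδ0 hδ1 _)
  have h2 := wsum_nonneg hm v
  have h3 := hB v
  rw [modEnergy]; positivity

/-- The stability estimate, with the constants made explicit. -/
theorem IsRegular.energy_le {ρ C C₁ : ℝ} (hR : M.IsRegular ρ) (hT : 0 ≤ T) (hρ : 0 < ρ) (hC : 0 ≤ C)
    (hctrl : ∀ s ∈ Icc 0 T, ∀ t ∈ Icc 0 T, s < t → t - s ≤ 1 → M.StepControl C s t)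
    (hC₁ : M.tri.card * M.h ^ 2 ≤ C₁) {ε θ δ τ : ℝ} (hε : 0 < ε) (hθ : 0 < θ) (hδ0 : 0 < δ)
    (hδ1 : δ < 1) (hτ : 0 < τ) (hτ1 : τ ≤ 1) (hτ2 : τ ≤ ε ^ 3 / 128) {Uh₀ : E3 → ℝ}
    {U W : ℕ → E3 → ℝ} (hUW : M.IsDiscreteSolution ε θ δ τ Uh₀ U W) {N : ℕ} (hN1 : 1 ≤ N)
    (hN : N ≤ ⌊T / τ⌋₊) :
    M.energyReg ε θ δ ((N : ℝ) * τ) (U N)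
      + ε * τ ^ 2 / 4 * ∑ n ∈ Finset.Icc 1 N,
          M.gradNormSq ((n : ℝ) * τ) (M.materialDiff τ U n)
      + τ * ∑ n ∈ Finset.Icc 1 N, M.gradNormSq ((n : ℝ) * τ) (W n)
    ≤ 4 * modEnergy ε θ (FlogReg δ) (M.mass 0) (M.stiffForm 0) (fun i => Uh₀ (M.node i 0))
        * Real.exp (stepConst ε C * ((N : ℝ) * τ)) + 1 / (2 * ε) * (3 * refBary * C₁) := by
  have htime : ∀ n : ℕ, n ≤ ⌊T / τ⌋₊ → (n : ℝ) * τ ∈ Icc 0 T := fun n hn => by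
    have h1 := (Nat.le_floor_iff (by positivity)).1 hn
    exact ⟨by positivity, (le_div_iff₀ hτ).1 h1⟩
  have hprop : ∀ n : ℕ, n ≤ ⌊T / τ⌋₊ → M.IsProper ((n : ℝ) * τ) := fun n hn =>
    hR.isProper hT hρ (htime n hn)
  have hpred : ∀ n : ℕ, 1 ≤ n → ((n - 1 : ℕ) : ℝ) * τ = ((n : ℝ) - 1) * τ := fun n hn => by
    rw [Nat.cast_sub hn, Nat.cast_one]
  set u : ℕ → Fin M.N → ℝ := fun n i => U n (M.node i ((n : ℝ) * τ)) with hu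
  set w : ℕ → Fin M.N → ℝ := fun n i => W n (M.node i ((n : ℝ) * τ)) with hw
  set X : ℕ → ℝ := fun n => modEnergy ε θ (FlogReg δ) (M.mass ((n : ℝ) * τ))
    (M.stiffForm ((n : ℝ) * τ)) (u n) with hX
  -- The dissipation as it comes out of `energy_step`; four times its sum is the dissipation in the
  -- stability estimate, hence the factor 4 in front of the initial energy.
  set D : ℕ → ℝ := fun n => 1 / 4 * (ε / 4 * M.stiffForm ((n : ℝ) * τ) (u n - u (n - 1))
    (u n - u (n - 1)) + τ * M.stiffForm ((n : ℝ) * τ) (w n) (w n)) with hD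
  have hD0 : ∀ n, 0 ≤ D n := fun n => by
    have h1 := stiffForm_nonneg (M := M) ((n : ℝ) * τ) (u n - u (n - 1))
    have h2 := stiffForm_nonneg (M := M) ((n : ℝ) * τ) (w n)
    rw [hD]; positivity
  have hc := stepConst_pos hε hC
  have hstep : ∀ n, 1 ≤ n → n ≤ N → X n + D n ≤ (1 + stepConst ε C * τ) * X (n - 1) := by
    intro n hn1 hnN
    have hn := hnN.trans hN
    have hs := hprop (n - 1) (by omega)
    have ht := hprop n hn
    have hst := hUW.2 n hn1 hn
    -- The scheme writes the previous time with real subtraction, the nodal sequences with natural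
    -- subtraction; they agree because `n ≥ 1`.
    rw [← hpred n hn1] at hst
    have hdiff : (n : ℝ) * τ - ((n - 1 : ℕ) : ℝ) * τ = τ := by rw [hpred n hn1]; ring
    have hctl := hctrl _ (htime (n - 1) (by omega)) _ (htime n hn) (by linarith) (by linarith)
    obtain ⟨h1, h2⟩ := (isStep_iff hs ht hst.1 hst.2.1).1 hst
    have hmass := hctl.mass_le
    have hratio := hctl.le_ratio
    have hB1 := hctl.stiff_mul (u (n - 1))
    have hB2 := hctl.stiff_one_sub (u (n - 1))
    rw [hdiff] at hmass hratio hB1 hB2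
    exact energy_step ht.mass_pos hs.mass_pos (stiffForm_symm _) (stiffForm_nonneg _)
      (stiffForm_nonneg _) hε hθ hτ hτ1 hτ2 hC (FlogReg_nonneg hδ0 hδ1) (FlogReg_sub_le hδ0 hδ1)
      (fun c b h0 h1 => FlogReg_mul_le hδ0 hδ1 h0 h1 b)
      (fun i => mul_div_cancel₀ _ (ht.mass_pos i).ne') hctl.mass_mono hmass hratio hB1 hB2 h1 h2
  have hgr := dissipative_gronwall (by positivity) hD0 hstep N le_rfl
  have hX0 : X 0 = modEnergy ε θ (FlogReg δ) (M.mass 0) (M.stiffForm 0)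
      (fun i => Uh₀ (M.node i 0)) := by
    simp only [hX, hu, hUW.1, Nat.cast_zero, zero_mul]
  have hX0n : 0 ≤ X 0 := modEnergy_nonneg hε hθ hδ0 hδ1 (hprop 0 (Nat.zero_le _)).mass_pos
    (stiffForm_nonneg _) _
  have hXN : 0 ≤ X N := modEnergy_nonneg hε hθ hδ0 hδ1 (hprop N hN).mass_pos (stiffForm_nonneg _) _
  have hexp : (1 + stepConst ε C * τ) ^ N ≤ Real.exp (stepConst ε C * ((N : ℝ) * τ)) := by
    have h1 : 1 + stepConst ε C * τ ≤ Real.exp (stepConst ε C * τ) := by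
      rw [add_comm]; exact Real.add_one_le_exp _
    calc _ ≤ Real.exp (stepConst ε C * τ) ^ N := by gcongr
      _ = _ := by rw [← Real.exp_nat_mul]; congr 1; ring
  have hUN : U N ∈ M.space ((N : ℝ) * τ) := (hUW.2 N hN1 hN).1
  have hE := (hprop N hN).energyReg_le (θ := θ) (δ := δ) hε hUN
  have hS := hR.sum_mass_le hT hρ hC₁ (htime N hN)
  have hS2 : 1 / (2 * ε) * ∑ i, M.mass ((N : ℝ) * τ) i ≤ 1 / (2 * ε) * (3 * refBary * C₁) := by
    gcongr
  have hdiss : ε * τ ^ 2 / 4 * ∑ n ∈ Finset.Icc 1 N,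
        M.gradNormSq ((n : ℝ) * τ) (M.materialDiff τ U n)
      + τ * ∑ n ∈ Finset.Icc 1 N, M.gradNormSq ((n : ℝ) * τ) (W n)
      = 4 * ∑ n ∈ Finset.Icc 1 N, D n := by
    rw [Finset.mul_sum, Finset.mul_sum, Finset.mul_sum, ← Finset.sum_add_distrib]
    refine Finset.sum_congr rfl fun n hn => ?_
    obtain ⟨hn1, hnN⟩ := Finset.mem_Icc.1 hn
    have ht := hprop n (hnN.trans hN)
    have hst := hUW.2 n hn1 (hnN.trans hN)
    have e1 := ht.gradNormSq_materialDiff hst.1 hτ.ne'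
    rw [← hpred n hn1] at e1
    have e2 := ht.gradNormSq_eq hst.2.1
    change τ ^ 2 * _ = M.stiffForm ((n : ℝ) * τ) (u n - u (n - 1)) (u n - u (n - 1)) at e1
    change _ = M.stiffForm ((n : ℝ) * τ) (w n) (w n) at e2
    simp only [hD]
    rw [← e1, ← e2]
    ring
  have hE' : M.energyReg ε θ δ ((N : ℝ) * τ) (U N) ≤ X N + 1 / (2 * ε) * (3 * refBary * C₁) :=
    hE.trans (add_le_add le_rfl hS2)
  rw [add_assoc, hdiss, ← hX0]
  have hfin : (1 + stepConst ε C * τ) ^ N * X 0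
      ≤ Real.exp (stepConst ε C * ((N : ℝ) * τ)) * X 0 := by gcongr
  linarith

/-- The approximation bound carries `h` in front of the `H¹` norm; discarding the `L²` part and
dividing by `h` leaves a gradient error of order `h`. -/
theorem Approximates.exists_gradient {c : ℝ} {u₀ η : E3 → ℝ} (h : M.Approximates c u₀ η)
    (hh : 0 < M.h) : ∃ g' : E3 → E3,
      HasWeakTangentialGradient S.Γ₀ (fun x => u₀ x - liftFun S.Γ₀ (M.surf 0) η x) g' ∧
      l2Norm S.Γ₀ g' ≤ c * M.h := by
  obtain ⟨g', hg', hle⟩ := h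
  refine ⟨g', hg', ?_⟩
  set a := l2Norm S.Γ₀ fun x => u₀ x - liftFun S.Γ₀ (M.surf 0) η x
  have ha : 0 ≤ a := ENNReal.toReal_nonneg
  have hb : l2Norm S.Γ₀ g' ≤ √(a ^ 2 + l2Norm S.Γ₀ g' ^ 2) :=
    Real.le_sqrt_of_sq_le (by linarith [sq_nonneg a])
  have h1 : M.h * l2Norm S.Γ₀ g' ≤ M.h * (c * M.h) := by
    calc _ ≤ M.h * √(a ^ 2 + l2Norm S.Γ₀ g' ^ 2) := by gcongr
      _ ≤ c * M.h ^ 2 := by linarith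
      _ = _ := by ring
  exact le_of_mul_le_mul_left h1 hh

end EvolvingTriangulation

theorem l2Norm_sub_le {F : Type*} [NormedAddCommGroup F] {Γ : Set E3} {f g : E3 → F}
    (hf : MemLp f 2 (surfaceMeasure.restrict Γ)) (hg : MemLp g 2 (surfaceMeasure.restrict Γ)) :
    l2Norm Γ (fun x => f x - g x) ≤ l2Norm Γ f + l2Norm Γ g := by
  rw [l2Norm, l2Norm, l2Norm, ← ENNReal.toReal_add hf.eLpNorm_ne_top hg.eLpNorm_ne_top]
  exact ENNReal.toReal_mono (ENNReal.add_ne_top.2 ⟨hf.eLpNorm_ne_top, hg.eLpNorm_ne_top⟩)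
    (eLpNorm_sub_le hf.aestronglyMeasurable hg.aestronglyMeasurable one_le_two)

end

/-! ### Choice of the constants. -/

theorem mainTheorem9 (T : ℝ) (hT : 0 < T) (S : EvolvingSurface T) (ρ : ℝ) (hρ : 0 < ρ) :
    ∃ h₀ : ℝ, 0 < h₀ ∧
      ∀ (ε θ : ℝ), 0 < ε → 0 < θ → θ < 1 →
      ∀ (u₀ : E3 → ℝ), IsAdmissible S ε θ u₀ → ∀ c₀ : ℝ,
      ∃ τ₀ C : ℝ, 0 < τ₀ ∧ 0 < C ∧
        ∀ M : EvolvingTriangulation S, M.IsRegular ρ → M.h < h₀ →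
        ∀ Uh₀ : E3 → ℝ, M.IsDiscreteAdmissible θ Uh₀ → M.Approximates c₀ u₀ Uh₀ →
        ∀ δ : ℝ, 0 < δ → δ < 1 →
        ∀ τ : ℝ, 0 < τ → τ ≤ τ₀ → τ ≤ ε ^ 3 / 2 →
          (∀ n : ℕ, 1 ≤ n → n ≤ ⌊T / τ⌋₊ → ∀ Uprev ∈ M.space ((n - 1 : ℝ) * τ),
            ∃! p : (E3 → ℝ) × (E3 → ℝ),
              M.IsStep ε θ δ τ ((n - 1 : ℝ) * τ) ((n : ℝ) * τ) Uprev p.1 p.2) ∧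
          (∃ U W : ℕ → E3 → ℝ, M.IsDiscreteSolution ε θ δ τ Uh₀ U W) ∧
          ∀ U W : ℕ → E3 → ℝ, M.IsDiscreteSolution ε θ δ τ Uh₀ U W →
            ∀ N : ℕ, 1 ≤ N → N ≤ ⌊T / τ⌋₊ →
              M.energyReg ε θ δ ((N : ℝ) * τ) (U N)
                + ε * τ ^ 2 / 4 * ∑ n ∈ Finset.Icc 1 N,
                    M.gradNormSq ((n : ℝ) * τ) (M.materialDiff τ U n)
                + τ * ∑ n ∈ Finset.Icc 1 N, M.gradNormSq ((n : ℝ) * τ) (W n)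
              ≤ C * Real.exp (C * ((N : ℝ) * τ)) := by

  have hT' := hT.le
  obtain ⟨L, hV⟩ := S.exists_velBound
  obtain ⟨d, L', hd, hL', hch⟩ := S.isClosedC2Surface.exists_chart
  obtain ⟨C, hC, hctrl⟩ := EvolvingTriangulation.IsRegular.exists_stepControl S hT' hρ hV
    (zero_le_one.trans hL') (hasQuadNormals_of_chart hd hch)
  obtain ⟨h₀, C₁, hh₀, hC₁, hinit⟩ := EvolvingTriangulation.exists_initial_bound hT' S hρ
  refine ⟨h₀, hh₀, fun ε θ hε hθ _ u₀ hu₀ c₀ => ?_⟩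
  obtain ⟨⟨g₀, hg₀, -⟩, -, -⟩ := hu₀
  -- Bounds the squared norm of the weak gradient `g₀ - g'` of the lifted datum. The absolute value
  -- is needed because no sign of `c₀` is prescribed.
  set I := (l2Norm S.Γ₀ g₀ + |c₀| * h₀) ^ 2 with hI
  set X₀ := ε / 2 * (C₁ * (I + C₁)) + (3 * θ + 1) / (2 * ε) * (3 * refBary * C₁) with hX₀
  have hrb := refBary_pos
  have hX₀0 : 0 ≤ X₀ := by positivity
  set B := 1 / (2 * ε) * (3 * refBary * C₁) with hB
  have hB0 : 0 ≤ B := by positivity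
  have hc := stepConst_pos hε hC
  -- The bound `τ₀` serves the energy estimate; solvability needs only `τ ≤ ε³/2`. A single `C` acts
  -- both as growth rate, through `stepConst`, and as prefactor, through `4 X₀ + B`, where `X₀`
  -- bounds the initial modified energy and `B` the constant term lost when passing back to the true
  -- energy.
  refine ⟨min 1 (ε ^ 3 / 128), stepConst ε C + 4 * X₀ + B, by positivity, by positivity,
    fun M hR hMh Uh₀ hadm happ δ hδ0 hδ1 τ hτ hτ0 hτε => ?_⟩
  have h0 : (0 : ℝ) ∈ Icc 0 T := ⟨le_rfl, hT'⟩
  have hprop : ∀ n : ℕ, 1 ≤ n → n ≤ ⌊T / τ⌋₊ →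
      M.IsProper ((n - 1 : ℝ) * τ) ∧ M.IsProper ((n : ℝ) * τ) := fun n hn1 hn => by
    have h1 := (le_div_iff₀ hτ).1 ((Nat.le_floor_iff (by positivity)).1 hn)
    have h2 : (1 : ℝ) ≤ n := by exact_mod_cast hn1
    exact ⟨hR.isProper hT' hρ ⟨mul_nonneg (by linarith) hτ.le, by nlinarith⟩,
      hR.isProper hT' hρ ⟨by positivity, h1⟩⟩
  have hex : ∀ n : ℕ, 1 ≤ n → n ≤ ⌊T / τ⌋₊ → ∀ P : E3 → ℝ, ∃ p : (E3 → ℝ) × (E3 → ℝ),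
      M.IsStep ε θ δ τ ((n - 1 : ℝ) * τ) ((n : ℝ) * τ) P p.1 p.2 := fun n hn1 hn P =>
    EvolvingTriangulation.exists_isStep (hprop n hn1 hn).1 (hprop n hn1 hn).2 hε hθ hδ0 hδ1 hτ hτε P
  refine ⟨fun n hn1 hn P _ => ?_, EvolvingTriangulation.exists_isDiscreteSolution hex Uh₀,
    fun U W hUW N hN1 hN => ?_⟩
  · obtain ⟨p, hp⟩ := hex n hn1 hn P
    exact ⟨p, hp, fun p' hp' => EvolvingTriangulation.isStep_unique (hprop n hn1 hn).1
      (hprop n hn1 hn).2 hε hθ hδ0 hδ1 hτ hτε hp' hp⟩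
  · have hM := hR.isProper hT' hρ h0
    have hhp := hR.h_pos hT'
    obtain ⟨hcard, hstiff⟩ := hinit M hR hMh
    have hmain := hR.energy_le hT' hρ hC (hctrl M hR) hcard hε hθ hδ0 hδ1 hτ
      (hτ0.trans (min_le_left _ _)) (hτ0.trans (min_le_right _ _)) hUW hN1 hN
    set v : Fin M.N → ℝ := fun i => Uh₀ (M.node i 0) with hv
    have hv1 : ∀ i, |v i| ≤ 1 := hM.abs_node_le hadm.1 hadm.2.1
    have hUv : Uh₀ = M.interp 0 v := hM.eq_interp_of_mem_space hadm.1
    obtain ⟨g', hg', hgl⟩ := happ.exists_gradient hhp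
    have hint : ∫ y in S.Γ₀, ‖g₀ y - g' y‖ ^ 2 ∂surfaceMeasure ≤ I := by
      refine (sq_l2Norm (hg₀.memLp_grad.sub hg'.memLp_grad)).ge.trans ?_
      change l2Norm S.Γ₀ (fun x => g₀ x - g' x) ^ 2 ≤ I
      rw [hI]
      have h1 := l2Norm_sub_le hg₀.memLp_grad hg'.memLp_grad
      have h2 : c₀ * M.h ≤ |c₀| * h₀ := by
        have := le_abs_self c₀
        gcongr
      have h3 : 0 ≤ l2Norm S.Γ₀ fun x => g₀ x - g' x := ENNReal.toReal_nonneg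
      exact pow_le_pow_left₀ h3 (by linarith) 2
    rw [hUv] at hg'
    have hst : M.stiffForm 0 v v ≤ C₁ * (I + C₁) :=
      (hstiff v hv1 u₀ g₀ g' hg₀ hg').trans (by gcongr)
    have hX : modEnergy ε θ (FlogReg δ) (M.mass 0) (M.stiffForm 0) v ≤ X₀ := by
      refine (EvolvingTriangulation.modEnergy_le hε hθ hδ0 hδ1 hM.mass_pos _ hv1).trans ?_
      rw [hX₀]
      gcongr
      exact hR.sum_mass_le hT' hρ hcard h0
    set t := (N : ℝ) * τ with ht
    have ht0 : 0 ≤ t := by positivity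
    have he : Real.exp (stepConst ε C * t) ≤ Real.exp ((stepConst ε C + 4 * X₀ + B) * t) := by
      gcongr; linarith
    have he1 : 1 ≤ Real.exp ((stepConst ε C + 4 * X₀ + B) * t) := Real.one_le_exp (by positivity)
    refine hmain.trans ?_
    calc _ ≤ 4 * X₀ * Real.exp ((stepConst ε C + 4 * X₀ + B) * t)
          + B * Real.exp ((stepConst ε C + 4 * X₀ + B) * t) := by
          refine add_le_add ?_ (le_mul_of_one_le_right hB0 he1)
          gcongr
      _ = (4 * X₀ + B) * Real.exp ((stepConst ε C + 4 * X₀ + B) * t) := by ring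
      _ ≤ _ := by gcongr; linarith
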